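/- A fusion category over $\mathbb R$ is a finite semisimple $\mathbb R$-linear abelian rigid monoidal category (with finite-dimensional Hom spaces and $\mathbb R$-bilinear tensor product) whose unit $\mathbf 1$ is simple; simple objects need not be split. It is a *Tambara–Yamagami category* if, up to isomorphism, it has exactly one non-invertible simple object $m$, and $m$ does not occur in $m\otimes m$. Call it *real-quaternionic* if moreover $\mathrm{End}(\mathbf 1)\cong\mathbb R$ and $\mathrm{End}(m)\cong\mathbb H$ as $\mathbb R$-algebras. Let $A$ be a finite group, let $\chi:A\times A\to\mathbb R^\times$ be a nondegenerate symmetric bicharacter, and let $\tau=\pm1/\sqrt{4|A|}$. A fusion category over $\mathbb R$ *is a category* $\mathcal C_{\mathbb H}(A,\chi,\tau)$ if it is a Tambara–Yamagami category whose invertible simple objects are, up to isomorphism and without repetition, indexed by $A$, and there are an identification $\mathbb H\cong\mathrm{End}(m)$, an isomorphism between $\mathbf 1$ and the object indexed by $1\in A$, isomorphisms $[a,b]:a\otimes b\to ab$, $[a,m]:a\otimes m\to m$, $[m,a]:m\otimes a\to m$ and nonzero morphisms $[a]:m\otimes m\to a$ (for $a,b\in A$) such that for all $h\in\mathbb H$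 $$[a,m](\mathrm{id}\otimes h)=h[a,m],\quad [m,a](h\otimes\mathrm{id})=h[m,a],\quad [a](\mathrm{id}\otimes h)=[a](\bar h\otimes\mathrm{id}),$$ the morphisms $[1,a],[a,1],[1,m],[m,1]$ are the unit constraints, and the associator $\alpha$ satisfies, for all $a,b,c\in A$, $$\begin{aligned} [a,bc](\mathrm{id}\otimes[b,c])\,\alpha&=[ab,c]([a,b]\otimes\mathrm{id}), & [a,m](\mathrm{id}\otimes[b,m])\,\alpha&=[ab,m]([a,b]\otimes\mathrm{id}),\\ [a,m](\mathrm{id}\otimes[m,b])\,\alpha&=\chi(a,b)\,[m,b]([a,m]\otimes\mathrm{id}), & [m,ab](\mathrm{id}\otimes[a,b])\,\alpha&=[m,b]([m,a]\otimes\mathrm{id}),\\ [a,b](\mathrm{id}\otimes[b])\,\alpha&=[ab]([a,m]\otimes\mathrm{id}), & [b](\mathrm{id}\otimes[a,m])\,\alpha&=\chi(a,b)\,[b]([m,a]\otimes\mathrm{id}),\\ [ba](\mathrm{id}\otimes[m,a])\,\alpha&=[b,a]([b]\otimes\mathrm{id}), & [m,a](\mathrm{id}\otimes[a])\,\alpha&=\sum_{b\in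 A}\frac{\tau}{\chi(a,b)}\sum_{s\in\{1,i,j,k\}}[b,m]([b]\otimes\mathrm{id})((\mathrm{id}\otimes s)\otimes s). \end{aligned}$$ **Theorem 5.4.** 1. For every finite group $A$, nondegenerate symmetric bicharacter $\chi:A\times A\to\mathbb R^\times$ and $\tau=\pm1/\sqrt{4|A|}$, there exists a category $\mathcal C_{\mathbb H}(A,\chi,\tau)$, and it is a real-quaternionic Tambara–Yamagami category. 2. Every real-quaternionic Tambara–Yamagami category over $\mathbb R$ is monoidally equivalent ($\mathbb R$-linearly) to a category $\mathcal C_{\mathbb H}(A,\chi,\tau)$ for some such triple. 3. Categories $\mathcal C_{\mathbb H}(A,\chi,\tau)$ and $\mathcal C_{\mathbb H}(A',\chi',\tau')$ are monoidally equivalent ($\mathbb R$-linearly) if and only if $\tau=\tau'$ and there is a group isomorphism $f:A\to A'$ with $\chi'(f(a),f(b))=\chi(a,b)$ for all $a,b\in A$. In particular, $\mathcal C_{\mathbb H}(A,\chi,\tau)$ is unique up to monoidal equivalence. -/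

import Mathlib

open CategoryTheory MonoidalCategory
open scoped Quaternion

universe v u v' u' w w'

/-- A fusion category over a field `𝕜`: a finite semisimple `𝕜`-linear abelian category with a
bilinear rigid monoidal structure and simple monoidal unit.  Simple objects are not required to be
split. -/
structure FusionCat (𝕜 : Type w) [Field 𝕜] where
  carrier : Type u
  [category : Category.{v} carrier]
  [abelian : Abelian carrier]
  [linear : Linear 𝕜 carrier]
  [monoidal : MonoidalCategory carrier]
  [monoidalPreadditive : MonoidalPreadditive carrier]
  [monoidalLinear : MonoidalLinear 𝕜 carrier]
  /-- Hom spaces are finite dimensional. -/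
  finite_hom : ∀ X Y : carrier, FiniteDimensional 𝕜 (X ⟶ Y)
  /-- Every object is a finite direct sum of simple objects. -/
  semisimple : ∀ X : carrier, ∃ (n : ℕ) (S : Fin n → carrier),
    (∀ i, Simple (S i)) ∧ ∃ b : Limits.Bicone S, Nonempty b.IsBilimit ∧ Nonempty (X ≅ b.pt)
  /-- There are finitely many simple objects up to isomorphism. -/
  finite_simples : ∃ (n : ℕ) (S : Fin n → carrier),
    ∀ X : carrier, Simple X → ∃ i, Nonempty (X ≅ S i)
  /-- Every object has a left and a right dual. -/
  rigid : Nonempty (RigidCategory carrier)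
  simple_unit : Simple (𝟙_ carrier)

instance (𝕜 : Type w) [Field 𝕜] : CoeSort (FusionCat.{v, u, w} 𝕜) (Type u) :=
  ⟨FusionCat.carrier⟩

attribute [instance] FusionCat.category FusionCat.abelian FusionCat.linear FusionCat.monoidal
  FusionCat.monoidalPreadditive FusionCat.monoidalLinear

/-- Two fusion categories over `𝕜` are monoidally equivalent: there is a `𝕜`-linear strong monoidal
functor between them which is an equivalence of categories. -/
def MonoidallyEquivalent {𝕜 : Type w} [Field 𝕜]
    (C : FusionCat.{v, u, w} 𝕜) (D : FusionCat.{v', u', w} 𝕜) : Prop :=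
  ∃ F : C ⥤ D, F.IsEquivalence ∧ F.Additive ∧ F.Linear 𝕜 ∧ Nonempty F.Monoidal

/-- An object of a monoidal category is invertible if it has a two-sided tensor inverse up to
isomorphism. -/
def IsInvertibleObj {C : Type u} [Category.{v} C] [MonoidalCategory C] (X : C) : Prop :=
  ∃ Y : C, Nonempty (X ⊗ Y ≅ 𝟙_ C) ∧ Nonempty (Y ⊗ X ≅ 𝟙_ C)

/-- `C` is a Tambara--Yamagami category with non-invertible simple object `m`: up to isomorphism
`m` is the only simple object that is not invertible, and `m` does not occur in `m ⊗ m`. -/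
structure IsTambaraYamagami {𝕜 : Type w} [Field 𝕜] (C : FusionCat.{v, u, w} 𝕜) (m : C) :
    Prop where
  simple : Simple m
  not_invertible : ¬ IsInvertibleObj m
  invertible_or_iso : ∀ X : C, Simple X → IsInvertibleObj X ∨ Nonempty (X ≅ m)
  multiplicity_zero : ∀ f : m ⊗ m ⟶ m, f = 0

/-- A Tambara--Yamagami category over `ℝ` with `End(𝟙) ≅ ℝ` and `End(m) ≅ ℍ`. -/
def IsRealQuaternionicTY (C : FusionCat.{v, u, 0} ℝ) : Prop :=
  ∃ m : C, IsTambaraYamagami C m ∧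
    Nonempty (End (𝟙_ C) ≃ₐ[ℝ] ℝ) ∧ Nonempty (End m ≃ₐ[ℝ] ℍ[ℝ])

/-- A nondegenerate symmetric bicharacter `χ : A × A → ℝˣ` together with a sign choice
`τ = ±1/√(4|A|)`. -/
structure TYDatum (A : Type w) [Group A] [Fintype A] where
  χ : A → A → ℝˣ
  τ : ℝ
  mul_left : ∀ a b c, χ (a * b) c = χ a c * χ b c
  mul_right : ∀ a b c, χ a (b * c) = χ a b * χ a c
  symm : ∀ a b, χ a b = χ b a
  nondegenerate : ∀ a, (∀ b, χ a b = 1) → a = 1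
  tau_eq : τ = 1 / Real.sqrt (4 * Fintype.card A) ∨ τ = -(1 / Real.sqrt (4 * Fintype.card A))

/-- The real basis `1, i, j, k` of the quaternions. -/
def quaternionUnits : Fin 4 → ℍ[ℝ] :=
  ![⟨1, 0, 0, 0⟩, ⟨0, 1, 0, 0⟩, ⟨0, 0, 1, 0⟩, ⟨0, 0, 0, 1⟩]

/-- A presentation of a fusion category `C` over `ℝ` as the category `𝒞_ℍ(A, χ, τ)`: the simple
objects are `A ⊔ {m}` with `End(m)` identified with `ℍ`, the tensor product is given by preferred
morphisms `[a,b] : a ⊗ b ⟶ ab`, `[a,m] : a ⊗ m ⟶ m`, `[m,a] : m ⊗ a ⟶ m`, `[a] : m ⊗ m ⟶ a`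
compatible with the quaternions, and in terms of these the unit constraints are trivial and the
associators have the prescribed coefficients
`α_{a,b,c} = 1`, `α_{a,b,m} = α_{m,a,b} = 1`, `α_{a,m,b} = χ(a,b)`, `α_{a,m,m} = α_{m,m,a} = 1`,
`α_{m,a,m} = ⨁_b χ(a,b)`, `α_{m,m,m} = τ χ(a,b)⁻¹ ∑_s (s, s)`. -/
structure CHPresentation (C : FusionCat.{v, u, 0} ℝ) {A : Type w} [Group A] [Fintype A]
    (d : TYDatum A) where
  /-- The non-invertible simple object. -/
  m : C
  isTY : IsTambaraYamagami C m
  /-- The identification of `End(m)` with the quaternions. -/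
  quat : ℍ[ℝ] ≃ₐ[ℝ] End m
  /-- The invertible simple objects. -/
  obj : A → C
  simple_obj : ∀ a, Simple (obj a)
  obj_invertible : ∀ a, IsInvertibleObj (obj a)
  obj_surjective : ∀ X : C, Simple X → IsInvertibleObj X → ∃ a, Nonempty (X ≅ obj a)
  obj_injective : ∀ a b, Nonempty (obj a ≅ obj b) → a = b
  /-- The unit object is the identity of `A`. -/
  unitIso : 𝟙_ C ≅ obj 1
  /-- `[a,b]` -/
  mul : ∀ a b : A, obj a ⊗ obj b ≅ obj (a * b)
  /-- `[a,m]` -/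
  actL : ∀ a : A, obj a ⊗ m ≅ m
  /-- `[m,a]` -/
  actR : ∀ a : A, m ⊗ obj a ≅ m
  /-- `[a]` -/
  proj : ∀ a : A, m ⊗ m ⟶ obj a
  proj_ne_zero : ∀ a, proj a ≠ 0
  /-- `[a,m](id ⊗ h) = h [a,m]` -/
  actL_quat : ∀ (a : A) (h : ℍ[ℝ]),
    obj a ◁ End.asHom (quat h) ≫ (actL a).hom =
      (actL a).hom ≫ End.asHom (quat h)
  /-- `[m,a](h ⊗ id) = h [m,a]` -/
  actR_quat : ∀ (a : A) (h : ℍ[ℝ]),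
    End.asHom (quat h) ▷ obj a ≫ (actR a).hom =
      (actR a).hom ≫ End.asHom (quat h)
  /-- `[a](id ⊗ h) = [a](h̄ ⊗ id)` -/
  proj_quat : ∀ (a : A) (h : ℍ[ℝ]),
    m ◁ End.asHom (quat h) ≫ proj a =
      End.asHom (quat (star h)) ▷ m ≫ proj a
  one_mul_eq : ∀ a : A,
    unitIso.hom ▷ obj a ≫ (mul 1 a).hom ≫ eqToHom (congrArg obj (one_mul a)) = (λ_ (obj a)).hom
  mul_one_eq : ∀ a : A,
    obj a ◁ unitIso.hom ≫ (mul a 1).hom ≫ eqToHom (congrArg obj (mul_one a)) = (ρ_ (obj a)).hom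
  one_actL : unitIso.hom ▷ m ≫ (actL 1).hom = (λ_ m).hom
  actR_one : m ◁ unitIso.hom ≫ (actR 1).hom = (ρ_ m).hom
  assoc_a_b_c : ∀ a b c : A,
    (α_ (obj a) (obj b) (obj c)).hom ≫ obj a ◁ (mul b c).hom ≫ (mul a (b * c)).hom =
      (mul a b).hom ▷ obj c ≫ (mul (a * b) c).hom ≫ eqToHom (congrArg obj (mul_assoc a b c))
  assoc_a_b_m : ∀ a b : A,
    (α_ (obj a) (obj b) m).hom ≫ obj a ◁ (actL b).hom ≫ (actL a).hom =
      (mul a b).hom ▷ m ≫ (actL (a * b)).hom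
  assoc_a_m_b : ∀ a b : A,
    (α_ (obj a) m (obj b)).hom ≫ obj a ◁ (actR b).hom ≫ (actL a).hom =
      (d.χ a b : ℝ) • ((actL a).hom ▷ obj b ≫ (actR b).hom)
  assoc_m_a_b : ∀ a b : A,
    (α_ m (obj a) (obj b)).hom ≫ m ◁ (mul a b).hom ≫ (actR (a * b)).hom =
      (actR a).hom ▷ obj b ≫ (actR b).hom
  assoc_a_m_m : ∀ a b : A,
    (α_ (obj a) m m).hom ≫ obj a ◁ proj b ≫ (mul a b).hom =
      (actL a).hom ▷ m ≫ proj (a * b)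
  assoc_m_a_m : ∀ a b : A,
    (α_ m (obj a) m).hom ≫ m ◁ (actL a).hom ≫ proj b =
      (d.χ a b : ℝ) • ((actR a).hom ▷ m ≫ proj b)
  assoc_m_m_a : ∀ a b : A,
    (α_ m m (obj a)).hom ≫ m ◁ (actR a).hom ≫ proj (b * a) =
      proj b ▷ obj a ≫ (mul b a).hom
  /-- `[m,a](id ⊗ [a]) α_{m,m,m} = ∑_b τ χ(a,b)⁻¹ ∑_s [b,m]([b] ⊗ id)((id ⊗ s) ⊗ s)` -/
  assoc_m_m_m : ∀ a : A,
    (α_ m m m).hom ≫ m ◁ proj a ≫ (actR a).hom =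
      ∑ b : A, (d.τ * (d.χ a b : ℝ)⁻¹) • ∑ i : Fin 4,
        ((𝟙 m ⊗ₘ End.asHom (quat (quaternionUnits i))) ⊗ₘ
            End.asHom (quat (quaternionUnits i))) ≫
          proj b ▷ m ≫ (actL b).hom

/-- `C` is (a model of) the fusion category `𝒞_ℍ(A, χ, τ)`. -/
def IsCH (C : FusionCat.{v, u, 0} ℝ) {A : Type w} [Group A] [Fintype A] (d : TYDatum A) : Prop :=
  Nonempty (CHPresentation C d)

/-! The proof has three independent pillars: a model for every triple, a normal form for an
arbitrary category, and a comparison of two normal forms.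

Existence is Galois descent from `ℂ`. The complex Tambara–Yamagami category with group `A`,
bicharacter `χ` and parameter `-2τ = ∓1/√|A|` is realised by label-preserving matrices, with
associator `tyF`; the pentagon is `tyF_pentagon`. Its coefficients are real, so entrywise
conjugation is a monoidal antilinear involution. The parity, `-1` on `m` and `1` on `A`, is a
monoidal automorphism of the identity functor because the fusion rules are `ℤ/2`-graded. Objects
equipped with `J` satisfying `J ≫ conj J = sgn` form the real category `Twisted`. On an object
labelled by `a ∈ A` such a `J` is a real structure; on multiples of `m` it is a quaternionic
structure, so the simple object there is `m ⊕ m`, with endomorphism algebra `ℍ`. The identity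
`symp_completeness` rewrites the complex coefficient `-2τ/χ(a,b)` as `τ/χ(a,b)` times a sum over the
quaternion units.

For the normal form (`TYGauge`), Skolem–Noether (`Quaternion.exists_conj`) makes `[a,m]` and `[m,a]`
linear over `ℍ` and a pairing `m ⊗ m ⟶ 1` balanced; Schur's lemma and the centre of `ℍ` then leave
only real scalars. These are spent as follows: `[a,b]` is scaled so that `α_{a,b,m}` is trivial,
`[a]` is defined from `[1]` so that `α_{a,m,m}` is trivial when the last two factors are paired into
`1`, and `[m,a]` is scaled so that `α_{m,m,a}` is trivial when the first two are. Pentagons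
propagate these normalisations to all labels and to `α_{a,b,c}` and `α_{m,a,b}`. What remains is a
scalar `chi` for `α_{a,m,b}`, a scalar `psi` for `α_{m,a,m}`, and `α_{m,m,m}`, which quaternion
equivariance confines to real combinations of Casimir sums over the quaternion units
(`exists_casimir`). The remaining pentagons give bimultiplicativity of `chi`, `psi = chi`, the
coefficients `τ/χ(a,b)`, symmetry, and an orthogonality relation (`sum_coeff`) containing both
`4τ²|A| = 1` and nondegeneracy.

For the classification, two presentations of one datum are matched on simple objects and their
endomorphisms. Semisimplicity extends the matching to a linear equivalence by acting on matrix
entries, and the vertices prescribe a tensorator on simple objects, which extends by naturality.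
Associativity needs checking only on families of vertices that split a triple product, where both
associators have the same coefficients (`CHPresentation.monoidallyEquivalent`). Conversely, a
monoidal equivalence transports a presentation, and two presentations on one category, after
matching their group labels, have vertices that agree up to real scalars and an intertwiner. The
scalars cancel from `χ`, and from `τ` because the unit constraints force the scalars of `[1,m]` and
`[m,1]` to agree (`CHPresentation.datum_eq`). -/

set_option linter.unusedSectionVars false

/-! ### Quaternion units and the Skolem–Noether theorem -/

namespace Quaternion

lemma ext_components {a b : ℍ[ℝ]} (h1 : a.re = b.re) (h2 : a.imI = b.imI) (h3 : a.imJ = b.imJ)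
    (h4 : a.imK = b.imK) : a = b := QuaternionAlgebra.ext h1 h2 h3 h4

/-- The quaternion `i`. -/
def unitI : ℍ[ℝ] := ⟨0, 1, 0, 0⟩
/-- The quaternion `j`. -/
def unitJ : ℍ[ℝ] := ⟨0, 0, 1, 0⟩
/-- The quaternion `k`. -/
def unitK : ℍ[ℝ] := ⟨0, 0, 0, 1⟩

@[simp] lemma unitI_re : unitI.re = 0 := rfl
@[simp] lemma unitI_imI : unitI.imI = 1 := rfl
@[simp] lemma unitI_imJ : unitI.imJ = 0 := rfl
@[simp] lemma unitI_imK : unitI.imK = 0 := rfl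
@[simp] lemma unitJ_re : unitJ.re = 0 := rfl
@[simp] lemma unitJ_imI : unitJ.imI = 0 := rfl
@[simp] lemma unitJ_imJ : unitJ.imJ = 1 := rfl
@[simp] lemma unitJ_imK : unitJ.imK = 0 := rfl
@[simp] lemma unitK_re : unitK.re = 0 := rfl
@[simp] lemma unitK_imI : unitK.imI = 0 := rfl
@[simp] lemma unitK_imJ : unitK.imJ = 0 := rfl
@[simp] lemma unitK_imK : unitK.imK = 1 := rfl

@[simp] lemma unitI_mul_unitI : unitI * unitI = -1 := by apply ext_components <;> simp
@[simp] lemma unitJ_mul_unitJ : unitJ * unitJ = -1 := by apply ext_components <;> simp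
@[simp] lemma unitK_mul_unitK : unitK * unitK = -1 := by apply ext_components <;> simp
@[simp] lemma unitI_mul_unitJ : unitI * unitJ = unitK := by apply ext_components <;> simp
@[simp] lemma unitJ_mul_unitK : unitJ * unitK = unitI := by apply ext_components <;> simp
@[simp] lemma unitK_mul_unitI : unitK * unitI = unitJ := by apply ext_components <;> simp
@[simp] lemma unitJ_mul_unitI : unitJ * unitI = -unitK := by apply ext_components <;> simp
@[simp] lemma unitK_mul_unitJ : unitK * unitJ = -unitI := by apply ext_components <;> simp
@[simp] lemma unitI_mul_unitK : unitI * unitK = -unitJ := by apply ext_components <;> simp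
@[simp] lemma star_unitI : star unitI = -unitI := by apply ext_components <;> simp
@[simp] lemma star_unitJ : star unitJ = -unitJ := by apply ext_components <;> simp
@[simp] lemma star_unitK : star unitK = -unitK := by apply ext_components <;> simp

@[simp] lemma quaternionUnits_zero : quaternionUnits 0 = 1 := by apply ext_components <;> rfl
@[simp] lemma quaternionUnits_one : quaternionUnits 1 = unitI := rfl
@[simp] lemma quaternionUnits_two : quaternionUnits 2 = unitJ := rfl
@[simp] lemma quaternionUnits_three : quaternionUnits 3 = unitK := rfl

lemma decomp (h : ℍ[ℝ]) :
    h = h.re • (1 : ℍ[ℝ]) + h.imI • unitI + h.imJ • unitJ + h.imK • unitK := by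
  apply ext_components <;> simp

/-- A quaternion commuting with `i` and `j` is real. -/
lemma eq_coe_of_commute (x : ℍ[ℝ]) (hi : x * unitI = unitI * x) (hj : x * unitJ = unitJ * x) :
    x = algebraMap ℝ ℍ[ℝ] x.re := by
  have h1 := congrArg QuaternionAlgebra.imK hi
  have h2 := congrArg QuaternionAlgebra.imJ hi
  have h3 := congrArg QuaternionAlgebra.imK hj
  simp at h1 h2 h3
  apply ext_components <;> simp <;> linarith

lemma eq_coe_of_central (x : ℍ[ℝ]) (h : ∀ y, x * y = y * x) : x = algebraMap ℝ ℍ[ℝ] x.re :=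
  eq_coe_of_commute x (h _) (h _)

/-- Skolem--Noether for the real quaternions. -/
theorem exists_conj (σ : ℍ[ℝ] →ₐ[ℝ] ℍ[ℝ]) : ∃ u : ℍ[ℝ], u ≠ 0 ∧ ∀ h, σ h * u = u * h := by
  -- The average of `σ(s) x s⁻¹` over the units `1, i, j, k`, up to normalisation; the signs come
  -- from `s⁻¹ = -s` for the imaginary units. Such an average intertwines `σ` with the identity.
  let U : ℍ[ℝ] → ℍ[ℝ] := fun x =>
    x - σ unitI * x * unitI - σ unitJ * x * unitJ - σ unitK * x * unitK
  have s (a b : ℍ[ℝ]) (x : ℍ[ℝ]) : σ a * (σ b * x) = σ (a * b) * x := by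
    rw [map_mul, mul_assoc]
  have hUi (x) : σ unitI * U x = U x * unitI := by
    simp only [U, mul_sub, sub_mul, mul_assoc, s, unitI_mul_unitI, unitI_mul_unitJ,
      unitI_mul_unitK, unitJ_mul_unitI, unitK_mul_unitI, map_neg, map_one]
    simp only [neg_mul, mul_neg, one_mul, mul_one]
    abel
  have hUj (x) : σ unitJ * U x = U x * unitJ := by
    simp only [U, mul_sub, sub_mul, mul_assoc, s, unitJ_mul_unitJ, unitI_mul_unitJ,
      unitJ_mul_unitK, unitJ_mul_unitI, unitK_mul_unitJ, map_neg, map_one]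
    simp only [neg_mul, mul_neg, one_mul, mul_one]
    abel
  have hUk (x) : σ unitK * U x = U x * unitK := by
    rw [← unitI_mul_unitJ, map_mul, mul_assoc, hUj, ← mul_assoc, hUi, mul_assoc]
  have hall (x h) : σ h * U x = U x * h := by
    rw [decomp h]
    simp only [map_add, map_smul, map_one, add_mul, mul_add, smul_mul_assoc, mul_smul_comm, hUi,
      hUj, hUk, one_mul, mul_one]
  by_contra hne
  push Not at hne
  have hz (x) : U x = 0 := by
    by_contra h0
    obtain ⟨h, hh⟩ := hne (U x) h0
    exact hh (hall x h)
  -- Some average is nonzero: in the sum of `U(t) t⁻¹` over the units, summing `t s⁻¹ t⁻¹` over `t`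
  -- cancels for imaginary `s`, and `s = 1` contributes `4`.
  have key : U 1 - U unitI * unitI - U unitJ * unitJ - U unitK * unitK =
      (1 + 1 + 1 + 1 : ℍ[ℝ]) := by
    simp only [U, sub_mul, mul_assoc, unitI_mul_unitI, unitJ_mul_unitJ, unitK_mul_unitK,
      unitI_mul_unitJ, unitJ_mul_unitI, unitI_mul_unitK, unitK_mul_unitI, unitJ_mul_unitK,
      unitK_mul_unitJ, mul_neg, neg_mul, mul_one, one_mul]
    abel
  rw [hz, hz, hz, hz] at key
  have := congrArg QuaternionAlgebra.re key
  simp only [zero_mul, sub_zero, Quaternion.re_add, Quaternion.re_zero, Quaternion.re_one] at this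
  norm_num at this

end Quaternion

/-! ### Semisimplicity, idempotents and direct sums -/

section General

variable {𝕜 : Type w} [Field 𝕜] {C : FusionCat.{v, u, w} 𝕜}

open Limits

/-- Every object is a finite direct sum of simple objects, in terms of inclusions and
projections. -/
lemma FusionCat.exists_decomposition (X : C) :
    ∃ (n : ℕ) (S : Fin n → C) (ι : ∀ i, S i ⟶ X) (π : ∀ i, X ⟶ S i),
      (∀ i, Simple (S i)) ∧ (∀ i, ι i ≫ π i = 𝟙 _) ∧ (∀ i j, i ≠ j → ι i ≫ π j = 0) ∧
        ∑ i, π i ≫ ι i = 𝟙 X := by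
  obtain ⟨n, S, hS, b, ⟨hb⟩, ⟨e⟩⟩ := C.semisimple X
  refine ⟨n, S, fun i => b.ι i ≫ e.inv, fun i => e.hom ≫ b.π i, hS, ?_, ?_, ?_⟩
  · intro i; simp
  · intro i j hij
    simp [bicone_ι_π_ne b hij]
  · have := IsBilimit.total hb
    calc _ = e.hom ≫ (∑ i, b.π i ≫ b.ι i) ≫ e.inv := by
          simp [Preadditive.comp_sum, Preadditive.sum_comp]
      _ = _ := by rw [this]; simp

/-- By Schur's lemma a nonzero endomorphism is invertible, and an invertible idempotent is the
identity. -/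
lemma idem_of_simple {D : Type u} [Category.{v} D] [Preadditive D] [HasKernels D]
    {X : D} [Simple X] (e : X ⟶ X) (he : e ≫ e = e) :
    e = 0 ∨ e = 𝟙 X := by
  by_cases h : e = 0
  · exact Or.inl h
  · have := isIso_of_hom_simple h
    exact Or.inr (by rw [← cancel_epi e, he, Category.comp_id])

/-- Semisimplicity supplies a simple summand, whose projector is nonzero and hence the identity.
Idempotents travel well along whiskering, adjunctions and functors, which makes this the working
test for simplicity. -/
lemma FusionCat.simple_of_idem (X : C) (h0 : 𝟙 X ≠ 0)
    (h : ∀ e : X ⟶ X, e ≫ e = e → e = 0 ∨ e = 𝟙 X) : Simple X := by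
  obtain ⟨n, S, ι, π, hS, h1, h2, h3⟩ := C.exists_decomposition X
  rcases n with _ | n
  · simp at h3; exact absurd h3.symm h0
  have := hS 0
  rcases h (π 0 ≫ ι 0) (by simp [reassoc_of% (h1 0)]) with h4 | h4
  · have : 𝟙 (S 0) = 0 := by
      calc 𝟙 (S 0) = ι 0 ≫ (π 0 ≫ ι 0) ≫ π 0 := by simp [h1 0]
        _ = 0 := by rw [h4]; simp
    exact absurd this (id_nonzero _)
  · exact Simple.of_iso (Y := S 0) ⟨π 0, ι 0, h4, h1 0⟩

/-- In a fusion category, a jointly monic and independent family of maps to simple objects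
exhibits the source as a direct sum. -/
lemma FusionCat.exists_dual_family {K : Type w'} [Fintype K] {X : C} (T : K → C)
    [∀ k, Simple (T k)]
    (p : ∀ k, X ⟶ T k) (hmono : ∀ (W : C) (f : W ⟶ X), (∀ k, f ≫ p k = 0) → f = 0)
    (hind : ∀ (Z : C) [Simple Z] (g : ∀ k, T k ⟶ Z), ∑ k, p k ≫ g k = 0 → ∀ k, g k = 0) :
    ∃ j : ∀ k, T k ⟶ X, (∀ k, j k ≫ p k = 𝟙 _) ∧ (∀ k l, k ≠ l → j k ≫ p l = 0) ∧
      ∑ k, p k ≫ j k = 𝟙 X := by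
  classical
  have : HasFiniteBiproducts C := Abelian.hasFiniteBiproducts
  -- Joint monicity makes `P` monic. Independence, tested on the simple summands of an arbitrary
  -- target, makes it epic. In an abelian category it is then invertible.
  let P : X ⟶ ⨁ T := biproduct.lift p
  have : Mono P := Preadditive.mono_of_cancel_zero _ fun f hf => by
    refine hmono _ f fun k => ?_
    have := congrArg (· ≫ biproduct.π T k) hf
    simpa [P] using this
  have : Epi P := Preadditive.epi_of_cancel_zero _ fun {Z} g hg => by
    obtain ⟨n, S, ι, π, hS, h1, h2, h3⟩ := C.exists_decomposition Z
    have h4 (i) : g ≫ π i = 0 := by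
      have := hS i
      have h5 := hind (S i) (fun k => biproduct.ι T k ≫ g ≫ π i) (by
        have : P = ∑ k, p k ≫ biproduct.ι T k := by
          apply biproduct.hom_ext; intro k
          simp [P, Preadditive.sum_comp, biproduct.ι_π, comp_dite]
        calc _ = (∑ k, p k ≫ biproduct.ι T k) ≫ g ≫ π i := by
              simp [Preadditive.sum_comp]
          _ = 0 := by rw [← this, reassoc_of% hg]; simp)
      apply biproduct.hom_ext'
      intro k
      simpa using h5 k
    calc g = g ≫ ∑ i, π i ≫ ι i := by rw [h3]; simp
      _ = 0 := by simp [Preadditive.comp_sum, reassoc_of% h4]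
  have : IsIso P := isIso_of_mono_of_epi P
  refine ⟨fun k => biproduct.ι T k ≫ inv P, ?_, ?_, ?_⟩
  · intro k
    have : p k = P ≫ biproduct.π T k := by simp [P]
    simp [this]
  · intro k l hkl
    have : p l = P ≫ biproduct.π T l := by simp [P]
    simp [this, biproduct.ι_π_ne _ hkl]
  · have : P = ∑ k, p k ≫ biproduct.ι T k := by
      apply biproduct.hom_ext; intro k
      simp [P, Preadditive.sum_comp, biproduct.ι_π, comp_dite]
    simp only [← Category.assoc]
    rw [← Preadditive.sum_comp, ← this]
    simp

end General

/-! ### Invertible objects of a monoidal category -/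

section Invertible

variable {C : Type u} [Category.{v} C] [MonoidalCategory C]

lemma IsInvertibleObj.of_iso {X Y : C} (h : IsInvertibleObj X) (e : X ≅ Y) :
    IsInvertibleObj Y := by
  obtain ⟨Z, ⟨a⟩, ⟨b⟩⟩ := h
  exact ⟨Z, ⟨whiskerRightIso e.symm Z ≪≫ a⟩, ⟨whiskerLeftIso Z e.symm ≪≫ b⟩⟩

lemma IsInvertibleObj.unit : IsInvertibleObj (𝟙_ C) := ⟨𝟙_ C, ⟨λ_ _⟩, ⟨λ_ _⟩⟩

lemma IsInvertibleObj.tensor {X Y : C} (hX : IsInvertibleObj X) (hY : IsInvertibleObj Y) :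
    IsInvertibleObj (X ⊗ Y) := by
  obtain ⟨X', ⟨a⟩, ⟨b⟩⟩ := hX
  obtain ⟨Y', ⟨c⟩, ⟨d⟩⟩ := hY
  refine ⟨Y' ⊗ X', ⟨?_⟩, ⟨?_⟩⟩
  · exact α_ _ _ _ ≪≫ whiskerLeftIso X ((α_ _ _ _).symm ≪≫ whiskerRightIso c X' ≪≫ λ_ _) ≪≫ a
  · exact α_ _ _ _ ≪≫ whiskerLeftIso Y' ((α_ _ _ _).symm ≪≫ whiskerRightIso b Y ≪≫ λ_ _) ≪≫ d

/-- Whiskering further with the tensor inverse of `X` recovers the morphism, up to isomorphisms of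
source and target. -/
lemma IsInvertibleObj.whiskerLeft_injective {X : C} (hX : IsInvertibleObj X) {Z W : C}
    {f g : Z ⟶ W} (h : X ◁ f = X ◁ g) : f = g := by
  obtain ⟨Y, _, ⟨j⟩⟩ := hX
  have h1 : 𝟙_ C ◁ f = 𝟙_ C ◁ g := by
    rw [← cancel_epi (j.hom ▷ Z), ← whisker_exchange, ← whisker_exchange, cancel_mono,
      ← cancel_mono (α_ _ _ _).hom]
    simp [h]
  simpa using h1

lemma IsInvertibleObj.whiskerRight_injective {X : C} (hX : IsInvertibleObj X) {Z W : C}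
    {f g : Z ⟶ W} (h : f ▷ X = g ▷ X) : f = g := by
  obtain ⟨Y, ⟨j⟩, _⟩ := hX
  have h1 : f ▷ 𝟙_ C = g ▷ 𝟙_ C := by
    rw [← cancel_mono (_ ◁ j.inv), ← whisker_exchange, ← whisker_exchange, cancel_epi,
      ← cancel_epi (α_ _ _ _).hom]
    rw [← associator_naturality_left, ← associator_naturality_left, h]
  simpa using h1

end Invertible

/-! ### Simplicity and duality in Tambara–Yamagami categories -/

section Fusion

variable {𝕜 : Type w} [Field 𝕜] {C : FusionCat.{v, u, w} 𝕜}

/-- Whiskering with the inverse `Y` is faithful and sends idempotents of `X` to idempotents of `X ⊗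
Y ≅ 𝟙`, which is simple. -/
lemma IsInvertibleObj.simple {X : C} (hX : IsInvertibleObj X) : Simple X := by
  obtain ⟨Y, ⟨a⟩, ⟨b⟩⟩ := id hX
  have := C.simple_unit
  have hXY : Simple (X ⊗ Y) := Simple.of_iso a
  have hY : IsInvertibleObj Y := ⟨X, ⟨b⟩, ⟨a⟩⟩
  refine C.simple_of_idem X (fun h => id_nonzero (X ⊗ Y) ?_) fun e he => ?_
  · rw [← id_whiskerRight, h, MonoidalPreadditive.zero_whiskerRight]
  · rcases idem_of_simple (e ▷ Y) (by rw [← comp_whiskerRight, he]) with h | h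
    · exact Or.inl (hY.whiskerRight_injective (by simpa using h))
    · exact Or.inr (hY.whiskerRight_injective (by simpa using h))

/-- Whiskering with the inverse of `X` moves idempotents faithfully into `Y ⊗ (X ⊗ Z) ≅ Z`. -/
lemma IsInvertibleObj.simple_tensor {X Z : C} (hX : IsInvertibleObj X) [Simple Z] :
    Simple (X ⊗ Z) := by
  obtain ⟨Y, ⟨a⟩, ⟨b⟩⟩ := id hX
  have hY : IsInvertibleObj Y := ⟨X, ⟨b⟩, ⟨a⟩⟩
  have hs : Simple (Y ⊗ (X ⊗ Z)) := Simple.of_iso ((α_ _ _ _).symm ≪≫ whiskerRightIso b Z ≪≫ λ_ Z)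
  refine C.simple_of_idem _ (fun h => id_nonzero (Y ⊗ (X ⊗ Z)) ?_) fun e he => ?_
  · rw [← whiskerLeft_id, h, MonoidalPreadditive.whiskerLeft_zero]
  · rcases idem_of_simple (Y ◁ e) (by rw [← whiskerLeft_comp, he]) with h | h
    · exact Or.inl (hY.whiskerLeft_injective (by simpa using h))
    · exact Or.inr (hY.whiskerLeft_injective (by simpa using h))

lemma IsInvertibleObj.tensor_simple {X Z : C} (hX : IsInvertibleObj X) [Simple Z] :
    Simple (Z ⊗ X) := by
  obtain ⟨Y, ⟨a⟩, ⟨b⟩⟩ := id hX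
  have hY : IsInvertibleObj Y := ⟨X, ⟨b⟩, ⟨a⟩⟩
  have hs : Simple ((Z ⊗ X) ⊗ Y) := Simple.of_iso (α_ _ _ _ ≪≫ whiskerLeftIso Z a ≪≫ ρ_ Z)
  refine C.simple_of_idem _ (fun h => id_nonzero ((Z ⊗ X) ⊗ Y) ?_) fun e he => ?_
  · rw [← id_whiskerRight, h, MonoidalPreadditive.zero_whiskerRight]
  · rcases idem_of_simple (e ▷ Y) (by rw [← comp_whiskerRight, he]) with h | h
    · exact Or.inl (hY.whiskerRight_injective (by simpa using h))
    · exact Or.inr (hY.whiskerRight_injective (by simpa using h))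

lemma whiskerLeft_sub {D : Type u} [Category.{v} D] [Preadditive D] [MonoidalCategory D]
    [MonoidalPreadditive D] (X : D) {Y Z : D} (f g : Y ⟶ Z) : X ◁ (f - g) = X ◁ f - X ◁ g :=
  (tensorLeft X).map_sub

lemma sub_whiskerRight {D : Type u} [Category.{v} D] [Preadditive D] [MonoidalCategory D]
    [MonoidalPreadditive D] (X : D) {Y Z : D} (f g : Y ⟶ Z) : (f - g) ▷ X = f ▷ X - g ▷ X :=
  (tensorRight X).map_sub

variable {m : C}

/-- The product is simple. If it were invertible, tensoring back with the inverse of `X` would make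
`m` invertible. -/
lemma IsTambaraYamagami.nonempty_tensor_iso (hm : IsTambaraYamagami C m) {X : C}
    (hX : IsInvertibleObj X) : Nonempty (X ⊗ m ≅ m) := by
  have := hm.simple
  have := hX.simple_tensor (Z := m)
  refine (hm.invertible_or_iso (X ⊗ m) this).resolve_left fun h => hm.not_invertible ?_
  obtain ⟨Y, ⟨a⟩, ⟨b⟩⟩ := id hX
  have hY : IsInvertibleObj Y := ⟨X, ⟨b⟩, ⟨a⟩⟩
  exact (hY.tensor h).of_iso ((α_ _ _ _).symm ≪≫ whiskerRightIso b m ≪≫ λ_ m)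

lemma IsTambaraYamagami.nonempty_iso_tensor (hm : IsTambaraYamagami C m) {X : C}
    (hX : IsInvertibleObj X) : Nonempty (m ⊗ X ≅ m) := by
  have := hm.simple
  have := hX.tensor_simple (Z := m)
  refine (hm.invertible_or_iso (m ⊗ X) this).resolve_left fun h => hm.not_invertible ?_
  obtain ⟨Y, ⟨a⟩, ⟨b⟩⟩ := id hX
  have hY : IsInvertibleObj Y := ⟨X, ⟨b⟩, ⟨a⟩⟩
  exact (h.tensor hY).of_iso (α_ _ _ _ ≪≫ whiskerLeftIso m a ≪≫ ρ_ m)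

/-- For an exact pairing of `L` and `m`, maps into `L ⊗ m` from the unit give an additive
anti-isomorphism of `End L` and `End m`, so `L` is simple if `m` is. -/
lemma simple_of_exactPairing {L : C} [ExactPairing L m] [Simple m] : Simple L := by
  let φ : (m ⟶ m) → (𝟙_ C ⟶ L ⊗ m) := fun h => η_ L m ≫ L ◁ h
  let ψ : (L ⟶ L) → (𝟙_ C ⟶ L ⊗ m) := fun h => η_ L m ≫ h ▷ m
  have hφ (h) : φ h = tensorLeftHomEquiv (𝟙_ C) L m m ((ρ_ m).hom ≫ h) := by
    simp [φ, tensorLeftHomEquiv, ← unitors_equal]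
  have hψ (h) : ψ h = tensorRightHomEquiv (𝟙_ C) L m L ((λ_ L).hom ≫ h) := by
    simp [ψ, tensorRightHomEquiv, unitors_equal]
  have hφi : Function.Injective φ := fun a b hab => by
    rw [hφ, hφ] at hab
    simpa using (tensorLeftHomEquiv _ _ _ _).injective hab
  have hψi : Function.Injective ψ := fun a b hab => by
    rw [hψ, hψ] at hab
    simpa using (tensorRightHomEquiv _ _ _ _).injective hab
  have hφs : Function.Surjective φ := fun x => by
    refine ⟨(ρ_ m).inv ≫ (tensorLeftHomEquiv _ _ _ _).symm x, ?_⟩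
    rw [hφ]; simp
  have hz : ψ 0 = φ 0 := by simp [φ, ψ]
  have ho : ψ (𝟙 L) = φ (𝟙 m) := by simp [φ, ψ]
  refine C.simple_of_idem L (fun h => ?_) fun e he => ?_
  · rw [h, hz] at ho
    exact id_nonzero m (hφi ho).symm
  · obtain ⟨f, hf⟩ := hφs (ψ e)
    -- Endomorphisms of `L` and of `m` act on the two different factors of `L ⊗ m`, so they commute
    -- by interchange and idempotency of `e` passes to `f`.
    have : f ≫ f = f := hφi (by
      rw [hf]
      simp only [φ, ψ, whiskerLeft_comp] at hf ⊢
      rw [reassoc_of% hf, ← whisker_exchange, reassoc_of% hf, ← comp_whiskerRight, he])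
    rcases idem_of_simple f this with h | h
    · left; apply hψi; rw [← hf, h, hz]
    · right; apply hψi; rw [← hf, h, ho]

/-- If `L` had a tensor inverse `Y`, the evaluation `m ⊗ L ⟶ 𝟙`, which is nonzero by a zigzag
identity, would yield a nonzero map `m ⟶ Y` between simple objects, and `m` would be invertible. -/
lemma not_invertible_of_exactPairing {L : C} [ExactPairing L m] [Simple m]
    (hm : ¬ IsInvertibleObj m) : ¬ IsInvertibleObj L := by
  intro hL
  obtain ⟨Y, ⟨a⟩, ⟨b⟩⟩ := id hL
  have hY : IsInvertibleObj Y := ⟨L, ⟨b⟩, ⟨a⟩⟩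
  have := hY.simple
  have hev : ε_ L m ≠ 0 := fun h => by
    have := ExactPairing.evaluation_coevaluation L m
    rw [h] at this
    simp at this
    have h2 : 𝟙 L = 0 := by
      rw [← cancel_mono (ρ_ L).inv, ← cancel_epi (λ_ L).hom, Category.id_comp, ← this]
      simp
    have := hL.simple
    exact id_nonzero L h2
  have hf : ε_ L m ▷ Y ≠ 0 := fun h => hev (hY.whiskerRight_injective (by simpa using h))
  let g : m ⟶ Y := (ρ_ m).inv ≫ m ◁ a.inv ≫ (α_ _ _ _).inv ≫ ε_ L m ▷ Y ≫ (λ_ Y).hom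
  have hg : g ≠ 0 := fun h => hf (by
    rw [← cancel_mono (λ_ Y).hom, ← cancel_epi (α_ _ _ _).inv, ← cancel_epi (m ◁ a.inv),
      ← cancel_epi (ρ_ m).inv]
    simpa [g] using h)
  have := isIso_of_hom_simple hg
  exact hm (hY.of_iso (asIso g).symm)

end Fusion

/-! ### The quaternion action on `m` and the maps from `m ⊗ m` to invertible objects -/

section Quaternionic

variable {C : FusionCat.{v, u, 0} ℝ} {m : C}

/-- The endomorphism of `m` given by a quaternion. -/
noncomputable abbrev qhom (q : ℍ[ℝ] ≃ₐ[ℝ] End m) (h : ℍ[ℝ]) : m ⟶ m := End.asHom (q h)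

section
variable (q : ℍ[ℝ] ≃ₐ[ℝ] End m)

lemma qhom_mul (g h : ℍ[ℝ]) : qhom q (g * h) = qhom q h ≫ qhom q g := by
  simp only [qhom, map_mul]; rfl
lemma qhom_one : qhom q 1 = 𝟙 m := by
  simp only [qhom, map_one]; rfl
lemma qhom_zero : qhom q 0 = 0 := by
  simp only [qhom, map_zero]
lemma qhom_add (g h : ℍ[ℝ]) : qhom q (g + h) = qhom q g + qhom q h := by
  simp only [qhom, map_add]
lemma qhom_sub (g h : ℍ[ℝ]) : qhom q (g - h) = qhom q g - qhom q h := by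
  simp only [qhom, map_sub]
lemma qhom_smul (r : ℝ) (h : ℍ[ℝ]) : qhom q (r • h) = r • qhom q h := by
  simp only [qhom, map_smul]
lemma qhom_algebraMap (r : ℝ) : qhom q (algebraMap ℝ ℍ[ℝ] r) = r • 𝟙 m := by
  rw [Algebra.algebraMap_eq_smul_one, qhom_smul, qhom_one]
lemma qhom_injective {g h : ℍ[ℝ]} (e : qhom q g = qhom q h) : g = h := q.injective e
lemma qhom_surjective (f : m ⟶ m) : ∃ h, qhom q h = f := q.surjective f
lemma qhom_sum {ι : Type*} (s : Finset ι) (f : ι → ℍ[ℝ]) :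
    qhom q (∑ i ∈ s, f i) = ∑ i ∈ s, qhom q (f i) := by
  simp only [qhom, map_sum]

lemma qhom_isIso {h : ℍ[ℝ]} (hh : h ≠ 0) : IsIso (qhom q h) :=
  ⟨qhom q h⁻¹, by rw [← qhom_mul, inv_mul_cancel₀ hh, qhom_one],
    by rw [← qhom_mul, mul_inv_cancel₀ hh, qhom_one]⟩

/-- An endomorphism of `m` commuting with all quaternions is a real scalar. -/
lemma eq_smul_of_qhom_commute (f : m ⟶ m) (hf : ∀ h, f ≫ qhom q h = qhom q h ≫ f) :
    ∃ r : ℝ, f = r • 𝟙 m := by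
  obtain ⟨x, rfl⟩ := qhom_surjective q f
  refine ⟨x.re, ?_⟩
  rw [← qhom_algebraMap, ← Quaternion.eq_coe_of_central x]
  intro y
  apply qhom_injective q
  rw [qhom_mul, qhom_mul, hf]

-- A nonzero quaternion acts by an isomorphism, so composing with it cannot annihilate a nonzero
-- `e`.
include q in
lemma qhom_proj_injective {X : C}
    {e : m ⊗ m ⟶ X} (he : e ≠ 0) {g g' : m ⟶ m} (h : m ◁ g ≫ e = m ◁ g' ≫ e) : g = g' := by
  obtain ⟨x, hx⟩ := qhom_surjective q (g - g')
  by_contra hne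
  have hx0 : x ≠ 0 := by
    rintro rfl
    rw [qhom_zero] at hx
    exact hne (sub_eq_zero.mp hx.symm)
  have := qhom_isIso q hx0
  apply he
  rw [← cancel_epi (m ◁ qhom q x), hx, whiskerLeft_sub, Preadditive.sub_comp, h]
  simp

-- Tensoring with `m` turns `f` into an endomorphism of `m` that commutes with all others by
-- interchange, hence into a central quaternion. Nothing is lost: a nonzero endomorphism of the
-- simple unit is invertible and survives tensoring with `m`.
include q in
lemma end_unit_scalar (hm : IsTambaraYamagami C m) (f : 𝟙_ C ⟶ 𝟙_ C) : ∃ r : ℝ, f = r • 𝟙 _ := by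
  have := hm.simple
  have := C.simple_unit
  obtain ⟨r, hr⟩ := eq_smul_of_qhom_commute q ((λ_ m).inv ≫ f ▷ m ≫ (λ_ m).hom) (fun h => by
    rw [Category.assoc, Category.assoc, ← leftUnitor_naturality, ← whisker_exchange_assoc,
      leftUnitor_inv_naturality_assoc])
  refine ⟨r, ?_⟩
  by_contra hne
  have hne' : f - r • 𝟙 _ ≠ 0 := sub_ne_zero.mpr hne
  have := isIso_of_hom_simple hne'
  have h0 : (f - r • 𝟙 _) ▷ m = 0 := by
    rw [← cancel_epi (λ_ m).inv, ← cancel_mono (λ_ m).hom]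
    simp only [sub_eq_add_neg, ← neg_smul, MonoidalPreadditive.add_whiskerRight,
      MonoidalLinear.smul_whiskerRight, Preadditive.comp_add, Preadditive.add_comp, Category.assoc]
    rw [hr]
    simp
  have h1 : 𝟙 (𝟙_ C ⊗ m) = 0 := by
    rw [← id_whiskerRight, ← IsIso.hom_inv_id (f - r • 𝟙 _), comp_whiskerRight, h0]
    simp
  refine id_nonzero m ?_
  rw [← cancel_epi (λ_ m).hom, ← cancel_mono (λ_ m).inv]
  simpa using h1

-- Tensoring with an inverse of `X` reduces the question to endomorphisms of the unit.
include q in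
lemma end_invertible_scalar (hm : IsTambaraYamagami C m) {X : C} (hX : IsInvertibleObj X)
    (f : X ⟶ X) : ∃ r : ℝ, f = r • 𝟙 _ := by
  obtain ⟨Y, ⟨a⟩, ⟨b⟩⟩ := id hX
  have hY : IsInvertibleObj Y := ⟨X, ⟨b⟩, ⟨a⟩⟩
  obtain ⟨r, hr⟩ := end_unit_scalar q hm (a.inv ≫ f ▷ Y ≫ a.hom)
  refine ⟨r, hY.whiskerRight_injective ?_⟩
  rw [← cancel_epi a.inv, ← cancel_mono a.hom, Category.assoc, hr]
  simp

include q in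
/-- Two maps to an invertible object, one of which is an isomorphism, are proportional. -/
lemma exists_smul_of_invertible (hm : IsTambaraYamagami C m) {X Y : C} (hX : IsInvertibleObj X)
    (f g : Y ⟶ X) [IsIso f] : ∃ r : ℝ, g = r • f := by
  obtain ⟨r, hr⟩ := end_invertible_scalar q hm hX (inv f ≫ g)
  refine ⟨r, ?_⟩
  rw [← cancel_epi (inv f), hr]; simp

/-- Two maps to `m` which intertwine the same action of the quaternions, one of which is an
isomorphism, are proportional over the reals. -/
lemma exists_smul_of_intertwine {X : C} (f g : X ⟶ m) [IsIso f] (x : ℍ[ℝ] → (X ⟶ X))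
    (hf : ∀ h, x h ≫ f = f ≫ qhom q h) (hg : ∀ h, x h ≫ g = g ≫ qhom q h) :
    ∃ r : ℝ, g = r • f := by
  obtain ⟨r, hr⟩ := eq_smul_of_qhom_commute q (inv f ≫ g) (fun h => by
    rw [Category.assoc, ← hg, ← cancel_epi f]
    simp [← reassoc_of% (hf h)])
  refine ⟨r, ?_⟩
  rw [← cancel_epi (inv f), hr]; simp
end

variable (hm : IsTambaraYamagami C m)
include hm

/-- The left dual of `m` is simple and not invertible, so it is isomorphic to `m`, and `m` absorbs
invertible objects. -/
lemma IsTambaraYamagami.exists_pairing :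
    ∃ (L : C) (_ : ExactPairing L m), ∀ X : C, IsInvertibleObj X → Nonempty (L ⊗ X ≅ m) := by
  obtain ⟨hr⟩ := C.rigid
  have := hm.simple
  refine ⟨ᘁm, inferInstance, fun X hX => ?_⟩
  have h1 : Simple (ᘁm) := simple_of_exactPairing (m := m)
  have h2 := not_invertible_of_exactPairing (L := ᘁm) hm.not_invertible
  obtain ⟨e⟩ := (hm.invertible_or_iso (ᘁm) h1).resolve_left h2
  obtain ⟨e'⟩ := hm.nonempty_iso_tensor hX
  exact ⟨whiskerRightIso e X ≪≫ e'⟩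

/-- Duality turns maps `m ⊗ m ⟶ X` into maps `m ⟶ L ⊗ X ≅ m`, and the inverse of this isomorphism is
a nonzero one. -/
lemma IsTambaraYamagami.exists_proj {X : C} (hX : IsInvertibleObj X) :
    ∃ e : m ⊗ m ⟶ X, e ≠ 0 := by
  obtain ⟨L, _, h⟩ := hm.exists_pairing
  obtain ⟨i⟩ := h X hX
  refine ⟨(tensorLeftHomEquiv m L m X).symm i.inv, fun h0 => ?_⟩
  have h1 : i.inv = 0 := by
    have : i.inv = tensorLeftHomEquiv m L m X 0 := by rw [← h0]; simp
    rw [this]; simp [tensorLeftHomEquiv]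
  have := hm.simple
  apply id_nonzero m
  rw [← i.inv_hom_id, h1]; simp

/-- Under the duality adjunction, acting on the second factor becomes precomposition on `End(m)`. As
`End(m)` is a division algebra, `Hom(m ⊗ m, X)` is free of rank one over it, on any nonzero
generator. -/
lemma IsTambaraYamagami.proj_torsor {X : C} (hX : IsInvertibleObj X)
    (e : m ⊗ m ⟶ X) (he : e ≠ 0) (f : m ⊗ m ⟶ X) : ∃ g : m ⟶ m, f = m ◁ g ≫ e := by
  obtain ⟨L, _, h⟩ := hm.exists_pairing
  obtain ⟨i⟩ := h X hX
  have := hm.simple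
  have hz : tensorLeftHomEquiv m L m X 0 = 0 := by simp [tensorLeftHomEquiv]
  have h1 : tensorLeftHomEquiv m L m X e ≫ i.hom ≠ 0 := fun h0 => he (by
    apply (tensorLeftHomEquiv m L m X).injective
    rw [hz, ← cancel_mono i.hom, h0]; simp)
  have := isIso_of_hom_simple h1
  refine ⟨tensorLeftHomEquiv m L m X f ≫ i.hom ≫ inv (tensorLeftHomEquiv m L m X e ≫ i.hom), ?_⟩
  have key (g : m ⟶ m) : m ◁ g ≫ e =
      (tensorLeftHomEquiv m L m X).symm (g ≫ tensorLeftHomEquiv m L m X e) := by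
    rw [tensorLeftHomEquiv_symm_naturality, Equiv.symm_apply_apply]
  rw [key, Equiv.eq_symm_apply, ← cancel_mono i.hom]
  simp

end Quaternionic

/-! ### Decomposition of `m ⊗ m` by twisted projections -/

section Completeness

variable {C : FusionCat.{v, u, 0} ℝ} {m : C}

/-- The map `m ⊗ m ⟶ X` obtained from `e` by twisting with the `s`-th quaternion unit. -/
noncomputable abbrev twistedProj (q : ℍ[ℝ] ≃ₐ[ℝ] End m) {X : C} (e : m ⊗ m ⟶ X) (s : Fin 4) :
    m ⊗ m ⟶ X := m ◁ qhom q (quaternionUnits s) ≫ e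

lemma sum_smul_twistedProj (q : ℍ[ℝ] ≃ₐ[ℝ] End m) {X : C} (e : m ⊗ m ⟶ X) (r : Fin 4 → ℝ) :
    ∑ s, r s • twistedProj q e s = m ◁ qhom q (∑ s, r s • quaternionUnits s) ≫ e := by
  rw [qhom_sum, whiskerLeft_sum, Preadditive.sum_comp]
  exact Finset.sum_congr rfl fun s _ => by rw [qhom_smul]; simp

lemma sum_quaternionUnits_eq_zero (r : Fin 4 → ℝ) (h : ∑ s, r s • quaternionUnits s = 0)
    (s : Fin 4) : r s = 0 := by
  rw [Fin.sum_univ_four] at h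
  have h0 := congrArg QuaternionAlgebra.re h
  have h1 := congrArg QuaternionAlgebra.imI h
  have h2 := congrArg QuaternionAlgebra.imJ h
  have h3 := congrArg QuaternionAlgebra.imK h
  simp at h0 h1 h2 h3
  fin_cases s <;> assumption

lemma exists_sum_quaternionUnits (h : ℍ[ℝ]) :
    ∃ r : Fin 4 → ℝ, h = ∑ s, r s • quaternionUnits s :=
  ⟨![h.re, h.imI, h.imJ, h.imK], by
    rw [Fin.sum_univ_four]; simpa [add_assoc] using Quaternion.decomp h⟩

/-- The maps `[a](id ⊗ s)` exhibit `m ⊗ m` as a direct sum. -/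
lemma IsTambaraYamagami.exists_dual (hm : IsTambaraYamagami C m) (q : ℍ[ℝ] ≃ₐ[ℝ] End m)
    {A : Type w} [Fintype A] {obj : A → C} (hinv : ∀ a, IsInvertibleObj (obj a))
    (hsurj : ∀ X : C, Simple X → IsInvertibleObj X → ∃ a, Nonempty (X ≅ obj a))
    (hinj : ∀ a b, Nonempty (obj a ≅ obj b) → a = b)
    (proj : ∀ a, m ⊗ m ⟶ obj a) (hne : ∀ a, proj a ≠ 0) :
    ∃ j : ∀ k : A × Fin 4, obj k.1 ⟶ m ⊗ m,
      (∀ k, j k ≫ twistedProj q (proj k.1) k.2 = 𝟙 _) ∧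
      (∀ k l, k ≠ l → j k ≫ twistedProj q (proj l.1) l.2 = 0) ∧
      ∑ k, twistedProj q (proj k.1) k.2 ≫ j k = 𝟙 _ := by
  have hs (a) : Simple (obj a) := (hinv a).simple
  refine C.exists_dual_family (fun k : A × Fin 4 => obj k.1)
    (fun k => twistedProj q (proj k.1) k.2) ?_ ?_
  · intro W f hf
    -- The four twists of `proj a` span all maps to `obj a` over the reals, so `f` is killed by
    -- every map to a labelled object.
    have hf' (a : A) (g : m ⊗ m ⟶ obj a) : f ≫ g = 0 := by
      obtain ⟨x, rfl⟩ := hm.proj_torsor (hinv a) (proj a) (hne a) g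
      obtain ⟨h, rfl⟩ := qhom_surjective q x
      obtain ⟨r, rfl⟩ := exists_sum_quaternionUnits h
      rw [← sum_smul_twistedProj, Preadditive.comp_sum]
      refine Finset.sum_eq_zero fun s _ => ?_
      rw [Linear.comp_smul, hf (a, s), smul_zero]
    obtain ⟨n, S, ι, π, hS, h1, h2, h3⟩ := C.exists_decomposition (m ⊗ m)
    have h4 (i) : f ≫ π i = 0 := by
      have := hS i
      -- A summand isomorphic to `m` would give a nonzero map `m ⊗ m ⟶ m`.
      have h5 : IsInvertibleObj (S i) := by
        refine (hm.invertible_or_iso _ (hS i)).resolve_right fun ⟨e⟩ => ?_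
        have h6 : π i = 0 := by
          rw [← cancel_mono e.hom, hm.multiplicity_zero (π i ≫ e.hom)]; simp
        have := h1 i
        rw [h6] at this
        exact id_nonzero (S i) (by rw [← this]; simp)
      obtain ⟨a, ⟨e⟩⟩ := hsurj _ (hS i) h5
      rw [← cancel_mono e.hom, Category.assoc, hf']; simp
    calc f = f ≫ ∑ i, π i ≫ ι i := by rw [h3]; simp
      _ = 0 := by simp [Preadditive.comp_sum, reassoc_of% h4]
  · intro Z _ g hg
    by_contra! hk
    obtain ⟨⟨a, s⟩, hk⟩ := hk
    have := isIso_of_hom_simple hk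
    -- Schur's lemma isolates the label `a`; real endomorphisms then turn the relation into the
    -- vanishing of a real combination of quaternion units.
    have h0 (b : A) (t) (hb : b ≠ a) : g (b, t) = 0 := by
      by_contra hne
      have := isIso_of_hom_simple hne
      exact hb (hinj b a ⟨asIso (g (b, t)) ≪≫ (asIso (g (a, s))).symm⟩)
    have h1 (t) : ∃ r : ℝ, g (a, t) = r • g (a, s) := by
      obtain ⟨r, hr⟩ := end_invertible_scalar q hm (hinv a) (g (a, t) ≫ inv (g (a, s)))
      exact ⟨r, by rw [← cancel_mono (inv (g (a, s))), hr]; simp⟩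
    choose r hr using h1
    rw [Fintype.sum_prod_type, Finset.sum_eq_single a] at hg
    · have h2 : (∑ t, r t • twistedProj q (proj a) t) ≫ g (a, s) = 0 := by
        rw [← hg, Preadditive.sum_comp]
        exact Finset.sum_congr rfl fun t _ => by rw [hr t]; simp
      rw [sum_smul_twistedProj] at h2
      have h3 : m ◁ qhom q (∑ t, r t • quaternionUnits t) ≫ proj a = m ◁ 0 ≫ proj a := by
        rw [← cancel_mono (g (a, s)), h2]; simp
      have h4 := qhom_proj_injective q (hne a) h3
      rw [← qhom_zero q] at h4
      have h5 := sum_quaternionUnits_eq_zero r (qhom_injective q h4) s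
      apply hk
      rw [hr s, h5, zero_smul]
    · intro b _ hb
      exact Finset.sum_eq_zero fun t _ => by rw [h0 b t hb]; simp
    · simp

end Completeness

/-! ### Equivalences obtained by matching simple objects -/

section Transfer

open Limits

variable {𝕜 : Type w} [Field 𝕜] {C : FusionCat.{v, u, w} 𝕜} {C' : FusionCat.{v', u', w} 𝕜}
  {S : Type w'} {lab : S → C} {lab' : S → C'}

/-- Simultaneous decompositions of objects of two categories into labelled objects. -/
structure PairDecomp (lab : S → C) (lab' : S → C') (X : C) (X' : C') where
  n : ℕ
  s : Fin n → S
  ι : ∀ i, lab (s i) ⟶ X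
  π : ∀ i, X ⟶ lab (s i)
  ι' : ∀ i, lab' (s i) ⟶ X'
  π' : ∀ i, X' ⟶ lab' (s i)
  ι_π : ∀ i, ι i ≫ π i = 𝟙 _
  ι_π_ne : ∀ i j, i ≠ j → ι i ≫ π j = 0
  total : ∑ i, π i ≫ ι i = 𝟙 X
  ι'_π' : ∀ i, ι' i ≫ π' i = 𝟙 _
  ι'_π'_ne : ∀ i j, i ≠ j → ι' i ≫ π' j = 0
  total' : ∑ i, π' i ≫ ι' i = 𝟙 X'

/-- A linear identification of the homs between labelled objects of two categories. -/
structure LabelIso (lab : S → C) (lab' : S → C') where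
  φ : ∀ s t, (lab s ⟶ lab t) ≃ₗ[𝕜] (lab' s ⟶ lab' t)
  map_id : ∀ s, φ s s (𝟙 _) = 𝟙 _
  map_comp : ∀ s t r (f : lab s ⟶ lab t) (g : lab t ⟶ lab r), φ s r (f ≫ g) = φ s t f ≫ φ t r g

/-- The inverse identification. -/
@[simps] def LabelIso.symm (Λ : LabelIso lab lab') : LabelIso lab' lab where
  φ s t := (Λ.φ s t).symm
  map_id s := by rw [LinearEquiv.symm_apply_eq, Λ.map_id]
  map_comp s t r f g := by rw [LinearEquiv.symm_apply_eq, Λ.map_comp]; simp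

/-- The decompositions with the roles of the categories exchanged. -/
@[simps] def PairDecomp.symm {X : C} {X' : C'} (D : PairDecomp lab lab' X X') :
    PairDecomp lab' lab X' X :=
  ⟨D.n, D.s, D.ι', D.π', D.ι, D.π, D.ι'_π', D.ι'_π'_ne, D.total', D.ι_π, D.ι_π_ne, D.total⟩

/-- The trivial decomposition of a labelled object. -/
@[simps] def PairDecomp.label (lab : S → C) (lab' : S → C') (s : S) :
    PairDecomp lab lab' (lab s) (lab' s) where
  n := 1
  s _ := s
  ι _ := 𝟙 _
  π _ := 𝟙 _
  ι' _ := 𝟙 _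
  π' _ := 𝟙 _
  ι_π := by simp
  ι_π_ne i j h := absurd (Subsingleton.elim i j) h
  total := by simp
  ι'_π' := by simp
  ι'_π'_ne i j h := absurd (Subsingleton.elim i j) h
  total' := by simp

/-- The partner of `X` is the direct sum of the objects of `C'` carrying the labels of the simple
summands of `X`. -/
lemma PairDecomp.exists_of_left (hsurj : ∀ X : C, Simple X → ∃ s, Nonempty (X ≅ lab s)) (X : C) :
    ∃ X' : C', Nonempty (PairDecomp lab lab' X X') := by
  obtain ⟨n, T, ι, π, hT, h1, h2, h3⟩ := C.exists_decomposition X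
  choose s e using fun i => hsurj (T i) (hT i)
  have := Abelian.hasFiniteBiproducts (C := C')
  refine ⟨⨁ fun i => lab' (s i), ⟨⟨n, s, fun i => (e i).some.inv ≫ ι i,
    fun i => π i ≫ (e i).some.hom, fun i => biproduct.ι (fun i => lab' (s i)) i,
    fun i => biproduct.π (fun i => lab' (s i)) i, ?_, ?_, ?_,
    ?_, ?_, ?_⟩⟩⟩
  · intro i; simp [reassoc_of% (h1 i)]
  · intro i j hij; simp [reassoc_of% (h2 i j hij)]
  · simpa using h3
  · intro i; simp
  · intro i j hij; simp [biproduct.ι_π_ne _ hij]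
  · exact IsBilimit.total (biproduct.isBilimit _)

variable (Λ : LabelIso lab lab')

/-- The morphism corresponding to `f` under an identification of labelled objects. -/
def LabelIso.transfer {X Y : C} {X' Y' : C'} (D : PairDecomp lab lab' X X')
    (E : PairDecomp lab lab' Y Y') (f : X ⟶ Y) : X' ⟶ Y' :=
  ∑ i, ∑ j, D.π' i ≫ Λ.φ _ _ (D.ι i ≫ f ≫ E.π j) ≫ E.ι' j

section
variable {X Y Z : C} {X' Y' Z' : C'} (D : PairDecomp lab lab' X X')
    (E : PairDecomp lab lab' Y Y') (F : PairDecomp lab lab' Z Z')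

/-- Orthogonality of the decompositions isolates one matrix entry. With `PairDecomp.hom_ext`, every
identity about transfers reduces to entries between labelled objects. -/
lemma LabelIso.ι_transfer_π (f : X ⟶ Y) (i) (j) :
    D.ι' i ≫ Λ.transfer D E f ≫ E.π' j = Λ.φ _ _ (D.ι i ≫ f ≫ E.π j) := by
  simp only [transfer, Preadditive.sum_comp, Preadditive.comp_sum, Category.assoc]
  rw [Finset.sum_eq_single i, Finset.sum_eq_single j]
  · rw [E.ι'_π', reassoc_of% (D.ι'_π' i), Category.comp_id]
  · intro k _ hk
    rw [E.ι'_π'_ne _ _ hk]; simp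
  · simp
  · intro k _ hk
    refine Finset.sum_eq_zero fun l _ => ?_
    rw [reassoc_of% (D.ι'_π'_ne _ _ hk.symm)]; simp
  · simp

variable {D E} in
lemma PairDecomp.hom_ext {f g : X' ⟶ Y'} (h : ∀ i j, D.ι' i ≫ f ≫ E.π' j = D.ι' i ≫ g ≫ E.π' j) :
    f = g := by
  have key (f : X' ⟶ Y') : f = ∑ i, ∑ j, D.π' i ≫ (D.ι' i ≫ f ≫ E.π' j) ≫ E.ι' j := by
    calc f = (∑ i, D.π' i ≫ D.ι' i) ≫ f ≫ ∑ j, E.π' j ≫ E.ι' j := by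
          rw [D.total', E.total']; simp
      _ = _ := by
          simp only [Preadditive.sum_comp, Preadditive.comp_sum, Category.assoc]
          exact Finset.sum_comm
  rw [key f, key g]
  simp only [h]

lemma LabelIso.transfer_id : Λ.transfer D D (𝟙 X) = 𝟙 X' := by
  refine PairDecomp.hom_ext (D := D) (E := D) fun i j => ?_
  rw [ι_transfer_π]
  by_cases h : i = j
  · subst h; simp [D.ι_π, D.ι'_π', Λ.map_id]
  · simp [D.ι_π_ne i j h, D.ι'_π'_ne i j h]

lemma LabelIso.transfer_comp (f : X ⟶ Y) (g : Y ⟶ Z) :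
    Λ.transfer D F (f ≫ g) = Λ.transfer D E f ≫ Λ.transfer E F g := by
  refine PairDecomp.hom_ext (D := D) (E := F) fun i k => ?_
  rw [ι_transfer_π]
  calc _ = Λ.φ _ _ (∑ j, (D.ι i ≫ f ≫ E.π j) ≫ (E.ι j ≫ g ≫ F.π k)) := by
        congr 1
        calc _ = D.ι i ≫ f ≫ (∑ j, E.π j ≫ E.ι j) ≫ g ≫ F.π k := by rw [E.total]; simp
          _ = _ := by simp [Preadditive.sum_comp, Preadditive.comp_sum]
    _ = ∑ j, (D.ι' i ≫ Λ.transfer D E f ≫ E.π' j) ≫ E.ι' j ≫ Λ.transfer E F g ≫ F.π' k := by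
        simp only [map_sum, Λ.map_comp, ι_transfer_π]
    _ = D.ι' i ≫ Λ.transfer D E f ≫ (∑ j, E.π' j ≫ E.ι' j) ≫ Λ.transfer E F g ≫ F.π' k := by
        simp [Preadditive.sum_comp, Preadditive.comp_sum]
    _ = _ := by rw [E.total']; simp

/-- Entrywise inversion inverts the transfer; this is the source of fullness and faithfulness of the
equivalence. -/
lemma LabelIso.symm_transfer (f : X ⟶ Y) :
    Λ.symm.transfer D.symm E.symm (Λ.transfer D E f) = f := by
  refine PairDecomp.hom_ext (D := D.symm) (E := E.symm) fun i j => ?_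
  rw [ι_transfer_π]
  exact (LinearEquiv.symm_apply_eq _).mpr (Λ.ι_transfer_π D E f i j)

lemma LabelIso.transfer_label (s t : S) (f : lab s ⟶ lab t) :
    Λ.transfer (.label _ _ s) (.label _ _ t) f = Λ.φ s t f := by
  change ∑ i : Fin 1, ∑ j : Fin 1, 𝟙 _ ≫ Λ.φ s t (𝟙 _ ≫ f ≫ 𝟙 _) ≫ 𝟙 _ = _
  simp

lemma LabelIso.transfer_add (f g : X ⟶ Y) :
    Λ.transfer D E (f + g) = Λ.transfer D E f + Λ.transfer D E g := by
  simp [transfer, Preadditive.comp_add, Preadditive.add_comp, Finset.sum_add_distrib]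

lemma LabelIso.transfer_smul (r : 𝕜) (f : X ⟶ Y) :
    Λ.transfer D E (r • f) = r • Λ.transfer D E f := by
  simp [transfer, Finset.smul_sum]

/-- Objects with matching decompositions in the same pattern are isomorphic. -/
@[simps] def LabelIso.isoOfPair {X' X'' : C'} (D : PairDecomp lab lab' X X')
    (E : PairDecomp lab lab' X X'') : X' ≅ X'' where
  hom := Λ.transfer D E (𝟙 X)
  inv := Λ.transfer E D (𝟙 X)
  hom_inv_id := by rw [← transfer_comp, Category.comp_id, transfer_id]
  inv_hom_id := by rw [← transfer_comp, Category.comp_id, transfer_id]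
end

/-- An identification of simple objects and their homs extends to an equivalence. -/
theorem LabelIso.exists_equivalence
    (hsurj : ∀ X : C, Simple X → ∃ s, Nonempty (X ≅ lab s))
    (hsurj' : ∀ X : C', Simple X → ∃ s, Nonempty (X ≅ lab' s)) :
    ∃ (Φ : C ⥤ C') (θ : ∀ s, Φ.obj (lab s) ≅ lab' s), Φ.IsEquivalence ∧ Φ.Additive ∧ Φ.Linear 𝕜 ∧
      ∀ s t (f : lab s ⟶ lab t), Φ.map f ≫ (θ t).hom = (θ s).hom ≫ Λ.φ s t f := by
  choose obj D using fun X => PairDecomp.exists_of_left (lab' := lab') hsurj X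
  let Φ : C ⥤ C' :=
    { obj := obj
      map := fun {X Y} f => Λ.transfer (D X).some (D Y).some f
      map_id := fun X => Λ.transfer_id _
      map_comp := fun {X Y Z} f g => Λ.transfer_comp _ _ _ f g }
  have hadd : Φ.Additive := ⟨fun {X Y f g} => Λ.transfer_add _ _ f g⟩
  refine ⟨Φ, fun s => Λ.isoOfPair (D _).some (.label _ _ s), ?_, hadd, ?_, ?_⟩
  · have : Φ.Full := ⟨fun {X Y} g => ⟨Λ.symm.transfer (D X).some.symm (D Y).some.symm g,
      Λ.symm.symm_transfer (D X).some.symm (D Y).some.symm g⟩⟩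
    have : Φ.Faithful := ⟨fun {X Y f g} h => by
      rw [← Λ.symm_transfer (D X).some (D Y).some f, ← Λ.symm_transfer (D X).some (D Y).some g]
      exact congrArg _ h⟩
    have : Φ.EssSurj := ⟨fun X' => by
      obtain ⟨X, ⟨E⟩⟩ := PairDecomp.exists_of_left (lab' := lab) hsurj' X'
      exact ⟨X, ⟨Λ.isoOfPair (D X).some E.symm⟩⟩⟩
    exact { }
  · exact { map_smul := fun {X Y} f r => Λ.transfer_smul _ _ r f }
  · intro s t f
    change Λ.transfer _ _ f ≫ Λ.transfer _ _ (𝟙 _) = Λ.transfer _ _ (𝟙 _) ≫ _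
    rw [← Λ.transfer_label, ← transfer_comp, ← transfer_comp]; simp

end Transfer

/-! ### Extending a tensorator from simple objects to all objects -/

section TensorExtension

open Limits

variable {𝕜 : Type w} [Field 𝕜] {C : FusionCat.{v, u, w} 𝕜} {C' : FusionCat.{v', u', w} 𝕜}
  {S : Type w'} {lab : S → C} {lab' : S → C'}

lemma exists_label_decomposition (hsurj : ∀ X : C, Simple X → ∃ s, Nonempty (X ≅ lab s)) (X : C) :
    ∃ (n : ℕ) (s : Fin n → S) (ι : ∀ i, lab (s i) ⟶ X) (π : ∀ i, X ⟶ lab (s i)),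
      ∑ i, π i ≫ ι i = 𝟙 X := by
  obtain ⟨n, T, ι, π, hT, h1, h2, h3⟩ := C.exists_decomposition X
  choose s e using fun i => hsurj (T i) (hT i)
  exact ⟨n, s, fun i => (e i).some.inv ≫ ι i, fun i => π i ≫ (e i).some.hom, by simpa using h3⟩

/-- Tensorators on labelled objects for a functor between fusion categories. -/
structure LabelTensor (Λ : LabelIso lab lab') (Φ : C ⥤ C') where
  hsurj : ∀ X : C, Simple X → ∃ s, Nonempty (X ≅ lab s)
  θ : ∀ s, Φ.obj (lab s) ≅ lab' s
  map_θ : ∀ s t (f : lab s ⟶ lab t), Φ.map f ≫ (θ t).hom = (θ s).hom ≫ Λ.φ s t f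
  ν : ∀ s t, lab' s ⊗ lab' t ≅ Φ.obj (lab s ⊗ lab t)
  ν_nat : ∀ s s' t t' (f : lab s ⟶ lab s') (g : lab t ⟶ lab t'),
    (Λ.φ _ _ f ⊗ₘ Λ.φ _ _ g) ≫ (ν s' t').hom = (ν s t).hom ≫ Φ.map (f ⊗ₘ g)

namespace LabelTensor

variable {Λ : LabelIso lab lab'} {Φ : C ⥤ C'} (T : LabelTensor Λ Φ)

/-- Elements of `Φ X` given by maps from labelled objects. -/
abbrev el {s : S} {X : C} (x : lab s ⟶ X) : lab' s ⟶ Φ.obj X := (T.θ s).inv ≫ Φ.map x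

lemma φ_el {s t : S} {X : C} (f : lab s ⟶ lab t) (x : lab t ⟶ X) :
    Λ.φ _ _ f ≫ T.el x = T.el (f ≫ x) := by
  have := T.map_θ s t f
  rw [← cancel_epi (T.θ s).hom, ← reassoc_of% this]
  simp [el]

lemma map_θ_eq {s t : S} {X : C} (x : lab s ⟶ X) (y : X ⟶ lab t) :
    T.el x ≫ Φ.map y ≫ (T.θ t).hom = Λ.φ _ _ (x ≫ y) := by
  have := T.map_θ s t (x ≫ y)
  rw [← cancel_epi (T.θ s).hom, ← this]
  simp [el]

/-- The map between labelled objects of `C'` corresponding to `v`. -/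
def hat {s t r : S} (v : lab s ⊗ lab t ⟶ lab r) : lab' s ⊗ lab' t ⟶ lab' r :=
  (T.ν s t).hom ≫ Φ.map v ≫ (T.θ r).hom

lemma hat_comp {s t r q : S} (v : lab s ⊗ lab t ⟶ lab r) (f : lab r ⟶ lab q) :
    T.hat (v ≫ f) = T.hat v ≫ Λ.φ _ _ f := by
  simp [hat, T.map_θ]

variable [Φ.Additive]

lemma exists_el_decomposition (X : C) : ∃ (n : ℕ) (s : Fin n → S) (ι : ∀ i, lab (s i) ⟶ X)
    (p : ∀ i, Φ.obj X ⟶ lab' (s i)), ∑ i, p i ≫ T.el (ι i) = 𝟙 _ := by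
  obtain ⟨n, s, ι, π, hX⟩ := exists_label_decomposition T.hsurj X
  refine ⟨n, s, ι, fun i => Φ.map (π i) ≫ (T.θ _).hom, ?_⟩
  simp only [el, Category.assoc, Iso.hom_inv_id_assoc, ← Φ.map_comp]
  rw [← Functor.map_sum, hX, Φ.map_id]

/-- The identity of `Φ.obj X` is a sum of maps ending in elements `T.el x`, so these are jointly
epic. `hom_ext₂` and `hom_ext₃` follow by biadditivity of the tensor product. -/
lemma hom_ext₁ {X : C} {Z : C'} {f g : Φ.obj X ⟶ Z}
    (h : ∀ s (x : lab s ⟶ X), T.el x ≫ f = T.el x ≫ g) : f = g := by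
  obtain ⟨n, s, ι, p, hX⟩ := T.exists_el_decomposition X
  rw [← Category.id_comp f, ← Category.id_comp g, ← hX]
  simp only [Preadditive.sum_comp, Category.assoc] at h ⊢
  exact Finset.sum_congr rfl fun i _ => by rw [h]

lemma hom_ext₂ {X Y : C} {Z : C'} {f g : Φ.obj X ⊗ Φ.obj Y ⟶ Z}
    (h : ∀ s t (x : lab s ⟶ X) (y : lab t ⟶ Y),
      (T.el x ⊗ₘ T.el y) ≫ f = (T.el x ⊗ₘ T.el y) ≫ g) : f = g := by
  obtain ⟨n, s, ι, p, hX⟩ := T.exists_el_decomposition X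
  obtain ⟨n', s', ι', p', hY⟩ := T.exists_el_decomposition Y
  have key : 𝟙 (Φ.obj X ⊗ Φ.obj Y) = ∑ i, ∑ j, (p i ⊗ₘ p' j) ≫ (T.el (ι i) ⊗ₘ T.el (ι' j)) := by
    rw [← id_tensorHom_id, ← hX, ← hY, sum_tensor]
    simp only [tensor_sum, tensorHom_comp_tensorHom]
  rw [← Category.id_comp f, ← Category.id_comp g, key]
  simp only [Preadditive.sum_comp, Category.assoc] at h ⊢
  exact Finset.sum_congr rfl fun i _ => Finset.sum_congr rfl fun j _ => by rw [h]

lemma hom_ext₃ {X Y W : C} {Z : C'} {f g : (Φ.obj X ⊗ Φ.obj Y) ⊗ Φ.obj W ⟶ Z}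
    (h : ∀ s t r (x : lab s ⟶ X) (y : lab t ⟶ Y) (z : lab r ⟶ W),
      ((T.el x ⊗ₘ T.el y) ⊗ₘ T.el z) ≫ f = ((T.el x ⊗ₘ T.el y) ⊗ₘ T.el z) ≫ g) : f = g := by
  obtain ⟨n, s, ι, p, hX⟩ := T.exists_el_decomposition X
  obtain ⟨n', s', ι', p', hY⟩ := T.exists_el_decomposition Y
  obtain ⟨n'', s'', ι'', p'', hW⟩ := T.exists_el_decomposition W
  have key : 𝟙 ((Φ.obj X ⊗ Φ.obj Y) ⊗ Φ.obj W) = ∑ i, ∑ j, ∑ k,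
      ((p i ⊗ₘ p' j) ⊗ₘ p'' k) ≫ ((T.el (ι i) ⊗ₘ T.el (ι' j)) ⊗ₘ T.el (ι'' k)) := by
    rw [← id_tensorHom_id, ← id_tensorHom_id, ← hX, ← hY, ← hW, sum_tensor, sum_tensor]
    simp only [tensor_sum, sum_tensor, tensorHom_comp_tensorHom]
    exact Finset.sum_congr rfl fun _ _ => Finset.sum_comm
  rw [← Category.id_comp f, ← Category.id_comp g, key]
  simp only [Preadditive.sum_comp, Category.assoc] at h ⊢
  exact Finset.sum_congr rfl fun i _ => Finset.sum_congr rfl fun j _ =>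
    Finset.sum_congr rfl fun k _ => by rw [h]

/-- The tensorator on labelled objects extends uniquely. -/
lemma exists_extension (X Y : C) : ∃ μ : Φ.obj X ⊗ Φ.obj Y ≅ Φ.obj (X ⊗ Y),
    ∀ s t (x : lab s ⟶ X) (y : lab t ⟶ Y),
      (T.el x ⊗ₘ T.el y) ≫ μ.hom = (T.ν s t).hom ≫ Φ.map (x ⊗ₘ y) := by
  obtain ⟨n, s, ι, π, hX⟩ := exists_label_decomposition T.hsurj X
  obtain ⟨n', s', ι', π', hY⟩ := exists_label_decomposition T.hsurj Y
  have hXY : ∑ i, ∑ j, ((π i ⊗ₘ π' j) ≫ (ι i ⊗ₘ ι' j)) = 𝟙 (X ⊗ Y) := by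
    simp only [tensorHom_comp_tensorHom]
    simp only [← tensor_sum, ← sum_tensor, hX, hY, id_tensorHom_id]
  -- The formula is forced by naturality along the summands. Naturality of `ν` on labels makes it
  -- correct on every pair of elements, and thus independent of the chosen decompositions.
  let f : Φ.obj X ⊗ Φ.obj Y ⟶ Φ.obj (X ⊗ Y) := ∑ i, ∑ j, ((Φ.map (π i) ≫ (T.θ _).hom) ⊗ₘ
      (Φ.map (π' j) ≫ (T.θ _).hom)) ≫ (T.ν _ _).hom ≫ Φ.map (ι i ⊗ₘ ι' j)
  let g : Φ.obj (X ⊗ Y) ⟶ Φ.obj X ⊗ Φ.obj Y := ∑ i, ∑ j, Φ.map (π i ⊗ₘ π' j) ≫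
      (T.ν _ _).inv ≫ (T.el (ι i) ⊗ₘ T.el (ι' j))
  have hf : ∀ s t (x : lab s ⟶ X) (y : lab t ⟶ Y),
      (T.el x ⊗ₘ T.el y) ≫ f = (T.ν s t).hom ≫ Φ.map (x ⊗ₘ y) := by
    intro s t x y
    calc _ = ∑ i, ∑ j, (Λ.φ _ _ (x ≫ π i) ⊗ₘ Λ.φ _ _ (y ≫ π' j)) ≫ (T.ν _ _).hom ≫
          Φ.map (ι i ⊗ₘ ι' j) := by
          simp only [f, Preadditive.comp_sum, tensorHom_comp_tensorHom_assoc, map_θ_eq]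
      _ = ∑ i, ∑ j, (T.ν s t).hom ≫ Φ.map ((x ⊗ₘ y) ≫ (π i ⊗ₘ π' j) ≫ (ι i ⊗ₘ ι' j)) := by
          simp only [reassoc_of% T.ν_nat, ← Φ.map_comp, tensorHom_comp_tensorHom, Category.assoc]
      _ = (T.ν s t).hom ≫ Φ.map ((x ⊗ₘ y) ≫ ∑ i, ∑ j, (π i ⊗ₘ π' j) ≫ (ι i ⊗ₘ ι' j)) := by
          simp only [Preadditive.comp_sum, Functor.map_sum]
      _ = _ := by rw [hXY, Category.comp_id]
  have hg : ∀ s t (x : lab s ⟶ X) (y : lab t ⟶ Y),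
      (T.ν s t).hom ≫ Φ.map (x ⊗ₘ y) ≫ g = (T.el x ⊗ₘ T.el y) := by
    intro s t x y
    calc _ = ∑ i, ∑ j, ((T.ν s t).hom ≫ Φ.map ((x ≫ π i) ⊗ₘ (y ≫ π' j))) ≫ (T.ν _ _).inv ≫
          (T.el (ι i) ⊗ₘ T.el (ι' j)) := by
          simp only [g, Preadditive.comp_sum, Category.assoc, ← Φ.map_comp_assoc,
            tensorHom_comp_tensorHom]
      _ = ∑ i, ∑ j, (T.el ((x ≫ π i) ≫ ι i) ⊗ₘ T.el ((y ≫ π' j) ≫ ι' j)) := by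
          simp only [← T.ν_nat, Category.assoc, Iso.hom_inv_id_assoc, tensorHom_comp_tensorHom,
            φ_el]
      _ = (T.el (x ≫ ∑ i, π i ≫ ι i) ⊗ₘ T.el (y ≫ ∑ i, π' i ≫ ι' i)) := by
          simp only [el, Preadditive.comp_sum, Functor.map_sum, tensor_sum, sum_tensor,
            Category.assoc]
          exact Finset.sum_comm
      _ = _ := by rw [hX, hY, Category.comp_id, Category.comp_id]
  refine ⟨⟨f, g, ?_, ?_⟩, hf⟩
  · refine T.hom_ext₂ fun s t x y => ?_
    rw [reassoc_of% hf, hg, Category.comp_id]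
  · simp only [g, Preadditive.sum_comp, Category.assoc, hf, Iso.inv_hom_id_assoc, ← Φ.map_comp]
    simp only [← Functor.map_sum, hXY, Φ.map_id]

/-- The extended tensorator. -/
noncomputable def μ (X Y : C) : Φ.obj X ⊗ Φ.obj Y ≅ Φ.obj (X ⊗ Y) := (T.exists_extension X Y).choose

lemma el_μ {X Y : C} {s t} (x : lab s ⟶ X) (y : lab t ⟶ Y) :
    (T.el x ⊗ₘ T.el y) ≫ (T.μ X Y).hom = (T.ν s t).hom ≫ Φ.map (x ⊗ₘ y) :=
  (T.exists_extension X Y).choose_spec s t x y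

lemma μ_natural {X X' Y Y' : C} (f : X ⟶ X') (g : Y ⟶ Y') :
    (Φ.map f ⊗ₘ Φ.map g) ≫ (T.μ X' Y').hom = (T.μ X Y).hom ≫ Φ.map (f ⊗ₘ g) := by
  refine T.hom_ext₂ fun s t x y => ?_
  have h1 := T.el_μ (x ≫ f) (y ≫ g)
  simp only [el, Φ.map_comp] at h1
  simp only [tensorHom_comp_tensorHom_assoc, Category.assoc]
  rw [h1, reassoc_of% T.el_μ x y, ← Φ.map_comp, tensorHom_comp_tensorHom]

lemma θ_inv_μ (s t : S) : ((T.θ s).inv ⊗ₘ (T.θ t).inv) ≫ (T.μ _ _).hom = (T.ν s t).hom := by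
  simpa [el] using T.el_μ (𝟙 (lab s)) (𝟙 (lab t))

/-- The left test map for associativity. -/
noncomputable def testLeft (s t r q : S) (f : (lab s ⊗ lab t) ⊗ lab r ⟶ lab q) :
    (lab' s ⊗ lab' t) ⊗ lab' r ⟶ lab' q :=
  ((T.ν s t).hom ⊗ₘ (T.θ r).inv) ≫ (T.μ _ _).hom ≫ Φ.map f ≫ (T.θ q).hom

/-- Naturality of the tensorator carries left-bracketed trees of vertices to trees of the
corresponding vertices. Together with `testRight_vertex` this reduces associativity to a comparison
of associator coefficients. -/
lemma testLeft_vertex {s t r p q : S} (w : lab s ⊗ lab t ⟶ lab p) (v : lab p ⊗ lab r ⟶ lab q) :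
    T.testLeft s t r q (w ▷ lab r ≫ v) = T.hat w ▷ lab' r ≫ T.hat v := by
  have h1 := T.μ_natural w (𝟙 (lab r))
  rw [testLeft, Φ.map_comp, Category.assoc, ← tensorHom_id w, ← reassoc_of% h1]
  simp only [hat, ← T.θ_inv_μ p r, Category.assoc]
  simp only [tensorHom_comp_tensorHom_assoc, ← tensorHom_id, Category.assoc, Iso.hom_inv_id,
    Category.comp_id, Category.id_comp, Φ.map_id]

lemma testLeft_sum {s t r q : S} {ι : Type*} (σ : Finset ι)
    (f : ι → ((lab s ⊗ lab t) ⊗ lab r ⟶ lab q)) :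
    T.testLeft s t r q (∑ i ∈ σ, f i) = ∑ i ∈ σ, T.testLeft s t r q (f i) := by
  simp only [testLeft, Functor.map_sum, Preadditive.sum_comp, Preadditive.comp_sum]

lemma testLeft_smul [Φ.Linear 𝕜] {s t r q : S} (c : 𝕜) (f : (lab s ⊗ lab t) ⊗ lab r ⟶ lab q) :
    T.testLeft s t r q (c • f) = c • T.testLeft s t r q f := by
  simp [testLeft]

lemma testRight_vertex {s t r p q : S} (w : lab t ⊗ lab r ⟶ lab p) (v : lab s ⊗ lab p ⟶ lab q) :
    ((T.θ s).inv ⊗ₘ (T.ν t r).hom) ≫ (T.μ _ _).hom ≫ Φ.map (lab s ◁ w ≫ v) ≫ (T.θ q).hom =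
      lab' s ◁ T.hat w ≫ T.hat v := by
  have h1 := T.μ_natural (𝟙 (lab s)) w
  rw [Φ.map_comp, Category.assoc, ← id_tensorHom _ w, ← reassoc_of% h1]
  simp only [hat, ← T.θ_inv_μ s p, Category.assoc]
  simp only [tensorHom_comp_tensorHom_assoc, ← id_tensorHom, Category.assoc, Iso.hom_inv_id,
    Category.comp_id, Category.id_comp, Φ.map_id]

/-- Associativity of the tensorator on labelled objects. -/
def Associative (s t r : S) : Prop :=
  ((T.ν s t).hom ⊗ₘ (T.θ r).inv) ≫ (T.μ _ _).hom ≫ Φ.map (α_ (lab s) (lab t) (lab r)).hom =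
    (α_ (lab' s) (lab' t) (lab' r)).hom ≫ ((T.θ s).inv ⊗ₘ (T.ν t r).hom) ≫ (T.μ _ _).hom

/-- Composition with a family that splits the right-bracketed product detects equality of maps into
it, so associativity may be tested on right-bracketed trees of vertices. -/
lemma associative_of_family {s t r : S} {K : Type*} [Fintype K] (p q : K → S)
    (w : ∀ k, lab t ⊗ lab r ⟶ lab (p k)) (v : ∀ k, lab s ⊗ lab (p k) ⟶ lab (q k))
    (j : ∀ k, lab (q k) ⟶ lab s ⊗ (lab t ⊗ lab r))
    (hj : ∑ k, (lab s ◁ w k ≫ v k) ≫ j k = 𝟙 _)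
    (h : ∀ k, (α_ (lab' s) (lab' t) (lab' r)).hom ≫ lab' s ◁ T.hat (w k) ≫ T.hat (v k) =
      T.testLeft s t r (q k) ((α_ _ _ _).hom ≫ lab s ◁ w k ≫ v k)) : T.Associative s t r := by
  have key (f : (lab' s ⊗ lab' t) ⊗ lab' r ⟶ Φ.obj (lab s ⊗ (lab t ⊗ lab r))) :
      f = ∑ k, (f ≫ Φ.map (lab s ◁ w k ≫ v k) ≫ (T.θ _).hom) ≫ (T.θ _).inv ≫ Φ.map (j k) := by
    calc f = f ≫ Φ.map (∑ k, (lab s ◁ w k ≫ v k) ≫ j k) := by rw [hj]; simp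
      _ = _ := by simp [Preadditive.comp_sum, Functor.map_sum]
  rw [Associative, key (_ ≫ _ ≫ _), key (_ ≫ _ ≫ (T.μ _ _).hom)]
  refine Finset.sum_congr rfl fun k _ => ?_
  congr 1
  have h1 := h k
  rw [← T.testRight_vertex, testLeft] at h1
  simpa using h1.symm

/-- A functor with a tensorator on labelled objects compatible with associators and unit
constraints is monoidal. -/
theorem nonempty_monoidal (hassoc : ∀ s t r, T.Associative s t r) (e : 𝟙_ C' ≅ Φ.obj (𝟙_ C))
    (hl : ∀ s, (λ_ (lab' s)).hom = (e.hom ⊗ₘ (T.θ s).inv) ≫ (T.μ _ _).hom ≫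
      Φ.map (λ_ (lab s)).hom ≫ (T.θ s).hom)
    (hr : ∀ s, (ρ_ (lab' s)).hom = ((T.θ s).inv ⊗ₘ e.hom) ≫ (T.μ _ _).hom ≫
      Φ.map (ρ_ (lab s)).hom ≫ (T.θ s).hom) : Nonempty Φ.Monoidal := by
  refine ⟨Functor.CoreMonoidal.toMonoidal
    { εIso := e
      μIso := T.μ
      μIso_hom_natural_left := fun f X => by simpa using T.μ_natural f (𝟙 X)
      μIso_hom_natural_right := fun X f => by simpa using T.μ_natural (𝟙 X) f
      associativity := fun X Y Z => ?_
      left_unitality := fun X => ?_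
      right_unitality := fun X => ?_ }⟩
  · refine T.hom_ext₃ fun s t r x y z => ?_
    -- On elements the tensorator becomes the prescribed `ν`, so the hexagon for `X`, `Y`, `Z` is
    -- the image under `x`, `y`, `z` of the one for labels.
    have h1 : ((T.el x ⊗ₘ T.el y) ⊗ₘ T.el z) ≫ (T.μ X Y).hom ▷ Φ.obj Z =
        ((T.ν s t).hom ⊗ₘ (T.θ r).inv) ≫ (Φ.map (x ⊗ₘ y) ⊗ₘ Φ.map z) := by
      rw [← tensorHom_id, tensorHom_comp_tensorHom, T.el_μ, tensorHom_comp_tensorHom,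
        Category.comp_id]
    have h2 : (T.el x ⊗ₘ T.el y ⊗ₘ T.el z) ≫ Φ.obj X ◁ (T.μ Y Z).hom =
        ((T.θ s).inv ⊗ₘ (T.ν t r).hom) ≫ (Φ.map x ⊗ₘ Φ.map (y ⊗ₘ z)) := by
      rw [← id_tensorHom, tensorHom_comp_tensorHom, T.el_μ, tensorHom_comp_tensorHom,
        Category.comp_id]
    have h3 := hassoc s t r
    rw [Associative] at h3
    rw [reassoc_of% h1, reassoc_of% T.μ_natural (x ⊗ₘ y) z, ← Φ.map_comp, associator_naturality,
      Φ.map_comp, reassoc_of% h3, associator_naturality_assoc, reassoc_of% h2,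
      T.μ_natural x (y ⊗ₘ z)]
  · have h1 : 𝟙 _ = (λ_ (Φ.obj X)).inv ≫ e.hom ▷ Φ.obj X ≫ (T.μ _ _).hom ≫
        Φ.map (λ_ X).hom := by
      refine T.hom_ext₁ fun s x => ?_
      have h2 : T.el x ≫ (λ_ (Φ.obj X)).inv ≫ e.hom ▷ Φ.obj X = (λ_ (lab' s)).inv ≫
          (e.hom ⊗ₘ (T.θ s).inv) ≫ (Φ.map (𝟙 _) ⊗ₘ Φ.map x) := by
        rw [leftUnitor_inv_naturality_assoc, ← id_tensorHom, ← tensorHom_id,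
          tensorHom_comp_tensorHom, tensorHom_comp_tensorHom]
        simp
      simp only [el, Category.assoc] at h2 ⊢
      rw [reassoc_of% h2, reassoc_of% T.μ_natural, ← Φ.map_comp, id_tensorHom,
        leftUnitor_naturality, Φ.map_comp, Category.comp_id]
      have h3 := hl s
      rw [← cancel_epi (λ_ (lab' s)).inv, ← cancel_mono (T.θ s).inv] at h3
      simp only [Category.assoc, Iso.inv_hom_id_assoc, Iso.hom_inv_id, Category.comp_id] at h3
      have h4 := congrArg (· ≫ Φ.map x) h3
      simpa only [Category.assoc] using h4
    rw [← cancel_epi (λ_ (Φ.obj X)).inv, ← h1, Iso.inv_hom_id]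
  · have h1 : 𝟙 _ = (ρ_ (Φ.obj X)).inv ≫ Φ.obj X ◁ e.hom ≫ (T.μ _ _).hom ≫
        Φ.map (ρ_ X).hom := by
      refine T.hom_ext₁ fun s x => ?_
      have h2 : T.el x ≫ (ρ_ (Φ.obj X)).inv ≫ Φ.obj X ◁ e.hom = (ρ_ (lab' s)).inv ≫
          ((T.θ s).inv ⊗ₘ e.hom) ≫ (Φ.map x ⊗ₘ Φ.map (𝟙 _)) := by
        rw [rightUnitor_inv_naturality_assoc, ← id_tensorHom, ← tensorHom_id,
          tensorHom_comp_tensorHom, tensorHom_comp_tensorHom]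
        simp
      simp only [el, Category.assoc] at h2 ⊢
      rw [reassoc_of% h2, reassoc_of% T.μ_natural, ← Φ.map_comp, tensorHom_id,
        rightUnitor_naturality, Φ.map_comp, Category.comp_id]
      have h3 := hr s
      rw [← cancel_epi (ρ_ (lab' s)).inv, ← cancel_mono (T.θ s).inv] at h3
      simp only [Category.assoc, Iso.inv_hom_id_assoc, Iso.hom_inv_id, Category.comp_id] at h3
      have h4 := congrArg (· ≫ Φ.map x) h3
      simpa only [Category.assoc] using h4
    rw [← cancel_epi (ρ_ (Φ.obj X)).inv, ← h1, Iso.inv_hom_id]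

end LabelTensor

end TensorExtension

/-! ### Constructing label identifications and checking unit constraints -/

section

variable {𝕜 : Type w} [Field 𝕜] {C : FusionCat.{v, u, w} 𝕜} {C' : FusionCat.{v', u', w} 𝕜}
  {S : Type w'} {lab : S → C} {lab' : S → C'}

/-- Without maps between distinct labels, an identification of homs amounts to one of endomorphism
algebras. -/
lemma LabelIso.exists_of_end (hz : ∀ s t, s ≠ t → ∀ f : lab s ⟶ lab t, f = 0)
    (hz' : ∀ s t, s ≠ t → ∀ f : lab' s ⟶ lab' t, f = 0)
    (e : ∀ s, (lab s ⟶ lab s) ≃ₗ[𝕜] (lab' s ⟶ lab' s)) (he : ∀ s, e s (𝟙 _) = 𝟙 _)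
    (hec : ∀ s (f g : lab s ⟶ lab s), e s (f ≫ g) = e s f ≫ e s g) :
    ∃ Λ : LabelIso lab lab', ∀ s f, Λ.φ s s f = e s f := by
  classical
  -- Equality of labels is only propositional, so the identification on the diagonal is recorded
  -- through `eqToHom`.
  have h (s t : S) : ∃ φ : (lab s ⟶ lab t) ≃ₗ[𝕜] (lab' s ⟶ lab' t),
      ∀ (h : s = t) (f : lab s ⟶ lab t),
        φ f = e s (f ≫ eqToHom (by rw [h])) ≫ eqToHom (by rw [h]) := by
    by_cases hst : s = t
    · subst hst
      exact ⟨e s, by simp⟩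
    · exact ⟨{ toFun := 0, invFun := 0, map_add' := by simp, map_smul' := by simp
               left_inv := fun f => (hz s t hst f).symm ▸ rfl
               right_inv := fun f => (hz' s t hst f).symm ▸ rfl }, fun h => absurd h hst⟩
  choose φ hφ using h
  refine ⟨⟨φ, fun s => ?_, fun s t r f g => ?_⟩, fun s f => ?_⟩
  · rw [hφ s s rfl]; simp [he]
  · by_cases hst : s = t
    · by_cases htr : t = r
      · subst hst htr
        simp [hφ _ _ rfl, hec]
      · rw [hz t r htr g]; simp
    · rw [hz s t hst f]; simp
  · simp [hφ s s rfl]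

/-- Naturality of the tensorator along `u` replaces the unit object by the labelled object `lab p`,
where the unit constraint is a vertex. -/
lemma LabelTensor.left_unit_of_vertex {Λ : LabelIso lab lab'} {Φ : C ⥤ C'} [Φ.Additive]
    (T : LabelTensor Λ Φ) {p s : S} (u : 𝟙_ C ≅ lab p) (u' : 𝟙_ C' ≅ lab' p)
    (v : lab p ⊗ lab s ⟶ lab s) (hv : u.hom ▷ lab s ≫ v = (λ_ _).hom)
    (hv' : u'.hom ▷ lab' s ≫ T.hat v = (λ_ _).hom) :
    (λ_ (lab' s)).hom = ((u' ≪≫ (T.θ p).symm ≪≫ Φ.mapIso u.symm).hom ⊗ₘ (T.θ s).inv) ≫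
      (T.μ _ _).hom ≫ Φ.map (λ_ (lab s)).hom ≫ (T.θ s).hom := by
  have h1 := T.μ_natural u.hom (𝟙 (lab s))
  rw [← hv', ← hv, Φ.map_comp, Category.assoc, ← tensorHom_id u.hom, ← reassoc_of% h1]
  simp only [LabelTensor.hat, ← T.θ_inv_μ, Category.assoc]
  simp only [tensorHom_comp_tensorHom_assoc, ← tensorHom_id, Category.assoc, Iso.trans_hom,
    Iso.symm_hom, Functor.mapIso_hom, ← Φ.map_comp, Iso.inv_hom_id, Category.comp_id,
    Category.id_comp, Φ.map_id]

lemma LabelTensor.right_unit_of_vertex {Λ : LabelIso lab lab'} {Φ : C ⥤ C'} [Φ.Additive]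
    (T : LabelTensor Λ Φ) {p s : S} (u : 𝟙_ C ≅ lab p) (u' : 𝟙_ C' ≅ lab' p)
    (v : lab s ⊗ lab p ⟶ lab s) (hv : lab s ◁ u.hom ≫ v = (ρ_ _).hom)
    (hv' : lab' s ◁ u'.hom ≫ T.hat v = (ρ_ _).hom) :
    (ρ_ (lab' s)).hom = ((T.θ s).inv ⊗ₘ (u' ≪≫ (T.θ p).symm ≪≫ Φ.mapIso u.symm).hom) ≫
      (T.μ _ _).hom ≫ Φ.map (ρ_ (lab s)).hom ≫ (T.θ s).hom := by
  have h1 := T.μ_natural (𝟙 (lab s)) u.hom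
  rw [← hv', ← hv, Φ.map_comp, Category.assoc, ← id_tensorHom _ u.hom, ← reassoc_of% h1]
  simp only [LabelTensor.hat, ← T.θ_inv_μ, Category.assoc]
  simp only [tensorHom_comp_tensorHom_assoc, ← id_tensorHom, Category.assoc, Iso.trans_hom,
    Iso.symm_hom, Functor.mapIso_hom, ← Φ.map_comp, Iso.inv_hom_id, Category.comp_id,
    Category.id_comp, Φ.map_id]

end

/-- A nonzero object with scalar endomorphisms has a one-dimensional endomorphism space. -/
noncomputable def endScalarEquiv {C : FusionCat.{v, u, 0} ℝ} {X : C} [Simple X]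
    (h : ∀ f : X ⟶ X, ∃ r : ℝ, f = r • 𝟙 _) : ℝ ≃ₗ[ℝ] (X ⟶ X) :=
  LinearEquiv.ofBijective (LinearMap.toSpanSingleton ℝ _ (𝟙 X))
    ⟨smul_left_injective ℝ (id_nonzero X), fun f => by
      obtain ⟨r, rfl⟩ := h f; exact ⟨r, rfl⟩⟩

lemma endScalarEquiv_apply {C : FusionCat.{v, u, 0} ℝ} {X : C} [Simple X]
    (h : ∀ f : X ⟶ X, ∃ r : ℝ, f = r • 𝟙 _) (r : ℝ) : endScalarEquiv h r = r • 𝟙 X := rfl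

/-! ### Presentations of the same datum give equivalent categories -/

namespace CHPresentation

variable {C : FusionCat.{v, u, 0} ℝ} {A : Type w} [Group A] [Fintype A] {d : TYDatum A}
  (P : CHPresentation C d)

/-- The simple object with label `s`. -/
@[reducible] def lab : Option A → C
  | none => P.m
  | some a => P.obj a

lemma simple_lab (s : Option A) : Simple (P.lab s) := by
  cases s with
  | none => exact P.isTY.simple
  | some a => exact P.simple_obj a

lemma exists_iso_lab (X : C) (hX : Simple X) : ∃ s, Nonempty (X ≅ P.lab s) := by
  rcases P.isTY.invertible_or_iso X hX with h | h
  · obtain ⟨a, ha⟩ := P.obj_surjective X hX h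
    exact ⟨some a, ha⟩
  · exact ⟨none, h⟩

lemma not_iso_m (a : A) (e : P.obj a ≅ P.m) : False :=
  P.isTY.not_invertible ((P.obj_invertible a).of_iso e)

lemma lab_injective {s t : Option A} (e : P.lab s ≅ P.lab t) : s = t := by
  cases s with
  | none => cases t with
    | none => rfl
    | some b => exact (P.not_iso_m b e.symm).elim
  | some a => cases t with
    | none => exact (P.not_iso_m a e).elim
    | some b => exact congrArg some (P.obj_injective a b ⟨e⟩)

lemma hom_lab_eq_zero {s t : Option A} (h : s ≠ t) (f : P.lab s ⟶ P.lab t) : f = 0 := by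
  have := P.simple_lab s
  have := P.simple_lab t
  by_contra hf
  have := isIso_of_hom_simple hf
  exact h (P.lab_injective (asIso f))

lemma end_obj_scalar (a : A) (f : P.obj a ⟶ P.obj a) : ∃ r : ℝ, f = r • 𝟙 _ :=
  end_invertible_scalar P.quat P.isTY (P.obj_invertible a) f

lemma actL_qhom (a : A) (h : ℍ[ℝ]) :
    P.obj a ◁ qhom P.quat h ≫ (P.actL a).hom = (P.actL a).hom ≫ qhom P.quat h := P.actL_quat a h

lemma actR_qhom (a : A) (h : ℍ[ℝ]) :
    qhom P.quat h ▷ P.obj a ≫ (P.actR a).hom = (P.actR a).hom ≫ qhom P.quat h := P.actR_quat a h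

lemma proj_qhom (a : A) (h : ℍ[ℝ]) :
    qhom P.quat h ▷ P.m ≫ P.proj a = P.m ◁ qhom P.quat (star h) ≫ P.proj a := by
  rw [P.proj_quat a (star h), star_star]

/-- The twisted projections `[a](id ⊗ s)`. -/
noncomputable abbrev tproj (a : A) (s : Fin 4) : P.m ⊗ P.m ⟶ P.obj a :=
  twistedProj P.quat (P.proj a) s

lemma assoc_a_m_m_tproj (a b : A) (s : Fin 4) :
    (α_ (P.obj a) P.m P.m).hom ≫ P.obj a ◁ P.tproj b s ≫ (P.mul a b).hom =
      (P.actL a).hom ▷ P.m ≫ P.tproj (a * b) s := by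
  simp only [tproj, twistedProj]
  rw [whiskerLeft_comp, Category.assoc, ← associator_naturality_right_assoc,
    P.assoc_a_m_m, whisker_exchange_assoc]

/-- The twist sits behind `[a,m]`, which is quaternion linear, so it can be moved to the last tensor
factor, where it is natural for the associator. -/
lemma assoc_m_a_m_tproj (a b : A) (s : Fin 4) :
    (α_ P.m (P.obj a) P.m).hom ≫ P.m ◁ (P.actL a).hom ≫ P.tproj b s =
      (d.χ a b : ℝ) • ((P.actR a).hom ▷ P.m ≫ P.tproj b s) := by
  simp only [tproj, twistedProj]
  rw [← whiskerLeft_comp_assoc, ← P.actL_qhom, whiskerLeft_comp_assoc,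
    ← associator_naturality_right_assoc, P.assoc_m_a_m, Linear.comp_smul, whisker_exchange_assoc]

lemma assoc_m_m_a_tproj (a b : A) (s : Fin 4) :
    (α_ P.m P.m (P.obj a)).hom ≫ P.m ◁ (P.actR a).hom ≫ P.tproj (b * a) s =
      P.tproj b s ▷ P.obj a ≫ (P.mul b a).hom := by
  simp only [tproj, twistedProj]
  rw [← whiskerLeft_comp_assoc, ← P.actR_qhom, whiskerLeft_comp_assoc,
    ← associator_naturality_middle_assoc, P.assoc_m_m_a]
  simp

/-- The twist is a quaternion on the third factor. On the other side it passes through `[b,m]` and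
multiplies the unit already present on the outgoing `m`. -/
lemma assoc_m_m_m_tproj (a : A) (s : Fin 4) :
    (α_ P.m P.m P.m).hom ≫ P.m ◁ P.tproj a s ≫ (P.actR a).hom =
      ∑ b : A, (d.τ * (d.χ a b : ℝ)⁻¹) • ∑ i : Fin 4, P.tproj b i ▷ P.m ≫
        (P.actL b).hom ≫ qhom P.quat (quaternionUnits i * quaternionUnits s) := by
  simp only [tproj, twistedProj]
  rw [whiskerLeft_comp, Category.assoc, ← associator_naturality_right_assoc,
    P.assoc_m_m_m, Preadditive.comp_sum]
  refine Finset.sum_congr rfl fun b _ => ?_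
  rw [Linear.comp_smul, Preadditive.comp_sum]
  congr 1
  refine Finset.sum_congr rfl fun i _ => ?_
  rw [qhom_mul, ← reassoc_of% P.actL_qhom b, ← P.actL_qhom, tensorHom_def_assoc, id_tensorHom,
    comp_whiskerRight]
  simp only [Category.assoc, ← whisker_exchange_assoc]

lemma exists_dual : ∃ j : ∀ k : A × Fin 4, P.obj k.1 ⟶ P.m ⊗ P.m,
      (∀ k, j k ≫ P.tproj k.1 k.2 = 𝟙 _) ∧ (∀ k l, k ≠ l → j k ≫ P.tproj l.1 l.2 = 0) ∧
      ∑ k, P.tproj k.1 k.2 ≫ j k = 𝟙 _ :=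
  P.isTY.exists_dual P.quat P.obj_invertible P.obj_surjective P.obj_injective P.proj P.proj_ne_zero

/-- Since `[a]` is balanced, a quaternion on the first factor reappears as its conjugate on the
second. -/
lemma proj_comp_qhom (a : A) (f g : ℍ[ℝ]) (s : Fin 4) :
    (qhom P.quat f ⊗ₘ qhom P.quat g) ≫ P.tproj a s =
      P.m ◁ qhom P.quat (star f * quaternionUnits s * g) ≫ P.proj a := by
  simp only [tproj, twistedProj]
  rw [tensorHom_def_assoc, ← whiskerLeft_comp_assoc, ← qhom_mul,
    ← whisker_exchange_assoc, P.proj_qhom, ← whiskerLeft_comp_assoc, ← qhom_mul, mul_assoc]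

section Comparison

variable {C' : FusionCat.{v', u', 0} ℝ} (P' : CHPresentation C' d)

/-- Quaternions are matched with quaternions on `m`, and real scalars with real scalars on the
invertible objects. -/
lemma exists_labelIso : ∃ Λ : LabelIso P.lab P'.lab,
    ∀ h, Λ.φ none none (qhom P.quat h) = qhom P'.quat h := by
  have hs (a) := P.simple_obj a
  have hs' (a) := P'.simple_obj a
  let e : ∀ s : Option A, (P.lab s ⟶ P.lab s) ≃ₗ[ℝ] (P'.lab s ⟶ P'.lab s) := fun s =>
    match s with
    | none => (P.quat.symm.trans P'.quat).toLinearEquiv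
    | some a => (endScalarEquiv (P.end_obj_scalar a)).symm.trans
        (endScalarEquiv (P'.end_obj_scalar a))
  have e_some (a : A) (r : ℝ) : e (some a) (r • 𝟙 (P.obj a)) = r • 𝟙 (P'.obj a) := by
    change endScalarEquiv (P'.end_obj_scalar a) ((endScalarEquiv (P.end_obj_scalar a)).symm _) = _
    rw [← endScalarEquiv_apply (P.end_obj_scalar a), LinearEquiv.symm_apply_apply,
      endScalarEquiv_apply]
  obtain ⟨Λ, hΛ⟩ := LabelIso.exists_of_end (lab := P.lab) (lab' := P'.lab)
    (fun s t h f => P.hom_lab_eq_zero h f) (fun s t h f => P'.hom_lab_eq_zero h f) e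
    (fun s => by
      cases s with
      | none => exact map_one (P.quat.symm.trans P'.quat)
      | some a => simpa using e_some a 1)
    (fun s f g => by
      cases s with
      | none => exact map_mul (P.quat.symm.trans P'.quat) (End.of g) (End.of f)
      | some a =>
        obtain ⟨r, rfl⟩ := P.end_obj_scalar a f
        obtain ⟨r', rfl⟩ := P.end_obj_scalar a g
        have h1 : (r • 𝟙 (P.obj a)) ≫ (r' • 𝟙 (P.obj a)) = (r * r') • 𝟙 (P.obj a) := by
          simp [smul_smul, mul_comm]
        have h2 : (r • 𝟙 (P'.obj a)) ≫ (r' • 𝟙 (P'.obj a)) = (r * r') • 𝟙 (P'.obj a) := by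
          simp [smul_smul, mul_comm]
        rw [e_some, e_some, h2]
        exact (congrArg (e (some a)) h1).trans (e_some a _))
  refine ⟨Λ, fun h => (hΛ none _).trans ?_⟩
  exact congrArg P'.quat (P.quat.symm_apply_apply h)

variable {P P'} {Λ : LabelIso P.lab P'.lab} {Φ : C ⥤ C'}

/-- Tensorators on simple objects. -/
noncomputable def tensorator (θ : ∀ s, Φ.obj (P.lab s) ≅ P'.lab s)
    (μm : P'.m ⊗ P'.m ≅ Φ.obj (P.m ⊗ P.m)) :
    ∀ s t, P'.lab s ⊗ P'.lab t ≅ Φ.obj (P.lab s ⊗ P.lab t)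
  | some a, some b => P'.mul a b ≪≫ (θ (some (a * b))).symm ≪≫ Φ.mapIso (P.mul a b).symm
  | some a, none => P'.actL a ≪≫ (θ none).symm ≪≫ Φ.mapIso (P.actL a).symm
  | none, some a => P'.actR a ≪≫ (θ none).symm ≪≫ Φ.mapIso (P.actR a).symm
  | none, none => μm

/-- In both categories the twisted projections split `m ⊗ m` into summands indexed by `A × Fin 4`;
the isomorphism matches the summands. -/
lemma exists_tensorator_m [Φ.Additive] (θ : ∀ s, Φ.obj (P.lab s) ≅ P'.lab s) :
    ∃ μm : P'.m ⊗ P'.m ≅ Φ.obj (P.m ⊗ P.m), ∀ a s,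
      μm.hom ≫ Φ.map (P.tproj a s) ≫ (θ (some a)).hom = P'.tproj a s := by
  obtain ⟨j, h1, h2, h3⟩ := P.exists_dual
  obtain ⟨j', h1', h2', h3'⟩ := P'.exists_dual
  have key (l : A × Fin 4) : (∑ k, P'.tproj k.1 k.2 ≫ (θ (some k.1)).inv ≫ Φ.map (j k)) ≫
      Φ.map (P.tproj l.1 l.2) ≫ (θ (some l.1)).hom = P'.tproj l.1 l.2 := by
    rw [Preadditive.sum_comp, Finset.sum_eq_single l]
    · have := Φ.congr_map (h1 l)
      rw [Φ.map_comp, Φ.map_id] at this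
      simp only [Category.assoc]
      rw [reassoc_of% this, Iso.inv_hom_id, Category.comp_id]
    · intro k _ hk
      have := Φ.congr_map (h2 k l hk)
      rw [Φ.map_comp, Φ.map_zero] at this
      simp only [Category.assoc]
      rw [reassoc_of% this]; simp
    · simp
  refine ⟨⟨∑ k, P'.tproj k.1 k.2 ≫ (θ (some k.1)).inv ≫ Φ.map (j k),
    ∑ k, Φ.map (P.tproj k.1 k.2) ≫ (θ (some k.1)).hom ≫ j' k, ?_, ?_⟩, fun a s => key (a, s)⟩
  · rw [Preadditive.comp_sum, ← h3']
    refine Finset.sum_congr rfl fun l _ => ?_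
    rw [← Category.assoc (Φ.map _), ← Category.assoc, key]
  · have h4 (l : A × Fin 4) : (∑ k, Φ.map (P.tproj k.1 k.2) ≫ (θ (some k.1)).hom ≫ j' k) ≫ P'.tproj l.1 l.2 =
        Φ.map (P.tproj l.1 l.2) ≫ (θ (some l.1)).hom := by
      rw [Preadditive.sum_comp, Finset.sum_eq_single l]
      · rw [Category.assoc, Category.assoc, h1']
        exact congrArg _ (Category.comp_id _)
      · intro k _ hk
        rw [Category.assoc, Category.assoc, h2' k l hk]
        simp
      · simp
    rw [Preadditive.comp_sum, ← Φ.map_id, ← h3, Φ.map_sum]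
    refine Finset.sum_congr rfl fun l _ => ?_
    rw [← Category.assoc, h4, Φ.map_comp (P.tproj l.1 l.2), Category.assoc, Iso.hom_inv_id_assoc]

lemma tensorator_hom_tproj [Φ.Additive] [Φ.Linear ℝ] (θ : ∀ s, Φ.obj (P.lab s) ≅ P'.lab s)
    (μm : P'.m ⊗ P'.m ≅ Φ.obj (P.m ⊗ P.m))
    (hμ : ∀ a s, μm.hom ≫ Φ.map (P.tproj a s) ≫ (θ (some a)).hom = P'.tproj a s)
    (a : A) (x : ℍ[ℝ]) :
    μm.hom ≫ Φ.map (P.m ◁ qhom P.quat x ≫ P.proj a) ≫ (θ (some a)).hom =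
      P'.m ◁ qhom P'.quat x ≫ P'.proj a := by
  obtain ⟨r, rfl⟩ := exists_sum_quaternionUnits x
  rw [← sum_smul_twistedProj, ← sum_smul_twistedProj, Φ.map_sum, Preadditive.sum_comp,
    Preadditive.comp_sum]
  refine Finset.sum_congr rfl fun s _ => ?_
  rw [Functor.map_smul, Linear.smul_comp, Linear.comp_smul, hμ]

/-- Nonzero maps between labelled objects are real scalars or quaternions, so naturality expresses
the quaternion linearity of `[a,m]` and `[m,a]`, and on `m ⊗ m` the balance of the projections. -/
lemma tensorator_natural [Φ.Additive] [Φ.Linear ℝ]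
    (hΛ : ∀ h, Λ.φ none none (qhom P.quat h) = qhom P'.quat h)
    (θ : ∀ s, Φ.obj (P.lab s) ≅ P'.lab s)
    (hθ : ∀ s t (f : P.lab s ⟶ P.lab t), Φ.map f ≫ (θ t).hom = (θ s).hom ≫ Λ.φ s t f)
    (μm : P'.m ⊗ P'.m ≅ Φ.obj (P.m ⊗ P.m))
    (hμ : ∀ a s, μm.hom ≫ Φ.map (P.tproj a s) ≫ (θ (some a)).hom = P'.tproj a s)
    (s s' t t' : Option A) (f : P.lab s ⟶ P.lab s') (g : P.lab t ⟶ P.lab t') :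
    (Λ.φ _ _ f ⊗ₘ Λ.φ _ _ g) ≫ (tensorator θ μm s' t').hom =
      (tensorator θ μm s t).hom ≫ Φ.map (f ⊗ₘ g) := by
  by_cases hs : s = s'; swap
  · rw [P.hom_lab_eq_zero hs f]; simp
  by_cases ht : t = t'; swap
  · rw [P.hom_lab_eq_zero ht g]; simp
  subst hs ht
  have hθ' (h : ℍ[ℝ]) : qhom P'.quat h ≫ (θ none).inv = (θ none).inv ≫ Φ.map (qhom P.quat h) := by
    rw [Iso.eq_inv_comp, ← hΛ, ← reassoc_of% hθ none none]
    simp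
  have hs (a : A) (r : ℝ) : Λ.φ (some a) (some a) (r • 𝟙 _) = r • 𝟙 _ := by
    rw [map_smul, Λ.map_id]
  match s, t with
  | some a, some b =>
    obtain ⟨r, rfl⟩ := P.end_obj_scalar a f
    obtain ⟨r', rfl⟩ := P.end_obj_scalar b g
    rw [hs, hs]
    simp [tensorator, MonoidalCategory.tensorHom_def]
  | some a, none =>
    obtain ⟨r, rfl⟩ := P.end_obj_scalar a f
    obtain ⟨h, rfl⟩ := qhom_surjective P.quat g
    rw [hs, hΛ]
    have h1 : (P.actL a).inv ≫ P.obj a ◁ qhom P.quat h = qhom P.quat h ≫ (P.actL a).inv := by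
      rw [Iso.inv_comp_eq, ← reassoc_of% P.actL_qhom]; simp
    simp only [tensorator, Iso.trans_hom, Iso.symm_hom, Functor.mapIso_hom, MonoidalCategory.tensorHom_def,
      MonoidalLinear.smul_whiskerRight, id_whiskerRight, Linear.smul_comp, Category.id_comp,
      Functor.map_smul, Linear.comp_smul, Category.assoc, ← Φ.map_comp, h1]
    rw [Φ.map_comp, ← reassoc_of% hθ', reassoc_of% P'.actL_qhom]
  | none, some a =>
    obtain ⟨r, rfl⟩ := P.end_obj_scalar a g
    obtain ⟨h, rfl⟩ := qhom_surjective P.quat f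
    rw [hs, hΛ]
    have h1 : (P.actR a).inv ≫ qhom P.quat h ▷ P.obj a = qhom P.quat h ≫ (P.actR a).inv := by
      rw [Iso.inv_comp_eq, ← reassoc_of% P.actR_qhom]; simp
    simp only [tensorator, Iso.trans_hom, Iso.symm_hom, Functor.mapIso_hom, MonoidalCategory.tensorHom_def,
      MonoidalLinear.whiskerLeft_smul, whiskerLeft_id, Linear.smul_comp, Category.comp_id,
      Functor.map_smul, Linear.comp_smul, Category.assoc, ← Φ.map_comp, h1]
    rw [Φ.map_comp, ← reassoc_of% hθ', reassoc_of% P'.actR_qhom]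
  | none, none =>
    obtain ⟨h, rfl⟩ := qhom_surjective P.quat f
    obtain ⟨h', rfl⟩ := qhom_surjective P.quat g
    rw [hΛ, hΛ]
    change _ ≫ μm.hom = μm.hom ≫ _
    obtain ⟨j, h1, h2, h3⟩ := P.exists_dual
    have key (f : P'.m ⊗ P'.m ⟶ Φ.obj (P.m ⊗ P.m)) : f = ∑ k, (f ≫ Φ.map (P.tproj k.1 k.2) ≫
        (θ (some k.1)).hom) ≫ (θ (some k.1)).inv ≫ Φ.map (j k) := by
      calc f = f ≫ Φ.map (∑ k, P.tproj k.1 k.2 ≫ j k) := by rw [h3]; simp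
        _ = _ := by
          rw [Φ.map_sum, Preadditive.comp_sum]
          refine Finset.sum_congr rfl fun k _ => ?_
          rw [Φ.map_comp (P.tproj k.1 k.2)]
          simp only [Category.assoc, Iso.hom_inv_id_assoc]
    rw [key (_ ≫ _), key (_ ≫ Φ.map _)]
    refine Finset.sum_congr rfl fun k _ => ?_
    congr 1
    rw [Category.assoc, Category.assoc, ← Φ.map_comp_assoc, P.proj_comp_qhom,
      tensorator_hom_tproj θ μm hμ]
    exact (P'.proj_comp_qhom _ _ _ _).trans (tensorator_hom_tproj θ μm hμ _ _).symm

/-- For each type of triple, a family of vertices splits the right-bracketed product, and the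
presentation expands the associator on it into left-bracketed vertices with coefficients depending
on `d` alone. The tensorator matches vertices, so the expansions agree. -/
theorem monoidallyEquivalent (P : CHPresentation C d) (P' : CHPresentation C' d) :
    MonoidallyEquivalent C C' := by
  obtain ⟨Λ, hΛ⟩ := P.exists_labelIso P'
  obtain ⟨Φ, θ, h1, h2, h3, hθ⟩ := Λ.exists_equivalence P.exists_iso_lab P'.exists_iso_lab
  refine ⟨Φ, h1, h2, h3, ?_⟩
  obtain ⟨μm, hμ⟩ := exists_tensorator_m (P := P) (P' := P') θ
  let T : LabelTensor Λ Φ := ⟨P.exists_iso_lab, θ, hθ, tensorator θ μm,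
    fun s s' t t' f g => tensorator_natural hΛ θ hθ μm hμ s s' t t' f g⟩
  have hmul (a b : A) : T.hat (s := some a) (t := some b) (r := some (a * b)) (P.mul a b).hom =
      (P'.mul a b).hom := by
    simp [T, LabelTensor.hat, tensorator, ← Φ.map_comp_assoc]
  have hactL (a : A) : T.hat (s := some a) (t := none) (r := none) (P.actL a).hom =
      (P'.actL a).hom := by
    simp [T, LabelTensor.hat, tensorator, ← Φ.map_comp_assoc]
  have hactR (a : A) : T.hat (s := none) (t := some a) (r := none) (P.actR a).hom =
      (P'.actR a).hom := by
    simp [T, LabelTensor.hat, tensorator, ← Φ.map_comp_assoc]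
  have hproj (a : A) (s) : T.hat (s := none) (t := none) (r := some a) (P.tproj a s) =
      P'.tproj a s := hμ a s
  have hmulE (a b c : A) (h : a * b = c) : T.hat (s := some a) (t := some b) (r := some c)
      ((P.mul a b).hom ≫ eqToHom (congrArg P.obj h)) =
      (P'.mul a b).hom ≫ eqToHom (congrArg P'.obj h) := by
    subst h; simpa using hmul a b
  have hactLq (a : A) (h : ℍ[ℝ]) : T.hat (s := some a) (t := none) (r := none)
      ((P.actL a).hom ≫ qhom P.quat h) = (P'.actL a).hom ≫ qhom P'.quat h := by
    refine (T.hat_comp (s := some a) (t := none) (r := none) (q := none) _ _).trans ?_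
    rw [hactL, hΛ]
  obtain ⟨j, -, -, hj⟩ := P.exists_dual
  have hassoc : ∀ s t r, T.Associative s t r := by
    intro s t r
    match s, t, r with
    | some a, some b, some c =>
      refine T.associative_of_family (K := Unit) (fun _ => some (b * c))
        (fun _ => some (a * (b * c))) (fun _ => (P.mul b c).hom) (fun _ => (P.mul a (b * c)).hom)
        (fun _ => (P.mul a (b * c)).inv ≫ P.obj a ◁ (P.mul b c).inv) (by simp) fun _ => ?_
      rw [hmul, hmul]
      refine (P'.assoc_a_b_c a b c).trans (Eq.trans ?_
        (congrArg (T.testLeft (some a) (some b) (some c) (some _)) (P.assoc_a_b_c a b c)).symm)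
      refine Eq.trans ?_ (T.testLeft_vertex (s := some a) (t := some b) (r := some c) (q := some (a * (b * c)))
        (p := some (a * b)) _ _).symm
      rw [hmul, hmulE (a * b) c _ (mul_assoc a b c)]
    | some a, some b, none =>
      refine T.associative_of_family (K := Unit) (fun _ => none)
        (fun _ => none) (fun _ => (P.actL b).hom) (fun _ => (P.actL a).hom)
        (fun _ => (P.actL a).inv ≫ P.obj a ◁ (P.actL b).inv) (by simp) fun _ => ?_
      rw [hactL, hactL]
      refine (P'.assoc_a_b_m a b).trans (Eq.trans ?_
        (congrArg (T.testLeft (some a) (some b) none none) (P.assoc_a_b_m a b)).symm)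
      refine Eq.trans ?_ (T.testLeft_vertex (s := some a) (t := some b) (r := none) (q := none)
        (p := some (a * b)) _ _).symm
      rw [hmul, hactL]
    | some a, none, some b =>
      refine T.associative_of_family (K := Unit) (fun _ => none)
        (fun _ => none) (fun _ => (P.actR b).hom) (fun _ => (P.actL a).hom)
        (fun _ => (P.actL a).inv ≫ P.obj a ◁ (P.actR b).inv) (by simp) fun _ => ?_
      rw [hactL, hactR]
      refine (P'.assoc_a_m_b a b).trans (Eq.trans ?_
        (congrArg (T.testLeft (some a) none (some b) none) (P.assoc_a_m_b a b)).symm)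
      rw [T.testLeft_smul]
      congr 1
      refine Eq.trans ?_ (T.testLeft_vertex (s := some a) (t := none) (r := some b) (q := none)
        (p := none) _ _).symm
      rw [hactR, hactL]
    | none, some a, some b =>
      refine T.associative_of_family (K := Unit) (fun _ => some (a * b))
        (fun _ => none) (fun _ => (P.mul a b).hom) (fun _ => (P.actR (a * b)).hom)
        (fun _ => (P.actR (a * b)).inv ≫ P.m ◁ (P.mul a b).inv) (by simp) fun _ => ?_
      rw [hmul, hactR]
      refine (P'.assoc_m_a_b a b).trans (Eq.trans ?_
        (congrArg (T.testLeft none (some a) (some b) none) (P.assoc_m_a_b a b)).symm)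
      refine Eq.trans ?_ (T.testLeft_vertex (s := none) (t := some a) (r := some b) (q := none)
        (p := none) _ _).symm
      rw [hactR, hactR]
    | some a, none, none =>
      refine T.associative_of_family (K := A × Fin 4) (fun k => some k.1)
        (fun k => some (a * k.1)) (fun k => P.tproj k.1 k.2) (fun k => (P.mul a k.1).hom)
        (fun k => (P.mul a k.1).inv ≫ P.obj a ◁ j k) ?_ fun k => ?_
      · refine Eq.trans (Finset.sum_congr rfl fun k _ => ?_) ((whiskerLeft_sum (P.obj a) _ _).symm.trans
          ((congrArg (P.obj a ◁ ·) hj).trans (whiskerLeft_id _ _)))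
        simp
      rw [hproj, hmul]
      refine (P'.assoc_a_m_m_tproj a k.1 k.2).trans (Eq.trans ?_
        (congrArg (T.testLeft (some a) none none (some _)) (P.assoc_a_m_m_tproj a k.1 k.2)).symm)
      refine Eq.trans ?_ (T.testLeft_vertex (s := some a) (t := none) (r := none) (q := some (a * k.1))
        (p := none) _ _).symm
      rw [hproj, hactL]
    | none, some a, none =>
      refine T.associative_of_family (K := A × Fin 4) (fun k => none)
        (fun k => some k.1) (fun k => (P.actL a).hom) (fun k => P.tproj k.1 k.2)
        (fun k => j k ≫ P.m ◁ (P.actL a).inv) ?_ fun k => ?_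
      · calc _ = P.m ◁ (P.actL a).hom ≫ (∑ k, P.tproj k.1 k.2 ≫ j k) ≫ P.m ◁ (P.actL a).inv := by
              simp [Preadditive.comp_sum, Preadditive.sum_comp]
          _ = _ := by rw [hj]; simp
      rw [hproj, hactL]
      refine (P'.assoc_m_a_m_tproj a k.1 k.2).trans (Eq.trans ?_
        (congrArg (T.testLeft none (some a) none (some _)) (P.assoc_m_a_m_tproj a k.1 k.2)).symm)
      rw [T.testLeft_smul]
      congr 1
      refine Eq.trans ?_ (T.testLeft_vertex (s := none) (t := some a) (r := none) (q := some k.1)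
        (p := none) _ _).symm
      rw [hproj, hactR]
    | none, none, some a =>
      -- The associator identity for `m ⊗ m ⊗ a` has target `b * a`, so the splitting family is
      -- reindexed by right multiplication.
      let e : A × Fin 4 ≃ A × Fin 4 := (Equiv.mulRight a).prodCongr (Equiv.refl _)
      refine T.associative_of_family (K := A × Fin 4) (fun k => none)
        (fun k => some (k.1 * a)) (fun k => (P.actR a).hom) (fun k => P.tproj (k.1 * a) k.2)
        (fun k => j (e k) ≫ P.m ◁ (P.actR a).inv) ?_ fun k => ?_
      · have hj' : ∑ k, P.tproj (e k).1 (e k).2 ≫ j (e k) = 𝟙 _ :=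
          (e.sum_comp fun k => P.tproj k.1 k.2 ≫ j k).trans hj
        calc _ = P.m ◁ (P.actR a).hom ≫ (∑ k, P.tproj (e k).1 (e k).2 ≫ j (e k)) ≫
              P.m ◁ (P.actR a).inv := by
              simp only [Preadditive.comp_sum, Preadditive.sum_comp, Category.assoc]; rfl
          _ = _ := by rw [hj']; simp
      rw [hproj, hactR]
      refine (P'.assoc_m_m_a_tproj a k.1 k.2).trans (Eq.trans ?_
        (congrArg (T.testLeft none none (some a) (some _)) (P.assoc_m_m_a_tproj a k.1 k.2)).symm)
      refine Eq.trans ?_ (T.testLeft_vertex (s := none) (t := none) (r := some a) (q := some (k.1 * a))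
        (p := some k.1) _ _).symm
      rw [hproj, hmul]
    | none, none, none =>
      refine T.associative_of_family (K := A × Fin 4) (fun k => some k.1)
        (fun k => none) (fun k => P.tproj k.1 k.2) (fun k => (P.actR k.1).hom)
        (fun k => (P.actR k.1).inv ≫ P.m ◁ j k) ?_ fun k => ?_
      · refine Eq.trans (Finset.sum_congr rfl fun k _ => ?_) ((whiskerLeft_sum P.m _ _).symm.trans
          ((congrArg (P.m ◁ ·) hj).trans (whiskerLeft_id _ _)))
        simp
      rw [hproj, hactR]
      refine (P'.assoc_m_m_m_tproj k.1 k.2).trans (Eq.trans ?_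
        (congrArg (T.testLeft none none none none) (P.assoc_m_m_m_tproj k.1 k.2)).symm)
      rw [T.testLeft_sum]
      refine Finset.sum_congr rfl fun b _ => ?_
      rw [T.testLeft_smul, T.testLeft_sum]
      congr 1
      refine Finset.sum_congr rfl fun i _ => ?_
      refine Eq.trans ?_ (T.testLeft_vertex (s := none) (t := none) (r := none) (q := none)
        (p := some b) _ _).symm
      rw [hproj, hactLq]
  refine T.nonempty_monoidal hassoc (P'.unitIso ≪≫ (θ (some 1)).symm ≪≫ Φ.mapIso P.unitIso.symm)
    ?_ ?_
  · intro s
    match s with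
    | none =>
      exact T.left_unit_of_vertex (p := some 1) (s := none) P.unitIso P'.unitIso (P.actL 1).hom
        P.one_actL (by rw [hactL]; exact P'.one_actL)
    | some a =>
      exact T.left_unit_of_vertex (p := some 1) (s := some a) P.unitIso P'.unitIso
        ((P.mul 1 a).hom ≫ eqToHom (congrArg P.obj (one_mul a))) (P.one_mul_eq a)
        (by rw [hmulE 1 a _ (one_mul a)]; exact P'.one_mul_eq a)
  · intro s
    match s with
    | none =>
      exact T.right_unit_of_vertex (p := some 1) (s := none) P.unitIso P'.unitIso (P.actR 1).hom
        P.actR_one (by rw [hactR]; exact P'.actR_one)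
    | some a =>
      exact T.right_unit_of_vertex (p := some 1) (s := some a) P.unitIso P'.unitIso
        ((P.mul a 1).hom ≫ eqToHom (congrArg P.obj (mul_one a))) (P.mul_one_eq a)
        (by rw [hmulE a 1 _ (mul_one a)]; exact P'.mul_one_eq a)

end Comparison

end CHPresentation

/-! ### Transport along monoidal equivalences and reindexing of the group -/

section Transport

open Functor.LaxMonoidal Functor.OplaxMonoidal

variable {C : FusionCat.{v, u, 0} ℝ} {C' : FusionCat.{v', u', 0} ℝ} (F : C ⥤ C') [F.Monoidal]

lemma IsInvertibleObj.map {X : C} (hX : IsInvertibleObj X) : IsInvertibleObj (F.obj X) := by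
  obtain ⟨Y, ⟨a⟩, ⟨b⟩⟩ := hX
  exact ⟨F.obj Y, ⟨Functor.Monoidal.μIso F X Y ≪≫ F.mapIso a ≪≫ (Functor.Monoidal.εIso F).symm⟩,
    ⟨Functor.Monoidal.μIso F Y X ≪≫ F.mapIso b ≪≫ (Functor.Monoidal.εIso F).symm⟩⟩

/-- The image of a map out of a tensor product. -/
def vertexMap {X Y Z : C} (w : X ⊗ Y ⟶ Z) : F.obj X ⊗ F.obj Y ⟶ F.obj Z := μ F X Y ≫ F.map w

/-- The image of a map out of a triple tensor product. -/
def vertexMap₃ {X Y Z W : C} (f : (X ⊗ Y) ⊗ Z ⟶ W) :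
    (F.obj X ⊗ F.obj Y) ⊗ F.obj Z ⟶ F.obj W :=
  μ F X Y ▷ F.obj Z ≫ μ F (X ⊗ Y) Z ≫ F.map f

variable {F}

lemma vertexMap_comp {X Y Z W : C} (w : X ⊗ Y ⟶ Z) (f : Z ⟶ W) :
    vertexMap F (w ≫ f) = vertexMap F w ≫ F.map f := by simp [vertexMap]

lemma vertexMap_whiskerRight {X X' Y Z : C} (f : X ⟶ X') (w : X' ⊗ Y ⟶ Z) :
    vertexMap F (f ▷ Y ≫ w) = F.map f ▷ F.obj Y ≫ vertexMap F w := by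
  simp [vertexMap]

lemma vertexMap_whiskerLeft {X Y Y' Z : C} (f : Y ⟶ Y') (w : X ⊗ Y' ⟶ Z) :
    vertexMap F (X ◁ f ≫ w) = F.obj X ◁ F.map f ≫ vertexMap F w := by
  simp [vertexMap]

lemma vertexMap₃_left {X Y Z W V : C} (w : X ⊗ Y ⟶ W) (v : W ⊗ Z ⟶ V) :
    vertexMap₃ F (w ▷ Z ≫ v) = vertexMap F w ▷ F.obj Z ≫ vertexMap F v := by
  simp [vertexMap₃, vertexMap]

/-- This is the associativity axiom of the tensorator in terms of vertices. With `vertexMap₃_left`,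
applying `vertexMap₃` to an associator identity yields the same identity for the image vertices. -/
lemma vertexMap₃_right {X Y Z W V : C} (w : Y ⊗ Z ⟶ W) (v : X ⊗ W ⟶ V) :
    vertexMap₃ F ((α_ X Y Z).hom ≫ X ◁ w ≫ v) =
      (α_ _ _ _).hom ≫ F.obj X ◁ vertexMap F w ≫ vertexMap F v := by
  simp [vertexMap₃, vertexMap]

lemma vertexMap₃_smul [F.Linear ℝ] {X Y Z W : C} (r : ℝ) (f : (X ⊗ Y) ⊗ Z ⟶ W) :
    vertexMap₃ F (r • f) = r • vertexMap₃ F f := by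
  simp [vertexMap₃]

lemma vertexMap₃_sum [F.Additive] {ι : Type*} (s : Finset ι) {X Y Z W : C} (f : ι → ((X ⊗ Y) ⊗ Z ⟶ W)) :
    vertexMap₃ F (∑ i ∈ s, f i) = ∑ i ∈ s, vertexMap₃ F (f i) := by
  simp [vertexMap₃, Preadditive.comp_sum, Functor.map_sum]

lemma unitLeft_tensor_vertex {X Y Y' Z Z' W V : C} (f : Y ⟶ Y') (g : Z ⟶ Z') (p : X ⊗ Y' ⟶ W)
    (l : W ⊗ Z' ⟶ V) :
    ((𝟙 X ⊗ₘ f) ⊗ₘ g) ≫ p ▷ Z' ≫ l = (X ◁ f ≫ p) ▷ Z ≫ W ◁ g ≫ l := by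
  rw [id_tensorHom, MonoidalCategory.tensorHom_def, Category.assoc, whisker_exchange_assoc,
    comp_whiskerRight, Category.assoc]

/-- Every idempotent of the image comes from an idempotent of `X`, because `F` is full and faithful.
-/
lemma simple_map {F : C ⥤ C'} [F.Additive] [F.IsEquivalence] {X : C} (hX : Simple X) : Simple (F.obj X) := by
  refine C'.simple_of_idem _ (fun h => id_nonzero X (F.map_injective (by simpa using h)))
    fun e he => ?_
  obtain ⟨f, rfl⟩ := F.map_surjective e
  rcases idem_of_simple f (F.map_injective (by simpa using he)) with h | h <;> simp [h]

lemma simple_of_map {F : C ⥤ C'} [F.Additive] [F.IsEquivalence] {X : C} (hX : Simple (F.obj X)) : Simple X := by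
  refine C.simple_of_idem _ (fun h => id_nonzero (F.obj X) (by rw [← F.map_id, h]; simp))
    fun e he => ?_
  rcases idem_of_simple (F.map e) (by rw [← F.map_comp, he]) with h | h
  · left; exact F.map_injective (by simpa using h)
  · right; exact F.map_injective (by simpa using h)

lemma IsInvertibleObj.of_map [F.IsEquivalence] {X : C} (hX : IsInvertibleObj (F.obj X)) : IsInvertibleObj X := by
  obtain ⟨Y, ⟨a⟩, ⟨b⟩⟩ := hX
  let e := F.objObjPreimageIso Y
  refine ⟨F.objPreimage Y, ⟨F.preimageIso ?_⟩, ⟨F.preimageIso ?_⟩⟩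
  · exact (Functor.Monoidal.μIso F _ _).symm ≪≫ whiskerLeftIso _ e ≪≫ a ≪≫
      Functor.Monoidal.εIso F
  · exact (Functor.Monoidal.μIso F _ _).symm ≪≫ whiskerRightIso e _ ≪≫ b ≪≫
      Functor.Monoidal.εIso F

lemma IsTambaraYamagami.map [F.Additive] [F.IsEquivalence] {m : C} (hm : IsTambaraYamagami C m) :
    IsTambaraYamagami C' (F.obj m) where
  simple := simple_map hm.simple
  not_invertible h := hm.not_invertible h.of_map
  invertible_or_iso X hX := by
    have e := F.objObjPreimageIso X
    have : Simple (F.obj (F.objPreimage X)) := Simple.of_iso e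
    rcases hm.invertible_or_iso _ (simple_of_map this) with h | ⟨⟨f⟩⟩
    · exact Or.inl ((h.map F).of_iso e)
    · exact Or.inr ⟨e.symm ≪≫ F.mapIso f⟩
  multiplicity_zero f := by
    have h := hm.multiplicity_zero (F.preimage (δ F m m ≫ f))
    have h2 := congrArg F.map h
    rw [F.map_preimage, F.map_zero] at h2
    rw [← cancel_epi (δ F m m), h2]; simp

/-- Transport of an identification of an endomorphism algebra. -/
noncomputable def mapQuat (F : C ⥤ C') [F.Additive] [F.Linear ℝ] [F.IsEquivalence] {m : C} (q : ℍ[ℝ] ≃ₐ[ℝ] End m) : ℍ[ℝ] ≃ₐ[ℝ] End (F.obj m) :=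
  AlgEquiv.ofBijective
    (AlgHom.ofLinearMap
      { toFun := fun h => (End.of (F.map (qhom q h)) : End (F.obj m))
        map_add' := fun x y => by rw [qhom_add, F.map_add]
        map_smul' := fun r x => by rw [qhom_smul, F.map_smul]; rfl }
      (by change F.map (qhom q 1) = _; rw [qhom_one, F.map_id]; rfl)
      (fun x y => by change F.map (qhom q (x * y)) = _; rw [qhom_mul, F.map_comp]; rfl))
    ⟨fun x y h => qhom_injective q (F.map_injective h), fun f => by
      obtain ⟨g, hg⟩ := F.map_surjective (End.asHom f)
      obtain ⟨h, rfl⟩ := qhom_surjective q g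
      exact ⟨h, hg⟩⟩

variable {A : Type w} [Group A] [Fintype A] {d : TYDatum A}

/-- Transport of a presentation along a monoidal equivalence. -/
noncomputable def CHPresentation.map (P : CHPresentation C d) (F : C ⥤ C') [F.Monoidal]
    [F.Additive] [F.Linear ℝ] [F.IsEquivalence] : CHPresentation C' d where
  m := F.obj P.m
  isTY := P.isTY.map
  quat := mapQuat F P.quat
  obj a := F.obj (P.obj a)
  simple_obj a := simple_map (P.simple_obj a)
  obj_invertible a := (P.obj_invertible a).map F
  obj_surjective X hX hX' := by
    have e := F.objObjPreimageIso X
    have h1 : Simple (F.obj (F.objPreimage X)) := Simple.of_iso e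
    have h2 : IsInvertibleObj (F.obj (F.objPreimage X)) := hX'.of_iso e.symm
    obtain ⟨a, ⟨i⟩⟩ := P.obj_surjective _ (simple_of_map h1) h2.of_map
    exact ⟨a, ⟨e.symm ≪≫ F.mapIso i⟩⟩
  obj_injective a b := fun ⟨e⟩ => P.obj_injective a b ⟨F.preimageIso e⟩
  unitIso := Functor.Monoidal.εIso F ≪≫ F.mapIso P.unitIso
  mul a b := Functor.Monoidal.μIso F _ _ ≪≫ F.mapIso (P.mul a b)
  actL a := Functor.Monoidal.μIso F _ _ ≪≫ F.mapIso (P.actL a)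
  actR a := Functor.Monoidal.μIso F _ _ ≪≫ F.mapIso (P.actR a)
  proj a := vertexMap F (P.proj a)
  proj_ne_zero a h := P.proj_ne_zero a (F.map_injective (by
    rw [← cancel_epi (μ F P.m P.m)]; simpa [vertexMap] using h))
  actL_quat a h := by
    have := congrArg (vertexMap F) (P.actL_qhom a h)
    rwa [vertexMap_whiskerLeft, vertexMap_comp] at this
  actR_quat a h := by
    have := congrArg (vertexMap F) (P.actR_qhom a h)
    rwa [vertexMap_whiskerRight, vertexMap_comp] at this
  proj_quat a h := by
    have := congrArg (vertexMap F) (P.proj_quat a h)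
    rwa [vertexMap_whiskerRight, vertexMap_whiskerLeft] at this
  one_mul_eq a := by
    have := congrArg F.map (P.one_mul_eq a)
    simp [← this, eqToHom_map]
  mul_one_eq a := by
    have := congrArg F.map (P.mul_one_eq a)
    simp [← this, eqToHom_map]
  one_actL := by
    have := congrArg F.map P.one_actL
    simp [← this]
  actR_one := by
    have := congrArg F.map P.actR_one
    simp [← this]
  assoc_a_b_c a b c := by
    have := congrArg (vertexMap₃ F) (P.assoc_a_b_c a b c)
    rw [vertexMap₃_left, vertexMap₃_right, vertexMap_comp, eqToHom_map] at this
    simpa [vertexMap] using this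
  assoc_a_b_m a b := by
    have := congrArg (vertexMap₃ F) (P.assoc_a_b_m a b)
    rwa [vertexMap₃_left, vertexMap₃_right] at this
  assoc_a_m_b a b := by
    have := congrArg (vertexMap₃ F) (P.assoc_a_m_b a b)
    rwa [vertexMap₃_smul, vertexMap₃_left, vertexMap₃_right] at this
  assoc_m_a_b a b := by
    have := congrArg (vertexMap₃ F) (P.assoc_m_a_b a b)
    rwa [vertexMap₃_left, vertexMap₃_right] at this
  assoc_a_m_m a b := by
    have := congrArg (vertexMap₃ F) (P.assoc_a_m_m a b)
    rwa [vertexMap₃_left, vertexMap₃_right] at this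
  assoc_m_a_m a b := by
    have := congrArg (vertexMap₃ F) (P.assoc_m_a_m a b)
    rwa [vertexMap₃_smul, vertexMap₃_left, vertexMap₃_right] at this
  assoc_m_m_a a b := by
    have := congrArg (vertexMap₃ F) (P.assoc_m_m_a a b)
    rwa [vertexMap₃_left, vertexMap₃_right] at this
  assoc_m_m_m a := by
    have := congrArg (vertexMap₃ F) (P.assoc_m_m_m a)
    rw [vertexMap₃_sum, vertexMap₃_right] at this
    refine this.trans (Finset.sum_congr rfl fun b _ => ?_)
    rw [vertexMap₃_smul, vertexMap₃_sum]
    congr 1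
    refine Finset.sum_congr rfl fun i _ => ?_
    rw [unitLeft_tensor_vertex, unitLeft_tensor_vertex, vertexMap₃_left, vertexMap_whiskerLeft,
      vertexMap_whiskerLeft]
    rfl

/-- Pulling back a datum along a group isomorphism. -/
def TYDatum.comap {A' : Type w'} [Group A'] [Fintype A'] (d' : TYDatum A') (f : A ≃* A') :
    TYDatum A where
  χ a b := d'.χ (f a) (f b)
  τ := d'.τ
  mul_left a b c := by rw [map_mul, d'.mul_left]
  mul_right a b c := by rw [map_mul, d'.mul_right]
  symm a b := d'.symm _ _
  nondegenerate a h := by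
    have := d'.nondegenerate (f a) fun b => by simpa using h (f.symm b)
    simpa using this
  tau_eq := by
    rw [Fintype.card_congr f.toEquiv]; exact d'.tau_eq

lemma TYDatum.ext {d d' : TYDatum A} (h1 : d.χ = d'.χ) (h2 : d.τ = d'.τ) : d = d' := by
  cases d; cases d'; cases h1; cases h2; rfl

namespace CHPresentation

variable (P : CHPresentation C d)

/-- Vertices commute with transport along equalities of labels. Reindexing needs this because `f (a
* b) = f a * f b` is not definitional. -/
lemma whiskerLeft_eqToHom_mul (a : A) {b c : A} (h : b = c) :
    P.obj a ◁ eqToHom (congrArg P.obj h) ≫ (P.mul a c).hom =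
      (P.mul a b).hom ≫ eqToHom (by rw [h]) := by
  subst h; simp

lemma eqToHom_whiskerRight_mul (a : A) {b c : A} (h : b = c) :
    eqToHom (congrArg P.obj h) ▷ P.obj a ≫ (P.mul c a).hom =
      (P.mul b a).hom ≫ eqToHom (by rw [h]) := by
  subst h; simp

lemma eqToHom_whiskerRight_actL {b c : A} (h : b = c) :
    eqToHom (congrArg P.obj h) ▷ P.m ≫ (P.actL c).hom = (P.actL b).hom := by
  subst h; simp

lemma whiskerLeft_eqToHom_actR {b c : A} (h : b = c) :
    P.m ◁ eqToHom (congrArg P.obj h) ≫ (P.actR c).hom = (P.actR b).hom := by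
  subst h; simp

lemma proj_eqToHom {b c : A} (h : b = c) :
    P.proj b ≫ eqToHom (congrArg P.obj h) = P.proj c := by
  subst h; simp

end CHPresentation

/-- Reindexing a presentation along a group isomorphism. -/
noncomputable def CHPresentation.reindex {A' : Type w'} [Group A'] [Fintype A'] {d' : TYDatum A'}
    (P : CHPresentation C d') (f : A ≃* A') : CHPresentation C (d'.comap f) where
  m := P.m
  isTY := P.isTY
  quat := P.quat
  obj a := P.obj (f a)
  simple_obj a := P.simple_obj _
  obj_invertible a := P.obj_invertible _
  obj_surjective X hX hX' := by
    obtain ⟨a, h⟩ := P.obj_surjective X hX hX'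
    exact ⟨f.symm a, by simpa using h⟩
  obj_injective a b h := f.injective (P.obj_injective _ _ h)
  unitIso := P.unitIso ≪≫ eqToIso (congrArg P.obj (map_one f).symm)
  mul a b := P.mul _ _ ≪≫ eqToIso (congrArg P.obj (map_mul f a b).symm)
  actL a := P.actL _
  actR a := P.actR _
  proj a := P.proj _
  proj_ne_zero a := P.proj_ne_zero _
  actL_quat a := P.actL_quat _
  actR_quat a := P.actR_quat _
  proj_quat a := P.proj_quat _
  one_mul_eq a := by
    rw [← P.one_mul_eq]
    simp only [Iso.trans_hom, eqToIso.hom, comp_whiskerRight, Category.assoc, eqToHom_trans,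
      reassoc_of% P.eqToHom_whiskerRight_mul (f a) (map_one f).symm]
  mul_one_eq a := by
    rw [← P.mul_one_eq]
    simp only [Iso.trans_hom, eqToIso.hom, whiskerLeft_comp, Category.assoc, eqToHom_trans,
      reassoc_of% P.whiskerLeft_eqToHom_mul (f a) (map_one f).symm]
  one_actL := by
    rw [← P.one_actL]
    simp only [Iso.trans_hom, eqToIso.hom, comp_whiskerRight, Category.assoc,
      P.eqToHom_whiskerRight_actL (map_one f).symm]
  actR_one := by
    rw [← P.actR_one]
    simp only [Iso.trans_hom, eqToIso.hom, whiskerLeft_comp, Category.assoc,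
      P.whiskerLeft_eqToHom_actR (map_one f).symm]
  assoc_a_b_c a b c := by
    have := P.assoc_a_b_c (f a) (f b) (f c)
    simp only [Iso.trans_hom, eqToIso.hom, whiskerLeft_comp, comp_whiskerRight, Category.assoc,
      reassoc_of% P.whiskerLeft_eqToHom_mul (f a) (map_mul f b c).symm, reassoc_of% this,
      reassoc_of% P.eqToHom_whiskerRight_mul (f c) (map_mul f a b).symm, eqToHom_trans]
  assoc_a_b_m a b := by
    have := P.assoc_a_b_m (f a) (f b)
    simp only [Iso.trans_hom, eqToIso.hom, comp_whiskerRight, Category.assoc, this,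
      P.eqToHom_whiskerRight_actL (map_mul f a b).symm]
  assoc_a_m_b a b := P.assoc_a_m_b _ _
  assoc_m_a_b a b := by
    have := P.assoc_m_a_b (f a) (f b)
    simp only [Iso.trans_hom, eqToIso.hom, whiskerLeft_comp, Category.assoc, this,
      P.whiskerLeft_eqToHom_actR (map_mul f a b).symm]
  assoc_a_m_m a b := by
    have := P.assoc_a_m_m (f a) (f b)
    simp [reassoc_of% this, P.proj_eqToHom (map_mul f a b).symm]
  assoc_m_a_m a b := P.assoc_m_a_m _ _
  assoc_m_m_a a b := by
    have := P.assoc_m_m_a (f a) (f b)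
    simp only [Iso.trans_hom, eqToIso.hom, ← reassoc_of% this, P.proj_eqToHom (map_mul f b a).symm]
  assoc_m_m_m a := by
    refine (P.assoc_m_m_m (f a)).trans ?_
    exact (f.toEquiv.sum_comp _).symm

end Transport

/-! ### The datum is determined by the monoidal category -/

section

variable {C : FusionCat.{v, u, 0} ℝ}

lemma smul_tensorHom {X X' Y Y' : C} (r : ℝ) (f : X ⟶ X') (g : Y ⟶ Y') :
    (r • f) ⊗ₘ g = r • (f ⊗ₘ g) := by
  simp [MonoidalCategory.tensorHom_def]

lemma tensorHom_smul {X X' Y Y' : C} (r : ℝ) (f : X ⟶ X') (g : Y ⟶ Y') :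
    f ⊗ₘ (r • g) = r • (f ⊗ₘ g) := by
  simp [MonoidalCategory.tensorHom_def]

end

namespace CHPresentation

variable {C : FusionCat.{v, u, 0} ℝ} {A : Type w} [Group A] [Fintype A] {d : TYDatum A}
  (P : CHPresentation C d)

/-- Any map to `obj a` is `[a]` twisted by some quaternion, and being balanced forces this
quaternion to be central, hence real. -/
lemma proj_eq_smul (a : A) (f : P.m ⊗ P.m ⟶ P.obj a)
    (hf : ∀ h, P.m ◁ qhom P.quat h ≫ f = qhom P.quat (star h) ▷ P.m ≫ f) :
    ∃ r : ℝ, f = r • P.proj a := by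
  obtain ⟨g, rfl⟩ := P.isTY.proj_torsor (P.obj_invertible a) _ (P.proj_ne_zero a) f
  obtain ⟨r, rfl⟩ := eq_smul_of_qhom_commute P.quat g fun h => by
    refine (qhom_proj_injective P.quat (P.proj_ne_zero a) ?_).symm
    rw [whiskerLeft_comp, Category.assoc, hf, ← whisker_exchange_assoc, whiskerLeft_comp,
      Category.assoc, P.proj_qhom, star_star]
  exact ⟨r, by simp⟩

/-- The inclusions dual to the twisted projections extract the coefficients one at a time. -/
lemma sum_tproj_eq_zero (c : A → Fin 4 → ℍ[ℝ])
    (h : ∑ b, ∑ i, P.tproj b i ▷ P.m ≫ (P.actL b).hom ≫ qhom P.quat (c b i) = 0) (b : A)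
    (i : Fin 4) : c b i = 0 := by
  obtain ⟨j, h1, h2, -⟩ := P.exists_dual
  apply qhom_injective P.quat
  rw [qhom_zero, ← cancel_epi (P.actL b).hom, Limits.comp_zero]
  have h3 := congrArg (fun f => j (b, i) ▷ P.m ≫ f) h
  simp only [Limits.comp_zero, ← Fintype.sum_prod_type', Preadditive.comp_sum] at h3
  rw [Finset.sum_eq_single (b, i)] at h3
  · rw [← comp_whiskerRight_assoc, h1, id_whiskerRight, Category.id_comp] at h3
    exact h3
  · intro k _ hk
    rw [← comp_whiskerRight_assoc, h2 _ _ hk.symm]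
    simp
  · simp

/-- Two presentations on the same category with isomorphic families of invertible objects have the
same data. -/
lemma datum_eq {d' : TYDatum A} (P' : CHPresentation C d')
    (φ : ∀ a, P.obj a ≅ P'.obj a) : d.τ = d'.τ ∧ d.χ = d'.χ := by
  have hm := P.isTY.simple
  have hm' := P'.isTY.simple
  obtain ⟨θ₀⟩ : Nonempty (P.m ≅ P'.m) :=
    (P'.isTY.invertible_or_iso P.m hm).resolve_left P.isTY.not_invertible
  -- Comparing the two quaternion actions through `θ₀` gives an algebra endomorphism of `ℍ`;
  -- Skolem–Noether supplies the quaternion that corrects `θ₀` to an intertwiner.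
  obtain ⟨θ, hθ⟩ : ∃ θ : P.m ≅ P'.m,
      ∀ h, qhom P.quat h ≫ θ.hom = θ.hom ≫ qhom P'.quat h := by
    choose s hs using fun h => qhom_surjective P'.quat (θ₀.inv ≫ qhom P.quat h ≫ θ₀.hom)
    let σ : ℍ[ℝ] →ₐ[ℝ] ℍ[ℝ] := AlgHom.ofLinearMap
      { toFun := s
        map_add' := fun x y => qhom_injective P'.quat (by
          rw [hs, qhom_add, qhom_add, hs, hs]; simp)
        map_smul' := fun r x => qhom_injective P'.quat (by
          rw [hs, qhom_smul, qhom_smul, RingHom.id_apply, hs]; simp) }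
      (qhom_injective P'.quat (by
          change qhom P'.quat (s 1) = _
          rw [hs, qhom_one, qhom_one]; simp))
      (fun x y => qhom_injective P'.quat (by
          change qhom P'.quat (s _) = qhom P'.quat (s _ * s _)
          rw [hs, qhom_mul, qhom_mul, hs, hs]; simp))
    obtain ⟨u, hu, h⟩ := Quaternion.exists_conj σ
    have := qhom_isIso P'.quat (inv_ne_zero hu)
    refine ⟨θ₀ ≪≫ asIso (qhom P'.quat u⁻¹), fun x => ?_⟩
    have h1 : u⁻¹ * s x = x * u⁻¹ := by
      rw [inv_mul_eq_iff_eq_mul₀ hu, ← mul_assoc, ← h x, mul_assoc, mul_inv_cancel₀ hu, mul_one]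
      rfl
    have h2 : qhom P.quat x ≫ θ₀.hom = θ₀.hom ≫ qhom P'.quat (s x) := by rw [hs]; simp
    simp only [Iso.trans_hom, asIso_hom, reassoc_of% h2, Category.assoc, ← qhom_mul, h1]
  -- Corresponding vertices satisfy the same quaternion relations, so they differ by real scalars:
  -- `x` for `[a,m]`, `y` for `[m,a]`, `w` for `[a]`.
  have hL (a : A) : ∃ x : ℝ, ((φ a).hom ⊗ₘ θ.hom) ≫ (P'.actL a).hom =
      x • ((P.actL a).hom ≫ θ.hom) := by
    obtain ⟨x, hx⟩ := exists_smul_of_intertwine P.quat (P.actL a).hom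
      (((φ a).hom ⊗ₘ θ.hom) ≫ (P'.actL a).hom ≫ θ.inv) (fun h => P.obj a ◁ qhom P.quat h)
      (P.actL_qhom a) (fun h => by
        have e : qhom P'.quat h ≫ θ.inv = θ.inv ≫ qhom P.quat h := by
          rw [Iso.eq_inv_comp, ← reassoc_of% hθ]; simp
        simp only [Category.assoc]
        rw [← e, ← reassoc_of% P'.actL_qhom, ← id_tensorHom, ← id_tensorHom,
          tensorHom_comp_tensorHom_assoc, tensorHom_comp_tensorHom_assoc, hθ]
        simp)
    exact ⟨x, by rw [← cancel_mono θ.inv]; simpa using hx⟩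
  have hR (a : A) : ∃ x : ℝ, (θ.hom ⊗ₘ (φ a).hom) ≫ (P'.actR a).hom =
      x • ((P.actR a).hom ≫ θ.hom) := by
    obtain ⟨x, hx⟩ := exists_smul_of_intertwine P.quat (P.actR a).hom
      ((θ.hom ⊗ₘ (φ a).hom) ≫ (P'.actR a).hom ≫ θ.inv) (fun h => qhom P.quat h ▷ P.obj a)
      (P.actR_qhom a) (fun h => by
        have e : qhom P'.quat h ≫ θ.inv = θ.inv ≫ qhom P.quat h := by
          rw [Iso.eq_inv_comp, ← reassoc_of% hθ]; simp
        simp only [Category.assoc]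
        rw [← e, ← reassoc_of% P'.actR_qhom, ← tensorHom_id, ← tensorHom_id,
          tensorHom_comp_tensorHom_assoc, tensorHom_comp_tensorHom_assoc, hθ]
        simp)
    exact ⟨x, by rw [← cancel_mono θ.inv]; simpa using hx⟩
  have hp (a : A) : ∃ x : ℝ, (θ.hom ⊗ₘ θ.hom) ≫ P'.proj a = x • (P.proj a ≫ (φ a).hom) := by
    obtain ⟨x, hx⟩ := P.proj_eq_smul a ((θ.hom ⊗ₘ θ.hom) ≫ P'.proj a ≫ (φ a).inv) (fun h => by
      rw [← id_tensorHom, ← tensorHom_id,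
          tensorHom_comp_tensorHom_assoc, tensorHom_comp_tensorHom_assoc, hθ, hθ]
      have e1 : (𝟙 P.m ≫ θ.hom ⊗ₘ θ.hom ≫ qhom P'.quat h) =
          (θ.hom ⊗ₘ θ.hom) ≫ P'.m ◁ qhom P'.quat h := by
        rw [← id_tensorHom, tensorHom_comp_tensorHom]; simp
      have e2 : (θ.hom ≫ qhom P'.quat (star h) ⊗ₘ 𝟙 P.m ≫ θ.hom) =
          (θ.hom ⊗ₘ θ.hom) ≫ qhom P'.quat (star h) ▷ P'.m := by
        rw [← tensorHom_id, tensorHom_comp_tensorHom]; simp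
      rw [e1, e2, Category.assoc, Category.assoc, reassoc_of% P'.proj_qhom a (star h), star_star])
    exact ⟨x, by rw [← cancel_mono (φ a).inv]; simpa using hx⟩
  choose x hL using hL
  choose y hR using hR
  choose w hp using hp
  have hx (a : A) : x a ≠ 0 := fun h => by
    have := hL a
    rw [h, zero_smul] at this
    refine id_nonzero P'.m ?_
    rw [← cancel_epi (((φ a).hom ⊗ₘ θ.hom) ≫ (P'.actL a).hom), Category.comp_id, this]; simp
  have hy (a : A) : y a ≠ 0 := fun h => by
    have := hR a
    rw [h, zero_smul] at this
    refine id_nonzero P'.m ?_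
    rw [← cancel_epi ((θ.hom ⊗ₘ (φ a).hom) ≫ (P'.actR a).hom), Category.comp_id, this]; simp
  have hw (a : A) : w a ≠ 0 := fun h => by
    have := hp a
    rw [h, zero_smul] at this
    refine P'.proj_ne_zero a ?_
    rw [← cancel_epi (θ.hom ⊗ₘ θ.hom), this]; simp
  -- The two unit isomorphisms differ by one scalar `r`, and the left and right unit constraints of
  -- `m` give `r * x 1 = 1` and `r * y 1 = 1`.
  have hxy : x 1 = y 1 := by
    have hu : ∃ r : ℝ, P'.unitIso.hom = r • (P.unitIso.hom ≫ (φ 1).hom) :=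
      exists_smul_of_invertible P.quat P.isTY (P'.obj_invertible 1) _ _
    obtain ⟨r, hr⟩ := hu
    have h1 : r * x 1 = 1 := by
      have e1 := P'.one_actL
      have e2 : 𝟙_ C ◁ θ.hom ≫ (r • (P.unitIso.hom ≫ (φ 1).hom)) ▷ P'.m ≫ (P'.actL 1).hom =
          (r * x 1) • (𝟙_ C ◁ θ.hom ≫ (λ_ P'.m).hom) := by
        have := hL 1
        rw [MonoidalCategory.tensorHom_def', Category.assoc] at this
        rw [MonoidalLinear.smul_whiskerRight, comp_whiskerRight, Linear.smul_comp,
          Linear.comp_smul, Category.assoc, whisker_exchange_assoc, this, Linear.comp_smul,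
          smul_smul, reassoc_of% P.one_actL, leftUnitor_naturality]
      rw [← hr, e1] at e2
      by_contra hne
      refine id_nonzero P'.m ?_
      have e3 : (1 - r * x 1) • (𝟙_ C ◁ θ.hom ≫ (λ_ P'.m).hom) = 0 := by
        rw [sub_smul, one_smul, ← e2, sub_self]
      have e4 := (smul_eq_zero.mp e3).resolve_left (sub_ne_zero.mpr (Ne.symm hne))
      rw [← cancel_epi (𝟙_ C ◁ θ.hom ≫ (λ_ P'.m).hom), Category.comp_id, e4]; simp
    have h2 : r * y 1 = 1 := by
      have e1 := P'.actR_one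
      have e2 : θ.hom ▷ 𝟙_ C ≫ P'.m ◁ (r • (P.unitIso.hom ≫ (φ 1).hom)) ≫ (P'.actR 1).hom =
          (r * y 1) • (θ.hom ▷ 𝟙_ C ≫ (ρ_ P'.m).hom) := by
        have := hR 1
        rw [MonoidalCategory.tensorHom_def, Category.assoc] at this
        rw [MonoidalLinear.whiskerLeft_smul, whiskerLeft_comp, Linear.smul_comp,
          Linear.comp_smul, Category.assoc, ← whisker_exchange_assoc, this, Linear.comp_smul,
          smul_smul, reassoc_of% P.actR_one, rightUnitor_naturality]
      rw [← hr, e1] at e2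
      by_contra hne
      refine id_nonzero P'.m ?_
      have e3 : (1 - r * y 1) • (θ.hom ▷ 𝟙_ C ≫ (ρ_ P'.m).hom) = 0 := by
        rw [sub_smul, one_smul, ← e2, sub_self]
      have e4 := (smul_eq_zero.mp e3).resolve_left (sub_ne_zero.mpr (Ne.symm hne))
      rw [← cancel_epi (θ.hom ▷ 𝟙_ C ≫ (ρ_ P'.m).hom), Category.comp_id, e4]; simp
    have hr0 : r ≠ 0 := left_ne_zero_of_mul_eq_one h1
    exact mul_left_cancel₀ hr0 (h1.trans h2.symm)
  refine ⟨?_, ?_⟩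
  -- For `τ`, the associator of `m, m, m` is compared at `a = b = 1` with trivial twists. One side
  -- is scaled by `w 1 * y 1`, the other by `w 1 * x 1`, and these agree.
  · have ht (a : A) (s : Fin 4) : (θ.hom ⊗ₘ θ.hom) ≫ P'.tproj a s =
        w a • (P.tproj a s ≫ (φ a).hom) := by
      simp only [tproj, twistedProj]
      rw [← id_tensorHom, tensorHom_comp_tensorHom_assoc, ← hθ, Category.comp_id,
        ← Category.id_comp θ.hom, Category.assoc, ← tensorHom_comp_tensorHom_assoc, id_tensorHom]
      rw [Category.id_comp, hp, Linear.comp_smul]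
    have hl : ((θ.hom ⊗ₘ θ.hom) ⊗ₘ θ.hom) ≫ (α_ _ _ _).hom ≫ P'.m ◁ P'.tproj 1 0 ≫
        (P'.actR 1).hom = (w 1 * y 1) • ((α_ _ _ _).hom ≫ P.m ◁ P.tproj 1 0 ≫
          (P.actR 1).hom ≫ θ.hom) := by
      have e : (θ.hom ⊗ₘ (θ.hom ⊗ₘ θ.hom)) ≫ P'.m ◁ P'.tproj 1 0 =
          w 1 • (P.m ◁ P.tproj 1 0 ≫ (θ.hom ⊗ₘ (φ 1).hom)) := by
        rw [← id_tensorHom, tensorHom_comp_tensorHom, ht, ← id_tensorHom, tensorHom_comp_tensorHom]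
        simp [tensorHom_smul]
      rw [associator_naturality_assoc, reassoc_of% e, Linear.smul_comp, Category.assoc, hR]
      simp [smul_smul]
    have hr (b : A) (i : Fin 4) : ((θ.hom ⊗ₘ θ.hom) ⊗ₘ θ.hom) ≫ P'.tproj b i ▷ P'.m ≫
        (P'.actL b).hom ≫ qhom P'.quat (quaternionUnits i * quaternionUnits 0) =
        (w b * x b) • (P.tproj b i ▷ P.m ≫ (P.actL b).hom ≫
          qhom P.quat (quaternionUnits i * quaternionUnits 0) ≫ θ.hom) := by
      have e : ((θ.hom ⊗ₘ θ.hom) ⊗ₘ θ.hom) ≫ P'.tproj b i ▷ P'.m =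
          w b • (P.tproj b i ▷ P.m ≫ ((φ b).hom ⊗ₘ θ.hom)) := by
        rw [← tensorHom_id, tensorHom_comp_tensorHom, ht, ← tensorHom_id, tensorHom_comp_tensorHom]
        simp [smul_tensorHom]
      rw [reassoc_of% e, Linear.smul_comp, Category.assoc, reassoc_of% hL b, Linear.smul_comp,
        Linear.comp_smul, Category.assoc, ← hθ, smul_smul]
    have e1 := P.assoc_m_m_m_tproj 1 0
    rw [P'.assoc_m_m_m_tproj, Preadditive.comp_sum, reassoc_of% e1] at hl
    simp only [Linear.comp_smul, Preadditive.comp_sum, hr] at hl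
    have hz : ∑ b : A, ∑ i : Fin 4, P.tproj b i ▷ P.m ≫ (P.actL b).hom ≫
        qhom P.quat ((d'.τ * (d'.χ 1 b : ℝ)⁻¹ * (w b * x b) - w 1 * y 1 * (d.τ * (d.χ 1 b : ℝ)⁻¹)) •
          (quaternionUnits i * quaternionUnits 0)) = 0 := by
      rw [← cancel_mono θ.hom, Limits.zero_comp, ← sub_eq_zero.mpr hl, Preadditive.sum_comp,
        Preadditive.sum_comp, Finset.smul_sum, ← Finset.sum_sub_distrib]
      refine Finset.sum_congr rfl fun b _ => ?_
      simp only [Preadditive.sum_comp, Linear.smul_comp, Finset.smul_sum]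
      rw [← Finset.sum_sub_distrib]
      refine Finset.sum_congr rfl fun i _ => ?_
      simp only [sub_smul, qhom_sub, qhom_smul, Preadditive.comp_sub, Preadditive.sub_comp,
        Linear.comp_smul, Linear.smul_comp, Category.assoc, smul_smul]
    have h0 := P.sum_tproj_eq_zero _ hz 1 0
    have hχ (d : TYDatum A) : d.χ 1 1 = 1 := by
      have := d.mul_left 1 1 1
      simpa using this
    rw [Quaternion.quaternionUnits_zero, mul_one, hχ, hχ, hxy] at h0
    have h1 := (smul_eq_zero.mp h0).resolve_right one_ne_zero
    apply mul_left_cancel₀ (mul_ne_zero (hw 1) (hy 1))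
    simp at h1
    linarith
  -- In the associator of `a, m, b` both bracketings acquire the same factor `x a * y b`, so `χ`
  -- does not change.
  · funext a b
    have e1 := P'.assoc_a_m_b a b
    have e2 : (x a * y b) • ((α_ (P.obj a) P.m (P.obj b)).hom ≫ P.obj a ◁ (P.actR b).hom ≫
        (P.actL a).hom ≫ θ.hom) = ((d'.χ a b : ℝ) * (x a * y b)) •
          ((P.actL a).hom ▷ P.obj b ≫ (P.actR b).hom ≫ θ.hom) := by
      have l : (((φ a).hom ⊗ₘ θ.hom) ⊗ₘ (φ b).hom) ≫ (α_ _ _ _).hom ≫ P'.obj a ◁ (P'.actR b).hom ≫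
          (P'.actL a).hom = (x a * y b) • ((α_ _ _ _).hom ≫
            P.obj a ◁ (P.actR b).hom ≫ (P.actL a).hom ≫ θ.hom) := by
        have e : ((φ a).hom ⊗ₘ (θ.hom ⊗ₘ (φ b).hom)) ≫ P'.obj a ◁ (P'.actR b).hom =
            y b • (P.obj a ◁ (P.actR b).hom ≫ ((φ a).hom ⊗ₘ θ.hom)) := by
          rw [← id_tensorHom, tensorHom_comp_tensorHom, hR, ← id_tensorHom,
            tensorHom_comp_tensorHom]
          simp [tensorHom_smul]
        rw [associator_naturality_assoc, reassoc_of% e, Linear.smul_comp, Category.assoc, hL]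
        simp [smul_smul, mul_comm]
      have r : (((φ a).hom ⊗ₘ θ.hom) ⊗ₘ (φ b).hom) ≫ (P'.actL a).hom ▷ P'.obj b ≫
          (P'.actR b).hom = (x a * y b) • ((P.actL a).hom ▷ P.obj b ≫ (P.actR b).hom ≫ θ.hom) := by
        have e : (((φ a).hom ⊗ₘ θ.hom) ⊗ₘ (φ b).hom) ≫ (P'.actL a).hom ▷ P'.obj b =
            x a • ((P.actL a).hom ▷ P.obj b ≫ (θ.hom ⊗ₘ (φ b).hom)) := by
          rw [← tensorHom_id, tensorHom_comp_tensorHom, hL, ← tensorHom_id,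
            tensorHom_comp_tensorHom]
          simp [smul_tensorHom]
        rw [reassoc_of% e, Linear.smul_comp, Category.assoc, hR]
        simp [smul_smul]
      rw [← l, e1, Linear.comp_smul, r, smul_smul]
    have e3 := P.assoc_a_m_b a b
    rw [reassoc_of% e3, Linear.smul_comp, smul_smul, Category.assoc] at e2
    have e4 := sub_eq_zero.mpr e2
    rw [← sub_smul] at e4
    rcases smul_eq_zero.mp e4 with h | h
    · apply Units.ext
      have := mul_ne_zero (hx a) (hy b)
      apply mul_left_cancel₀ this
      linarith
    · exfalso
      refine id_nonzero P'.m ?_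
      rw [← cancel_epi ((P.actL a).hom ▷ P.obj b ≫ (P.actR b).hom ≫ θ.hom), Category.comp_id, h]
      simp

/-- Both groups label the isomorphism classes of invertible objects, and the vertices `[a,b]` make
the matching of labels multiplicative. Reindexing along it reduces the claim to `datum_eq`. -/
theorem exists_mulEquiv {A' : Type w'} [Group A'] [Fintype A'] {d' : TYDatum A'}
    (P : CHPresentation C d) (P' : CHPresentation C d') :
    d.τ = d'.τ ∧ ∃ f : A ≃* A', ∀ a b, d'.χ (f a) (f b) = d.χ a b := by
  choose f hf using fun a => P'.obj_surjective _ (P.simple_obj a) (P.obj_invertible a)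
  choose g hg using fun a => P.obj_surjective _ (P'.simple_obj a) (P'.obj_invertible a)
  let F : A ≃* A' :=
    { toFun := f
      invFun := g
      left_inv := fun a => P.obj_injective _ _ ⟨(hg (f a)).some.symm ≪≫ (hf a).some.symm⟩
      right_inv := fun a => P'.obj_injective _ _ ⟨(hf (g a)).some.symm ≪≫ (hg a).some.symm⟩
      map_mul' := fun a b => P'.obj_injective _ _ ⟨(hf (a * b)).some.symm ≪≫ (P.mul a b).symm ≪≫
        MonoidalCategory.tensorIso (hf a).some (hf b).some ≪≫ P'.mul _ _⟩ }
  obtain ⟨h1, h2⟩ := P.datum_eq (P'.reindex F) fun a => (hf a).some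
  exact ⟨h1, F, fun a b => (congrFun (congrFun h2 a) b).symm⟩

end CHPresentation

/-! ### Associator coefficients of the complex model -/

section Model

open scoped Classical

variable {A : Type} [Group A] [Fintype A]

/-- Labels of matrix indices: `some (some a)` for the invertible objects, `some none` for the
non-invertible object, and `none` for indices to be ignored. -/
abbrev TYLabel (A : Type) : Type := Option (Option A)

/-- The label of an invertible object. -/
abbrev TYLabel.inv (a : A) : TYLabel A := some (some a)
/-- The label of the non-invertible object. -/
abbrev TYLabel.m : TYLabel A := some none

open TYLabel

/-- The fusion rule: whether `u` occurs in `s ⊗ t`. -/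
def TYLabel.Occurs (s t u : TYLabel A) : Prop :=
  match s, t, u with
  | some (some a), some (some b), some (some c) => c = a * b
  | some (some _), some none, some none => True
  | some none, some (some _), some none => True
  | some none, some none, some (some _) => True
  | _, _, _ => False

/-- Evaluation at a label of an invertible object. -/
def TYLabel.onInv (f : A → ℝ) : TYLabel A → ℝ
  | some (some a) => f a
  | _ => 0

/-- The indicator of the non-invertible label. -/
def TYLabel.isM : TYLabel A → ℝ
  | some none => 1
  | _ => 0

section
@[simp] lemma TYLabel.onInv_inv (f : A → ℝ) (a : A) : onInv f (some (some a)) = f a := rfl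
@[simp] lemma TYLabel.onInv_m (f : A → ℝ) : onInv f (some none) = 0 := rfl
@[simp] lemma TYLabel.onInv_dead (f : A → ℝ) : onInv f none = 0 := rfl
@[simp] lemma TYLabel.isM_inv (a : A) : isM (some (some a)) = 0 := rfl
@[simp] lemma TYLabel.isM_m : isM (A := A) (some none) = 1 := rfl
@[simp] lemma TYLabel.isM_dead : isM (A := A) none = 0 := rfl
end

/-- Associator coefficients with given values on the four nontrivial types. -/
noncomputable def tyCoeff (p q : A → A → ℝ) (r : A → A → ℝ) (i j k v u w : TYLabel A) : ℝ :=
  match i, j, k with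
  | some (some a), some (some b), some (some c) => onInv (Pi.single (a * b) 1) u *
      (onInv (Pi.single (b * c) 1) w * onInv (Pi.single (a * b * c) 1) v)
  | some (some a), some (some b), some none => onInv (Pi.single (a * b) 1) u * (isM w * isM v)
  | some none, some (some a), some (some b) => isM u * (onInv (Pi.single (a * b) 1) w * isM v)
  | some (some a), some none, some (some b) => isM u * (isM w * (isM v * p a b))
  | some (some a), some none, some none =>
      isM u * onInv (fun y => onInv (Pi.single (a * y) 1) v) w
  | some none, some none, some (some a) =>
      isM w * onInv (fun x => onInv (Pi.single (x * a) 1) v) u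
  | some none, some (some a), some none => isM u * (isM w * onInv (fun z => q a z) v)
  | some none, some none, some none => isM v * onInv (fun x => onInv (fun y => r x y) w) u
  | _, _, _ => 0

section
variable (p q r : A → A → ℝ) (a b c : A) (i j k v u w : TYLabel A)
@[simp] lemma tyCoeff_inv_inv_inv : tyCoeff p q r (some (some a)) (some (some b)) (some (some c)) v u w =
  onInv (Pi.single (a * b) 1) u *
      (onInv (Pi.single (b * c) 1) w * onInv (Pi.single (a * b * c) 1) v) := rfl
@[simp] lemma tyCoeff_inv_inv_m : tyCoeff p q r (some (some a)) (some (some b)) (some none) v u w =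
  onInv (Pi.single (a * b) 1) u * (isM w * isM v) := rfl
@[simp] lemma tyCoeff_m_inv_inv : tyCoeff p q r (some none) (some (some a)) (some (some b)) v u w =
  isM u * (onInv (Pi.single (a * b) 1) w * isM v) := rfl
@[simp] lemma tyCoeff_inv_m_inv : tyCoeff p q r (some (some a)) (some none) (some (some b)) v u w =
  isM u * (isM w * (isM v * p a b)) := rfl
@[simp] lemma tyCoeff_inv_m_m : tyCoeff p q r (some (some a)) (some none) (some none) v u w =
  isM u * onInv (fun y => onInv (Pi.single (a * y) 1) v) w := rfl
@[simp] lemma tyCoeff_m_m_inv : tyCoeff p q r (some none) (some none) (some (some a)) v u w =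
  isM w * onInv (fun x => onInv (Pi.single (x * a) 1) v) u := rfl
@[simp] lemma tyCoeff_m_inv_m : tyCoeff p q r (some none) (some (some a)) (some none) v u w =
  isM u * (isM w * onInv (fun z => q a z) v) := rfl
@[simp] lemma tyCoeff_m_m_m : tyCoeff p q r (some none) (some none) (some none) v u w =
  isM v * onInv (fun x => onInv (fun y => r x y) w) u := rfl
@[simp] lemma tyCoeff_dead₁ : tyCoeff p q r none j k v u w = 0 := rfl
@[simp] lemma tyCoeff_dead₂ : tyCoeff p q r i none k v u w = 0 := by
  rcases i with _ | _ | _ <;> rfl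
@[simp] lemma tyCoeff_dead₃ : tyCoeff p q r i j none v u w = 0 := by
  rcases i with _ | _ | _ <;> rcases j with _ | _ | _ <;> rfl
end

/-- The associator coefficients. -/
noncomputable def tyF (d : TYDatum A) (i j k v u w : TYLabel A) : ℝ :=
  tyCoeff (fun a b => d.χ a b) (fun a b => d.χ a b) (fun a b => -2 * d.τ * (d.χ a b : ℝ)⁻¹)
    i j k v u w

/-- The coefficients of the inverse associator. -/
noncomputable def tyG (d : TYDatum A) (i j k v w u : TYLabel A) : ℝ :=
  tyCoeff (fun a b => (d.χ a b : ℝ)⁻¹) (fun a b => (d.χ a b : ℝ)⁻¹)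
    (fun a b => -2 * d.τ * (d.χ a b : ℝ)) i j k v u w

namespace TYDatum

variable (d : TYDatum A)

lemma χ_one_left (a : A) : d.χ 1 a = 1 := by simpa using d.mul_left 1 1 a
lemma χ_inv_left (a b : A) : d.χ a⁻¹ b = (d.χ a b)⁻¹ := by
  rw [eq_inv_iff_mul_eq_one, ← d.mul_left, inv_mul_cancel, d.χ_one_left]

lemma tau_sq : 4 * d.τ ^ 2 * Fintype.card A = 1 := by
  have hc : (0 : ℝ) < 4 * Fintype.card A := by
    have := Fintype.card_pos (α := A)
    positivity
  have h : d.τ ^ 2 = 1 / (4 * Fintype.card A) := by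
    rcases d.tau_eq with h | h <;> rw [h] <;> simp only [neg_sq, div_pow, Real.sq_sqrt hc.le, one_pow]
  rw [h]
  field_simp

/-- Orthogonality of characters: translation by some `c` with `χ(a,c) ≠ 1` multiplies the sum by
`χ(a,c)` without changing it. -/
lemma χ_real_sum (a : A) : ∑ b, (d.χ a b : ℝ) = if a = 1 then (Fintype.card A : ℝ) else 0 := by
  split_ifs with h
  · simp [h, d.χ_one_left]
  · obtain ⟨c, hc⟩ : ∃ c, d.χ a c ≠ 1 := by
      by_contra! hh
      exact h (d.nondegenerate a hh)
    have h1 : ∑ b, (d.χ a b : ℝ) = (d.χ a c : ℝ) * ∑ b, (d.χ a b : ℝ) := by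
      rw [Finset.mul_sum, ← Equiv.sum_comp (Equiv.mulLeft c)]
      exact Finset.sum_congr rfl fun b _ => by simp [d.mul_right]
    have h2 : ((d.χ a c : ℝ) - 1) * ∑ b, (d.χ a b : ℝ) = 0 := by rw [sub_mul, one_mul, ← h1, sub_self]
    refine (mul_eq_zero.mp h2).resolve_left (sub_ne_zero.mpr fun h => hc (Units.ext h))

lemma χ_real_sum_mul_inv (a b : A) : ∑ c, (d.χ a c : ℝ) * (d.χ b c : ℝ)⁻¹ =
    if a = b then (Fintype.card A : ℝ) else 0 := by
  have := d.χ_real_sum (a * b⁻¹)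
  simp only [d.mul_left, d.χ_inv_left, mul_inv_eq_one, Units.val_mul, Units.val_inv_eq_inv_val] at this
  exact this

end TYDatum

lemma sum_ite_eq_mul (a z : A) : (∑ i, if z = a * i then (1 : ℝ) else 0) = 1 := by
  have : ∀ i, (z = a * i) = (a⁻¹ * z = i) := fun i => by rw [inv_mul_eq_iff_eq_mul]
  simp [this]

lemma sum_ite_eq_mul' (a z : A) : (∑ i, if z = i * a then (1 : ℝ) else 0) = 1 := by
  have : ∀ i, (z = i * a) = (z * a⁻¹ = i) := fun i => by rw [mul_inv_eq_iff_eq_mul]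
  simp [this]

lemma ite_ite_same {P : Prop} {α : Type*} (x y : α) :
    (if P then (if P then x else y) else y) = if P then x else y := by
  split_ifs <;> rfl

/-- The only block with a genuine matrix is `m, m, m`: a multiple of the character table of `A`,
inverted by orthogonality together with `4τ²|A| = 1`. -/
lemma tyF_mul_tyG (d : TYDatum A) (i j k v u u' : TYLabel A) :
    ∑ w, tyF d i j k v u w * tyG d i j k v w u' =
      if u = u' ∧ Occurs i j u ∧ Occurs u k v then 1 else 0 := by
  rcases i with _ | _ | a <;> try (simp [tyF, Occurs]; done)
  all_goals rcases j with _ | _ | b <;> try (simp [tyF, Occurs]; done)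
  all_goals rcases k with _ | _ | c <;> try (simp [tyF, Occurs]; done)
  all_goals rcases u with _ | _ | x <;> try (simp [tyF, Occurs]; done)
  all_goals rcases v with _ | _ | z <;> try (simp [tyF, Occurs]; done)
  all_goals rcases u' with _ | _ | x' <;> try (simp [tyF, tyG, Occurs]; done)
  all_goals simp [tyF, tyG, Occurs, Fintype.sum_option, Pi.single_apply]
  · have h (i : A) : 2 * d.τ * (d.χ x i : ℝ)⁻¹ * (2 * d.τ * (d.χ x' i : ℝ)) =
        4 * d.τ ^ 2 * ((d.χ x' i : ℝ) * (d.χ x i : ℝ)⁻¹) := by ring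
    simp only [h]
    rw [← Finset.mul_sum, d.χ_real_sum_mul_inv]
    by_cases hx : x = x'
    · simp [hx, d.tau_sq]
    · simp [hx, Ne.symm hx]
  · by_cases h1 : z = x * c
    · subst h1; by_cases h2 : x = x' <;> simp [h2]
    · simp [h1]
  · simp only [ite_ite_same, sum_ite_eq_mul]
  · by_cases h1 : x = a * b
    · subst h1; simp [eq_comm]
    · simp [h1]
  · by_cases h1 : x = a * b
    · subst h1; by_cases h2 : z = a * b * c <;> simp [h2, eq_comm]
    · simp [h1]

lemma tyG_mul_tyF (d : TYDatum A) (i j k v w w' : TYLabel A) :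
    ∑ u, tyG d i j k v w u * tyF d i j k v u w' =
      if w = w' ∧ Occurs j k w ∧ Occurs i w v then 1 else 0 := by
  rcases i with _ | _ | a <;> try (simp [tyF, Occurs]; done)
  all_goals rcases j with _ | _ | b <;> try (simp [tyF, Occurs]; done)
  all_goals rcases k with _ | _ | c <;> try (simp [tyF, Occurs]; done)
  all_goals rcases w with _ | _ | x <;> try (simp [tyG, Occurs]; done)
  all_goals rcases v with _ | _ | z <;> try (simp [tyF, Occurs]; done)
  all_goals rcases w' with _ | _ | x' <;> try (simp [tyF, tyG, Occurs]; done)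
  all_goals simp [tyF, tyG, Occurs, Fintype.sum_option, Pi.single_apply]
  · have h (i : A) : 2 * d.τ * (d.χ i x : ℝ) * (2 * d.τ * (d.χ i x' : ℝ)⁻¹) =
        4 * d.τ ^ 2 * ((d.χ x i : ℝ) * (d.χ x' i : ℝ)⁻¹) := by
      rw [d.symm i x, d.symm i x']; ring
    simp only [h]
    rw [← Finset.mul_sum, d.χ_real_sum_mul_inv]
    by_cases hx : x = x'
    · simp [hx, d.tau_sq]
    · simp [hx]
  · simp only [ite_ite_same, sum_ite_eq_mul']
  · by_cases h1 : x = b * c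
    · subst h1; simp [eq_comm]
    · simp [h1]
  · by_cases h1 : z = a * x
    · subst h1; by_cases h2 : x = x' <;> simp [h2]
    · simp [h1]
  · by_cases h1 : x = b * c
    · subst h1; by_cases h2 : z = a * (b * c) <;> simp [h2, eq_comm, mul_assoc]
    · simp [h1]

end Model

/-! ### The pentagon for the coefficients -/

section Model

open scoped Classical

variable {A : Type} [Group A] [Fintype A]
open TYLabel
lemma TYDatum.χ_inv_right (d : TYDatum A) (a b : A) : d.χ a b⁻¹ = (d.χ a b)⁻¹ := by
  rw [d.symm, d.χ_inv_left, d.symm]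

-- The pentagon is checked by types of the four outer labels. Four copies of `m` require
-- orthogonality of `χ` and the value of `τ²`; all other cases use only the group law and the
-- symmetric bicharacter identities.
set_option maxHeartbeats 2000000 in
lemma tyF_pentagon (d : TYDatum A) (i j k l t u v x y : TYLabel A) :
    ∑ w, tyF d i j k v u w * (tyF d i w l t v y * tyF d j k l y w x) =
      tyF d u k l t v x * tyF d i j x t u y := by
  have h₁ : ∀ y e i : A, (y = i * e) = (y * e⁻¹ = i) := fun y e i => by rw [mul_inv_eq_iff_eq_mul]
  have h₂ : ∀ y e i : A, (y = e * i) = (e⁻¹ * y = i) := fun y e i => by rw [inv_mul_eq_iff_eq_mul]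
  rcases i with _ | _ | a <;> try (simp [tyF]; done)
  all_goals rcases j with _ | _ | b <;> try (simp [tyF]; done)
  all_goals rcases k with _ | _ | c <;> try (simp [tyF]; done)
  all_goals rcases l with _ | _ | e <;> try (simp [tyF]; done)
  all_goals rcases u with _ | _ | u <;> try (simp [tyF]; done)
  all_goals rcases v with _ | _ | v <;> try (simp [tyF]; done)
  all_goals rcases t with _ | _ | t <;> try (simp [tyF, Fintype.sum_option]; done)
  all_goals rcases x with _ | _ | x <;> try (simp [tyF, Fintype.sum_option]; done)
  all_goals rcases y with _ | _ | y <;> try (simp [tyF, Fintype.sum_option]; done)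
  all_goals simp [tyF, Fintype.sum_option, Pi.single_apply]
  · have h (i : A) : 2 * d.τ * (d.χ u i : ℝ)⁻¹ * ((d.χ i t : ℝ) * (2 * d.τ * (d.χ i x : ℝ)⁻¹)) =
        4 * d.τ ^ 2 * ((d.χ t i : ℝ) * (d.χ (u * x) i : ℝ)⁻¹) := by
      rw [d.symm i t, d.symm i x, d.mul_left, Units.val_mul, mul_inv]; ring
    simp only [h, ite_ite_same]
    rw [← Finset.mul_sum, d.χ_real_sum_mul_inv]
    by_cases hx : t = u * x
    · simp [hx, d.tau_sq]
    · simp [hx]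
  · simp only [ite_ite_same, h₁]
    simp [d.mul_right, d.χ_inv_right]
    ring
  · by_cases h : v = u * c
    · subst h; simp [d.mul_left]; field_simp
    · simp [h]
  · by_cases h : x = c * e
    · subst h; by_cases h' : v = u * c
      · subst h'; simp [mul_assoc]
      · simp [h']
    · simp [h]
  · by_cases h : y = b * x
    · subst h; simp [d.mul_right, d.symm b v]; field_simp
    · simp [h]
  · by_cases h : t = v * e
    · subst h; simp [d.mul_right]
    · simp [h]
  · simp [d.mul_left]; ring
  · by_cases h : x = c * e
    · subst h; simp [mul_assoc]
    · simp [h]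
  · simp only [ite_ite_same, h₂]
    simp [d.mul_left, d.χ_inv_left]
    ring
  · simp only [ite_ite_same, h₁ y e]
    simp only [Finset.sum_ite_eq, Finset.mem_univ, if_true]
    have e1 : (v = a * (y * e⁻¹)) = (a * y = v * e) := by
      rw [← mul_assoc, eq_mul_inv_iff_mul_eq]; exact propext eq_comm
    have e2 : a * (y * e⁻¹) * e = a * y := by group
    rw [e2, e1]
    by_cases h : t = a * y
    · simp [h]
    · simp [h]
  · by_cases h : t = a * y
    · subst h; simp [d.mul_right, d.symm c a]
    · simp [h]
  · by_cases h : x = c * e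
    · subst h; simp [d.mul_right]
    · simp [h]
  · by_cases h : y = b * x
    · subst h; by_cases h' : u = a * b
      · subst h'; simp [mul_assoc]
      · simp [h']
    · simp [h]
  · by_cases h : u = a * b
    · subst h; simp [d.mul_left]
    · simp [h]
  · by_cases h : u = a * b
    · subst h; by_cases h' : v = a * b * c <;> simp [h', mul_assoc]
    · simp [h]
  · by_cases h : u = a * b
    · subst h; by_cases h' : x = c * e
      · subst h'
        simp only [mul_assoc]
        by_cases h2 : v = a * (b * c)
        · subst h2
          by_cases h3 : y = b * (c * e) <;> simp [h3]
        · simp [h2]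
      · simp [h']
    · simp [h]

end Model

/-! ### The complex category of label-preserving matrices -/

section Model

open scoped Classical

variable {A : Type} [Group A] [Fintype A]
open TYLabel

/-- Coefficients vanish off the fusion rules. Hence the associator preserves labels and avoids
ignored indices, and fusion-rule indicators next to a coefficient can be absorbed. -/
lemma occurs_of_tyF_ne_zero (d : TYDatum A) {i j k v u w : TYLabel A} (h : tyF d i j k v u w ≠ 0) :
    (Occurs i j u ∧ Occurs u k v) ∧ Occurs j k w ∧ Occurs i w v := by
  rcases i with _ | _ | a <;> try (simp [tyF] at h; done)
  all_goals rcases j with _ | _ | b <;> try (simp [tyF] at h; done)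
  all_goals rcases k with _ | _ | c <;> try (simp [tyF] at h; done)
  all_goals rcases u with _ | _ | x <;> try (simp [tyF] at h; done)
  all_goals rcases v with _ | _ | z <;> try (simp [tyF] at h; done)
  all_goals rcases w with _ | _ | y <;> try (simp [tyF] at h; done)
  all_goals simp [tyF, Pi.single_apply] at h
  all_goals simp [Occurs, h, mul_assoc]

lemma tyG_eq_zero_of_tyF (d : TYDatum A) {i j k v u w : TYLabel A} (h : tyG d i j k v w u ≠ 0) :
    tyF d i j k v u w ≠ 0 := by
  rcases i with _ | _ | a <;> try (simp [tyG] at h; done)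
  all_goals rcases j with _ | _ | b <;> try (simp [tyG] at h; done)
  all_goals rcases k with _ | _ | c <;> try (simp [tyG] at h; done)
  all_goals rcases u with _ | _ | x <;> try (simp [tyG] at h; done)
  all_goals rcases v with _ | _ | z <;> try (simp [tyG] at h; done)
  all_goals rcases w with _ | _ | y <;> try (simp [tyG] at h; done)
  all_goals simp [tyG, Pi.single_apply] at h
  all_goals simp [tyF, h]

/-- The label of an index of a tensor product. -/
noncomputable def TYLabel.tdeg (s t u : TYLabel A) : TYLabel A := if Occurs s t u then u else none

/-- The indicator of the fusion rule. -/
noncomputable def TYLabel.occ (s t u : TYLabel A) : ℂ := if Occurs s t u then 1 else 0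

/-- Codes for the objects of the complex model. -/
inductive TYCode (A : Type) : Type
  | pt (l : TYLabel A)
  | tensor (X Y : TYCode A)
  | sum (n : ℕ) (X : Fin n → TYCode A)

/-- The matrix indices of an object. -/
def TYCode.idx : TYCode A → Type
  | pt _ => Unit
  | tensor X Y => idx X × idx Y × TYLabel A
  | sum n X => Σ k : Fin n, idx (X k)

noncomputable instance TYCode.fintypeIdx : (X : TYCode A) → Fintype X.idx
  | pt _ => inferInstanceAs (Fintype Unit)
  | tensor X Y =>
    letI := fintypeIdx X
    letI := fintypeIdx Y
    inferInstanceAs (Fintype (X.idx × Y.idx × TYLabel A))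
  | sum n X =>
    letI := fun k => fintypeIdx (X k)
    inferInstanceAs (Fintype (Σ k : Fin n, (X k).idx))

/-- The labels of the matrix indices. -/
noncomputable def TYCode.deg : (X : TYCode A) → X.idx → TYLabel A
  | pt l, _ => l
  | tensor X Y, i => tdeg (deg X i.1) (deg Y i.2.1) i.2.2
  | sum _ X, i => deg (X i.1) i.2

/-- The objects of the complex Tambara--Yamagami category of a datum. -/
def TYModel (_ : TYDatum A) : Type := TYCode A

namespace TYModel

variable {d : TYDatum A}

/-- The matrix indices. -/
def idx (X : TYModel d) : Type := TYCode.idx X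
noncomputable instance (X : TYModel d) : Fintype X.idx := TYCode.fintypeIdx X
/-- The labels of the matrix indices. -/
noncomputable def deg (X : TYModel d) : X.idx → TYLabel A := TYCode.deg X

/-- Label preserving matrices. -/
def homs (X Y : TYModel d) : Submodule ℂ (X.idx → Y.idx → ℂ) where
  carrier := {f | ∀ i j, ¬ (X.deg i = Y.deg j ∧ X.deg i ≠ none) → f i j = 0}
  add_mem' hf hg i j h := by simp [hf i j h, hg i j h]
  zero_mem' _ _ _ := rfl
  smul_mem' c f hf i j h := by simp [hf i j h]

lemma homs_deg {X Y : TYModel d} (f : homs X Y) {i : X.idx} {j : Y.idx} (h : f.1 i j ≠ 0) :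
    X.deg i = Y.deg j ∧ X.deg i ≠ none := by
  by_contra h'
  exact h (f.2 i j h')

/-- The action of a matrix on vectors. -/
noncomputable def act {X Y : TYModel d} (f : homs X Y) (φ : Y.idx → ℂ) (i : X.idx) : ℂ :=
  ∑ j, f.1 i j * φ j

/-- Testing on vectors replaces products of matrices by iterated substitutions, the form in which
the coherence laws are verified below. -/
lemma act_ext {X Y : TYModel d} {f g : homs X Y} (h : ∀ φ i, act f φ i = act g φ i) : f = g := by
  apply Subtype.ext
  funext i j
  simpa [act, Pi.single_apply] using h (Pi.single j 1) i

/-- The index set of a tensor product lists every label, allowed or not. Disallowed ones have degree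
`none`, where all matrices, including the identity, vanish, so they contribute no summand. -/
noncomputable instance : Category.{0} (TYModel d) where
  Hom X Y := homs X Y
  id X := ⟨fun i j => if i = j ∧ X.deg i ≠ none then 1 else 0, fun i j h => if_neg fun h' => h (by
    obtain ⟨rfl, h2⟩ := h'; exact ⟨rfl, h2⟩)⟩
  comp {X Y Z} f g := ⟨fun i k => ∑ j, f.1 i j * g.1 j k, fun i k h =>
    Finset.sum_eq_zero fun j _ => by
      by_cases h1 : f.1 i j = 0
      · rw [h1, zero_mul]
      by_cases h2 : g.1 j k = 0
      · rw [h2, mul_zero]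
      have h3 := homs_deg f h1
      have h4 := homs_deg g h2
      exact absurd ⟨h3.1.trans h4.1, h3.2⟩ h⟩
  id_comp {X Y} f := by
    apply Subtype.ext
    funext i k
    by_cases h : f.1 i k = 0
    · rw [h]
      refine Finset.sum_eq_zero fun j _ => ?_
      by_cases hij : i = j
      · subst hij; rw [h, mul_zero]
      · simp [hij]
    · simp [(homs_deg f h).2]
  comp_id {X Y} f := by
    apply Subtype.ext
    funext i k
    by_cases h : f.1 i k = 0
    · rw [h]
      refine Finset.sum_eq_zero fun j _ => ?_
      by_cases hij : j = k
      · subst hij; rw [h, zero_mul]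
      · simp [hij]
    · have := homs_deg f h
      rw [this.1] at this
      have h2 (j : Y.idx) : (j = k ∧ Y.deg j ≠ none) = (j = k) := by
        apply propext
        constructor
        · exact fun h => h.1
        · rintro rfl; exact ⟨rfl, this.2⟩
      simp [h2]
  assoc f g h := by
    apply Subtype.ext
    funext i l
    simp only [Finset.sum_mul, Finset.mul_sum, mul_assoc]
    exact Finset.sum_comm

noncomputable instance (X Y : TYModel d) : AddCommGroup (X ⟶ Y) :=
  inferInstanceAs (AddCommGroup (homs X Y))
noncomputable instance (X Y : TYModel d) : Module ℂ (X ⟶ Y) :=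
  inferInstanceAs (Module ℂ (homs X Y))

variable {X Y Z W : TYModel d}

lemma hom_ext {f g : X ⟶ Y} (h : ∀ i j, f.1 i j = g.1 i j) : f = g :=
  Subtype.ext (funext fun i => funext fun j => h i j)

lemma comp_apply (f : X ⟶ Y) (g : Y ⟶ Z) (i k) : (f ≫ g).1 i k = ∑ j, f.1 i j * g.1 j k := rfl
lemma id_apply (i j) : (𝟙 X : X ⟶ X).1 i j = if i = j ∧ X.deg i ≠ none then 1 else 0 := rfl
@[simp] lemma add_apply (f g : X ⟶ Y) (i j) : (f + g).1 i j = f.1 i j + g.1 i j := rfl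
@[simp] lemma zero_apply (i j) : (0 : X ⟶ Y).1 i j = 0 := rfl
@[simp] lemma smul_apply (c : ℂ) (f : X ⟶ Y) (i j) : (c • f).1 i j = c * f.1 i j := rfl

noncomputable instance : Preadditive (TYModel d) where
  homGroup X Y := inferInstance
  add_comp X Y Z f g h := hom_ext fun i j => by
    simp [comp_apply, add_mul, Finset.sum_add_distrib]
  comp_add X Y Z f g h := hom_ext fun i j => by
    simp [comp_apply, mul_add, Finset.sum_add_distrib]

noncomputable instance : Linear ℂ (TYModel d) where
  homModule X Y := inferInstance
  smul_comp X Y Z f g h := hom_ext fun i j => by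
    simp [comp_apply, mul_assoc, Finset.mul_sum]
  comp_smul X Y Z f g h := hom_ext fun i j => by
    simp [comp_apply, Finset.mul_sum, mul_left_comm]

/-- The action of a morphism on vectors. -/
noncomputable abbrev actHom (f : X ⟶ Y) (φ : Y.idx → ℂ) (i : X.idx) : ℂ := act f φ i

lemma act_hom_ext {f g : X ⟶ Y} (h : ∀ φ i, actHom f φ i = actHom g φ i) : f = g := act_ext h

lemma act_comp (f : X ⟶ Y) (g : Y ⟶ Z) (φ i) : actHom (f ≫ g) φ i = actHom f (actHom g φ) i := by
  simp only [act, comp_apply, Finset.sum_mul, Finset.mul_sum, mul_assoc]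
  exact Finset.sum_comm

lemma act_id (φ i) : actHom (𝟙 X) φ i = if X.deg i = none then 0 else φ i := by
  simp only [act, id_apply]
  split_ifs with h <;> simp [h]

end TYModel

end Model

/-! ### The monoidal structure of the complex model -/

section Model

open scoped Classical

variable {A : Type} [Group A] [Fintype A]
open TYLabel

lemma TYLabel.occ_ne_zero {s t u : TYLabel A} : occ s t u ≠ 0 ↔ Occurs s t u := by simp [occ]

lemma TYLabel.occurs_alive {s t u : TYLabel A} (h : Occurs s t u) :
    s ≠ none ∧ t ≠ none ∧ u ≠ none := by
  rcases s with _ | _ | _ <;> rcases t with _ | _ | _ <;> rcases u with _ | _ | _ <;>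
    simp [Occurs] at h ⊢

lemma TYLabel.tdeg_ne_none {s t u : TYLabel A} : tdeg s t u ≠ none ↔ Occurs s t u := by
  unfold tdeg
  split_ifs with h
  · simp [h, (occurs_alive h).2.2]
  · simp [h]

lemma TYLabel.tdeg_eq {s t u : TYLabel A} (h : Occurs s t u) : tdeg s t u = u := if_pos h

lemma TYLabel.occurs_one_left {s u : TYLabel A} :
    Occurs (some (some 1)) s u ↔ s = u ∧ s ≠ none := by
  rcases s with _ | _ | _ <;> rcases u with _ | _ | _ <;> simp [Occurs, eq_comm]

lemma TYLabel.occurs_one_right {s u : TYLabel A} :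
    Occurs s (some (some 1)) u ↔ s = u ∧ s ≠ none := by
  rcases s with _ | _ | _ <;> rcases u with _ | _ | _ <;> simp [Occurs, eq_comm]

lemma TYLabel.occurs_tdeg_left {s t u r v : TYLabel A} :
    Occurs (tdeg s t u) r v ↔ Occurs s t u ∧ Occurs u r v := by
  by_cases h : Occurs s t u
  · simp [tdeg_eq h, h]
  · simp only [tdeg, h, if_false, false_and, iff_false]
    exact fun h => (occurs_alive h).1 rfl

lemma TYLabel.occurs_tdeg_right {s t u r v : TYLabel A} :
    Occurs r (tdeg s t u) v ↔ Occurs s t u ∧ Occurs r u v := by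
  by_cases h : Occurs s t u
  · simp [tdeg_eq h, h]
  · simp only [tdeg, h, if_false, false_and, iff_false]
    exact fun h => (occurs_alive h).2.1 rfl

lemma TYLabel.tdeg_eq_none {s t u : TYLabel A} : tdeg s t u = none ↔ ¬ Occurs s t u := by
  rw [← tdeg_ne_none, not_not]

/-- Absorption of the fusion rule into the associator coefficients. -/
lemma TYLabel.occ_mul_tyF (d : TYDatum A) (i j k v u w : TYLabel A) :
    occ i j u * (tyF d i j k v u w : ℂ) = tyF d i j k v u w := by
  by_cases h : tyF d i j k v u w = 0
  · simp [h]
  · simp [occ, (occurs_of_tyF_ne_zero d h).1.1]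

lemma TYLabel.occ_tdeg_mul_tyF (d : TYDatum A) (i j k v u w : TYLabel A) :
    occ (tdeg i j u) k v * (tyF d i j k v u w : ℂ) = tyF d i j k v u w := by
  by_cases h : tyF d i j k v u w = 0
  · simp [h]
  · have := occurs_of_tyF_ne_zero d h
    simp [occ, tdeg_eq this.1.1, this.1.2]

lemma TYLabel.tyF_mul_occ (d : TYDatum A) (i j k v u w : TYLabel A) :
    (tyF d i j k v u w : ℂ) * occ j k w = tyF d i j k v u w := by
  by_cases h : tyF d i j k v u w = 0
  · simp [h]
  · simp [occ, (occurs_of_tyF_ne_zero d h).2.1]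

lemma TYLabel.tyF_mul_occ_tdeg (d : TYDatum A) (i j k v u w : TYLabel A) :
    (tyF d i j k v u w : ℂ) * occ i (tdeg j k w) v = tyF d i j k v u w := by
  by_cases h : tyF d i j k v u w = 0
  · simp [h]
  · have := occurs_of_tyF_ne_zero d h
    simp [occ, tdeg_eq this.2.1, this.2.2]

namespace TYModel

variable {d : TYDatum A}

/-- The tensor product of objects. -/
def tens (X Y : TYModel d) : TYModel d := TYCode.tensor X Y
/-- The one-point object with a given label. -/
def point (d : TYDatum A) (l : TYLabel A) : TYModel d := TYCode.pt l

/-- A simple point of an object with one index. -/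
def pointIdx {l : TYLabel A} : (point d l).idx := ()
instance {l : TYLabel A} : Unique (point d l).idx := inferInstanceAs (Unique Unit)

/-- Indices of a tensor product. -/
def tidx {X Y : TYModel d} (i : X.idx) (j : Y.idx) (u : TYLabel A) : (tens X Y).idx := (i, j, u)

variable {X Y Z W X' Y' Z' : TYModel d}

lemma sum_tens (f : (tens X Y).idx → ℂ) : ∑ x, f x = ∑ i, ∑ j, ∑ u, f (tidx i j u) := by
  refine (Fintype.sum_prod_type (fun x : X.idx × Y.idx × TYLabel A => f x)).trans ?_
  exact Finset.sum_congr rfl fun i _ => Fintype.sum_prod_type _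

lemma deg_tidx (i : X.idx) (j : Y.idx) (u) :
    (tens X Y).deg (tidx i j u) = tdeg (X.deg i) (Y.deg j) u := rfl

lemma deg_point {l : TYLabel A} (i) : (point d l).deg i = l := rfl

/-- The tensor product of morphisms. -/
noncomputable def tensHom (f : X ⟶ X') (g : Y ⟶ Y') : tens X Y ⟶ tens X' Y' :=
  ⟨fun x y => if x.2.2 = y.2.2 then
      occ (X.deg x.1) (Y.deg x.2.1) x.2.2 * (f.1 x.1 y.1 * g.1 x.2.1 y.2.1) else 0, by
    rintro ⟨i, j, u⟩ ⟨i', j', u'⟩ h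
    by_contra hne
    obtain ⟨h1, h2⟩ := ite_ne_right_iff.mp hne
    simp only at h1 h2
    subst h1
    have h3 := occ_ne_zero.mp (left_ne_zero_of_mul h2)
    have h4 := homs_deg f (left_ne_zero_of_mul (right_ne_zero_of_mul h2))
    have h5 := homs_deg g (right_ne_zero_of_mul (right_ne_zero_of_mul h2))
    apply h
    change tdeg (X.deg i) (Y.deg j) u = tdeg (X'.deg i') (Y'.deg j') u ∧ tdeg _ _ u ≠ none
    rw [← h4.1, ← h5.1]
    exact ⟨rfl, tdeg_ne_none.mpr h3⟩⟩

lemma tensHom_apply (f : X ⟶ X') (g : Y ⟶ Y') (i j u i' j' u') :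
    (tensHom f g).1 (tidx i j u) (tidx i' j' u') = if u = u' then
      occ (X.deg i) (Y.deg j) u * (f.1 i i' * g.1 j j') else 0 := rfl

lemma act_tensHom (f : X ⟶ X') (g : Y ⟶ Y') (φ) (i j u) :
    actHom (tensHom f g) φ (tidx i j u) = occ (X.deg i) (Y.deg j) u *
      actHom f (fun i' => actHom g (fun j' => φ (tidx i' j' u)) j) i := by
  simp only [act, sum_tens, tensHom_apply, ite_mul, zero_mul, Finset.sum_ite_eq, Finset.mem_univ,
    if_true, Finset.mul_sum, mul_assoc]

/-- Morphisms to a sum of three indices given by coefficients. -/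
noncomputable def assocHom : tens (tens X Y) Z ⟶ tens X (tens Y Z) :=
  ⟨fun x y => if x.1.1 = y.1 ∧ x.1.2.1 = y.2.1.1 ∧ x.2.1 = y.2.1.2.1 ∧ x.2.2 = y.2.2 then
      tyF d (X.deg x.1.1) (Y.deg x.1.2.1) (Z.deg x.2.1) x.2.2 x.1.2.2 y.2.1.2.2 else 0, by
    rintro ⟨⟨i, j, u⟩, k, v⟩ ⟨i', ⟨j', k', w⟩, v'⟩ h
    by_contra hne
    obtain ⟨⟨h1, h2, h3, h4⟩, h5⟩ := ite_ne_right_iff.mp hne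
    simp only at h1 h2 h3 h4 h5
    subst h1 h2 h3 h4
    have h6 := occurs_of_tyF_ne_zero d (Complex.ofReal_ne_zero.mp h5)
    apply h
    change tdeg (tdeg (X.deg i) (Y.deg j) u) (Z.deg k) v =
      tdeg (X.deg i) (tdeg (Y.deg j) (Z.deg k) w) v ∧
        tdeg (tdeg (X.deg i) (Y.deg j) u) (Z.deg k) v ≠ none
    rw [tdeg_eq h6.1.1, tdeg_eq h6.2.1, tdeg_eq h6.1.2, tdeg_eq h6.2.2]
    exact ⟨rfl, (occurs_alive h6.1.2).2.2⟩⟩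

lemma assocHom_apply (i j u k v i' j' k' w v') :
    (assocHom (X := X) (Y := Y) (Z := Z)).1 (tidx (tidx i j u) k v) (tidx i' (tidx j' k' w) v') =
      if i = i' ∧ j = j' ∧ k = k' ∧ v = v' then
        (tyF d (X.deg i) (Y.deg j) (Z.deg k) v u w : ℂ) else 0 := rfl

lemma act_assocHom (φ) (i j u k v) :
    actHom (assocHom (X := X) (Y := Y) (Z := Z)) φ (tidx (tidx i j u) k v) =
      ∑ w, (tyF d (X.deg i) (Y.deg j) (Z.deg k) v u w : ℂ) * φ (tidx i (tidx j k w) v) := by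
  simp only [act, sum_tens, assocHom_apply, ite_and, ite_mul, zero_mul]
  simp

/-- The inverse associator. -/
noncomputable def assocInv : tens X (tens Y Z) ⟶ tens (tens X Y) Z :=
  ⟨fun y x => if y.1 = x.1.1 ∧ y.2.1.1 = x.1.2.1 ∧ y.2.1.2.1 = x.2.1 ∧ y.2.2 = x.2.2 then
      tyG d (X.deg y.1) (Y.deg y.2.1.1) (Z.deg y.2.1.2.1) y.2.2 y.2.1.2.2 x.1.2.2 else 0, by
    rintro ⟨i', ⟨j', k', w⟩, v'⟩ ⟨⟨i, j, u⟩, k, v⟩ h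
    by_contra hne
    obtain ⟨⟨h1, h2, h3, h4⟩, h5⟩ := ite_ne_right_iff.mp hne
    simp only at h1 h2 h3 h4 h5
    subst h1 h2 h3 h4
    have h6 := occurs_of_tyF_ne_zero d (tyG_eq_zero_of_tyF d (Complex.ofReal_ne_zero.mp h5))
    apply h
    change tdeg (X.deg i') (tdeg (Y.deg j') (Z.deg k') w) v' =
      tdeg (tdeg (X.deg i') (Y.deg j') u) (Z.deg k') v' ∧
        tdeg (X.deg i') (tdeg (Y.deg j') (Z.deg k') w) v' ≠ none
    rw [tdeg_eq h6.1.1, tdeg_eq h6.2.1, tdeg_eq h6.1.2, tdeg_eq h6.2.2]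
    exact ⟨rfl, (occurs_alive h6.1.2).2.2⟩⟩

lemma assocInv_apply (i j u k v i' j' k' w v') :
    (assocInv (X := X) (Y := Y) (Z := Z)).1 (tidx i' (tidx j' k' w) v') (tidx (tidx i j u) k v) =
      if i' = i ∧ j' = j ∧ k' = k ∧ v' = v then
        (tyG d (X.deg i') (Y.deg j') (Z.deg k') v' w u : ℂ) else 0 := rfl

lemma act_assocInv (φ) (i j w k v) :
    actHom (assocInv (X := X) (Y := Y) (Z := Z)) φ (tidx i (tidx j k w) v) =
      ∑ u, (tyG d (X.deg i) (Y.deg j) (Z.deg k) v w u : ℂ) * φ (tidx (tidx i j u) k v) := by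
  simp only [act, sum_tens, assocInv_apply, ite_and, ite_mul, zero_mul]
  simp

lemma exists_tidx (x : (tens X Y).idx) : ∃ i j u, x = tidx i j u := ⟨_, _, _, rfl⟩

/-- The associator. -/
noncomputable def assocIso : tens (tens X Y) Z ≅ tens X (tens Y Z) where
  hom := assocHom
  inv := assocInv
  hom_inv_id := act_hom_ext fun φ x => by
    obtain ⟨x, k, v, rfl⟩ := exists_tidx x
    obtain ⟨i, j, u, rfl⟩ := exists_tidx x
    rw [act_comp, act_assocHom, act_id]
    simp only [act_assocInv, Finset.mul_sum, ← mul_assoc]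
    rw [Finset.sum_comm]
    simp only [← Finset.sum_mul, ← Complex.ofReal_mul, ← Complex.ofReal_sum, tyF_mul_tyG]
    simp only [deg_tidx, tdeg_eq_none, occurs_tdeg_left]
    by_cases h' : Occurs (X.deg i) (Y.deg j) u ∧ Occurs u (Z.deg k) v
    · rw [Finset.sum_eq_single u (fun x _ hx => by simp [hx.symm]) (by simp)]
      simp [h']
    · rw [if_pos h']
      refine Finset.sum_eq_zero fun u' _ => ?_
      rw [if_neg fun h => h' h.2]
      simp
  inv_hom_id := act_hom_ext fun φ x => by
    obtain ⟨i, x, v, rfl⟩ := exists_tidx x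
    obtain ⟨j, k, w, rfl⟩ := exists_tidx x
    rw [act_comp, act_assocInv, act_id]
    simp only [act_assocHom, Finset.mul_sum, ← mul_assoc]
    rw [Finset.sum_comm]
    simp only [← Finset.sum_mul, ← Complex.ofReal_mul, ← Complex.ofReal_sum, tyG_mul_tyF]
    simp only [deg_tidx, tdeg_eq_none, occurs_tdeg_right]
    by_cases h' : Occurs (Y.deg j) (Z.deg k) w ∧ Occurs (X.deg i) w v
    · rw [Finset.sum_eq_single w (fun x _ hx => by simp [hx.symm]) (by simp)]
      simp [h']
    · rw [if_pos h']
      refine Finset.sum_eq_zero fun u' _ => ?_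
      rw [if_neg fun h => h' h.2]
      simp

/-- The left unitor. -/
noncomputable def lunit : tens (point d (inv 1)) X ⟶ X :=
  ⟨fun x i => if x.2.1 = i ∧ x.2.2 = X.deg i ∧ X.deg i ≠ none then 1 else 0, by
    rintro ⟨_, i, u⟩ j h
    refine if_neg fun h' => h ?_
    obtain ⟨h1, h2, h3⟩ := h'
    simp only at h1 h2
    subst h1 h2
    change tdeg (inv 1) (X.deg i) (X.deg i) = _ ∧ tdeg (inv 1) (X.deg i) (X.deg i) ≠ none
    rw [tdeg_eq (occurs_one_left.mpr ⟨rfl, h3⟩)]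
    exact ⟨rfl, h3⟩⟩

lemma act_lunit (φ) (e i u) : actHom (lunit (X := X)) φ (tidx e i u) =
    occ (inv 1) (X.deg i) u * φ i := by
  change (∑ j, (if i = j ∧ u = X.deg j ∧ X.deg j ≠ none then 1 else 0) * φ j) = _
  simp only [ite_and, ite_mul, zero_mul, Finset.sum_ite_eq, Finset.mem_univ, if_true, one_mul, occ,
    occurs_one_left]
  by_cases h : u = X.deg i
  · subst h; simp
  · simp [h, Ne.symm h]

/-- The inverse of the left unitor. -/
noncomputable def lunitInv : X ⟶ tens (point d (inv 1)) X :=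
  ⟨fun i x => if i = x.2.1 ∧ x.2.2 = X.deg i ∧ X.deg i ≠ none then 1 else 0, by
    rintro j ⟨_, i, u⟩ h
    refine if_neg fun h' => h ?_
    obtain ⟨h1, h2, h3⟩ := h'
    simp only at h1 h2
    subst h1 h2
    change _ = tdeg (inv 1) (X.deg j) (X.deg j) ∧ _
    rw [tdeg_eq (occurs_one_left.mpr ⟨rfl, h3⟩)]
    exact ⟨rfl, h3⟩⟩

lemma act_lunitInv (φ) (i) : actHom (lunitInv (X := X)) φ i =
    if X.deg i = none then 0 else φ (tidx pointIdx i (X.deg i)) := by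
  rw [actHom, act, sum_tens, Fintype.sum_unique]
  change (∑ j, ∑ u, (if i = j ∧ u = X.deg i ∧ X.deg i ≠ none then (1 : ℂ) else 0) * _) = _
  by_cases h : X.deg i = none
  · simp [h]
  · simp only [ite_and, ite_mul, zero_mul, one_mul, h]
    simp [h]
    rfl

/-- The right unitor. -/
noncomputable def runit : tens X (point d (inv 1)) ⟶ X :=
  ⟨fun x i => if x.1 = i ∧ x.2.2 = X.deg i ∧ X.deg i ≠ none then 1 else 0, by
    rintro ⟨i, _, u⟩ j h
    refine if_neg fun h' => h ?_
    obtain ⟨h1, h2, h3⟩ := h'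
    simp only at h1 h2
    subst h1 h2
    change tdeg (X.deg i) (inv 1) (X.deg i) = _ ∧ tdeg (X.deg i) (inv 1) (X.deg i) ≠ none
    rw [tdeg_eq (occurs_one_right.mpr ⟨rfl, h3⟩)]
    exact ⟨rfl, h3⟩⟩

lemma act_runit (φ) (e i u) : actHom (runit (X := X)) φ (tidx i e u) =
    occ (X.deg i) (inv 1) u * φ i := by
  change (∑ j, (if i = j ∧ u = X.deg j ∧ X.deg j ≠ none then 1 else 0) * φ j) = _
  simp only [ite_and, ite_mul, zero_mul, Finset.sum_ite_eq, Finset.mem_univ, if_true, one_mul, occ,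
    occurs_one_right]
  by_cases h : u = X.deg i
  · subst h; simp
  · simp [h, Ne.symm h]

/-- The inverse of the right unitor. -/
noncomputable def runitInv : X ⟶ tens X (point d (inv 1)) :=
  ⟨fun i x => if i = x.1 ∧ x.2.2 = X.deg i ∧ X.deg i ≠ none then 1 else 0, by
    rintro j ⟨i, _, u⟩ h
    refine if_neg fun h' => h ?_
    obtain ⟨h1, h2, h3⟩ := h'
    simp only at h1 h2
    subst h1 h2
    change _ = tdeg (X.deg j) (inv 1) (X.deg j) ∧ _
    rw [tdeg_eq (occurs_one_right.mpr ⟨rfl, h3⟩)]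
    exact ⟨rfl, h3⟩⟩

lemma act_runitInv (φ) (i) : actHom (runitInv (X := X)) φ i =
    if X.deg i = none then 0 else φ (tidx i pointIdx (X.deg i)) := by
  rw [actHom, act, sum_tens]
  simp only [Fintype.sum_unique]
  change (∑ j, ∑ u, (if i = j ∧ u = X.deg i ∧ X.deg i ≠ none then (1 : ℂ) else 0) * _) = _
  by_cases h : X.deg i = none
  · simp [h]
  · simp only [ite_and, ite_mul, zero_mul, one_mul, h]
    simp [h]
    rfl

lemma act_alive (f : X ⟶ Y) (φ) (i) (h : X.deg i = none) : actHom f φ i = 0 :=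
  Finset.sum_eq_zero fun j _ => by
    rw [f.2 i j fun h' => h'.2 h, zero_mul]

/-- A row only sees columns with its own label, so that label may be substituted inside the summand.
This is the mechanism behind the naturality proofs. -/
lemma act_congr (f : X ⟶ Y) {φ ψ : Y.idx → ℂ} (i)
    (h : ∀ j, Y.deg j = X.deg i → X.deg i ≠ none → φ j = ψ j) : actHom f φ i = actHom f ψ i :=
  Finset.sum_congr rfl fun j _ => by
    by_cases h' : f.1 i j = 0
    · simp [h']
    · have := homs_deg f h'
      rw [h j this.1.symm this.2]

lemma act_sum_mul (f : X ⟶ Y) {ι : Type*} (s : Finset ι) (c : ι → ℂ) (φ : ι → Y.idx → ℂ) (i) :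
    actHom f (fun j => ∑ w ∈ s, c w * φ w j) i = ∑ w ∈ s, c w * actHom f (φ w) i := by
  simp only [act, Finset.mul_sum]
  rw [Finset.sum_comm]
  exact Finset.sum_congr rfl fun w _ => Finset.sum_congr rfl fun j _ => by ring

lemma act_const_mul (f : X ⟶ Y) (c : ℂ) (φ : Y.idx → ℂ) (i) :
    actHom f (fun j => c * φ j) i = c * actHom f φ i := by
  simp only [act, Finset.mul_sum]
  exact Finset.sum_congr rfl fun j _ => by ring

lemma act_act_comm (f : X ⟶ X') (g : Y ⟶ Y') (φ : X'.idx → Y'.idx → ℂ) (i j) :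
    actHom f (fun i' => actHom g (fun j' => φ i' j') j) i =
      actHom g (fun j' => actHom f (fun i' => φ i' j') i) j := by
  simp only [act, Finset.mul_sum]
  rw [Finset.sum_comm]
  exact Finset.sum_congr rfl fun w _ => Finset.sum_congr rfl fun j _ => by ring

lemma occ_mul_ite_left (s t u : TYLabel A) (x : ℂ) :
    occ s t u * (if s = none then 0 else x) = occ s t u * x := by
  by_cases h : Occurs s t u
  · rw [if_neg (occurs_alive h).1]
  · simp [occ, h]

lemma occ_mul_ite_right (s t u : TYLabel A) (x : ℂ) :
    occ s t u * (if t = none then 0 else x) = occ s t u * x := by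
  by_cases h : Occurs s t u
  · rw [if_neg (occurs_alive h).2.1]
  · simp [occ, h]

lemma act_tensHom_id_left (g : Y ⟶ Y') (φ) (i j u) :
    actHom (tensHom (𝟙 X) g) φ (tidx i j u) = occ (X.deg i) (Y.deg j) u *
      actHom g (fun j' => φ (tidx i j' u)) j := by
  rw [act_tensHom, act_id, occ_mul_ite_left]

lemma act_tensHom_id_right (f : X ⟶ X') (φ) (i j u) :
    actHom (tensHom f (𝟙 Y)) φ (tidx i j u) = occ (X.deg i) (Y.deg j) u *
      actHom f (fun i' => φ (tidx i' j u)) i := by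
  rw [act_tensHom, act_act_comm, act_id, occ_mul_ite_right]

noncomputable instance : MonoidalCategoryStruct (TYModel d) where
  tensorObj := tens
  whiskerLeft X _ _ f := tensHom (𝟙 X) f
  whiskerRight f Y := tensHom f (𝟙 Y)
  tensorHom := tensHom
  tensorUnit := point d (inv 1)
  associator X Y Z := assocIso
  leftUnitor X :=
    { hom := lunit
      inv := lunitInv
      hom_inv_id := act_hom_ext fun φ x => by
        obtain ⟨e, i, u, rfl⟩ := exists_tidx x
        rw [act_comp, act_lunit, act_lunitInv, act_id]
        simp only [deg_tidx, tdeg_eq_none, deg_point]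
        by_cases h : Occurs (inv 1) (X.deg i) u
        · obtain ⟨rfl, h2⟩ := occurs_one_left.mp h
          rw [occ, if_pos h, if_neg h2, if_neg (not_not.mpr h), one_mul, Subsingleton.elim e pointIdx]
        · simp [occ, h]
      inv_hom_id := act_hom_ext fun φ i => by
        rw [act_comp, act_lunitInv, act_lunit, act_id]
        by_cases h : X.deg i = none
        · simp [h]
        · simp [h, occ, occurs_one_left] }
  rightUnitor X :=
    { hom := runit
      inv := runitInv
      hom_inv_id := act_hom_ext fun φ x => by
        obtain ⟨i, e, u, rfl⟩ := exists_tidx x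
        rw [act_comp, act_runit, act_runitInv, act_id]
        simp only [deg_tidx, tdeg_eq_none, deg_point]
        by_cases h : Occurs (X.deg i) (inv 1) u
        · obtain ⟨rfl, h2⟩ := occurs_one_right.mp h
          rw [occ, if_pos h, if_neg h2, if_neg (not_not.mpr h), one_mul, Subsingleton.elim e pointIdx]
        · simp [occ, h]
      inv_hom_id := act_hom_ext fun φ i => by
        rw [act_comp, act_runitInv, act_runit, act_id]
        by_cases h : X.deg i = none
        · simp [h]
        · simp [h, occ, occurs_one_right] }

/-- With the unit in the middle every coefficient is `0` or `1`; the block `m, 1, m` uses `χ(1,·) =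
1`. -/
lemma tyF_triangle (d : TYDatum A) (i k u v w : TYLabel A) :
    (tyF d i (inv 1) k v u w : ℂ) * occ (inv 1) k w =
      if u = i ∧ w = k ∧ Occurs i k v then 1 else 0 := by
  rcases i with _ | _ | a <;> rcases k with _ | _ | c <;> rcases u with _ | _ | x <;>
    rcases v with _ | _ | z <;> rcases w with _ | _ | y <;>
    simp [tyF, occ, Occurs, Pi.single_apply, d.χ_one_left] <;>
    split_ifs <;> simp_all

/-- The numerical pentagon in the form in which it acts on vectors: indicators and truncated degrees
disappear because the neighbouring coefficients vanish wherever these differ from the plain labels.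
-/
lemma tyF_pentagon_sum (d : TYDatum A) (i j k l u v t : TYLabel A) (φ : TYLabel A → TYLabel A → ℂ) :
    occ (tdeg (tdeg i j u) k v) l t * ∑ w, (tyF d i j k v u w : ℂ) *
      ∑ y, (tyF d i (tdeg j k w) l t v y : ℂ) * (occ i (tdeg (tdeg j k w) l y) t *
        ∑ x, (tyF d j k l y w x : ℂ) * φ x y) =
    ∑ x, (tyF d (tdeg i j u) k l t v x : ℂ) * ∑ y, (tyF d i j (tdeg k l x) t u y : ℂ) * φ x y := by
  have e1 (w y x) : occ (tdeg (tdeg i j u) k v) l t * ((tyF d i j k v u w : ℂ) *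
      ((tyF d i (tdeg j k w) l t v y : ℂ) * (occ i (tdeg (tdeg j k w) l y) t *
        ((tyF d j k l y w x : ℂ) * φ x y)))) =
      ((tyF d i j k v u w * (tyF d i w l t v y * tyF d j k l y w x) : ℝ) : ℂ) * φ x y := by
    by_cases h1 : tyF d i j k v u w = 0
    · simp [h1]
    have o1 := occurs_of_tyF_ne_zero d h1
    rw [tdeg_eq o1.1.1, tdeg_eq o1.1.2, tdeg_eq o1.2.1]
    by_cases h2 : tyF d i w l t v y = 0
    · simp [h2]
    have o2 := occurs_of_tyF_ne_zero d h2
    rw [tdeg_eq o2.2.1, occ, occ, if_pos o2.1.2, if_pos o2.2.2]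
    push_cast
    ring
  have e2 (y x) : (tyF d (tdeg i j u) k l t v x : ℂ) *
      ((tyF d i j (tdeg k l x) t u y : ℂ) * φ x y) =
      ((tyF d u k l t v x * tyF d i j x t u y : ℝ) : ℂ) * φ x y := by
    by_cases h : Occurs i j u ∧ Occurs k l x
    · rw [tdeg_eq h.1, tdeg_eq h.2]
      push_cast
      ring
    · trans 0
      · by_cases h1 : tyF d (tdeg i j u) k l t v x = 0
        · simp [h1]
        by_cases h2 : tyF d i j (tdeg k l x) t u y = 0
        · simp [h2]
        have o1 := occurs_of_tyF_ne_zero d h1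
        have o2 := occurs_of_tyF_ne_zero d h2
        exact absurd ⟨o2.1.1, o1.2.1⟩ h
      · symm
        by_cases h1 : tyF d u k l t v x = 0
        · simp [h1]
        by_cases h2 : tyF d i j x t u y = 0
        · simp [h2]
        have o1 := occurs_of_tyF_ne_zero d h1
        have o2 := occurs_of_tyF_ne_zero d h2
        exact absurd ⟨o2.1.1, o1.2.1⟩ h
  simp only [Finset.mul_sum, e1, e2]
  rw [Finset.sum_congr rfl fun w _ => Finset.sum_comm, Finset.sum_comm]
  refine Finset.sum_congr rfl fun x _ => ?_
  rw [Finset.sum_comm]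
  refine Finset.sum_congr rfl fun y _ => ?_
  rw [← tyF_pentagon, ← Finset.sum_mul, ← Complex.ofReal_sum]

lemma deg_tensorObj_tidx (i : X.idx) (j : Y.idx) (u) :
    (X ⊗ Y).deg (tidx i j u) = tdeg (X.deg i) (Y.deg j) u := rfl

lemma deg_tensorUnit (e : (𝟙_ (TYModel d)).idx) : (𝟙_ (TYModel d)).deg e = inv 1 := rfl

lemma pentagon_assocHom : tensHom (assocHom (X := X) (Y := Y) (Z := Z)) (𝟙 W) ≫
    assocHom ≫ tensHom (𝟙 X) assocHom = assocHom ≫ assocHom := act_hom_ext fun φ x => by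
  obtain ⟨x, l, t, rfl⟩ := exists_tidx x
  obtain ⟨x, k, v, rfl⟩ := exists_tidx x
  obtain ⟨i, j, u, rfl⟩ := exists_tidx x
  have key := tyF_pentagon_sum d (X.deg i) (Y.deg j) (Z.deg k) (W.deg l) u v t
    fun x y => φ (tidx i (tidx j (tidx k l x) y) t)
  rw [act_comp, act_tensHom_id_right, act_comp (assocHom (X := tens X Y)), act_assocHom,
    act_assocHom]
  simp only [act_assocHom, act_comp, act_tensHom_id_left, deg_tidx]
  exact key

lemma triangle_assocHom : assocHom ≫ tensHom (𝟙 X) (lunit (X := Y)) = tensHom (runit (X := X)) (𝟙 Y) :=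
    act_hom_ext fun φ x => by
  obtain ⟨x, k, v, rfl⟩ := exists_tidx x
  obtain ⟨i, e, u, rfl⟩ := exists_tidx x
  refine (act_comp _ _ _ _).trans ((act_assocHom _ _ _ _ _ _).trans ?_)
  refine Eq.trans ?_ (act_tensHom_id_right _ _ _ _ _).symm
  refine Eq.trans ?_ (congrArg _ (act_runit _ _ _ _).symm)
  have e1 (w) : (tyF d (X.deg i) (inv 1) (Y.deg k) v u w : ℂ) *
      actHom (tensHom (𝟙 X) (lunit (X := Y))) φ (tidx i (tidx e k w) v) =
      if u = X.deg i ∧ w = Y.deg k ∧ Occurs (X.deg i) (Y.deg k) v then φ (tidx i k v) else 0 := by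
    rw [act_tensHom_id_left, act_lunit, ← mul_assoc]
    refine (congrArg (· * _) (tyF_mul_occ_tdeg d _ _ _ _ _ _)).trans ?_
    rw [← mul_assoc, tyF_triangle]
    simp
  refine (Finset.sum_congr rfl fun w _ => e1 w).trans ?_
  change _ = occ (tdeg (X.deg i) (inv 1) u) (Y.deg k) v * (occ (X.deg i) (inv 1) u * φ (tidx i k v))
  rw [Finset.sum_eq_single (Y.deg k) (fun w _ hw => by simp [hw]) (by simp)]
  by_cases h : Occurs (X.deg i) (inv 1) u
  · obtain ⟨rfl, h2⟩ := occurs_one_right.mp h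
    simp [occ, h, tdeg_eq h]
  · rw [occ, occ, if_neg h, if_neg]
    · simp
    · rintro ⟨rfl, -, h3⟩
      exact h (occurs_one_right.mpr ⟨rfl, (occurs_alive h3).1⟩)

noncomputable instance : MonoidalCategory (TYModel d) := MonoidalCategory.ofTensorHom
  (id_tensorHom_id := fun X Y => act_hom_ext fun φ x => by
    obtain ⟨i, j, u, rfl⟩ := exists_tidx x
    refine (act_tensHom_id_left _ _ _ _ _).trans ?_
    rw [act_id, occ_mul_ite_right]
    refine Eq.trans ?_ (act_id _ _).symm
    simp only [deg_tensorObj_tidx, tdeg_eq_none]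
    simp [occ])
  (id_tensorHom := fun _ {_ _} _ => rfl)
  (tensorHom_id := fun {_ _} _ _ => rfl)
  (tensorHom_comp_tensorHom := fun f₁ f₂ g₁ g₂ => act_hom_ext fun φ x => by
    obtain ⟨i, j, u, rfl⟩ := exists_tidx x
    refine (act_comp _ _ _ _).trans ((act_tensHom _ _ _ _ _ _).trans ?_)
    refine Eq.trans ?_ (act_tensHom _ _ _ _ _ _).symm
    by_cases ho : Occurs (TYModel.deg _ i) (TYModel.deg _ j) u
    swap
    · simp [occ, ho]
    congr 1
    rw [act_comp]
    refine act_congr f₁ i fun i' hi _ => ?_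
    simp only [act_comp]
    rw [act_act_comm g₁ f₂]
    refine act_congr f₂ j fun j' hj _ => ?_
    refine (act_tensHom _ _ _ _ _ _).trans ?_
    rw [hi, hj, occ, if_pos ho, one_mul])
  (associator_naturality := fun {X₁ X₂ X₃ Y₁ Y₂ Y₃} f g h => act_hom_ext fun φ x => by
    obtain ⟨x, k, v, rfl⟩ := exists_tidx x
    obtain ⟨i, j, u, rfl⟩ := exists_tidx x
    refine (act_comp _ _ _ _).trans ((act_tensHom _ _ _ _ _ _).trans ?_)
    refine Eq.trans ?_ ((act_comp _ _ _ _).trans (act_assocHom _ _ _ _ _ _)).symm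
    refine (congrArg _ (act_tensHom _ _ _ _ _ _)).trans ?_
    have e1 : actHom f (fun i' => actHom g (fun j' => actHom h (fun k' =>
        actHom (assocHom (X := Y₁) (Y := Y₂) (Z := Y₃)) φ (tidx (tidx i' j' u) k' v)) k) j) i =
        ∑ w, (tyF d (X₁.deg i) (X₂.deg j) (X₃.deg k) v u w : ℂ) *
          actHom f (fun i' => actHom g (fun j' => actHom h (fun k' =>
            φ (tidx i' (tidx j' k' w) v)) k) j) i := by
      rw [← act_sum_mul]
      refine act_congr f i fun i' hi _ => ?_
      rw [← act_sum_mul]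
      refine act_congr g j fun j' hj _ => ?_
      rw [← act_sum_mul]
      refine act_congr h k fun k' hk _ => ?_
      rw [act_assocHom, hi, hj, hk]
    refine (congrArg (fun z => _ * (_ * z)) e1).trans ?_
    rw [Finset.mul_sum, Finset.mul_sum]
    refine Finset.sum_congr rfl fun w _ => ?_
    have e2 : actHom (tensHom f (tensHom g h)) φ (tidx i (tidx j k w) v) =
        occ (X₁.deg i) (tdeg (X₂.deg j) (X₃.deg k) w) v * (occ (X₂.deg j) (X₃.deg k) w *
          actHom f (fun i' => actHom g (fun j' => actHom h (fun k' =>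
            φ (tidx i' (tidx j' k' w) v)) k) j) i) := by
      rw [act_tensHom]
      simp only [act_tensHom, act_const_mul]
      rfl
    refine Eq.trans ?_ (congrArg _ e2).symm
    generalize actHom f _ i = T
    -- The two tensor products introduce different fusion-rule indicators on the two sides; the
    -- coefficient absorbs all four.
    have a1 := occ_mul_tyF d (X₁.deg i) (X₂.deg j) (X₃.deg k) v u w
    have a2 := occ_tdeg_mul_tyF d (X₁.deg i) (X₂.deg j) (X₃.deg k) v u w
    have a3 := tyF_mul_occ d (X₁.deg i) (X₂.deg j) (X₃.deg k) v u w
    have a4 := tyF_mul_occ_tdeg d (X₁.deg i) (X₂.deg j) (X₃.deg k) v u w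
    change occ (tdeg (X₁.deg i) (X₂.deg j) u) (X₃.deg k) v * _ = _
    calc _ = occ (tdeg (X₁.deg i) (X₂.deg j) u) (X₃.deg k) v *
          (occ (X₁.deg i) (X₂.deg j) u * (tyF d (X₁.deg i) (X₂.deg j) (X₃.deg k) v u w : ℂ)) * T := by ring
      _ = ((tyF d (X₁.deg i) (X₂.deg j) (X₃.deg k) v u w : ℂ) *
          occ (X₁.deg i) (tdeg (X₂.deg j) (X₃.deg k) w) v) * occ (X₂.deg j) (X₃.deg k) w * T := by
            rw [a1, a2, a4, a3]
      _ = _ := by ring)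
  (leftUnitor_naturality := fun {X Y} f => act_hom_ext fun φ x => by
    obtain ⟨e, i, u, rfl⟩ := exists_tidx x
    refine (act_comp _ _ _ _).trans ((act_tensHom_id_left _ _ _ _ _).trans ?_)
    refine Eq.trans ?_ ((act_comp _ _ _ _).trans (act_lunit _ _ _ _)).symm
    by_cases ho : Occurs (inv 1) (X.deg i) u
    swap
    · simp [occ, ho, deg_tensorUnit]
    congr 1
    refine act_congr f i fun j hj _ => (act_lunit _ _ _ _).trans ?_
    rw [hj, occ, if_pos ho, one_mul])
  (rightUnitor_naturality := fun {X Y} f => act_hom_ext fun φ x => by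
    obtain ⟨i, e, u, rfl⟩ := exists_tidx x
    refine (act_comp _ _ _ _).trans ((act_tensHom_id_right _ _ _ _ _).trans ?_)
    refine Eq.trans ?_ ((act_comp _ _ _ _).trans (act_runit _ _ _ _)).symm
    by_cases ho : Occurs (X.deg i) (inv 1) u
    swap
    · simp [occ, ho, deg_tensorUnit]
    congr 1
    refine act_congr f i fun j hj _ => (act_runit _ _ _ _).trans ?_
    rw [hj, occ, if_pos ho, one_mul])
  (pentagon := fun _ _ _ _ => pentagon_assocHom)
  (triangle := fun _ _ => triangle_assocHom)

lemma tensHom_def (f : X ⟶ X') (g : Y ⟶ Y') : f ⊗ₘ g = tensHom f g := rfl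

lemma tens_hom_ext {V : TYModel d} {f g : tens X Y ⟶ V}
    (h : ∀ i j u k, f.1 (tidx i j u) k = g.1 (tidx i j u) k) : f = g :=
  hom_ext fun x k => h x.1 x.2.1 x.2.2 k

lemma tensHom_add_right (f : X ⟶ X') (g g' : Y ⟶ Y') :
    tensHom f (g + g') = tensHom f g + tensHom f g' :=
  hom_ext fun x y => by
    obtain ⟨i, j, u, rfl⟩ := exists_tidx x
    obtain ⟨i', j', u', rfl⟩ := exists_tidx y
    simp only [tensHom_apply, add_apply]
    split_ifs <;> ring

lemma tensHom_add_left (f f' : X ⟶ X') (g : Y ⟶ Y') :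
    tensHom (f + f') g = tensHom f g + tensHom f' g :=
  hom_ext fun x y => by
    obtain ⟨i, j, u, rfl⟩ := exists_tidx x
    obtain ⟨i', j', u', rfl⟩ := exists_tidx y
    simp only [tensHom_apply, add_apply]
    split_ifs <;> ring

lemma tensHom_smul_right (c : ℂ) (f : X ⟶ X') (g : Y ⟶ Y') :
    tensHom f (c • g) = c • tensHom f g :=
  hom_ext fun x y => by
    obtain ⟨i, j, u, rfl⟩ := exists_tidx x
    obtain ⟨i', j', u', rfl⟩ := exists_tidx y
    simp only [tensHom_apply, smul_apply]
    split_ifs <;> ring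

lemma tensHom_smul_left (c : ℂ) (f : X ⟶ X') (g : Y ⟶ Y') :
    tensHom (c • f) g = c • tensHom f g :=
  hom_ext fun x y => by
    obtain ⟨i, j, u, rfl⟩ := exists_tidx x
    obtain ⟨i', j', u', rfl⟩ := exists_tidx y
    simp only [tensHom_apply, smul_apply]
    split_ifs <;> ring

lemma tensHom_zero_right (f : X ⟶ X') : tensHom f (0 : Y ⟶ Y') = 0 := by
  simpa using tensHom_smul_right 0 f (0 : Y ⟶ Y')

lemma tensHom_zero_left (g : Y ⟶ Y') : tensHom (0 : X ⟶ X') g = 0 := by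
  simpa using tensHom_smul_left 0 (0 : X ⟶ X') g

noncomputable instance : MonoidalPreadditive (TYModel d) where
  whiskerLeft_zero {X _ _} := tensHom_zero_right (𝟙 X)
  zero_whiskerRight {X _ _} := tensHom_zero_left (𝟙 X)
  whiskerLeft_add {X _ _} f g := tensHom_add_right (𝟙 X) f g
  add_whiskerRight {X _ _} f g := tensHom_add_left f g (𝟙 X)

noncomputable instance : MonoidalLinear ℂ (TYModel d) where
  whiskerLeft_smul X _ _ c f := tensHom_smul_right c (𝟙 X) f
  smul_whiskerRight c _ _ f X := tensHom_smul_left c f (𝟙 X)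

end TYModel

end Model

/-! ### Von Neumann regular categories, simple decompositions and duals of sums -/

section Regular

open Limits

variable {C : Type u} [Category.{v} C] [Preadditive C]

/-- In a preadditive category in which every morphism has a generalized inverse, kernels of
morphisms are obtained by splitting idempotents. -/
lemma hasKernel_of_regular [IsIdempotentComplete C] {X Y : C} (f : X ⟶ Y) {g : Y ⟶ X}
    (h : f ≫ g ≫ f = f) : HasKernel f := by
  obtain ⟨K, i, e, hie, hei⟩ := IsIdempotentComplete.idempotents_split X (𝟙 X - f ≫ g)
    (by have := congrArg (· ≫ g) h; simp only [Category.assoc] at this; simp [this])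
  have hi : i = i ≫ (𝟙 X - f ≫ g) := by rw [← hei, ← Category.assoc, hie, Category.id_comp]
  have hif : i ≫ f = 0 := by
    rw [hi]; simp [h]
  exact ⟨⟨KernelFork.ofι i hif, KernelFork.IsLimit.ofι i hif (fun k _ => k ≫ e)
    (fun k hk => by simp [hei, reassoc_of% hk])
    (fun k _ m hm => by rw [← hm, Category.assoc, hie, Category.comp_id])⟩⟩

/-- Dually to kernels, the cokernel is a splitting of the idempotent `𝟙 Y - g ≫ f`. -/
lemma hasCokernel_of_regular [IsIdempotentComplete C] {X Y : C} (f : X ⟶ Y) {g : Y ⟶ X}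
    (h : f ≫ g ≫ f = f) : HasCokernel f := by
  obtain ⟨K, i, e, hie, hei⟩ := IsIdempotentComplete.idempotents_split Y (𝟙 Y - g ≫ f)
    (by simp [h])
  have hi : e = (𝟙 Y - g ≫ f) ≫ e := by rw [← hei, Category.assoc, hie, Category.comp_id]
  have hif : f ≫ e = 0 := by
    rw [hi, ← Category.assoc]; simp [h]
  exact ⟨⟨CokernelCofork.ofπ e hif, CokernelCofork.IsColimit.ofπ e hif (fun k _ => i ≫ k)
    (fun k hk => by rw [← Category.assoc, hei]; simp [hk])
    (fun k _ m hm => by rw [← hm, ← Category.assoc, hie, Category.id_comp])⟩⟩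

/-- A von Neumann regular idempotent complete additive category is abelian. -/
@[reducible]
noncomputable def abelianOfRegular [HasFiniteBiproducts C] [IsIdempotentComplete C]
    (h : ∀ {X Y : C} (f : X ⟶ Y), ∃ g : Y ⟶ X, f ≫ g ≫ f = f) : Abelian C where
  normalMonoOfMono {X Y} f _ := ⟨by
    have hf := (h f).choose_spec
    have hfg : f ≫ (h f).choose = 𝟙 X := by
      rw [← cancel_mono f, Category.assoc, hf, Category.id_comp]
    exact
    { Z := Y
      g := 𝟙 Y - (h f).choose ≫ f
      w := by simp [hf]
      isLimit := KernelFork.IsLimit.ofι _ _ (fun k _ => k ≫ (h f).choose)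
        (fun k hk => by
          rw [Preadditive.comp_sub, Category.comp_id, sub_eq_zero] at hk
          rw [Category.assoc, ← hk])
        (fun k _ m hm => by rw [← hm, Category.assoc, hfg, Category.comp_id]) }⟩
  normalEpiOfEpi {X Y} f _ := ⟨by
    have hf := (h f).choose_spec
    have hfg : (h f).choose ≫ f = 𝟙 Y := by
      rw [← cancel_epi f, hf, Category.comp_id]
    exact
    { W := X
      g := 𝟙 X - f ≫ (h f).choose
      w := by simp [hf]
      isColimit := CokernelCofork.IsColimit.ofπ _ _ (fun k _ => (h f).choose ≫ k)
        (fun k hk => by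
          rw [Preadditive.sub_comp, Category.id_comp, sub_eq_zero] at hk
          rw [← Category.assoc, ← hk])
        (fun k _ m hm => by rw [← hm, ← Category.assoc, hfg, Category.id_comp]) }⟩
  has_finite_products := ⟨fun _ => inferInstance⟩
  has_kernels := ⟨fun f => let ⟨_, hg⟩ := h f; hasKernel_of_regular f hg⟩
  has_cokernels := ⟨fun f => let ⟨_, hg⟩ := h f; hasCokernel_of_regular f hg⟩

/-- In a regular category, a nonzero object whose only idempotents are trivial is simple. -/
lemma simple_of_regular (h : ∀ {X Y : C} (f : X ⟶ Y), ∃ g : Y ⟶ X, f ≫ g ≫ f = f) {X : C}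
    (hX : 𝟙 X ≠ 0) (he : ∀ e : X ⟶ X, e ≫ e = e → e = 0 ∨ e = 𝟙 X) : Simple X where
  mono_isIso_iff_nonzero {Y} f _ := by
    obtain ⟨g, hg⟩ := h f
    have hfg : f ≫ g = 𝟙 Y := by rw [← cancel_mono f, Category.assoc, hg, Category.id_comp]
    constructor
    · rintro ⟨k, -, hk⟩ rfl
      exact hX (by rw [← hk, comp_zero])
    · intro hf
      refine ⟨g, hfg, (he (g ≫ f) (by simp [hg])).resolve_left fun h0 => hf ?_⟩
      rw [← hg, h0, comp_zero]

/-- In a regular idempotent complete linear category with finite dimensional morphism spaces,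
objects decompose into simple objects. -/
lemma exists_simple_decomposition {𝕜 : Type w} [Field 𝕜] [Linear 𝕜 C] [IsIdempotentComplete C]
    [∀ X Y : C, FiniteDimensional 𝕜 (X ⟶ Y)]
    (h : ∀ {X Y : C} (f : X ⟶ Y), ∃ g : Y ⟶ X, f ≫ g ≫ f = f) (X : C) :
    ∃ (J : Type) (_ : Fintype J) (S : J → C) (ι : ∀ j, S j ⟶ X) (π : ∀ j, X ⟶ S j),
      (∀ j, Simple (S j)) ∧ (∀ j, ι j ≫ π j = 𝟙 _) ∧ (∀ j k, j ≠ k → ι j ≫ π k = 0) ∧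
        ∑ j, π j ≫ ι j = 𝟙 X := by
  classical
  induction hn : Module.finrank 𝕜 (X ⟶ X) using Nat.strong_induction_on generalizing X with
  | _ n ih =>
  subst hn
  by_cases h0 : 𝟙 X = 0
  · exact ⟨Empty, inferInstance, Empty.elim, fun j => j.elim, fun j => j.elim, fun j => j.elim,
      fun j => j.elim, fun j => j.elim, by simp [h0]⟩
  by_cases he : ∀ e : X ⟶ X, e ≫ e = e → e = 0 ∨ e = 𝟙 X
  · refine ⟨Unit, inferInstance, fun _ => X, fun _ => 𝟙 X, fun _ => 𝟙 X,
      fun _ => simple_of_regular h h0 he, by simp, fun j k hjk => absurd rfl hjk, by simp⟩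
  push Not at he
  obtain ⟨e, hee, he0, he1⟩ := he
  -- The image of a proper idempotent has strictly fewer endomorphisms: they embed as the corner cut
  -- out by `e`, and this corner does not contain `𝟙 X - e`. This drives the induction for both `e`
  -- and its complement.
  have key (e : X ⟶ X) (hee : e ≫ e = e) (he1 : e ≠ 𝟙 X) : ∃ (Y : C) (i : Y ⟶ X) (p : X ⟶ Y),
      i ≫ p = 𝟙 Y ∧ p ≫ i = e ∧ Module.finrank 𝕜 (Y ⟶ Y) < Module.finrank 𝕜 (X ⟶ X) := by
    obtain ⟨Y, i, p, hip, hpi⟩ := IsIdempotentComplete.idempotents_split X e hee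
    refine ⟨Y, i, p, hip, hpi, ?_⟩
    let L : (Y ⟶ Y) →ₗ[𝕜] (X ⟶ X) :=
      { toFun := fun f => p ≫ f ≫ i
        map_add' := by simp
        map_smul' := by simp }
    have hL (f : Y ⟶ Y) : L f = p ≫ f ≫ i := rfl
    have hinj : Function.Injective L := fun f g hfg => by
      have := congrArg (fun z => i ≫ z ≫ p) hfg
      simpa [hL, hip, reassoc_of% hip] using this
    rw [← LinearMap.finrank_range_of_inj hinj]
    refine Submodule.finrank_lt fun htop => ?_
    obtain ⟨f, hf⟩ : 𝟙 X - e ∈ LinearMap.range L := by rw [htop]; trivial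
    have h2 : L f ≫ e = L f := by rw [hL, ← hpi]; simp [reassoc_of% hip]
    rw [hf, Preadditive.sub_comp, hee, Category.id_comp, sub_self] at h2
    exact he1 (sub_eq_zero.mp h2.symm).symm
  obtain ⟨Y, i, p, hip, hpi, hlt⟩ := key e hee he1
  obtain ⟨Y', i', p', hip', hpi', hlt'⟩ := key (𝟙 X - e) (by simp [hee]) (by simpa using he0)
  obtain ⟨J, _, S, ι, π, hS, h1, h2, h3⟩ := ih _ hlt Y rfl
  obtain ⟨J', _, S', ι', π', hS', h1', h2', h3'⟩ := ih _ hlt' Y' rfl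
  have hz : i ≫ p' = 0 := by
    have : i ≫ e ≫ (𝟙 X - e) ≫ p' = i ≫ p' := by
      rw [← hpi', ← hpi]; simp [hip', reassoc_of% hip]
    rw [← this]; simp [reassoc_of% hee]
  have hz' : i' ≫ p = 0 := by
    have : i' ≫ (𝟙 X - e) ≫ e ≫ p = i' ≫ p := by
      rw [← hpi', ← hpi]; simp [hip, reassoc_of% hip']
    rw [← this]; simp [reassoc_of% hee]
  refine ⟨J ⊕ J', inferInstance, Sum.elim S S',
    fun j => match j with
      | .inl j => ι j ≫ i
      | .inr j => ι' j ≫ i',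
    fun j => match j with
      | .inl j => p ≫ π j
      | .inr j => p' ≫ π' j, ?_, ?_, ?_, ?_⟩
  · rintro (j | j)
    exacts [hS j, hS' j]
  · rintro (j | j)
    · simpa [reassoc_of% hip] using h1 j
    · simpa [reassoc_of% hip'] using h1' j
  · rintro (j | j) (k | k) hjk
    · change (ι j ≫ i) ≫ p ≫ π k = 0
      rw [Category.assoc, reassoc_of% hip, h2 j k (by simpa using hjk)]
    · change (ι j ≫ i) ≫ p' ≫ π' k = 0
      rw [Category.assoc, reassoc_of% hz, zero_comp, comp_zero]
    · change (ι' j ≫ i') ≫ p ≫ π k = 0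
      rw [Category.assoc, reassoc_of% hz', zero_comp, comp_zero]
    · change (ι' j ≫ i') ≫ p' ≫ π' k = 0
      rw [Category.assoc, reassoc_of% hip', h2' j k (by simpa using hjk)]
  · rw [Fintype.sum_sum_type]
    have e1 : ∑ j, (p ≫ π j) ≫ ι j ≫ i = p ≫ (∑ j, π j ≫ ι j) ≫ i := by
      simp [Preadditive.sum_comp, Preadditive.comp_sum]
    have e2 : ∑ j, (p' ≫ π' j) ≫ ι' j ≫ i' = p' ≫ (∑ j, π' j ≫ ι' j) ≫ i' := by
      simp [Preadditive.sum_comp, Preadditive.comp_sum]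
    refine (congrArg₂ (· + ·) e1 e2).trans ?_
    simp [h3, h3', hpi, hpi']

/-- Duality is compatible with finite direct sums. -/
lemma nonempty_exactPairing_of_sum [MonoidalCategory C] [MonoidalPreadditive C] {J : Type w}
    [Fintype J] {S S' : J → C} (P : ∀ j, ExactPairing (S j) (S' j)) {X X' : C}
    (ι : ∀ j, S j ⟶ X) (π : ∀ j, X ⟶ S j) (h1 : ∀ j, ι j ≫ π j = 𝟙 _)
    (h2 : ∀ j k, j ≠ k → ι j ≫ π k = 0) (h3 : ∑ j, π j ≫ ι j = 𝟙 X)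
    (ι' : ∀ j, S' j ⟶ X') (π' : ∀ j, X' ⟶ S' j) (h1' : ∀ j, ι' j ≫ π' j = 𝟙 _)
    (h2' : ∀ j k, j ≠ k → ι' j ≫ π' k = 0) (h3' : ∑ j, π' j ≫ ι' j = 𝟙 X') :
    Nonempty (ExactPairing X X') := by
  classical
  refine ⟨⟨∑ j, η_ (S j) (S' j) ≫ (ι j ⊗ₘ ι' j), ∑ j, (π' j ⊗ₘ π j) ≫ ε_ (S j) (S' j), ?_, ?_⟩⟩
  -- In the double sum the inner factor `ι j ≫ π k` kills the off-diagonal terms, and each diagonal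
  -- term is the zigzag of one summand.
  · have key (j k) : X' ◁ (η_ (S j) (S' j) ≫ (ι j ⊗ₘ ι' j)) ≫ (α_ X' X X').inv ≫
        ((π' k ⊗ₘ π k) ≫ ε_ (S k) (S' k)) ▷ X' =
          if j = k then (ρ_ X').hom ≫ (π' j ≫ ι' j) ≫ (λ_ X').inv else 0 := by
      have e1 : X' ◁ (ι j ⊗ₘ ι' j) ≫ (α_ X' X X').inv ≫ (π' k ⊗ₘ π k) ▷ X' =
          (π' k ▷ _) ≫ (α_ _ _ _).inv ≫ (S' k ◁ (ι j ≫ π k)) ▷ _ ≫ _ ◁ ι' j := by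
        simp only [← id_tensorHom, ← tensorHom_id, associator_inv_naturality_assoc,
          tensorHom_comp_tensorHom, Category.id_comp, Category.comp_id]
        rw [← id_tensorHom_id, associator_inv_naturality_assoc]
        simp only [tensorHom_comp_tensorHom, Category.id_comp, Category.comp_id]
      rw [MonoidalCategory.whiskerLeft_comp, comp_whiskerRight, Category.assoc, reassoc_of% e1]
      split_ifs with h
      · subst h
        have e2 := ExactPairing.coevaluation_evaluation (S j) (S' j)
        rw [h1, MonoidalCategory.whiskerLeft_id, id_whiskerRight, Category.id_comp,
          whisker_exchange_assoc, whisker_exchange, reassoc_of% e2, rightUnitor_naturality_assoc,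
          leftUnitor_inv_naturality_assoc]
        simp
      · simp [h2 j k h]
    simp only [whiskerLeft_sum, sum_whiskerRight,
      Preadditive.sum_comp, Preadditive.comp_sum]
    rw [Finset.sum_congr rfl fun k _ => Finset.sum_congr rfl fun j _ => key j k]
    simp only [Finset.sum_ite_eq', Finset.mem_univ, if_true]
    rw [← Preadditive.comp_sum, ← Preadditive.sum_comp, h3', Category.id_comp]
  · have key (j k) : (η_ (S j) (S' j) ≫ (ι j ⊗ₘ ι' j)) ▷ X ≫ (α_ X X' X).hom ≫
        X ◁ ((π' k ⊗ₘ π k) ≫ ε_ (S k) (S' k)) =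
          if j = k then (λ_ X).hom ≫ (π j ≫ ι j) ≫ (ρ_ X).inv else 0 := by
      have e1 : (ι j ⊗ₘ ι' j) ▷ X ≫ (α_ X X' X).hom ≫ X ◁ (π' k ⊗ₘ π k) =
          (_ ◁ π k) ≫ (α_ _ _ _).hom ≫ (_ ◁ ((ι' j ≫ π' k) ▷ S k)) ≫ ι j ▷ _ := by
        simp only [← id_tensorHom, ← tensorHom_id, associator_naturality_assoc,
          tensorHom_comp_tensorHom, Category.id_comp, Category.comp_id]
        rw [← id_tensorHom_id, associator_naturality_assoc]
        simp only [tensorHom_comp_tensorHom, Category.id_comp, Category.comp_id]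
      rw [MonoidalCategory.whiskerLeft_comp, comp_whiskerRight, Category.assoc, reassoc_of% e1]
      split_ifs with h
      · subst h
        have e2 := ExactPairing.evaluation_coevaluation (S j) (S' j)
        rw [h1', id_whiskerRight, MonoidalCategory.whiskerLeft_id, Category.id_comp,
          ← whisker_exchange_assoc, ← whisker_exchange, reassoc_of% e2,
          leftUnitor_naturality_assoc, rightUnitor_inv_naturality_assoc]
        simp
      · simp [h2' j k h]
    simp only [whiskerLeft_sum, sum_whiskerRight,
      Preadditive.sum_comp, Preadditive.comp_sum]
    rw [Finset.sum_congr rfl fun k _ => Finset.sum_congr rfl fun j _ => key j k]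
    simp only [Finset.sum_ite_eq', Finset.mem_univ, if_true]
    rw [← Preadditive.comp_sum, ← Preadditive.sum_comp, h3, Category.id_comp]

end Regular

/-! ### Twisted Galois descent from complex to real categories -/

/-- A complex conjugation on the morphisms of a complex linear monoidal category together with a
monoidal sign automorphism of its identity functor. -/
class ConjTwist (E : Type u) [Category.{v} E] [Preadditive E] [Linear ℂ E]
    [MonoidalCategory E] where
  conj {X Y : E} : (X ⟶ Y) → (X ⟶ Y)
  conj_conj {X Y : E} (f : X ⟶ Y) : conj (conj f) = f
  conj_add {X Y : E} (f g : X ⟶ Y) : conj (f + g) = conj f + conj g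
  conj_smul {X Y : E} (c : ℂ) (f : X ⟶ Y) : conj (c • f) = star c • conj f
  conj_comp {X Y Z : E} (f : X ⟶ Y) (g : Y ⟶ Z) : conj (f ≫ g) = conj f ≫ conj g
  conj_id (X : E) : conj (𝟙 X) = 𝟙 X
  conj_tensor {X Y X' Y' : E} (f : X ⟶ Y) (g : X' ⟶ Y') : conj (f ⊗ₘ g) = conj f ⊗ₘ conj g
  conj_associator (X Y Z : E) : conj (α_ X Y Z).hom = (α_ X Y Z).hom
  conj_leftUnitor (X : E) : conj (λ_ X).hom = (λ_ X).hom
  conj_rightUnitor (X : E) : conj (ρ_ X).hom = (ρ_ X).hom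
  sgn (X : E) : X ⟶ X
  conj_sgn (X : E) : conj (sgn X) = sgn X
  sgn_comp_sgn (X : E) : sgn X ≫ sgn X = 𝟙 X
  sgn_naturality {X Y : E} (f : X ⟶ Y) : sgn X ≫ f = f ≫ sgn Y
  sgn_tensor (X Y : E) : sgn (X ⊗ Y) = sgn X ⊗ₘ sgn Y
  sgn_unit : sgn (𝟙_ E) = 𝟙 _

open ConjTwist

/-- An object with an antilinear structure squaring to the sign automorphism. -/
structure Twisted (E : Type u) [Category.{v} E] [Preadditive E] [Linear ℂ E] [MonoidalCategory E]
    [ConjTwist E] where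
  X : E
  J : X ⟶ X
  J_conj : J ≫ conj J = sgn X

namespace Twisted

variable {E : Type u} [Category.{v} E] [Preadditive E] [Linear ℂ E] [MonoidalCategory E]
  [ConjTwist E]

lemma conj_real_smul {X Y : E} (r : ℝ) (f : X ⟶ Y) : conj (r • f) = r • conj f := by
  rw [← Complex.coe_smul, conj_smul, ← Complex.coe_smul]
  simp

lemma real_smul_comp {X Y Z : E} (r : ℝ) (f : X ⟶ Y) (g : Y ⟶ Z) : (r • f) ≫ g = r • (f ≫ g) := by
  rw [← Complex.coe_smul, ← Complex.coe_smul, Linear.smul_comp]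

lemma comp_real_smul {X Y Z : E} (r : ℝ) (f : X ⟶ Y) (g : Y ⟶ Z) : f ≫ (r • g) = r • (f ≫ g) := by
  rw [← Complex.coe_smul, ← Complex.coe_smul, Linear.comp_smul]

lemma conj_zero {X Y : E} : conj (0 : X ⟶ Y) = 0 := by
  simpa using conj_real_smul 0 (0 : X ⟶ Y)

/-- The real space of morphisms compatible with the antilinear structures. -/
def homs (A B : Twisted E) : Submodule ℝ (A.X ⟶ B.X) where
  carrier := {f | A.J ≫ conj f = f ≫ B.J}
  add_mem' {f g} hf hg := by
    change _ ≫ conj (f + g) = _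
    rw [conj_add, Preadditive.comp_add, Preadditive.add_comp, hf, hg]
  zero_mem' := by
    change _ ≫ conj 0 = _
    simp [conj_zero]
  smul_mem' r f hf := by
    change _ ≫ conj (r • f) = _
    rw [conj_real_smul, comp_real_smul, real_smul_comp, hf]

instance : Category (Twisted E) where
  Hom A B := homs A B
  id A := ⟨𝟙 A.X, by change _ ≫ conj _ = _; simp [conj_id]⟩
  comp {A B C} f g := ⟨f.1 ≫ g.1, by
    change _ ≫ conj _ = _
    have hf : A.J ≫ conj f.1 = f.1 ≫ B.J := f.2
    have hg : B.J ≫ conj g.1 = g.1 ≫ C.J := g.2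
    rw [conj_comp, reassoc_of% hf, hg, Category.assoc]⟩
  id_comp f := Subtype.ext (Category.id_comp _)
  comp_id f := Subtype.ext (Category.comp_id _)
  assoc f g h := Subtype.ext (Category.assoc _ _ _)

variable {A B C D : Twisted E}

lemma hom_comm (f : A ⟶ B) : A.J ≫ conj f.1 = f.1 ≫ B.J := f.2
lemma hom_ext {f g : A ⟶ B} (h : f.1 = g.1) : f = g := Subtype.ext h
@[simp] lemma comp_val (f : A ⟶ B) (g : B ⟶ C) : (f ≫ g).1 = f.1 ≫ g.1 := rfl
@[simp] lemma id_val : (𝟙 A : A ⟶ A).1 = 𝟙 A.X := rfl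

instance : AddCommGroup (A ⟶ B) := inferInstanceAs (AddCommGroup (homs A B))
instance : Module ℝ (A ⟶ B) := inferInstanceAs (Module ℝ (homs A B))

@[simp] lemma add_val (f g : A ⟶ B) : (f + g).1 = f.1 + g.1 := rfl
@[simp] lemma zero_val : (0 : A ⟶ B).1 = 0 := rfl
@[simp] lemma smul_val (r : ℝ) (f : A ⟶ B) : (r • f).1 = r • f.1 := rfl

instance : Preadditive (Twisted E) where
  homGroup _ _ := inferInstance
  add_comp _ _ _ _ _ _ := hom_ext (Preadditive.add_comp _ _ _ _ _ _)
  comp_add _ _ _ _ _ _ := hom_ext (Preadditive.comp_add _ _ _ _ _ _)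

instance : Linear ℝ (Twisted E) where
  homModule _ _ := inferInstance
  smul_comp _ _ _ _ _ _ := hom_ext (real_smul_comp _ _ _)
  comp_smul _ _ _ _ _ _ := hom_ext (comp_real_smul _ _ _)

@[simp] lemma sum_val {ι : Type*} (s : Finset ι) (f : ι → (A ⟶ B)) :
    (∑ i ∈ s, f i).1 = ∑ i ∈ s, (f i).1 :=
  map_sum (homs A B).subtype f s

lemma finiteDimensional_hom [FiniteDimensional ℂ (A.X ⟶ B.X)] : FiniteDimensional ℝ (A ⟶ B) :=
  letI : FiniteDimensional ℝ (A.X ⟶ B.X) := FiniteDimensional.complexToReal _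
  inferInstanceAs (FiniteDimensional ℝ (homs A B))

/-- An isomorphism of underlying objects compatible with the antilinear structures. -/
@[simps]
def mkIso (e : A.X ≅ B.X) (h : A.J ≫ conj e.hom = e.hom ≫ B.J) : A ≅ B where
  hom := ⟨e.hom, h⟩
  inv := ⟨e.inv, by
    change _ ≫ conj _ = _
    rw [← cancel_epi e.hom, ← reassoc_of% h, ← conj_comp]
    simp [conj_id]⟩
  hom_inv_id := hom_ext e.hom_inv_id
  inv_hom_id := hom_ext e.inv_hom_id

lemma conj_J_comp (A : Twisted E) : conj A.J ≫ A.J = sgn A.X := by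
  rw [← conj_sgn, ← A.J_conj, conj_comp, conj_conj]

lemma tensorHom_comm (f : A ⟶ B) (g : C ⟶ D) :
    (A.J ⊗ₘ C.J) ≫ conj (f.1 ⊗ₘ g.1) = (f.1 ⊗ₘ g.1) ≫ (B.J ⊗ₘ D.J) := by
  rw [conj_tensor, tensorHom_comp_tensorHom, tensorHom_comp_tensorHom, hom_comm, hom_comm]

lemma whiskerLeft_comm (A : Twisted E) (f : B ⟶ C) :
    (A.J ⊗ₘ B.J) ≫ conj (A.X ◁ f.1) = (A.X ◁ f.1) ≫ (A.J ⊗ₘ C.J) := by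
  have := tensorHom_comm (𝟙 A) f
  rwa [id_val, id_tensorHom] at this

lemma whiskerRight_comm (f : A ⟶ B) (C : Twisted E) :
    (A.J ⊗ₘ C.J) ≫ conj (f.1 ▷ C.X) = (f.1 ▷ C.X) ≫ (B.J ⊗ₘ C.J) := by
  have := tensorHom_comm f (𝟙 C)
  rwa [id_val, tensorHom_id] at this

lemma associator_comm (A B C : Twisted E) :
    ((A.J ⊗ₘ B.J) ⊗ₘ C.J) ≫ conj (α_ A.X B.X C.X).hom =
      (α_ A.X B.X C.X).hom ≫ (A.J ⊗ₘ (B.J ⊗ₘ C.J)) := by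
  rw [conj_associator, associator_naturality]

lemma leftUnitor_comm (A : Twisted E) :
    (𝟙 (𝟙_ E) ⊗ₘ A.J) ≫ conj (λ_ A.X).hom = (λ_ A.X).hom ≫ A.J := by
  rw [conj_leftUnitor, id_tensorHom, leftUnitor_naturality]

lemma rightUnitor_comm (A : Twisted E) :
    (A.J ⊗ₘ 𝟙 (𝟙_ E)) ≫ conj (ρ_ A.X).hom = (ρ_ A.X).hom ≫ A.J := by
  rw [conj_rightUnitor, tensorHom_id, rightUnitor_naturality]

/-- The tensor product of twisted objects. -/
@[simps]
def tens (A B : Twisted E) : Twisted E := ⟨A.X ⊗ B.X, A.J ⊗ₘ B.J, by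
  rw [conj_tensor, tensorHom_comp_tensorHom, A.J_conj, B.J_conj, sgn_tensor]⟩

/-- The twisted unit object. -/
@[simps]
def one : Twisted E := ⟨𝟙_ E, 𝟙 _, by rw [conj_id, Category.comp_id, sgn_unit]⟩

instance : MonoidalCategoryStruct (Twisted E) where
  tensorObj := tens
  tensorUnit := one
  tensorHom f g := ⟨f.1 ⊗ₘ g.1, tensorHom_comm f g⟩
  whiskerLeft A _ _ f := ⟨A.X ◁ f.1, whiskerLeft_comm A f⟩
  whiskerRight f C := ⟨f.1 ▷ C.X, whiskerRight_comm f C⟩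
  associator A B C := mkIso (A := tens (tens A B) C) (B := tens A (tens B C)) (α_ A.X B.X C.X)
    (associator_comm A B C)
  leftUnitor A := mkIso (A := tens one A) (λ_ A.X) (leftUnitor_comm A)
  rightUnitor A := mkIso (A := tens A one) (ρ_ A.X) (rightUnitor_comm A)

instance : MonoidalCategory (Twisted E) where
  tensorHom_def f g := hom_ext (MonoidalCategory.tensorHom_def _ _)
  id_tensorHom_id A B := hom_ext (id_tensorHom_id _ _)
  tensorHom_comp_tensorHom _ _ _ _ := hom_ext (tensorHom_comp_tensorHom _ _ _ _)
  whiskerLeft_id A B := hom_ext (MonoidalCategory.whiskerLeft_id _ _)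
  id_whiskerRight A B := hom_ext (id_whiskerRight _ _)
  associator_naturality _ _ _ := hom_ext (associator_naturality _ _ _)
  leftUnitor_naturality _ := hom_ext (leftUnitor_naturality _)
  rightUnitor_naturality _ := hom_ext (rightUnitor_naturality _)
  pentagon _ _ _ _ := hom_ext (pentagon _ _ _ _)
  triangle _ _ := hom_ext (triangle _ _)

section

variable [MonoidalPreadditive E]

instance : MonoidalPreadditive (Twisted E) where
  whiskerLeft_zero := hom_ext MonoidalPreadditive.whiskerLeft_zero
  zero_whiskerRight := hom_ext MonoidalPreadditive.zero_whiskerRight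
  whiskerLeft_add _ _ := hom_ext (MonoidalPreadditive.whiskerLeft_add _ _)
  add_whiskerRight _ _ := hom_ext (MonoidalPreadditive.add_whiskerRight _ _)

instance [MonoidalLinear ℂ E] : MonoidalLinear ℝ (Twisted E) where
  whiskerLeft_smul A B C r f := hom_ext (by
    change A.X ◁ (r • f.1) = r • (A.X ◁ f.1)
    rw [← Complex.coe_smul, ← Complex.coe_smul, MonoidalLinear.whiskerLeft_smul])
  smul_whiskerRight r A B f C := hom_ext (by
    change (r • f.1) ▷ C.X = r • (f.1 ▷ C.X)
    rw [← Complex.coe_smul, ← Complex.coe_smul, MonoidalLinear.smul_whiskerRight])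

end

/-- The antilinear involution on morphisms whose fixed points are the compatible morphisms. -/
def bar (A B : Twisted E) (f : A.X ⟶ B.X) : A.X ⟶ B.X := A.J ≫ conj f ≫ conj B.J ≫ sgn B.X

lemma bar_eq_iff {f : A.X ⟶ B.X} : bar A B f = f ↔ A.J ≫ conj f = f ≫ B.J := by
  unfold bar
  constructor
  · intro h
    conv_rhs => rw [← h]
    simp only [Category.assoc, sgn_naturality B.J]
    rw [reassoc_of% conj_J_comp, sgn_comp_sgn, Category.comp_id]
  · intro h
    rw [reassoc_of% h, reassoc_of% B.J_conj, sgn_comp_sgn, Category.comp_id]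

lemma bar_bar (f : A.X ⟶ B.X) : bar A B (bar A B f) = f := by
  unfold bar
  simp only [conj_comp, conj_conj, conj_sgn, Category.assoc, reassoc_of% A.J_conj]
  rw [reassoc_of% (sgn_naturality (conj B.J)), sgn_comp_sgn, Category.comp_id, B.J_conj, ← sgn_naturality f,
    reassoc_of% sgn_comp_sgn]

lemma bar_add (f g : A.X ⟶ B.X) : bar A B (f + g) = bar A B f + bar A B g := by
  simp [bar, conj_add]

lemma bar_smul (c : ℂ) (f : A.X ⟶ B.X) : bar A B (c • f) = star c • bar A B f := by
  simp [bar, conj_smul]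

/-- `bar` is an antilinear involution with the compatible morphisms as fixed points. So `f + bar f`
is compatible, and if it vanishes then `I • f` is. -/
lemma exists_hom_ne_zero {f : A.X ⟶ B.X} (hf : f ≠ 0) : ∃ g : A ⟶ B, g ≠ 0 := by
  by_cases h : f + bar A B f = 0
  · refine ⟨⟨Complex.I • f, bar_eq_iff.mp ?_⟩, fun h0 => ?_⟩
    · rw [bar_smul, ← neg_eq_of_add_eq_zero_right h]
      simp
    · have := congrArg Subtype.val h0
      exact hf ((smul_eq_zero.mp this).resolve_left Complex.I_ne_zero)
  · refine ⟨⟨f + bar A B f, bar_eq_iff.mp ?_⟩, fun h0 => h (congrArg Subtype.val h0)⟩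
    rw [bar_add, bar_bar, add_comm]

/-- If `g` is a generalized inverse of a compatible morphism, so is `bar g`, and their average is
both compatible and a generalized inverse. -/
lemma exists_regular (h : ∀ {X Y : E} (f : X ⟶ Y), ∃ g : Y ⟶ X, f ≫ g ≫ f = f) (f : A ⟶ B) :
    ∃ g : B ⟶ A, f ≫ g ≫ f = f := by
  obtain ⟨g, hg⟩ := h f.1
  have hf := hom_comm f
  have hb : f.1 ≫ bar B A g ≫ f.1 = f.1 := by
    have : bar A B (f.1 ≫ g ≫ f.1) = f.1 := by rw [hg, bar_eq_iff.mpr hf]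
    refine Eq.trans ?_ this
    unfold bar
    have h2 : conj A.J ≫ f.1 = conj f.1 ≫ conj B.J := by
      rw [← conj_comp, ← hf, conj_comp, conj_conj]
    simp only [conj_comp, Category.assoc]
    rw [← reassoc_of% hf, sgn_naturality, reassoc_of% h2]
  refine ⟨⟨(1 / 2 : ℂ) • (g + bar B A g), bar_eq_iff.mp ?_⟩, hom_ext ?_⟩
  · rw [bar_smul, bar_add, bar_bar, add_comm]
    simp
  · change f.1 ≫ ((1 / 2 : ℂ) • (g + bar B A g)) ≫ f.1 = f.1
    rw [Linear.smul_comp, Linear.comp_smul, Preadditive.add_comp, Preadditive.comp_add, hg, hb,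
      ← two_smul ℂ, smul_smul]
    simp

/-- A compatible idempotent commutes with `J` up to conjugation, so compressing `J` to the image as
`i ≫ J ≫ conj e` is again an antilinear structure, for which the splitting maps are compatible. -/
lemma isIdempotentComplete [IsIdempotentComplete E] : IsIdempotentComplete (Twisted E) where
  idempotents_split A p hp := by
    obtain ⟨K, i, e, hie, hei⟩ := IsIdempotentComplete.idempotents_split A.X p.1
      (congrArg Subtype.val hp)
    have hc := hom_comm p
    have h1 : i ≫ p.1 = i := by rw [← hei, reassoc_of% hie]
    have h2 : p.1 ≫ e = e := by rw [← hei, Category.assoc, hie, Category.comp_id]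
    have h3 : conj i ≫ conj e = 𝟙 _ := by rw [← conj_comp, hie, conj_id]
    have h4 : conj e ≫ conj i = conj p.1 := by rw [← conj_comp, hei]
    refine ⟨⟨K, i ≫ A.J ≫ conj e, ?_⟩, ⟨i, ?_⟩, ⟨e, ?_⟩, hom_ext hie, hom_ext hei⟩
    · simp only [conj_comp, conj_conj, Category.assoc]
      rw [reassoc_of% h4, reassoc_of% hc, reassoc_of% h1, reassoc_of% A.J_conj,
        sgn_naturality, reassoc_of% hie]
    · change _ ≫ conj i = i ≫ A.J
      simp only [Category.assoc]
      rw [h4, hc, reassoc_of% h1]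
    · change A.J ≫ conj e = e ≫ i ≫ A.J ≫ conj e
      rw [reassoc_of% hei, ← reassoc_of% hc, ← conj_comp, h2]

-- Real inclusions and projections let the antilinear structures of the summands be added
-- diagonally.
open Limits in
lemma hasFiniteBiproducts (h : ∀ (n : ℕ) (F : Fin n → E), ∃ (P : E) (ι : ∀ k, F k ⟶ P)
    (π : ∀ k, P ⟶ F k), (∀ k, ι k ≫ π k = 𝟙 _) ∧ (∀ j k, j ≠ k → ι j ≫ π k = 0) ∧
      ∑ k, π k ≫ ι k = 𝟙 P ∧ (∀ k, conj (ι k) = ι k) ∧ ∀ k, conj (π k) = π k) :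
    HasFiniteBiproducts (Twisted E) where
  out n := ⟨fun F => by
    classical
    obtain ⟨P, ι, π, h1, h2, h3, h4, h5⟩ := h n fun k => (F k).X
    have key (f : ∀ k, (F k).X ⟶ (F k).X) (g : ∀ k, (F k).X ⟶ (F k).X) :
        (∑ k, π k ≫ f k ≫ ι k) ≫ (∑ k, π k ≫ g k ≫ ι k) = ∑ k, π k ≫ (f k ≫ g k) ≫ ι k := by
      rw [Preadditive.sum_comp]
      refine Finset.sum_congr rfl fun k _ => ?_
      rw [Preadditive.comp_sum, Finset.sum_eq_single k]
      · simp [reassoc_of% h1]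
      · intro j _ hj
        simp [reassoc_of% (h2 k j hj.symm)]
      · simp
    have hι (k) (f : ∀ k, (F k).X ⟶ (F k).X) : ι k ≫ (∑ k, π k ≫ f k ≫ ι k) = f k ≫ ι k := by
      rw [Preadditive.comp_sum, Finset.sum_eq_single k]
      · simp [reassoc_of% h1]
      · intro j _ hj
        simp [reassoc_of% (h2 k j hj.symm)]
      · simp
    have hπ (k) (f : ∀ k, (F k).X ⟶ (F k).X) : (∑ k, π k ≫ f k ≫ ι k) ≫ π k = π k ≫ f k := by
      rw [Preadditive.sum_comp, Finset.sum_eq_single k]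
      · simp [h1]
      · intro j _ hj
        simp [h2 j k hj]
      · simp
    have hcs (f : Fin n → (P ⟶ P)) : conj (∑ k, f k) = ∑ k, conj (f k) :=
      map_sum (⟨⟨conj, conj_zero⟩, conj_add⟩ : (P ⟶ P) →+ (P ⟶ P)) f _
    let T : Twisted E := ⟨P, ∑ k, π k ≫ (F k).J ≫ ι k, by
      rw [hcs]
      simp only [conj_comp, h4, h5]
      rw [key]
      simp only [(F _).J_conj, sgn_naturality, ← Category.assoc]
      rw [← Preadditive.sum_comp, h3, Category.id_comp]⟩
    let b : Bicone F :=
      { pt := T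
        ι := fun k => ⟨ι k, by
          change _ ≫ conj _ = _ ≫ (∑ k, π k ≫ (F k).J ≫ ι k)
          rw [h4, hι]⟩
        π := fun k => ⟨π k, by
          change (∑ k, π k ≫ (F k).J ≫ ι k) ≫ conj _ = _
          rw [h5, hπ]⟩
        ι_π := fun j k => by
          split_ifs with h
          · subst h
            exact hom_ext (h1 _)
          · exact hom_ext (h2 _ _ h) }
    exact hasBiproduct_of_total b (hom_ext ((sum_val _ _).trans h3))⟩

end Twisted

/-- Every linear map of vector spaces has a generalized inverse. -/
lemma LinearMap.exists_generalized_inverse {K V W : Type*} [Field K] [AddCommGroup V] [Module K V]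
    [AddCommGroup W] [Module K W] (f : V →ₗ[K] W) : ∃ g : W →ₗ[K] V, ∀ x, f (g (f x)) = f x := by
  obtain ⟨r, hr⟩ := f.rangeRestrict.exists_rightInverse_of_surjective f.range_rangeRestrict
  obtain ⟨g, hg⟩ := LinearMap.exists_extend r
  refine ⟨g, fun x => ?_⟩
  have h1 : g (f x) = r (f.rangeRestrict x) := LinearMap.congr_fun hg (f.rangeRestrict x)
  have h2 := LinearMap.congr_fun hr (f.rangeRestrict x)
  rw [h1]
  exact congrArg Subtype.val h2

/-! ### Conjugation, parity, regularity and idempotents in the complex model -/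

section Model

open scoped Classical

variable {A : Type} [Group A] [Fintype A]
open TYLabel

/-- The parity of a label. -/
noncomputable def TYLabel.parity (l : TYLabel A) : ℂ := if l = TYLabel.m then -1 else 1

lemma TYLabel.parity_mul_self (l : TYLabel A) : parity l * parity l = 1 := by
  unfold parity; split_ifs <;> norm_num

lemma TYLabel.star_parity (l : TYLabel A) : star (parity l) = parity l := by
  unfold parity; split_ifs <;> simp

/-- The fusion rules are `ℤ/2`-graded with `m` odd. This makes the sign automorphism monoidal. -/
lemma TYLabel.parity_of_occurs {s t u : TYLabel A} (h : Occurs s t u) :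
    parity u = parity s * parity t := by
  rcases s with _ | _ | _ <;> rcases t with _ | _ | _ <;> rcases u with _ | _ | _ <;>
    simp [Occurs, parity] at h ⊢

namespace TYModel

variable {d : TYDatum A} {X Y Z W : TYModel d}

/-- Entrywise complex conjugation. -/
noncomputable def conjHom (f : X ⟶ Y) : X ⟶ Y :=
  ⟨fun i j => star (f.1 i j), fun i j h => by
    change star (f.1 i j) = 0
    rw [f.2 i j h, star_zero]⟩

lemma conjHom_apply (f : X ⟶ Y) (i j) : (conjHom f).1 i j = star (f.1 i j) := rfl

/-- The parity automorphism. -/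
noncomputable def sgnHom (X : TYModel d) : X ⟶ X :=
  ⟨fun i j => if i = j ∧ X.deg i ≠ none then parity (X.deg i) else 0, fun i j h => if_neg fun h' =>
    h (by obtain ⟨rfl, h2⟩ := h'; exact ⟨rfl, h2⟩)⟩

lemma sgnHom_apply (i j) : (sgnHom X).1 i j =
  if i = j ∧ X.deg i ≠ none then parity (X.deg i) else 0 := rfl

lemma act_sgnHom (φ) (i) : actHom (sgnHom X) φ i =
    if X.deg i = none then 0 else parity (X.deg i) * φ i := by
  simp only [act, sgnHom_apply]
  split_ifs with h <;> simp [h]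

lemma star_ite_ofReal (p : Prop) [Decidable p] (r : ℝ) : star (if p then (r : ℂ) else 0) = if p then (r : ℂ) else 0 := by
  split_ifs <;> simp

/-- Conjugation is compatible with the associator because all associator coefficients are real. -/
noncomputable instance : ConjTwist (TYModel d) where
  conj := conjHom
  conj_conj f := hom_ext fun i j => by simp [conjHom_apply]
  conj_add f g := hom_ext fun i j => by simp [conjHom_apply]
  conj_smul c f := hom_ext fun i j => by simp [conjHom_apply]
  conj_comp f g := hom_ext fun i j => by simp [conjHom_apply, comp_apply]
  conj_id X := hom_ext fun i j => by
    rw [conjHom_apply, id_apply]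
    split_ifs <;> simp
  conj_tensor f g := hom_ext fun x y => by
    obtain ⟨i, j, u, rfl⟩ := exists_tidx x
    obtain ⟨i', j', u', rfl⟩ := exists_tidx y
    rw [tensHom_def, tensHom_def, conjHom_apply, tensHom_apply, tensHom_apply, conjHom_apply,
      conjHom_apply]
    unfold occ
    split_ifs <;> simp
  conj_associator X Y Z := hom_ext fun x y => by
    obtain ⟨x, k, v, rfl⟩ := exists_tidx x
    obtain ⟨i, j, u, rfl⟩ := exists_tidx x
    obtain ⟨i', y, v', rfl⟩ := exists_tidx y
    obtain ⟨j', k', w, rfl⟩ := exists_tidx y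
    change star (assocHom.1 _ _) = assocHom.1 _ _
    rw [assocHom_apply]
    exact star_ite_ofReal _ _
  conj_leftUnitor X := hom_ext fun x y => by
    change star (if _ then (1 : ℂ) else 0) = if _ then (1 : ℂ) else 0
    split_ifs <;> simp
  conj_rightUnitor X := hom_ext fun x y => by
    change star (if _ then (1 : ℂ) else 0) = if _ then (1 : ℂ) else 0
    split_ifs <;> simp
  sgn := sgnHom
  conj_sgn X := hom_ext fun i j => by
    rw [conjHom_apply, sgnHom_apply]
    split_ifs
    exacts [star_parity _, star_zero _]
  sgn_comp_sgn X := act_hom_ext fun φ i => by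
    rw [act_comp, act_sgnHom, act_sgnHom, act_id]
    split_ifs
    · rfl
    · rw [← mul_assoc, parity_mul_self, one_mul]
  sgn_naturality {X Y} f := act_hom_ext fun φ i => by
    rw [act_comp, act_comp, act_sgnHom]
    split_ifs with h
    · rw [act_alive _ _ _ h]
    · rw [← act_const_mul]
      exact act_congr f i fun j hj _ => by rw [act_sgnHom, hj, if_neg h]
  sgn_tensor X Y := act_hom_ext fun φ x => by
    obtain ⟨i, j, u, rfl⟩ := exists_tidx x
    refine (act_sgnHom _ _).trans (Eq.trans ?_ (act_tensHom _ _ _ _ _ _).symm)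
    rw [act_sgnHom, act_sgnHom, occ_mul_ite_left, mul_left_comm, occ_mul_ite_right]
    change (if tdeg (X.deg i) (Y.deg j) u = none then 0 else
      parity (tdeg (X.deg i) (Y.deg j) u) * φ (tidx i j u)) = _
    by_cases h : Occurs (X.deg i) (Y.deg j) u
    · rw [if_neg (tdeg_ne_none.mpr h), tdeg_eq h, parity_of_occurs h, occ, if_pos h]
      ring
    · rw [if_pos (tdeg_eq_none.mpr h), occ, if_neg h]
      ring
  sgn_unit := act_hom_ext fun φ i => by
    rw [act_sgnHom, act_id]
    change (if (inv 1 : TYLabel A) = none then 0 else parity (inv 1) * φ i) = _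
    simp [parity, deg_tensorUnit]

instance (X Y : TYModel d) : FiniteDimensional ℂ (X ⟶ Y) :=
  inferInstanceAs (FiniteDimensional ℂ (homs X Y))

/-- A generalized inverse of the underlying matrix may mix labels, but between two copies of `f`
only its label-preserving entries contribute, so the others may be discarded. -/
lemma exists_regular (f : X ⟶ Y) : ∃ g : Y ⟶ X, f ≫ g ≫ f = f := by
  obtain ⟨G, hG⟩ := (Matrix.mulVecLin (Matrix.of f.1)).exists_generalized_inverse
  have hM : Matrix.of f.1 * LinearMap.toMatrix' G * Matrix.of f.1 = Matrix.of f.1 := by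
    apply Matrix.toLin'.injective
    apply LinearMap.ext
    intro x
    rw [Matrix.toLin'_mul, Matrix.toLin'_mul, Matrix.toLin'_toMatrix']
    exact hG x
  let g : Y ⟶ X := ⟨fun j i => if Y.deg j = X.deg i ∧ Y.deg j ≠ none then LinearMap.toMatrix' G j i
    else 0, fun i j h => if_neg h⟩
  refine ⟨g, hom_ext fun i l => ?_⟩
  by_cases hil : X.deg i = Y.deg l ∧ X.deg i ≠ none
  swap
  · rw [f.2 i l hil, (f ≫ g ≫ f).2 i l hil]
  have := congrFun (congrFun hM i) l
  rw [Matrix.mul_assoc] at this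
  simp only [Matrix.mul_apply, Matrix.of_apply] at this
  rw [← this]
  simp only [comp_apply]
  refine Finset.sum_congr rfl fun j _ => ?_
  by_cases hj : f.1 i j = 0
  · simp [hj]
  congr 1
  refine Finset.sum_congr rfl fun k _ => ?_
  by_cases hk : f.1 k l = 0
  · simp [hk]
  have h1 := homs_deg f hj
  have h2 := homs_deg f hk
  congr 1
  exact if_pos ⟨by rw [← h1.1, hil.1, h2.1], by rw [← h1.1]; exact h1.2⟩

/-- The inclusions and projections are blocks of the identity matrix of the sum, hence real. -/
lemma exists_sum (n : ℕ) (F : Fin n → TYModel d) : ∃ (P : TYModel d) (ι : ∀ k, F k ⟶ P)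
    (π : ∀ k, P ⟶ F k), (∀ k, ι k ≫ π k = 𝟙 _) ∧ (∀ j k, j ≠ k → ι j ≫ π k = 0) ∧
      ∑ k, π k ≫ ι k = 𝟙 P ∧ (∀ k, ConjTwist.conj (ι k) = ι k) ∧
        ∀ k, ConjTwist.conj (π k) = π k := by
  let P : TYModel d := TYCode.sum n F
  let ix (k : Fin n) (i : (F k).idx) : P.idx := ⟨k, i⟩
  have hix (k i) : P.deg (ix k i) = (F k).deg i := rfl
  let ι (k) : F k ⟶ P := ⟨fun i x => (𝟙 P : P ⟶ P).1 (ix k i) x, fun i x h =>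
    (𝟙 P : P ⟶ P).2 _ _ h⟩
  let π (k) : P ⟶ F k := ⟨fun x i => (𝟙 P : P ⟶ P).1 x (ix k i), fun x i h =>
    (𝟙 P : P ⟶ P).2 _ _ h⟩
  have hιπ (k l i j) : (ι k ≫ π l).1 i j = (𝟙 P : P ⟶ P).1 (ix k i) (ix l j) := by
    conv_rhs => rw [← Category.id_comp (𝟙 P)]
    rfl
  have hsum (f : P.idx → ℂ) : ∑ x, f x = ∑ k, ∑ i, f (ix k i) :=
    Fintype.sum_sigma (fun x : Σ k, (F k).idx => f x)
  have hsa (f : Fin n → (P ⟶ P)) (x y) : (∑ k, f k).1 x y = ∑ k, (f k).1 x y :=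
    map_sum (⟨⟨fun g => g.1 x y, rfl⟩, fun _ _ => rfl⟩ : (P ⟶ P) →+ ℂ) f _
  have hstar (x y) : star ((𝟙 P : P ⟶ P).1 x y) = (𝟙 P : P ⟶ P).1 x y :=
    congrFun (congrFun (congrArg Subtype.val (ConjTwist.conj_id P)) x) y
  refine ⟨P, ι, π, fun k => hom_ext fun i j => ?_, fun k l hkl => hom_ext fun i j => ?_,
    hom_ext fun x y => ?_, fun k => hom_ext fun i x => hstar _ _, fun k => hom_ext fun i x => hstar _ _⟩
  · rw [hιπ, id_apply, id_apply, hix]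
    have : ix k i = ix k j ↔ i = j :=
      ⟨fun h => eq_of_heq (Sigma.mk.inj h).2, fun h => congrArg _ h⟩
    simp only [this]
  · rw [hιπ, id_apply, if_neg]
    · rfl
    · rintro ⟨h, -⟩
      exact hkl (congrArg Sigma.fst h)
  · rw [hsa]
    conv_rhs => rw [← Category.id_comp (𝟙 P)]
    rw [comp_apply, hsum]
    rfl

/-- Idempotents of the complex model split. -/
instance : IsIdempotentComplete (TYModel d) where
  idempotents_split X p hp := by
    -- The vectors supported on label `s` and fixed by `p`. Bases of all these spaces together index
    -- the image of `p`, and `V none` is zero because morphisms vanish on ignored indices.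
    let V (s : TYLabel A) : Submodule ℂ (X.idx → ℂ) :=
      { carrier := {φ | (∀ i, X.deg i ≠ s → φ i = 0) ∧ ∀ i, actHom p φ i = φ i}
        add_mem' := fun {φ ψ} h1 h2 => ⟨fun i hi => by simp [h1.1 i hi, h2.1 i hi], fun i => by
          rw [Pi.add_apply, ← h1.2 i, ← h2.2 i]
          simp [act, mul_add, Finset.sum_add_distrib]⟩
        zero_mem' := ⟨fun _ _ => rfl, fun i => by simp [act]⟩
        smul_mem' := fun c φ h => ⟨fun i hi => by simp [h.1 i hi], fun i => by
          rw [Pi.smul_apply, smul_eq_mul, ← h.2 i]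
          exact act_const_mul p c φ i⟩ }
    have hV0 (φ) (h : φ ∈ V none) : φ = 0 := funext fun i => by
      by_cases hi : X.deg i = none
      · rw [← h.2 i, act_alive p φ i hi]; rfl
      · exact h.1 i hi
    let b (s) := Module.finBasis ℂ (V s)
    -- Coordinates are extended to the ambient space so that linearity can be used on sums of
    -- columns of `p`, which lie in different `V s`.
    have hc (s) (k : Fin (Module.finrank ℂ (V s))) : ∃ c : (X.idx → ℂ) →ₗ[ℂ] ℂ,
        ∀ v : V s, c v = (b s).repr v k := by
      obtain ⟨c, hc⟩ := LinearMap.exists_extend ((b s).coord k)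
      exact ⟨c, fun v => LinearMap.congr_fun hc v⟩
    choose c hc using hc
    let S := Σ s : TYLabel A, Fin (Module.finrank ℂ (V s))
    have hS (x : S) : x.1 ≠ none := by
      obtain ⟨s, k⟩ := x
      rintro rfl
      exact (b none).ne_zero k (Subtype.ext (hV0 _ (b none k).2))
    let e : S ≃ Fin (Fintype.card S) := Fintype.equivFin S
    let K : TYModel d := TYCode.sum (Fintype.card S) fun k => TYCode.pt (e.symm k).1
    let κ : K.idx ≃ S := (Equiv.sigmaPUnit _ : (Σ _ : Fin (Fintype.card S), Unit) ≃ _).trans e.symm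
    have hκ (k : K.idx) : K.deg k = (κ k).1 := rfl
    let bv (x : S) : X.idx → ℂ := (b x.1 x.2).1
    have hbv (x : S) (i) (h : X.deg i ≠ x.1) : bv x i = 0 := (b x.1 x.2).2.1 i h
    have hbp (x : S) (i) : actHom p (bv x) i = bv x i := (b x.1 x.2).2.2 i
    let vec (j : X.idx) : X.idx → ℂ := fun i => p.1 i j
    have hvec (j) : vec j ∈ V (X.deg j) := ⟨fun i hi => p.2 i j fun h => hi h.1, fun i =>
      congrFun (congrFun (congrArg Subtype.val hp) i) j⟩
    let π : X ⟶ K := ⟨fun i k => bv (κ k) i, fun i k h => by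
      by_contra hne
      refine h ⟨?_, ?_⟩
      · by_contra h1
        exact hne (hbv _ _ h1)
      · intro h1
        refine hne (hbv _ _ ?_)
        rw [h1]
        exact (hS _).symm⟩
    let ι : K ⟶ X := ⟨fun k j => if K.deg k = X.deg j ∧ K.deg k ≠ none then
      c (κ k).1 (κ k).2 (vec j) else 0, fun k j h => if_neg h⟩
    have hι (k j) : ι.1 k j = if (κ k).1 = X.deg j then c (κ k).1 (κ k).2 (vec j) else 0 := by
      change ite _ _ _ = _
      simp only [hκ, hS, ne_eq, not_false_eq_true, and_true]
    refine ⟨K, ι, π, hom_ext fun k k' => ?_, hom_ext fun i j => ?_⟩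
    · rw [comp_apply, id_apply]
      have e1 : ∑ j, ι.1 k j * π.1 j k' = if (κ k).1 = (κ k').1 then
          c (κ k).1 (κ k).2 (bv (κ k')) else 0 := by
        split_ifs with h
        · have : bv (κ k') = ∑ j, bv (κ k') j • vec j := funext fun i => by
            rw [← hbp, Finset.sum_apply]
            exact Finset.sum_congr rfl fun j _ => mul_comm _ _
          rw [this, map_sum]
          refine Finset.sum_congr rfl fun j _ => ?_
          rw [hι, map_smul, smul_eq_mul, mul_comm]
          change bv (κ k') j * _ = _
          split_ifs with h'
          · rfl
          · rw [hbv _ _ fun h2 => h' (h.trans h2.symm)]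
            simp
        · refine Finset.sum_eq_zero fun j _ => ?_
          rw [hι]
          split_ifs with h'
          · change _ * bv (κ k') j = 0
            rw [hbv _ _ fun h2 => h (h'.trans h2), mul_zero]
          · simp
      rw [e1]
      have e2 (x y : S) : (if x.1 = y.1 then c x.1 x.2 (bv y) else 0) = if x = y then 1 else 0 := by
        obtain ⟨s, k⟩ := x
        obtain ⟨t, l⟩ := y
        by_cases h : s = t
        · subst h
          rw [if_pos rfl, hc s k (b s l), Module.Basis.repr_self, Finsupp.single_apply]
          by_cases hkl : l = k
          · subst hkl; rw [if_pos rfl, if_pos rfl]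
          · rw [if_neg hkl, if_neg fun h' : (⟨s, k⟩ : S) = ⟨s, l⟩ =>
              hkl (eq_of_heq (Sigma.mk.inj h').2).symm]
        · rw [if_neg h, if_neg fun h' => h (congrArg Sigma.fst h')]
      rw [e2]
      simp only [κ.injective.eq_iff, hκ, hS, ne_eq, not_false_eq_true, and_true]
    · rw [comp_apply]
      have e1 : ∑ k, π.1 i k * ι.1 k j = ∑ x : S, bv x i * if x.1 = X.deg j then
          c x.1 x.2 (vec j) else 0 := by
        rw [← κ.sum_comp]
        exact Finset.sum_congr rfl fun k _ => by rw [hι]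
      rw [e1, Fintype.sum_sigma, Finset.sum_eq_single (X.deg j)]
      · simp only [if_true]
        have := congrArg (fun v : V (X.deg j) => v.1 i) ((b (X.deg j)).sum_repr ⟨vec j, hvec j⟩)
        refine Eq.trans ?_ this
        simp only [Submodule.coe_sum, Finset.sum_apply, Submodule.coe_smul, Pi.smul_apply, smul_eq_mul]
        exact Finset.sum_congr rfl fun k _ => by rw [hc _ k ⟨vec j, hvec j⟩, mul_comm]
      · intro s _ hs
        simp [hs]
      · simp

end TYModel

end Model

/-! ### Calculus of vertices on objects with a single label -/

section Model

open scoped Classical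

variable {A : Type} [Group A] [Fintype A]
open TYLabel

namespace TYModel

variable {d : TYDatum A} {X Y Z W V U X' Y' Z' : TYModel d} {s t r w o a : TYLabel A}

/-- All indices of an object have a given label. -/
def IsPure (X : TYModel d) (s : TYLabel A) : Prop := ∀ i, X.deg i = s

/-- A matrix as a morphism. -/
noncomputable def pureHom (M : X.idx → Z.idx → ℂ) : X ⟶ Z :=
  ⟨fun i k => if X.deg i = Z.deg k ∧ X.deg i ≠ none then M i k else 0, fun _ _ h => if_neg h⟩

/-- A morphism from a tensor product with given coefficients. -/
noncomputable def vert (c : X.idx → Y.idx → Z.idx → ℂ) : tens X Y ⟶ Z :=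
  ⟨fun x k => if Occurs (X.deg x.1) (Y.deg x.2.1) (Z.deg k) ∧ x.2.2 = Z.deg k then
    c x.1 x.2.1 k else 0, by
    rintro ⟨i, j, u⟩ k h
    refine if_neg fun h' => h ?_
    obtain ⟨h1, h2⟩ := h'
    simp only at h1 h2
    subst h2
    change tdeg (X.deg i) (Y.deg j) _ = _ ∧ tdeg (X.deg i) (Y.deg j) _ ≠ none
    exact ⟨tdeg_eq h1, tdeg_ne_none.mpr h1⟩⟩

/-- A morphism to a tensor product with given coefficients. -/
noncomputable def covert (c : Z.idx → X.idx → Y.idx → ℂ) : Z ⟶ tens X Y :=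
  ⟨fun k x => if Occurs (X.deg x.1) (Y.deg x.2.1) (Z.deg k) ∧ x.2.2 = Z.deg k then
    c k x.1 x.2.1 else 0, by
    rintro k ⟨i, j, u⟩ h
    refine if_neg fun h' => h ?_
    obtain ⟨h1, h2⟩ := h'
    simp only at h1 h2
    subst h2
    change _ = tdeg (X.deg i) (Y.deg j) _ ∧ _
    exact ⟨(tdeg_eq h1).symm, (occurs_alive h1).2.2⟩⟩

lemma act_pureHom (hX : X.IsPure s) (hZ : Z.IsPure s) (hs : s ≠ none) (M : X.idx → Z.idx → ℂ)
    (φ) (i) : actHom (pureHom M) φ i = ∑ k, M i k * φ k := by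
  refine Finset.sum_congr rfl fun k _ => ?_
  congr 1
  exact if_pos ⟨by rw [hX, hZ], by rwa [hX]⟩

lemma act_vert (hX : X.IsPure s) (hY : Y.IsPure t) (hZ : Z.IsPure r) (h : Occurs s t r)
    (c : X.idx → Y.idx → Z.idx → ℂ) (φ) (i j u) :
    actHom (vert c) φ (tidx i j u) = if u = r then ∑ k, c i j k * φ k else 0 := by
  have e (k) : (vert c).1 (tidx i j u) k = if u = r then c i j k else 0 := by
    change (if Occurs (X.deg i) (Y.deg j) (Z.deg k) ∧ u = Z.deg k then c i j k else 0) = _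
    simp only [hX i, hY j, hZ k, h, true_and]
  rw [actHom, act]
  simp only [e, ite_mul, zero_mul]
  split_ifs <;> simp

lemma act_covert (hX : X.IsPure s) (hY : Y.IsPure t) (hZ : Z.IsPure r) (h : Occurs s t r)
    (c : Z.idx → X.idx → Y.idx → ℂ) (φ) (k) :
    actHom (covert c) φ k = ∑ i, ∑ j, c k i j * φ (tidx i j r) := by
  have e (i j u) : (covert c).1 k (tidx i j u) = if u = r then c k i j else 0 := by
    change (if Occurs (X.deg i) (Y.deg j) (Z.deg k) ∧ u = Z.deg k then c k i j else 0) = _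
    simp only [hX i, hY j, hZ k, h, true_and]
  rw [actHom, act, sum_tens]
  simp only [e, ite_mul, zero_mul, Finset.sum_ite_eq', Finset.mem_univ, if_true]

lemma conj_pureHom (M : X.idx → Z.idx → ℂ) :
    ConjTwist.conj (pureHom M) = pureHom (fun i k => star (M i k)) :=
  hom_ext fun i k => by
    change star (if _ then _ else _) = if _ then _ else _
    split_ifs <;> simp

lemma conj_vert (c : X.idx → Y.idx → Z.idx → ℂ) :
    ConjTwist.conj (vert c) = vert (fun i j k => star (c i j k)) :=
  hom_ext fun i k => by
    change star (if _ then _ else _) = if _ then _ else _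
    split_ifs <;> simp

lemma conj_covert (c : Z.idx → X.idx → Y.idx → ℂ) :
    ConjTwist.conj (covert c) = covert (fun i j k => star (c i j k)) :=
  hom_ext fun i k => by
    change star (if _ then _ else _) = if _ then _ else _
    split_ifs <;> simp

lemma id_eq_pureHom : 𝟙 X = pureHom fun i j => if i = j then 1 else 0 :=
  hom_ext fun i k => by
    change (if _ then _ else _) = if _ then _ else _
    by_cases h : i = k
    · subst h; simp
    · simp [h]

lemma pureHom_comp (hX : X.IsPure s) (hY : Y.IsPure s) (hZ : Z.IsPure s) (hs : s ≠ none)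
    (M : X.idx → Y.idx → ℂ) (N : Y.idx → Z.idx → ℂ) :
    pureHom M ≫ pureHom N = pureHom fun i k => ∑ j, M i j * N j k :=
  act_hom_ext fun φ i => by
    rw [act_comp, act_pureHom hX hY hs, act_pureHom hX hZ hs]
    simp only [act_pureHom hY hZ hs, Finset.sum_mul, Finset.mul_sum, mul_assoc]
    exact Finset.sum_comm

lemma vert_pureHom (hX : X.IsPure s) (hY : Y.IsPure t) (hZ : Z.IsPure r) (hW : W.IsPure r)
    (h : Occurs s t r) (c : X.idx → Y.idx → Z.idx → ℂ) (M : Z.idx → W.idx → ℂ) :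
    vert c ≫ pureHom M = vert fun i j k => ∑ k', c i j k' * M k' k :=
  act_hom_ext fun φ x => by
    obtain ⟨i, j, u, rfl⟩ := exists_tidx x
    rw [act_comp, act_vert hX hY hZ h, act_vert hX hY hW h]
    simp only [act_pureHom hZ hW (occurs_alive h).2.2, Finset.sum_mul, Finset.mul_sum, mul_assoc]
    rw [Finset.sum_comm]

lemma tensHom_vert (hX : X.IsPure s) (hY : Y.IsPure t) (hZ : Z.IsPure r) (hX' : X'.IsPure s)
    (hY' : Y'.IsPure t) (h : Occurs s t r) (M : X.idx → X'.idx → ℂ) (N : Y.idx → Y'.idx → ℂ)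
    (c : X'.idx → Y'.idx → Z.idx → ℂ) :
    tensHom (pureHom M) (pureHom N) ≫ vert c =
      vert fun i j k => ∑ i', ∑ j', M i i' * (N j j' * c i' j' k) :=
  act_hom_ext fun φ x => by
    obtain ⟨i, j, u, rfl⟩ := exists_tidx x
    rw [act_comp, act_tensHom, act_vert hX hY hZ h, act_pureHom hX hX' (occurs_alive h).1]
    simp only [act_pureHom hY hY' (occurs_alive h).2.1, act_vert hX' hY' hZ h]
    by_cases hu : u = r
    · subst hu
      simp only [if_true, Finset.sum_mul, Finset.mul_sum, mul_assoc, hX i, hY j, occ, if_pos h,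
        one_mul]
      rw [Finset.sum_congr rfl fun i' _ => Finset.sum_comm, Finset.sum_comm]
    · simp [hu]

lemma covert_tensHom (hX : X.IsPure s) (hY : Y.IsPure t) (hZ : Z.IsPure r) (hX' : X'.IsPure s)
    (hY' : Y'.IsPure t) (h : Occurs s t r) (M : X.idx → X'.idx → ℂ) (N : Y.idx → Y'.idx → ℂ)
    (c : Z.idx → X.idx → Y.idx → ℂ) :
    covert c ≫ tensHom (pureHom M) (pureHom N) =
      covert fun k i' j' => ∑ i, ∑ j, c k i j * (M i i' * N j j') :=
  act_hom_ext fun φ k => by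
    rw [act_comp, act_covert hX hY hZ h, act_covert hX' hY' hZ h]
    simp only [act_tensHom, act_pureHom hX hX' (occurs_alive h).1,
      act_pureHom hY hY' (occurs_alive h).2.1, hX _, hY _, occ, if_pos h, one_mul, Finset.sum_mul,
      Finset.mul_sum, mul_assoc]
    simp only [← Fintype.sum_prod_type']
    exact Fintype.sum_equiv ⟨fun x => (x.2.2.1, x.2.2.2, x.1, x.2.1),
      fun x => (x.2.2.1, x.2.2.2, x.1, x.2.1), fun _ => rfl, fun _ => rfl⟩ _ _ fun _ => rfl

/-- An isomorphism from a tensor product given by a matrix and its inverse. -/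
noncomputable def vertIso (hX : X.IsPure s) (hY : Y.IsPure t) (hZ : Z.IsPure r)
    (h : ∀ u, Occurs s t u ↔ u = r) (c : X.idx → Y.idx → Z.idx → ℂ)
    (c' : Z.idx → X.idx → Y.idx → ℂ)
    (h1 : ∀ i j i' j', ∑ k, c i j k * c' k i' j' = if i = i' ∧ j = j' then 1 else 0)
    (h2 : ∀ k k', ∑ i, ∑ j, c' k i j * c i j k' = if k = k' then 1 else 0) : tens X Y ≅ Z where
  hom := vert c
  inv := covert c'
  hom_inv_id := act_hom_ext fun φ x => by
    have hr := (h r).mpr rfl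
    obtain ⟨i, j, u, rfl⟩ := exists_tidx x
    rw [act_comp, act_vert hX hY hZ hr, act_id]
    simp only [act_covert hX hY hZ hr, deg_tidx, tdeg_eq_none, hX i, hY j, h]
    by_cases hu : u = r
    · subst hu
      simp only [if_true, not_true_eq_false, if_false, Finset.mul_sum, ← mul_assoc]
      rw [Finset.sum_comm]
      simp only [Finset.sum_comm (γ := Z.idx), ← Finset.sum_mul, h1, ite_and, ite_mul, zero_mul, one_mul]
      simp
    · simp [hu]
  inv_hom_id := act_hom_ext fun φ k => by
    have hr := (h r).mpr rfl
    rw [act_comp, act_covert hX hY hZ hr, act_id, if_neg (by rw [hZ]; exact (occurs_alive hr).2.2)]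
    simp only [act_vert hX hY hZ hr, if_true, Finset.mul_sum, ← mul_assoc]
    rw [Finset.sum_congr rfl fun i _ => Finset.sum_comm, Finset.sum_comm]
    simp only [← Finset.sum_mul, h2, ite_mul, zero_mul, one_mul]
    simp

lemma act_assoc_right (hX : X.IsPure s) (hY : Y.IsPure t) (hZ : Z.IsPure r) (hW : W.IsPure w)
    (hV : V.IsPure o) (h : Occurs t r w) (h' : Occurs s w o) (c : Y.idx → Z.idx → W.idx → ℂ)
    (c' : X.idx → W.idx → V.idx → ℂ) (φ) (i j u k x) :
    actHom (assocHom ≫ tensHom (𝟙 X) (vert c) ≫ vert c') φ (tidx (tidx i j u) k x) =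
      if x = o then (tyF d s t r o u w : ℂ) * ∑ p, (∑ q, c j k q * c' i q p) * φ p else 0 := by
  rw [act_comp, act_assocHom]
  simp only [act_comp, act_tensHom_id_left, act_vert hY hZ hW h, act_vert hX hW hV h', hX i, hY j,
    hZ k, deg_tidx]
  rw [Finset.sum_eq_single w]
  · by_cases hx : x = o
    · subst hx
      simp only [if_true, tdeg_eq h, occ, if_pos h', one_mul, Finset.mul_sum, Finset.sum_mul,
        mul_assoc]
      rw [Finset.sum_comm]
    · simp [hx]
  · intro w' _ hw
    simp [hw]
  · simp

lemma act_assoc_left (hX : X.IsPure s) (hY : Y.IsPure t) (hZ : Z.IsPure r) (hU : U.IsPure a)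
    (hV : V.IsPure o) (h : Occurs s t a) (h' : Occurs a r o) (c : X.idx → Y.idx → U.idx → ℂ)
    (c' : U.idx → Z.idx → V.idx → ℂ) (φ) (i j u k x) :
    actHom (tensHom (vert c) (𝟙 Z) ≫ vert c') φ (tidx (tidx i j u) k x) =
      if x = o then if u = a then ∑ p, (∑ q, c i j q * c' q k p) * φ p else 0 else 0 := by
  rw [act_comp, act_tensHom_id_right, act_vert hX hY hU h]
  simp only [act_vert hU hZ hV h', deg_tidx, hX i, hY j, hZ k]
  by_cases hu : u = a
  · subst hu
    by_cases hx : x = o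
    · subst hx
      simp only [if_true, tdeg_eq h, occ, if_pos h', one_mul, Finset.mul_sum, Finset.sum_mul,
        mul_assoc]
      rw [Finset.sum_comm]
    · simp [hx]
  · simp [hu]

/-- Both sides are evaluated on a vector. The associator contributes one coefficient for each
intermediate label `u`, so the identity reduces to the scalar condition `hc`. -/
lemma assoc_vert_eq_sum {B : Type*} [Fintype B] {U : B → TYModel d} {a : B → TYLabel A}
    (hX : X.IsPure s) (hY : Y.IsPure t) (hZ : Z.IsPure r) (hW : W.IsPure w) (hV : V.IsPure o)
    (hU : ∀ b, (U b).IsPure (a b)) (h : Occurs t r w) (h' : Occurs s w o)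
    (h1 : ∀ b, Occurs s t (a b)) (h1' : ∀ b, Occurs (a b) r o)
    (c : Y.idx → Z.idx → W.idx → ℂ) (c' : X.idx → W.idx → V.idx → ℂ)
    (c₁ : ∀ b, X.idx → Y.idx → (U b).idx → ℂ) (c₂ : ∀ b, (U b).idx → Z.idx → V.idx → ℂ)
    (κ : B → ℂ) (hc : ∀ i j k p u, (tyF d s t r o u w : ℂ) * ∑ q, c j k q * c' i q p =
      ∑ b, if u = a b then κ b * ∑ q, c₁ b i j q * c₂ b q k p else 0) :
    assocHom ≫ tensHom (𝟙 X) (vert c) ≫ vert c' =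
      ∑ b, κ b • (tensHom (vert (c₁ b)) (𝟙 Z) ≫ vert (c₂ b)) := by
  refine act_hom_ext fun φ x => ?_
  obtain ⟨x, k, x', rfl⟩ := exists_tidx x
  obtain ⟨i, j, u, rfl⟩ := exists_tidx x
  rw [act_assoc_right hX hY hZ hW hV h h']
  have hs : actHom (∑ b, κ b • (tensHom (vert (c₁ b)) (𝟙 Z) ≫ vert (c₂ b))) φ
      (tidx (tidx i j u) k x') = ∑ b, κ b *
        actHom (tensHom (vert (c₁ b)) (𝟙 Z) ≫ vert (c₂ b)) φ (tidx (tidx i j u) k x') := by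
    let L : (tens (tens X Y) Z ⟶ V) →ₗ[ℂ] ℂ :=
      { toFun := fun f => actHom f φ (tidx (tidx i j u) k x')
        map_add' := fun f g => by simp [act, add_mul, Finset.sum_add_distrib]
        map_smul' := fun c f => by simp [act, mul_assoc, Finset.mul_sum] }
    change L _ = ∑ b, κ b * L _
    rw [map_sum]
    simp only [map_smul, smul_eq_mul]
  rw [hs]
  simp only [act_assoc_left hX hY hZ (hU _) hV (h1 _) (h1' _)]
  by_cases hx : x' = o
  · simp only [hx, if_true]
    rw [Finset.mul_sum]
    simp_rw [← mul_assoc, hc]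
    simp only [Finset.sum_mul]
    rw [Finset.sum_comm]
    refine Finset.sum_congr rfl fun b _ => ?_
    split_ifs
    · simp only [Finset.mul_sum, mul_assoc, Finset.sum_mul]
    · simp
  · simp [hx]

lemma assoc_vert_eq_smul (hX : X.IsPure s) (hY : Y.IsPure t) (hZ : Z.IsPure r) (hW : W.IsPure w)
    (hV : V.IsPure o) (hU : U.IsPure a) (h : Occurs t r w) (h' : Occurs s w o)
    (h1 : Occurs s t a) (h1' : Occurs a r o)
    (c : Y.idx → Z.idx → W.idx → ℂ) (c' : X.idx → W.idx → V.idx → ℂ)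
    (c₁ : X.idx → Y.idx → U.idx → ℂ) (c₂ : U.idx → Z.idx → V.idx → ℂ) (κ : ℝ)
    (hF : ∀ u, tyF d s t r o u w = if u = a then κ else 0)
    (hc : ∀ i j k p, ∑ q, c j k q * c' i q p = ∑ q, c₁ i j q * c₂ q k p) :
    assocHom ≫ tensHom (𝟙 X) (vert c) ≫ vert c' =
      (κ : ℂ) • (tensHom (vert c₁) (𝟙 Z) ≫ vert c₂) := by
  have := assoc_vert_eq_sum (B := Unit) hX hY hZ hW hV (fun _ => hU) h h' (fun _ => h1)
    (fun _ => h1') c c' (fun _ => c₁) (fun _ => c₂) (fun _ => κ) (fun i j k p u => by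
      rw [hF, hc]
      by_cases hu : u = a <;> simp [hu])
  simpa using this

/-- Evaluation and coevaluation pass through the unit label only, so the zigzag is a matrix product
scaled by the single associator coefficient at unit labels. -/
lemma zigzag_left (hX : X.IsPure s) (hY : Y.IsPure t) (h : Occurs s t (inv 1))
    (h' : Occurs t s (inv 1)) (n : (point d (inv 1)).idx → X.idx → Y.idx → ℂ)
    (e : Y.idx → X.idx → (point d (inv 1)).idx → ℂ)
    (hc : ∀ j j', (tyG d t s t t (inv 1) (inv 1) : ℂ) *
      ∑ i, n default i j' * e j i default = if j = j' then 1 else 0) :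
    tensHom (𝟙 Y) (covert n) ≫ assocInv ≫ tensHom (vert e) (𝟙 Y) ≫ lunit = runit := by
  have h1 : (point d (inv 1)).IsPure (inv 1) := fun _ => rfl
  refine act_hom_ext fun φ x => ?_
  obtain ⟨j, x, u, rfl⟩ := exists_tidx x
  rw [Subsingleton.elim x default, act_comp, act_tensHom_id_left, act_covert hX hY h1 h, act_runit]
  have ht := (occurs_alive h').1
  by_cases hu : Occurs t (inv 1) u
  swap
  · rw [hY, deg_point, occ, if_neg hu]; ring
  obtain ⟨rfl, -⟩ := occurs_one_right.mp hu
  have hl : Occurs (inv 1) t t := occurs_one_left.mpr ⟨rfl, ht⟩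
  have e1 (i j') : actHom (assocInv ≫ tensHom (vert e) (𝟙 Y) ≫ lunit) φ
      (tidx j (tidx i j' (inv 1)) t) =
        tyG d t s t t (inv 1) (inv 1) * e j i default * φ j' := by
    rw [act_comp, act_assocInv, Finset.sum_eq_single (inv 1)]
    · rw [act_comp, act_tensHom_id_right, act_vert hY hX h1 h']
      simp only [act_lunit, if_true, Fintype.sum_unique, deg_tidx, hX i, hY _, tdeg_eq h', occ,
        if_pos hl]
      ring
    · intro u' _ hu'
      rw [act_comp, act_tensHom_id_right, act_vert hY hX h1 h', if_neg hu']
      ring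
    · simp
  simp only [e1]
  rw [hY, deg_point, occ, if_pos hu, one_mul, one_mul, Finset.sum_comm]
  have e2 (j') : ∑ i, n default i j' * ((tyG d t s t t (inv 1) (inv 1) : ℂ) * e j i default * φ j') =
      (if j = j' then 1 else 0) * φ j' := by
    rw [← hc, Finset.mul_sum, Finset.sum_mul]
    exact Finset.sum_congr rfl fun i _ => by ring
  simp [e2]

lemma zigzag_right (hX : X.IsPure s) (hY : Y.IsPure t) (h : Occurs s t (inv 1))
    (h' : Occurs t s (inv 1)) (n : (point d (inv 1)).idx → X.idx → Y.idx → ℂ)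
    (e : Y.idx → X.idx → (point d (inv 1)).idx → ℂ)
    (hc : ∀ i i', (tyF d s t s s (inv 1) (inv 1) : ℂ) *
      ∑ j, n default i' j * e j i default = if i = i' then 1 else 0) :
    tensHom (covert n) (𝟙 X) ≫ assocHom ≫ tensHom (𝟙 X) (vert e) ≫ runit = lunit := by
  have h1 : (point d (inv 1)).IsPure (inv 1) := fun _ => rfl
  refine act_hom_ext fun φ x => ?_
  obtain ⟨x, i, u, rfl⟩ := exists_tidx x
  rw [Subsingleton.elim x default, act_comp, act_tensHom_id_right, act_covert hX hY h1 h, act_lunit]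
  have ht := (occurs_alive h').2.1
  by_cases hu : Occurs (inv 1) s u
  swap
  · rw [hX, deg_point, occ, if_neg hu]; ring
  obtain ⟨rfl, -⟩ := occurs_one_left.mp hu
  have hl : Occurs s (inv 1) s := occurs_one_right.mpr ⟨rfl, ht⟩
  have e1 (i' j) : actHom (assocHom ≫ tensHom (𝟙 X) (vert e) ≫ runit) φ
      (tidx (tidx i' j (inv 1)) i s) =
        tyF d s t s s (inv 1) (inv 1) * e j i default * φ i' := by
    rw [act_comp, act_assocHom, Finset.sum_eq_single (inv 1)]
    · rw [act_comp, act_tensHom_id_left, act_vert hY hX h1 h']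
      simp only [act_runit, if_true, Fintype.sum_unique, deg_tidx, hX _, hY j, tdeg_eq h', occ,
        if_pos hl]
      ring
    · intro u' _ hu'
      rw [act_comp, act_tensHom_id_left, act_vert hY hX h1 h', if_neg hu']
      ring
    · simp
  simp only [e1]
  rw [hX, deg_point, occ, if_pos hu, one_mul, one_mul]
  have e2 (i') : ∑ j, n default i' j * ((tyF d s t s s (inv 1) (inv 1) : ℂ) * e j i default * φ i') =
      (if i = i' then 1 else 0) * φ i' := by
    rw [← hc, Finset.mul_sum, Finset.sum_mul]
    exact Finset.sum_congr rfl fun i _ => by ring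
  simp [e2]

end TYModel

end Model

/-! ### Biproducts and two-sided duals -/

section
open Limits

variable {C : Type u} [Category.{v} C] [Preadditive C]

/-- A finite decomposition of the identity yields a biproduct. -/
lemma exists_bicone_of_decomposition {J : Type} [Fintype J] {S : J → C} {X : C}
    (ι : ∀ j, S j ⟶ X) (π : ∀ j, X ⟶ S j) (h1 : ∀ j, ι j ≫ π j = 𝟙 _)
    (h2 : ∀ j k, j ≠ k → ι j ≫ π k = 0) (h3 : ∑ j, π j ≫ ι j = 𝟙 X) :
    ∃ b : Bicone (fun k : Fin (Fintype.card J) => S ((Fintype.equivFin J).symm k)),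
      Nonempty b.IsBilimit ∧ Nonempty (X ≅ b.pt) := by
  let e := (Fintype.equivFin J).symm
  let b : Bicone (fun k : Fin (Fintype.card J) => S (e k)) :=
    { pt := X
      π := fun k => π (e k)
      ι := fun k => ι (e k)
      ι_π := fun j k => by
        split_ifs with h
        · subst h; exact h1 _
        · exact h2 _ _ fun h' => h (e.injective h') }
  refine ⟨b, ⟨isBilimitOfTotal b ?_⟩, ⟨Iso.refl _⟩⟩
  rw [← h3]
  exact e.sum_comp fun j => π j ≫ ι j

variable [MonoidalCategory C]

/-- An object with a two-sided dual. -/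
def HasTwoSidedDual (X : C) : Prop :=
  ∃ Y : C, Nonempty (ExactPairing X Y) ∧ Nonempty (ExactPairing Y X)

lemma HasTwoSidedDual.of_iso {X Y : C} (h : HasTwoSidedDual X) (e : X ≅ Y) : HasTwoSidedDual Y := by
  obtain ⟨Z, ⟨P⟩, ⟨Q⟩⟩ := h
  exact ⟨Z, ⟨exactPairingCongrLeft e.symm⟩, ⟨exactPairingCongrRight e.symm⟩⟩

lemma HasTwoSidedDual.of_sum [MonoidalPreadditive C] [HasFiniteBiproducts C] {J : Type}
    [Fintype J] {S : J → C} {X : C} (hS : ∀ j, HasTwoSidedDual (S j))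
    (ι : ∀ j, S j ⟶ X) (π : ∀ j, X ⟶ S j) (h1 : ∀ j, ι j ≫ π j = 𝟙 _)
    (h2 : ∀ j k, j ≠ k → ι j ≫ π k = 0) (h3 : ∑ j, π j ≫ ι j = 𝟙 X) : HasTwoSidedDual X := by
  classical
  choose S' P Q using hS
  refine ⟨⨁ S', ?_, ?_⟩
  · exact nonempty_exactPairing_of_sum (fun j => (P j).some) ι π h1 h2 h3 (biproduct.ι S')
      (biproduct.π S') (biproduct.ι_π_self S') (fun j k h => biproduct.ι_π_ne S' h)
      biproduct.total
  · exact nonempty_exactPairing_of_sum (fun j => (Q j).some) (biproduct.ι S')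
      (biproduct.π S') (biproduct.ι_π_self S') (fun j k h => biproduct.ι_π_ne S' h)
      biproduct.total ι π h1 h2 h3

lemma nonempty_rigidCategory (h : ∀ X : C, HasTwoSidedDual X) : Nonempty (RigidCategory C) := by
  choose Y P Q using h
  exact ⟨{ rightDual := fun X => { rightDual := Y X, exact := (P X).some }
           leftDual := fun X => { leftDual := Y X, exact := (Q X).some } }⟩

end

/-! ### The doubled object, quaternion matrices and the symplectic form -/

section Model

open scoped Classical

variable {A : Type} [Group A] [Fintype A]
open TYLabel

namespace TYModel

variable {d : TYDatum A}

/-- The sum of two points with the non-invertible label. -/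
def dbl (d : TYDatum A) : TYModel d := TYCode.sum 2 fun _ => TYCode.pt TYLabel.m

/-- The coordinates of the two points. -/
def co : (dbl d).idx ≃ Fin 2 := (Equiv.sigmaPUnit _ : (Σ _ : Fin 2, Unit) ≃ _)

lemma dbl_isPure : (dbl d).IsPure TYLabel.m := fun _ => rfl
lemma point_isPure (l : TYLabel A) : (point d l).IsPure l := fun _ => rfl

lemma sum_dbl (f : Fin 2 → ℂ) : ∑ k : (dbl d).idx, f (co k) = f 0 + f 1 := by
  rw [co.sum_comp, Fin.sum_univ_two]

lemma pureHom_apply {X Y : TYModel d} {s : TYLabel A} (hX : X.IsPure s) (hY : Y.IsPure s)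
    (hs : s ≠ none) (M : X.idx → Y.idx → ℂ) (i j) : (pureHom M).1 i j = M i j :=
  if_pos ⟨by rw [hX, hY], by rwa [hX]⟩

/-- A matrix as an endomorphism of the double point. -/
noncomputable def dblHom (d : TYDatum A) (M : Fin 2 → Fin 2 → ℂ) : dbl d ⟶ dbl d :=
  pureHom fun i j => M (co i) (co j)

/-- Multiplication of two by two matrices. -/
def mul₂ (M N : Fin 2 → Fin 2 → ℂ) (i j : Fin 2) : ℂ := M i 0 * N 0 j + M i 1 * N 1 j

lemma dblHom_apply (M : Fin 2 → Fin 2 → ℂ) (i j) : (dblHom d M).1 i j = M (co i) (co j) :=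
  pureHom_apply dbl_isPure dbl_isPure (by simp) _ _ _

lemma dblHom_comp (M N : Fin 2 → Fin 2 → ℂ) : dblHom d M ≫ dblHom d N = dblHom d (mul₂ M N) := by
  refine (pureHom_comp dbl_isPure dbl_isPure dbl_isPure (by simp) _ _).trans ?_
  unfold dblHom
  congr 1
  funext i j
  exact sum_dbl fun k => M (co i) k * N k (co j)

lemma conj_dblHom (M : Fin 2 → Fin 2 → ℂ) :
    ConjTwist.conj (dblHom d M) = dblHom d fun i j => star (M i j) := conj_pureHom _

lemma dblHom_one : dblHom d (fun i j => if i = j then 1 else 0) = 𝟙 _ :=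
  hom_ext fun i j => by
    rw [dblHom_apply, id_apply, dbl_isPure]
    simp

lemma dblHom_injective {M N : Fin 2 → Fin 2 → ℂ} (h : dblHom d M = dblHom d N) : M = N := by
  funext i j
  have := congrFun (congrFun (congrArg Subtype.val h) (co.symm i)) (co.symm j)
  rw [dblHom_apply, dblHom_apply] at this
  simpa using this

lemma dblHom_surjective (f : dbl d ⟶ dbl d) : ∃ M, dblHom d M = f :=
  ⟨fun k l => f.1 (co.symm k) (co.symm l), hom_ext fun i j => by rw [dblHom_apply]; simp⟩

lemma dblHom_add (M N : Fin 2 → Fin 2 → ℂ) : dblHom d (M + N) = dblHom d M + dblHom d N :=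
  hom_ext fun i j => by rw [add_apply, dblHom_apply, dblHom_apply, dblHom_apply]; rfl

lemma dblHom_smul (c : ℂ) (M : Fin 2 → Fin 2 → ℂ) : dblHom d (c • M) = c • dblHom d M :=
  hom_ext fun i j => by rw [smul_apply, dblHom_apply, dblHom_apply]; rfl

lemma sgn_dbl : ConjTwist.sgn (dbl d) = dblHom d fun i j => if i = j then -1 else 0 :=
  hom_ext fun i j => by
    rw [dblHom_apply]
    refine (sgnHom_apply _ _).trans ?_
    rw [dbl_isPure]
    simp [parity]

/-- Vertices of type `a ⊗ b ⟶ ab`. -/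
noncomputable def vertAB (d : TYDatum A) (a b : A) :
    tens (point d (inv a)) (point d (inv b)) ⟶ point d (inv (a * b)) := vert fun _ _ _ => 1

/-- Vertices of type `a ⊗ m ⟶ m`. -/
noncomputable def vertAM (d : TYDatum A) (a : A) (M : Fin 2 → Fin 2 → ℂ) :
    tens (point d (inv a)) (dbl d) ⟶ dbl d := vert fun _ j k => M (co j) (co k)

/-- Vertices of type `m ⊗ a ⟶ m`. -/
noncomputable def vertMA (d : TYDatum A) (a : A) (M : Fin 2 → Fin 2 → ℂ) :
    tens (dbl d) (point d (inv a)) ⟶ dbl d := vert fun j _ k => M (co j) (co k)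

/-- Vertices of type `m ⊗ m ⟶ a`. -/
noncomputable def vertMM (d : TYDatum A) (a : A) (M : Fin 2 → Fin 2 → ℂ) :
    tens (dbl d) (dbl d) ⟶ point d (inv a) := vert fun j k _ => M (co j) (co k)

lemma occurs_iff_AB (a b : A) (u) : Occurs (inv a) (inv b) u ↔ u = inv (a * b) := by
  rcases u with _ | _ | _ <;> simp [Occurs]
lemma occurs_iff_AM (a : A) (u) : Occurs (inv a) m u ↔ u = m := by
  rcases u with _ | _ | _ <;> simp [Occurs]
lemma occurs_iff_MA (a : A) (u) : Occurs m (inv a) u ↔ u = m := by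
  rcases u with _ | _ | _ <;> simp [Occurs]
lemma occurs_AM (a : A) : Occurs (inv a) m m := trivial
lemma occurs_MA (a : A) : Occurs m (inv a) m := trivial
lemma occurs_MM (a : A) : Occurs m m (inv a) := trivial

lemma conj_vertAB (a b : A) : ConjTwist.conj (vertAB d a b) = vertAB d a b := by
  refine (conj_vert _).trans ?_
  simp [vertAB]

lemma conj_vertAM (a : A) (M : Fin 2 → Fin 2 → ℂ) :
    ConjTwist.conj (vertAM d a M) = vertAM d a fun i j => star (M i j) := conj_vert _
lemma conj_vertMA (a : A) (M : Fin 2 → Fin 2 → ℂ) :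
    ConjTwist.conj (vertMA d a M) = vertMA d a fun i j => star (M i j) := conj_vert _
lemma conj_vertMM (a : A) (M : Fin 2 → Fin 2 → ℂ) :
    ConjTwist.conj (vertMM d a M) = vertMM d a fun i j => star (M i j) := conj_vert _

lemma vertAM_dblHom (a : A) (M N : Fin 2 → Fin 2 → ℂ) :
    vertAM d a M ≫ dblHom d N = vertAM d a (mul₂ M N) := by
  refine (vert_pureHom (point_isPure (inv a)) dbl_isPure dbl_isPure dbl_isPure (occurs_AM a)
    _ _).trans ?_
  unfold vertAM
  congr 1
  funext _ i j
  exact sum_dbl fun k => M (co i) k * N k (co j)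

lemma vertMA_dblHom (a : A) (M N : Fin 2 → Fin 2 → ℂ) :
    vertMA d a M ≫ dblHom d N = vertMA d a (mul₂ M N) := by
  refine (vert_pureHom dbl_isPure (point_isPure (inv a)) dbl_isPure dbl_isPure (occurs_MA a)
    _ _).trans ?_
  unfold vertMA
  congr 1
  funext i _ j
  exact sum_dbl fun k => M (co i) k * N k (co j)

lemma dblHom_vertAM (a : A) (M N : Fin 2 → Fin 2 → ℂ) :
    tensHom (𝟙 _) (dblHom d M) ≫ vertAM d a N = vertAM d a (mul₂ M N) := by
  rw [id_eq_pureHom]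
  refine (tensHom_vert (point_isPure (inv a)) dbl_isPure dbl_isPure (point_isPure (inv a))
    dbl_isPure (occurs_AM a) _ _ _).trans ?_
  unfold vertAM
  congr 1
  funext x i j
  rw [Fintype.sum_unique]
  simp only [Subsingleton.elim x default, if_true, one_mul]
  exact sum_dbl fun k => M (co i) k * N k (co j)

lemma dblHom_vertMA (a : A) (M N : Fin 2 → Fin 2 → ℂ) :
    tensHom (dblHom d M) (𝟙 _) ≫ vertMA d a N = vertMA d a (mul₂ M N) := by
  rw [id_eq_pureHom]
  refine (tensHom_vert dbl_isPure (point_isPure (inv a)) dbl_isPure dbl_isPure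
    (point_isPure (inv a)) (occurs_MA a) _ _ _).trans ?_
  unfold vertMA
  congr 1
  funext i x j
  simp only [Fintype.sum_unique, Subsingleton.elim x default, if_true, one_mul]
  exact sum_dbl fun k => M (co i) k * N k (co j)

lemma dblHom_vertMM (a : A) (M N P : Fin 2 → Fin 2 → ℂ) :
    tensHom (dblHom d M) (dblHom d N) ≫ vertMM d a P =
      vertMM d a (mul₂ M (mul₂ P fun i j => N j i)) := by
  refine (tensHom_vert dbl_isPure dbl_isPure (point_isPure (inv a)) dbl_isPure
    dbl_isPure (occurs_MM a) _ _ _).trans ?_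
  unfold vertMM
  congr 1
  funext i j _
  rw [Finset.sum_congr rfl fun i' _ => sum_dbl fun k => M (co i) (co i') * (N (co j) k * P (co i') k),
    sum_dbl fun i' => M (co i) i' * (N (co j) 0 * P i' 0) + M (co i) i' * (N (co j) 1 * P i' 1)]
  simp only [mul₂]
  ring

/-- The matrix of the identity. -/
def one₂ : Fin 2 → Fin 2 → ℂ := fun i j => if i = j then 1 else 0

lemma mul₂_one (M : Fin 2 → Fin 2 → ℂ) : mul₂ M one₂ = M := by
  funext i j
  fin_cases j <;> simp [mul₂, one₂]

lemma one_mul₂ (M : Fin 2 → Fin 2 → ℂ) : mul₂ one₂ M = M := by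
  funext i j
  fin_cases i <;> simp [mul₂, one₂]

lemma star_one₂ : (fun i j => star (one₂ i j)) = one₂ := by
  funext i j
  unfold one₂
  split_ifs <;> simp

/-- The isomorphism `a ⊗ b ≅ ab` of the complex model. -/
noncomputable def isoAB (d : TYDatum A) (a b : A) :
    tens (point d (inv a)) (point d (inv b)) ≅ point d (inv (a * b)) :=
  vertIso (point_isPure (inv a)) (point_isPure (inv b)) (point_isPure (inv (a * b)))
      (occurs_iff_AB a b) (fun _ _ _ => 1) (fun _ _ _ => 1)
      (fun i j i' j' => by
        rw [Fintype.sum_unique, if_pos ⟨Subsingleton.elim _ _, Subsingleton.elim _ _⟩, one_mul])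
      (fun i j => by
        rw [Fintype.sum_unique, Fintype.sum_unique, if_pos (Subsingleton.elim _ _), one_mul])

/-- The isomorphism `a ⊗ m ≅ m` of the complex model. -/
noncomputable def isoAM (d : TYDatum A) (a : A) : tens (point d (inv a)) (dbl d) ≅ dbl d :=
  vertIso (point_isPure (inv a)) dbl_isPure dbl_isPure (occurs_iff_AM a)
    (fun _ j k => one₂ (co j) (co k)) (fun k _ j => one₂ (co j) (co k))
    (fun i j i' j' => by
      rw [sum_dbl fun k => one₂ (co j) k * one₂ (co j') k]
      simp only [Subsingleton.elim i i', true_and, ← co.injective.eq_iff]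
      generalize co j = j
      generalize co j' = j'
      fin_cases j <;> fin_cases j' <;> simp [one₂])
    (fun j j' => by
      rw [Fintype.sum_unique, sum_dbl fun k => one₂ k (co j) * one₂ k (co j')]
      simp only [← co.injective.eq_iff]
      generalize co j = j
      generalize co j' = j'
      fin_cases j <;> fin_cases j' <;> simp [one₂])

/-- The isomorphism `m ⊗ a ≅ m` of the complex model. -/
noncomputable def isoMA (d : TYDatum A) (a : A) : tens (dbl d) (point d (inv a)) ≅ dbl d :=
  vertIso dbl_isPure (point_isPure (inv a)) dbl_isPure (occurs_iff_MA a)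
    (fun j _ k => one₂ (co j) (co k)) (fun k j _ => one₂ (co j) (co k))
    (fun j i j' i' => by
      rw [sum_dbl fun k => one₂ (co j) k * one₂ (co j') k]
      simp only [Subsingleton.elim i i', and_true, ← co.injective.eq_iff]
      generalize co j = j
      generalize co j' = j'
      fin_cases j <;> fin_cases j' <;> simp [one₂])
    (fun j j' => by
      simp only [Fintype.sum_unique]
      rw [sum_dbl fun k => one₂ k (co j) * one₂ k (co j')]
      simp only [← co.injective.eq_iff]
      generalize co j = j
      generalize co j' = j'
      fin_cases j <;> fin_cases j' <;> simp [one₂])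

/-- The complex matrix of a quaternion. -/
def qmat (h : ℍ[ℝ]) : Fin 2 → Fin 2 → ℂ :=
  ![![⟨h.re, h.imI⟩, ⟨-h.imJ, h.imK⟩], ![⟨h.imJ, h.imK⟩, ⟨h.re, -h.imI⟩]]

/-- The standard symplectic form. -/
def symp : Fin 2 → Fin 2 → ℂ := ![![0, 1], ![-1, 0]]

lemma star_symp : (fun i j => star (symp i j)) = symp := by
  funext i j
  fin_cases i <;> fin_cases j <;> simp [symp]

/-- The sign is the parity of `m`: the real matrix `symp` is therefore an admissible antilinear
structure on the doubled object. -/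
lemma symp_mul_symp : mul₂ symp symp = fun i j => if i = j then -1 else 0 := by
  funext i j
  fin_cases i <;> fin_cases j <;> simp [symp, mul₂]

/-- Invariance of the form under its own matrix makes the pairing `m ⊗ m ⟶ a` compatible with the
antilinear structures. -/
lemma symp_invariant : mul₂ symp (mul₂ symp fun i j => symp j i) = symp := by
  funext i j
  fin_cases i <;> fin_cases j <;> simp [symp, mul₂]

/-- Quaternion matrices commute with the antilinear structure; `exists_qmat` is the converse. -/
lemma symp_qmat (h : ℍ[ℝ]) : mul₂ symp (fun i j => star (qmat h i j)) = mul₂ (qmat h) symp := by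
  funext i j
  fin_cases i <;> fin_cases j <;> simp [symp, qmat, mul₂, Complex.ext_iff]

/-- The adjoint of a quaternion for the symplectic form is its conjugate, which is why `[a]` is
balanced. -/
lemma symp_qmat_transpose (h : ℍ[ℝ]) :
    mul₂ one₂ (mul₂ symp fun i j => qmat h j i) =
      mul₂ (qmat (star h)) (mul₂ symp fun i j => one₂ j i) := by
  funext i j
  fin_cases i <;> fin_cases j <;> simp [symp, qmat, mul₂, one₂, Complex.ext_iff]

/-- The reversal matches the multiplication of `End`, which is opposite to the left-to-right
composition of matrices used here. -/
lemma qmat_mul (x y : ℍ[ℝ]) : qmat (x * y) = mul₂ (qmat y) (qmat x) := by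
  funext i j
  fin_cases i <;> fin_cases j <;> simp [qmat, mul₂, Complex.ext_iff] <;> constructor <;> ring

lemma qmat_one : qmat 1 = one₂ := by
  funext i j
  fin_cases i <;> fin_cases j <;> simp [qmat, one₂, Complex.ext_iff]

lemma qmat_add (x y : ℍ[ℝ]) : qmat (x + y) = qmat x + qmat y := by
  funext i j
  fin_cases i <;> fin_cases j <;> simp [qmat, Complex.ext_iff, add_comm]

lemma qmat_smul (r : ℝ) (x : ℍ[ℝ]) : qmat (r • x) = (r : ℂ) • qmat x := by
  funext i j
  fin_cases i <;> fin_cases j <;> simp [qmat, Complex.ext_iff]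

lemma qmat_injective {x y : ℍ[ℝ]} (h : qmat x = qmat y) : x = y := by
  have h00 := congrFun (congrFun h 0) 0
  have h10 := congrFun (congrFun h 1) 0
  simp [qmat, Complex.ext_iff] at h00 h10
  exact Quaternion.ext_components h00.1 h00.2 h10.1 h10.2

lemma exists_qmat {M : Fin 2 → Fin 2 → ℂ} (h : mul₂ symp (fun i j => star (M i j)) = mul₂ M symp) :
    ∃ x, qmat x = M := by
  have k00 := congrFun (congrFun h 0) 0
  have k01 := congrFun (congrFun h 0) 1
  refine ⟨⟨(M 0 0).re, (M 0 0).im, (M 1 0).re, (M 1 0).im⟩, ?_⟩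
  simp [symp, mul₂, Complex.ext_iff] at k00 k01
  funext i j
  fin_cases i <;> fin_cases j <;> simp [qmat, Complex.ext_iff] <;> constructor <;> linarith

/-- The completeness relation of the symplectic form. -/
lemma symp_completeness (i j k l : Fin 2) : ∑ s : Fin 4,
    mul₂ symp (fun p q => qmat (quaternionUnits s) q p) i j * qmat (quaternionUnits s) k l =
      -2 * (symp j k * one₂ i l) := by
  -- The constant `-2` is the reason for the parameter `-2τ` in the complex associator.
  rw [Fin.sum_univ_four]
  fin_cases i <;> fin_cases j <;> fin_cases k <;> fin_cases l <;>
    simp [symp, qmat, mul₂, one₂, quaternionUnits, Complex.ext_iff] <;> norm_num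

end TYModel

end Model

/-! ### The real fusion category of a datum -/

section Model

open scoped Classical

variable {A : Type} [Group A] [Fintype A]
open TYLabel

namespace TYModel

variable {d : TYDatum A}

lemma sgn_point (a : A) : ConjTwist.sgn (point d (inv a)) = 𝟙 _ := act_hom_ext fun φ i => by
  refine (act_sgnHom _ _).trans (Eq.trans ?_ (act_id _ _).symm)
  simp [deg_point, parity]

/-- The invertible objects. -/
noncomputable def objInv (d : TYDatum A) (a : A) : Twisted (TYModel d) where
  X := point d (inv a)
  J := 𝟙 _
  J_conj := by rw [ConjTwist.conj_id, Category.comp_id, sgn_point]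

/-- The non-invertible simple object. -/
noncomputable def objM (d : TYDatum A) : Twisted (TYModel d) where
  X := dbl d
  J := dblHom d symp
  J_conj := by rw [conj_dblHom, star_symp, dblHom_comp, symp_mul_symp, sgn_dbl]

lemma commAB (a b : A) : tensHom (𝟙 _) (𝟙 _) ≫ ConjTwist.conj (vertAB d a b) =
    vertAB d a b ≫ 𝟙 _ := by
  rw [conj_vertAB, Category.comp_id]
  exact (congrArg (· ≫ _) (id_tensorHom_id _ _)).trans (Category.id_comp _)

lemma commAM (a : A) : tensHom (𝟙 _) (dblHom d symp) ≫ ConjTwist.conj (vertAM d a one₂) =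
    vertAM d a one₂ ≫ dblHom d symp := by
  rw [conj_vertAM, star_one₂, dblHom_vertAM, vertAM_dblHom, mul₂_one, one_mul₂]

lemma commMA (a : A) : tensHom (dblHom d symp) (𝟙 _) ≫ ConjTwist.conj (vertMA d a one₂) =
    vertMA d a one₂ ≫ dblHom d symp := by
  rw [conj_vertMA, star_one₂, dblHom_vertMA, vertMA_dblHom, mul₂_one, one_mul₂]

lemma commMM (a : A) : tensHom (dblHom d symp) (dblHom d symp) ≫
    ConjTwist.conj (vertMM d a symp) = vertMM d a symp ≫ 𝟙 _ := by
  rw [conj_vertMM, star_symp, dblHom_vertMM, symp_invariant, Category.comp_id]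

/-- The isomorphism `a ⊗ b ≅ ab`. -/
noncomputable def isoMul (d : TYDatum A) (a b : A) : objInv d a ⊗ objInv d b ≅ objInv d (a * b) :=
  Twisted.mkIso (A := Twisted.tens (objInv d a) (objInv d b)) (isoAB d a b) (commAB a b)

/-- The isomorphism `a ⊗ m ≅ m`. -/
noncomputable def isoActL (d : TYDatum A) (a : A) : objInv d a ⊗ objM d ≅ objM d :=
  Twisted.mkIso (A := Twisted.tens (objInv d a) (objM d)) (isoAM d a) (commAM a)

/-- The isomorphism `m ⊗ a ≅ m`. -/
noncomputable def isoActR (d : TYDatum A) (a : A) : objM d ⊗ objInv d a ≅ objM d :=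
  Twisted.mkIso (A := Twisted.tens (objM d) (objInv d a)) (isoMA d a) (commMA a)

/-- The pairing `m ⊗ m ⟶ a`. -/
noncomputable def homProj (d : TYDatum A) (a : A) : objM d ⊗ objM d ⟶ objInv d a :=
  ⟨vertMM d a symp, commMM a⟩

/-- The endomorphism of a quaternion. -/
noncomputable def quatHom (d : TYDatum A) (h : ℍ[ℝ]) : objM d ⟶ objM d :=
  ⟨dblHom d (qmat h), by
    change dblHom d symp ≫ ConjTwist.conj (dblHom d (qmat h)) = dblHom d (qmat h) ≫ dblHom d symp
    rw [conj_dblHom, dblHom_comp, dblHom_comp, symp_qmat]⟩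

lemma quatHom_val (h : ℍ[ℝ]) : (quatHom d h).1 = dblHom d (qmat h) := rfl

lemma quatHom_mul (x y : ℍ[ℝ]) : quatHom d (x * y) = quatHom d y ≫ quatHom d x :=
  Twisted.hom_ext (by
    rw [Twisted.comp_val, quatHom_val, qmat_mul]
    exact (dblHom_comp _ _).symm)

lemma quatHom_surjective (f : objM d ⟶ objM d) : ∃ h, quatHom d h = f := by
  obtain ⟨M, hM⟩ := dblHom_surjective (d := d) f.1
  have hf : dblHom d symp ≫ ConjTwist.conj (dblHom d M) = dblHom d M ≫ dblHom d symp := by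
    rw [hM]; exact Twisted.hom_comm f
  rw [conj_dblHom, dblHom_comp, dblHom_comp] at hf
  obtain ⟨x, rfl⟩ := exists_qmat (dblHom_injective hf)
  exact ⟨x, Twisted.hom_ext hM⟩

/-- The real linear map from the quaternions to endomorphisms. -/
noncomputable def quatLin (d : TYDatum A) : ℍ[ℝ] →ₗ[ℝ] End (objM d) where
  toFun := fun h => quatHom d h
  map_add' := fun x y => Twisted.hom_ext (by
    change dblHom d _ = dblHom d _ + dblHom d _
    rw [qmat_add, dblHom_add])
  map_smul' := fun r x => Twisted.hom_ext (by
    change dblHom d _ = r • dblHom d _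
    rw [qmat_smul, dblHom_smul, Complex.coe_smul])

/-- The identification of the quaternions with the endomorphisms of the non-invertible object. -/
noncomputable def quatEquiv (d : TYDatum A) : ℍ[ℝ] ≃ₐ[ℝ] End (objM d) :=
  AlgEquiv.ofBijective (AlgHom.ofLinearMap (quatLin d)
    (Twisted.hom_ext (by
      change dblHom d _ = 𝟙 (dbl d)
      rw [qmat_one]
      exact dblHom_one))
    quatHom_mul)
  ⟨fun _ _ h => qmat_injective (dblHom_injective (congrArg Subtype.val h)), quatHom_surjective⟩

lemma exists_smul_of_conj_eq {a : A} (f : point d (inv a) ⟶ point d (inv a))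
    (h : ConjTwist.conj f = f) : ∃ r : ℝ, f = r • 𝟙 _ := by
  have h1 : star (f.1 default default) = f.1 default default :=
    congrFun (congrFun (congrArg Subtype.val h) _) _
  refine ⟨(f.1 default default).re, ?_⟩
  rw [← Complex.coe_smul]
  refine hom_ext fun i j => ?_
  rw [smul_apply, id_apply, if_pos ⟨Subsingleton.elim i j, by simp [deg_point]⟩, mul_one,
    Complex.conj_eq_iff_re.mp h1, Subsingleton.elim i default, Subsingleton.elim j default]

lemma exists_smul_of_objInv {a : A} (f : objInv d a ⟶ objInv d a) : ∃ r : ℝ, f = r • 𝟙 _ := by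
  obtain ⟨r, hr⟩ := exists_smul_of_conj_eq (d := d) (a := a) f.1 (by
    have hf : 𝟙 _ ≫ ConjTwist.conj f.1 = f.1 ≫ 𝟙 _ := Twisted.hom_comm f
    exact (Category.id_comp _).symm.trans (hf.trans (Category.comp_id _)))
  exact ⟨r, Twisted.hom_ext hr⟩

lemma objInv_id_ne_zero (a : A) : 𝟙 (objInv d a) ≠ 0 := fun h => by
  have h1 : (𝟙 (point d (inv a)) : _ ⟶ _).1 default default = 0 :=
    congrFun (congrFun (congrArg Subtype.val (congrArg Subtype.val h))
      (default : (point d (inv a)).idx)) (default : (point d (inv a)).idx)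
  rw [id_apply] at h1
  simp [deg_point] at h1

lemma regular {X Y : Twisted (TYModel d)} (f : X ⟶ Y) : ∃ g : Y ⟶ X, f ≫ g ≫ f = f :=
  Twisted.exists_regular exists_regular f

instance : IsIdempotentComplete (Twisted (TYModel d)) := Twisted.isIdempotentComplete
instance : Limits.HasFiniteBiproducts (Twisted (TYModel d)) := Twisted.hasFiniteBiproducts exists_sum
instance (X Y : Twisted (TYModel d)) : FiniteDimensional ℝ (X ⟶ Y) := Twisted.finiteDimensional_hom
noncomputable instance : Abelian (Twisted (TYModel d)) := abelianOfRegular regular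

lemma simple_objInv (a : A) : Simple (objInv d a) :=
  simple_of_regular regular (objInv_id_ne_zero a) fun e he => by
    obtain ⟨r, rfl⟩ := exists_smul_of_objInv e
    have h : (r * r - r) • 𝟙 (objInv d a) = 0 := by
      rw [sub_smul, sub_eq_zero, ← smul_smul]
      simpa using he
    have h2 := (smul_eq_zero.mp h).resolve_right (objInv_id_ne_zero a)
    have h3 : r * (r - 1) = 0 := by linarith
    rcases mul_eq_zero.mp h3 with h4 | h4
    · left; rw [h4, zero_smul]
    · right; rw [sub_eq_zero.mp h4, one_smul]

lemma simple_objM : Simple (objM d) :=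
  simple_of_regular regular
    (fun h => one_ne_zero ((quatEquiv d).injective ((map_one _).trans (Eq.trans h (map_zero _).symm))))
    fun e he => by
    obtain ⟨x, rfl⟩ := quatHom_surjective e
    rw [← quatHom_mul] at he
    have h := (quatEquiv d).injective he
    have h3 : x * (x - 1) = 0 := by rw [mul_sub, h, mul_one, sub_self]
    rcases mul_eq_zero.mp h3 with h4 | h4
    · left; rw [h4]; exact map_zero (quatEquiv d)
    · right; rw [sub_eq_zero.mp h4]; exact map_one (quatEquiv d)

/-- Every simple object is isomorphic to one of the standard ones. -/
lemma iso_of_simple (X : Twisted (TYModel d)) [Simple X] :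
    (∃ a, Nonempty (X ≅ objInv d a)) ∨ Nonempty (X ≅ objM d) := by
  have hX : ∃ i, X.X.deg i ≠ none := by
    by_contra h
    push Not at h
    apply id_nonzero X
    exact Twisted.hom_ext (hom_ext fun i j => (𝟙 X.X : X.X ⟶ X.X).2 i j fun h' => h'.2 (h i))
  obtain ⟨i, hi⟩ := hX
  match hl : X.X.deg i with
  | none => exact absurd hl hi
  | some (some a) =>
    left
    -- An index with label `a` gives a nonzero complex map from the point. Descent turns it into a
    -- nonzero compatible map, an isomorphism by Schur's lemma.
    let f : point d (inv a) ⟶ X.X := ⟨fun _ j => if j = i then 1 else 0, fun _ j h => if_neg fun h' =>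
      h (by subst h'; rw [hl]; exact ⟨rfl, by simp [deg_point]⟩)⟩
    have hf : f ≠ 0 := fun h => one_ne_zero (α := ℂ) (by
      have h2 : (if i = i then (1 : ℂ) else 0) = 0 := congrFun (congrFun (congrArg Subtype.val h) default) i
      simp at h2)
    obtain ⟨g, hg⟩ := Twisted.exists_hom_ne_zero (A := objInv d a) (B := X) hf
    have := simple_objInv (d := d) a
    have := isIso_of_hom_simple hg
    exact ⟨a, ⟨(asIso g).symm⟩⟩
  | some none =>
    right
    let f : dbl d ⟶ X.X := ⟨fun k j => if j = i ∧ k = co.symm 0 then 1 else 0, fun _ j h => if_neg fun h' =>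
      h (by obtain ⟨rfl, -⟩ := h'; rw [hl]; exact ⟨rfl, by simp [dbl_isPure _]⟩)⟩
    have hf : f ≠ 0 := fun h => one_ne_zero (α := ℂ) (by
      have h2 : (if i = i ∧ co.symm 0 = co.symm 0 then (1 : ℂ) else 0) = 0 :=
        congrFun (congrFun (congrArg Subtype.val h) (co.symm 0)) i
      simp at h2)
    obtain ⟨g, hg⟩ := Twisted.exists_hom_ne_zero (A := objM d) (B := X) hf
    have := simple_objM (d := d)
    have := isIso_of_hom_simple hg
    exact ⟨(asIso g).symm⟩

lemma exactPairing_of_zigzag {X Y : Twisted (TYModel d)} (n : 𝟙_ (Twisted (TYModel d)) ⟶ X ⊗ Y)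
    (e : Y ⊗ X ⟶ 𝟙_ _)
    (h1 : tensHom (𝟙 Y.X) n.1 ≫ assocInv ≫ tensHom e.1 (𝟙 Y.X) ≫ lunit = runit)
    (h2 : tensHom n.1 (𝟙 X.X) ≫ assocHom ≫ tensHom (𝟙 X.X) e.1 ≫ runit = lunit) :
    Nonempty (ExactPairing X Y) := by
  refine ⟨⟨n, e, ?_, ?_⟩⟩
  · rw [← cancel_mono (λ_ Y).hom]
    simp only [Category.assoc, Iso.inv_hom_id, Category.comp_id]
    exact Twisted.hom_ext h1
  · rw [← cancel_mono (ρ_ X).hom]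
    simp only [Category.assoc, Iso.inv_hom_id, Category.comp_id]
    exact Twisted.hom_ext h2

lemma conj_vert_one {X Y Z : TYModel d} :
    ConjTwist.conj (vert (X := X) (Y := Y) (Z := Z) fun _ _ _ => 1) = vert fun _ _ _ => 1 := by
  rw [conj_vert]; simp

lemma conj_covert_one {X Y Z : TYModel d} :
    ConjTwist.conj (covert (X := X) (Y := Y) (Z := Z) fun _ _ _ => 1) = covert fun _ _ _ => 1 := by
  rw [conj_covert]; simp

lemma id_comp_comm_tensor {X Y Z : TYModel d} (f : Z ⟶ tens X Y) (h : ConjTwist.conj f = f) :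
    𝟙 _ ≫ ConjTwist.conj f = f ≫ tensHom (𝟙 X) (𝟙 Y) := by
  rw [h, Category.id_comp]
  exact ((congrArg (f ≫ ·) (id_tensorHom_id X Y)).trans (Category.comp_id _)).symm

lemma id_comp_tensor_comm {X Y Z : TYModel d} (f : tens X Y ⟶ Z) (h : ConjTwist.conj f = f) :
    tensHom (𝟙 X) (𝟙 Y) ≫ ConjTwist.conj f = f ≫ 𝟙 _ := by
  rw [h, Category.comp_id]
  exact (congrArg (· ≫ f) (id_tensorHom_id X Y)).trans (Category.id_comp _)

/-- The evaluation of an invertible object. -/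
noncomputable def pairInv (d : TYDatum A) (a b : A) :
    tens (point d (inv a)) (point d (inv b)) ⟶ point d (inv 1) := vert fun _ _ _ => 1

/-- The coevaluation of an invertible object. -/
noncomputable def copairInv (d : TYDatum A) (a b : A) :
    point d (inv 1) ⟶ tens (point d (inv a)) (point d (inv b)) := covert fun _ _ _ => 1

lemma pairInv_zigzag_left {a b : A} (hab : a * b = 1) (hba : b * a = 1) :
    tensHom (𝟙 _) (copairInv d a b) ≫ assocInv ≫ tensHom (pairInv d b a) (𝟙 _) ≫ lunit = runit := by
  have o1 : Occurs (inv a) (inv b) (inv 1) := hab.symm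
  have o2 : Occurs (inv b) (inv a) (inv 1) := hba.symm
  refine zigzag_left (point_isPure _) (point_isPure _) o1 o2 _ _ fun j j' => ?_
  rw [Fintype.sum_unique, if_pos (Subsingleton.elim _ _)]
  simp [tyG, hab, hba]

lemma pairInv_zigzag_right {a b : A} (hab : a * b = 1) (hba : b * a = 1) :
    tensHom (copairInv d a b) (𝟙 _) ≫ assocHom ≫ tensHom (𝟙 _) (pairInv d b a) ≫ runit = lunit := by
  have o1 : Occurs (inv a) (inv b) (inv 1) := hab.symm
  have o2 : Occurs (inv b) (inv a) (inv 1) := hba.symm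
  refine zigzag_right (point_isPure _) (point_isPure _) o1 o2 _ _ fun j j' => ?_
  rw [Fintype.sum_unique, if_pos (Subsingleton.elim _ _)]
  simp [tyF, hab, hba]

/-- The evaluation of an invertible object. -/
noncomputable def evalInv (d : TYDatum A) (a b : A) :
    objInv d a ⊗ objInv d b ⟶ 𝟙_ (Twisted (TYModel d)) :=
  ⟨pairInv d a b, id_comp_tensor_comm (pairInv d a b) conj_vert_one⟩

/-- The coevaluation of an invertible object. -/
noncomputable def coevalInv (d : TYDatum A) (a b : A) :
    𝟙_ (Twisted (TYModel d)) ⟶ objInv d a ⊗ objInv d b :=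
  ⟨copairInv d a b, id_comp_comm_tensor (copairInv d a b) conj_covert_one⟩

lemma nonempty_exactPairing_objInv {a b : A} (hab : a * b = 1) (hba : b * a = 1) :
    Nonempty (ExactPairing (objInv d a) (objInv d b)) :=
  exactPairing_of_zigzag (coevalInv d a b) (evalInv d b a) (pairInv_zigzag_left hab hba)
    (pairInv_zigzag_right hab hba)

lemma hasTwoSidedDual_objInv (a : A) : HasTwoSidedDual (objInv d a) :=
  ⟨objInv d a⁻¹, nonempty_exactPairing_objInv (by simp) (by simp),
    nonempty_exactPairing_objInv (by simp) (by simp)⟩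

lemma tau_ne_zero (d : TYDatum A) : d.τ ≠ 0 := fun h => by
  have := d.tau_sq
  simp [h] at this

/-- The copairing of the double point with itself. -/
noncomputable def copair (d : TYDatum A) : point d (inv 1) ⟶ tens (dbl d) (dbl d) :=
  -- The scalar cancels the coefficient `-2τ` of the associator at unit labels, the sign being
  -- supplied by the square of `symp`.
  covert fun _ i j => (2 * d.τ : ℂ)⁻¹ * symp (co i) (co j)

lemma copair_comm : 𝟙 _ ≫ ConjTwist.conj (copair d) =
    copair d ≫ tensHom (dblHom d symp) (dblHom d symp) := by
  have h2 : copair d ≫ tensHom (dblHom d symp) (dblHom d symp) = copair d := by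
    refine (covert_tensHom dbl_isPure dbl_isPure (point_isPure (inv 1)) dbl_isPure
      dbl_isPure (occurs_MM 1) _ _ _).trans ?_
    unfold copair
    congr 1
    funext _ i j
    rw [Finset.sum_congr rfl fun i' _ => sum_dbl fun k => (2 * d.τ : ℂ)⁻¹ * symp (co i') k *
        (symp (co i') (co i) * symp k (co j)),
      sum_dbl fun i' => (2 * d.τ : ℂ)⁻¹ * symp i' 0 * (symp i' (co i) * symp 0 (co j)) +
        (2 * d.τ : ℂ)⁻¹ * symp i' 1 * (symp i' (co i) * symp 1 (co j))]
    generalize co i = i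
    generalize co j = j
    fin_cases i <;> fin_cases j <;> simp [symp]
  rw [h2, Category.id_comp]
  refine (conj_covert _).trans ?_
  unfold copair
  congr 1
  funext _ i j
  have := congrFun (congrFun star_symp (co i)) (co j)
  rw [star_mul']
  exact congrArg₂ (· * ·) (by simp) this

lemma sum_symp_mul_symp (i j : (dbl d).idx) :
    ∑ k : (dbl d).idx, symp (co i) (co k) * symp (co k) (co j) = if i = j then -1 else 0 := by
  rw [sum_dbl fun k => symp (co i) k * symp k (co j)]
  simp only [← co.injective.eq_iff]
  exact congrFun (congrFun symp_mul_symp (co i)) (co j)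

lemma copair_zigzag_left : tensHom (𝟙 _) (copair d) ≫ assocInv ≫
    tensHom (vertMM d 1 symp) (𝟙 _) ≫ lunit = runit := by
  have hτ : (d.τ : ℂ) ≠ 0 := Complex.ofReal_ne_zero.mpr (tau_ne_zero d)
  refine zigzag_left dbl_isPure dbl_isPure (occurs_MM 1) (occurs_MM 1) _ _ fun j j' => ?_
  have e : ∑ i : (dbl d).idx, (2 * d.τ : ℂ)⁻¹ * symp (co i) (co j') * symp (co j) (co i) =
      (2 * d.τ : ℂ)⁻¹ * if j = j' then -1 else 0 := by
    rw [← sum_symp_mul_symp, Finset.mul_sum]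
    exact Finset.sum_congr rfl fun _ _ => by ring
  rw [e]
  simp only [tyG, tyCoeff_m_m_m, isM_m, onInv_inv, d.χ_one_left]
  split_ifs
  · push_cast
    field_simp
  · simp

lemma copair_zigzag_right : tensHom (copair d) (𝟙 _) ≫ assocHom ≫
    tensHom (𝟙 _) (vertMM d 1 symp) ≫ runit = lunit := by
  have hτ : (d.τ : ℂ) ≠ 0 := Complex.ofReal_ne_zero.mpr (tau_ne_zero d)
  refine zigzag_right dbl_isPure dbl_isPure (occurs_MM 1) (occurs_MM 1) _ _ fun j j' => ?_
  have e : ∑ i : (dbl d).idx, (2 * d.τ : ℂ)⁻¹ * symp (co j') (co i) * symp (co i) (co j) =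
      (2 * d.τ : ℂ)⁻¹ * if j' = j then -1 else 0 := by
    rw [← sum_symp_mul_symp, Finset.mul_sum]
    exact Finset.sum_congr rfl fun _ _ => by ring
  rw [e, eq_comm (a := j')]
  simp only [tyF, tyCoeff_m_m_m, isM_m, onInv_inv, d.χ_one_left]
  split_ifs
  · push_cast
    field_simp
  · simp

/-- The coevaluation of the non-invertible object. -/
noncomputable def coevalM (d : TYDatum A) : 𝟙_ (Twisted (TYModel d)) ⟶ objM d ⊗ objM d :=
  ⟨copair d, copair_comm⟩

/-- The evaluation of the non-invertible object. -/
noncomputable def evalM (d : TYDatum A) : objM d ⊗ objM d ⟶ 𝟙_ (Twisted (TYModel d)) :=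
  ⟨vertMM d 1 symp, commMM 1⟩

lemma hasTwoSidedDual_objM : HasTwoSidedDual (objM d) :=
  have key : Nonempty (ExactPairing (objM d) (objM d)) :=
    exactPairing_of_zigzag (coevalM d) (evalM d) copair_zigzag_left copair_zigzag_right
  ⟨objM d, key, key⟩

lemma objInv_injective {a b : A} (h : Nonempty (objInv d a ≅ objInv d b)) : a = b := by
  obtain ⟨e⟩ := h
  by_contra hab
  apply objInv_id_ne_zero (d := d) a
  rw [← e.hom_inv_id]
  have : e.hom = 0 := Twisted.hom_ext (hom_ext fun i j => e.hom.1.2 i j fun h => by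
    have h1 : (inv a : TYLabel A) = inv b := h.1
    simp at h1
    exact hab h1)
  rw [this, Limits.zero_comp]

/-- The non-ignored indices of the product are labelled by elements of `A`, while those of the
target are labelled by `m`. -/
lemma hom_mm_m_eq_zero (f : objM d ⊗ objM d ⟶ objM d) : f = 0 :=
  Twisted.hom_ext (tens_hom_ext (X := dbl d) (Y := dbl d) (V := dbl d) fun i j u k =>
    f.1.2 _ _ fun h => by
      have h1 : tdeg m m u = (m : TYLabel A) := h.1
      have h2 : Occurs m m u := by
        by_contra h3
        rw [tdeg_eq_none.mpr h3] at h1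
        simp at h1
      rw [tdeg_eq h2] at h1
      subst h1
      exact h2)

variable (d) in
/-- The real Tambara--Yamagami category of a datum. -/
noncomputable def fusionCat : FusionCat.{0, 0, 0} ℝ where
  carrier := Twisted (TYModel d)
  finite_hom _ _ := inferInstance
  semisimple X := by
    obtain ⟨J, _, S, ι, π, hS, h1, h2, h3⟩ := exists_simple_decomposition (𝕜 := ℝ) regular X
    exact ⟨_, _, fun k => hS _, exists_bicone_of_decomposition ι π h1 h2 h3⟩
  finite_simples := by
    refine ⟨Fintype.card (Option A), fun i => ((Fintype.equivFin (Option A)).symm i).elim (objM d)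
      (objInv d), fun X _ => ?_⟩
    rcases iso_of_simple X with ⟨a, h⟩ | h
    · exact ⟨Fintype.equivFin (Option A) (some a), by simpa using h⟩
    · exact ⟨Fintype.equivFin (Option A) none, by simpa using h⟩
  rigid := nonempty_rigidCategory fun X => by
    obtain ⟨J, _, S, ι, π, hS, h1, h2, h3⟩ := exists_simple_decomposition (𝕜 := ℝ) regular X
    refine HasTwoSidedDual.of_sum (fun j => ?_) ι π h1 h2 h3
    have := hS j
    obtain ⟨a, ⟨h⟩⟩ | ⟨⟨h⟩⟩ := iso_of_simple (S j)
    · exact (hasTwoSidedDual_objInv a).of_iso h.symm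
    · exact hasTwoSidedDual_objM.of_iso h.symm
  simple_unit := simple_objInv (1 : A)

end TYModel

end Model

/-! ### Evaluation of the model's associators and unitors on vertices -/

section Model

open scoped Classical

variable {A : Type} [Group A] [Fintype A]
open TYLabel

namespace TYModel

variable {d : TYDatum A}

/-! ### The associators of the complex model on vertices -/

/-- The vertex of type `a ⊗ b ⟶ c`. -/
noncomputable def vertPt (d : TYDatum A) (a b c : A) :
    tens (point d (inv a)) (point d (inv b)) ⟶ point d (inv c) := vert fun _ _ _ => 1

lemma assoc_AAA (a b c e : A) (he : a * b * c = e) :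
    assocHom ≫ tensHom (𝟙 _) (vertPt d b c (b * c)) ≫ vertPt d a (b * c) e =
      tensHom (vertPt d a b (a * b)) (𝟙 _) ≫ vertPt d (a * b) c e := by
  have he' : a * (b * c) = e := by rw [← he, mul_assoc]
  refine (assoc_vert_eq_smul (d := d) (s := inv a) (t := inv b) (r := inv c) (w := inv (b * c))
    (o := inv e) (a := inv (a * b)) (point_isPure _) (point_isPure _) (point_isPure _)
    (point_isPure _) (point_isPure _) (point_isPure _) rfl he'.symm rfl he.symm _ _
    (fun _ _ _ => 1) (fun _ _ _ => 1) 1 (fun u => ?_)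
    (fun i j k p => ?_)).trans ?_
  · rcases u with _ | _ | x <;> simp [tyF, Pi.single_apply, ← he]
  · simp
  · simp only [Complex.ofReal_one, one_smul]; rfl

lemma assoc_AAM (a b : A) :
    assocHom ≫ tensHom (𝟙 _) (vertAM d b one₂) ≫ vertAM d a one₂ =
      tensHom (vertPt d a b (a * b)) (𝟙 _) ≫ vertAM d (a * b) one₂ := by
  refine (assoc_vert_eq_smul (d := d) (s := inv a) (t := inv b) (r := m) (w := m)
    (o := m) (a := inv (a * b)) (point_isPure _) (point_isPure _) dbl_isPure
    dbl_isPure dbl_isPure (point_isPure _) trivial trivial rfl trivial _ _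
    (fun _ _ _ => 1) (fun _ j k => one₂ (co j) (co k)) 1 (fun u => ?_)
    (fun i j k p => ?_)).trans ?_
  · rcases u with _ | _ | x <;> simp [tyF, Pi.single_apply]
  · rw [sum_dbl fun q => one₂ (co k) q * one₂ q (co p), Fintype.sum_unique]
    exact (congrFun (congrFun (mul₂_one one₂) _) _).trans (one_mul _).symm
  · simp only [Complex.ofReal_one, one_smul]; rfl

lemma assoc_AMA (a b : A) :
    assocHom ≫ tensHom (𝟙 _) (vertMA d b one₂) ≫ vertAM d a one₂ =
      ((d.χ a b : ℝ) : ℂ) • (tensHom (vertAM d a one₂) (𝟙 _) ≫ vertMA d b one₂) := by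
  refine (assoc_vert_eq_smul (d := d) (s := inv a) (t := m) (r := inv b) (w := m)
    (o := m) (a := m) (point_isPure _) dbl_isPure (point_isPure _)
    dbl_isPure dbl_isPure dbl_isPure trivial trivial trivial trivial _ _
    (fun _ j k => one₂ (co j) (co k)) (fun j _ k => one₂ (co j) (co k)) (d.χ a b) (fun u => ?_)
    (fun i j k p => ?_)).trans ?_
  · rcases u with _ | _ | x <;> simp [tyF]
  · rfl
  · rfl

lemma assoc_MAA (a b : A) :
    assocHom ≫ tensHom (𝟙 _) (vertPt d a b (a * b)) ≫ vertMA d (a * b) one₂ =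
      tensHom (vertMA d a one₂) (𝟙 _) ≫ vertMA d b one₂ := by
  refine (assoc_vert_eq_smul (d := d) (s := m) (t := inv a) (r := inv b) (w := inv (a * b))
    (o := m) (a := m) dbl_isPure (point_isPure _) (point_isPure _)
    (point_isPure _) dbl_isPure dbl_isPure rfl trivial trivial trivial _ _
    (fun j _ k => one₂ (co j) (co k)) (fun j _ k => one₂ (co j) (co k)) 1 (fun u => ?_)
    (fun i j k p => ?_)).trans ?_
  · rcases u with _ | _ | x <;> simp [tyF]
  · rw [sum_dbl fun q => one₂ (co i) q * one₂ q (co p), Fintype.sum_unique]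
    exact (one_mul _).trans (congrFun (congrFun (mul₂_one one₂) _) _).symm
  · simp only [Complex.ofReal_one, one_smul]; rfl

lemma assoc_AMM (a b : A) :
    assocHom ≫ tensHom (𝟙 _) (vertMM d b symp) ≫ vertPt d a b (a * b) =
      tensHom (vertAM d a one₂) (𝟙 _) ≫ vertMM d (a * b) symp := by
  refine (assoc_vert_eq_smul (d := d) (s := inv a) (t := m) (r := m) (w := inv b)
    (o := inv (a * b)) (a := m) (point_isPure _) dbl_isPure dbl_isPure
    (point_isPure _) (point_isPure _) dbl_isPure trivial rfl trivial trivial _ _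
    (fun _ j k => one₂ (co j) (co k)) (fun j k _ => symp (co j) (co k)) 1 (fun u => ?_)
    (fun i j k p => ?_)).trans ?_
  · rcases u with _ | _ | x <;> simp [tyF]
  · rw [sum_dbl fun q => one₂ (co j) q * symp q (co k), Fintype.sum_unique, mul_one]
    exact (congrFun (congrFun (one_mul₂ symp) _) _).symm
  · simp only [Complex.ofReal_one, one_smul]; rfl

lemma assoc_MAM (a b : A) :
    assocHom ≫ tensHom (𝟙 _) (vertAM d a one₂) ≫ vertMM d b symp =
      ((d.χ a b : ℝ) : ℂ) • (tensHom (vertMA d a one₂) (𝟙 _) ≫ vertMM d b symp) := by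
  refine (assoc_vert_eq_smul (d := d) (s := m) (t := inv a) (r := m) (w := m)
    (o := inv b) (a := m) dbl_isPure (point_isPure _) dbl_isPure
    dbl_isPure (point_isPure _) dbl_isPure trivial trivial trivial trivial _ _
    (fun j _ k => one₂ (co j) (co k)) (fun j k _ => symp (co j) (co k)) (d.χ a b) (fun u => ?_)
    (fun i j k p => ?_)).trans ?_
  · rcases u with _ | _ | x <;> simp [tyF]
  · rw [sum_dbl fun q => one₂ (co k) q * symp (co i) q, sum_dbl fun q => one₂ (co i) q * symp q (co k)]
    refine Eq.trans ?_ (congrFun (congrFun (one_mul₂ symp) (co i)) (co k)).symm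
    refine Eq.trans ?_ (congrFun (congrFun (mul₂_one symp) (co i)) (co k))
    generalize co k = k
    generalize co i = i
    fin_cases k <;> simp [one₂, mul₂]
  · rfl

lemma assoc_MMA (a b : A) :
    assocHom ≫ tensHom (𝟙 _) (vertMA d a one₂) ≫ vertMM d (b * a) symp =
      tensHom (vertMM d b symp) (𝟙 _) ≫ vertPt d b a (b * a) := by
  refine (assoc_vert_eq_smul (d := d) (s := m) (t := m) (r := inv a) (w := m)
    (o := inv (b * a)) (a := inv b) dbl_isPure dbl_isPure (point_isPure _)
    dbl_isPure (point_isPure _) (point_isPure _) trivial trivial trivial rfl _ _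
    (fun j k _ => symp (co j) (co k)) (fun _ _ _ => 1) 1 (fun u => ?_)
    (fun i j k p => ?_)).trans ?_
  · rcases u with _ | _ | x <;> simp [tyF, Pi.single_apply, eq_comm]
  · rw [sum_dbl fun q => one₂ (co j) q * symp (co i) q, Fintype.sum_unique, mul_one]
    refine Eq.trans ?_ (congrFun (congrFun (mul₂_one symp) (co i)) (co j))
    generalize co j = k
    generalize co i = i
    fin_cases k <;> simp [one₂, mul₂]
  · simp only [Complex.ofReal_one, one_smul]; rfl

/-- The complex associator has one coefficient `-2τ/χ(a,x)` per intermediate label `x`. The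
completeness relation of the symplectic form trades its factor `-2` for the sum over quaternion
units. -/
lemma assoc_MMM (a : A) :
    assocHom ≫ tensHom (𝟙 _) (vertMM d a symp) ≫ vertMA d a one₂ =
      ∑ b : A × Fin 4, ((d.τ * (d.χ a b.1 : ℝ)⁻¹ : ℝ) : ℂ) •
        (tensHom (vertMM d b.1 (mul₂ symp fun p q => qmat (quaternionUnits b.2) q p)) (𝟙 _) ≫
          vertAM d b.1 (qmat (quaternionUnits b.2))) := by
  refine assoc_vert_eq_sum (d := d) (s := m) (t := m) (r := m) (w := inv a)
    (o := m) (a := fun b : A × Fin 4 => inv b.1) dbl_isPure dbl_isPure dbl_isPure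
    (point_isPure _) dbl_isPure (fun _ => point_isPure _) trivial trivial (fun _ => trivial)
    (fun _ => trivial) _ _
    (fun b j k _ => mul₂ symp (fun p q => qmat (quaternionUnits b.2) q p) (co j) (co k))
    (fun b _ j k => qmat (quaternionUnits b.2) (co j) (co k))
    (fun b => ((d.τ * (d.χ a b.1 : ℝ)⁻¹ : ℝ) : ℂ)) (fun i j k p u => ?_)
  rw [Fintype.sum_prod_type]
  simp only [Fintype.sum_unique]
  rcases u with _ | _ | x
  · simp [tyF]
  · simp [tyF]
  · rw [Finset.sum_eq_single x (fun y _ hy => by simp [hy.symm]) (by simp)]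
    simp only [if_true, ← Finset.mul_sum]
    rw [symp_completeness]
    simp only [tyF, tyCoeff_m_m_m, isM_m, onInv_inv, d.symm x a]
    push_cast
    ring

lemma lunit_eq_vertPt (a : A) : (lunit : tens (point d (inv 1)) (point d (inv a)) ⟶ _) =
    vertPt d 1 a a := act_hom_ext fun φ x => by
  obtain ⟨i, j, u, rfl⟩ := exists_tidx x
  rw [act_lunit, vertPt, act_vert (point_isPure (inv 1)) (point_isPure (inv a))
    (point_isPure (inv a)) (one_mul a).symm, Fintype.sum_unique, deg_point]
  simp [occ, occurs_iff_AB, Subsingleton.elim j default]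

lemma runit_eq_vertPt (a : A) : (runit : tens (point d (inv a)) (point d (inv 1)) ⟶ _) =
    vertPt d a 1 a := act_hom_ext fun φ x => by
  obtain ⟨i, j, u, rfl⟩ := exists_tidx x
  rw [act_runit, vertPt, act_vert (point_isPure (inv a)) (point_isPure (inv 1))
    (point_isPure (inv a)) (mul_one a).symm, Fintype.sum_unique, deg_point]
  simp [occ, occurs_iff_AB, Subsingleton.elim i default]

lemma sum_one₂_mul (i : (dbl d).idx) (φ : (dbl d).idx → ℂ) :
    ∑ k, one₂ (co i) (co k) * φ k = φ i := by
  simp [one₂, co.injective.eq_iff]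

lemma lunit_eq_vertAM : (lunit : tens (point d (inv 1)) (dbl d) ⟶ _) =
    vertAM d 1 one₂ := act_hom_ext fun φ x => by
  obtain ⟨i, j, u, rfl⟩ := exists_tidx x
  rw [act_lunit, vertAM, act_vert (point_isPure (inv 1)) dbl_isPure
    dbl_isPure (occurs_AM 1), sum_one₂_mul, dbl_isPure]
  simp [occ, occurs_iff_AM]

lemma runit_eq_vertMA : (runit : tens (dbl d) (point d (inv 1)) ⟶ _) =
    vertMA d 1 one₂ := act_hom_ext fun φ x => by
  obtain ⟨i, j, u, rfl⟩ := exists_tidx x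
  rw [act_runit, vertMA, act_vert dbl_isPure (point_isPure (inv 1))
    dbl_isPure (occurs_MA 1), sum_one₂_mul, dbl_isPure]
  simp [occ, occurs_iff_MA]

end TYModel

end Model

/-! ### The presentation of the model -/

section Model

open scoped Classical

variable {A : Type} [Group A] [Fintype A]
open TYLabel

namespace TYModel

variable {d : TYDatum A}

lemma isoMul_eqToHom {a b c : A} (h : a * b = c) :
    ((isoMul d a b).hom ≫ eqToHom (congrArg (objInv d) h)).1 = vertPt d a b c := by
  subst h
  rw [eqToHom_refl, Category.comp_id]
  rfl

/-- Isomorphisms between invertible objects with equal labels. -/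
noncomputable def isoMulTo (d : TYDatum A) {a b c : A} (h : a * b = c) :
    objInv d a ⊗ objInv d b ≅ objInv d c :=
  isoMul d a b ≪≫ eqToIso (congrArg (objInv d) h)

lemma objInv_invertible (a : A) : IsInvertibleObj (objInv d a) :=
  ⟨objInv d a⁻¹, ⟨isoMulTo d (mul_inv_cancel a)⟩, ⟨isoMulTo d (inv_mul_cancel a)⟩⟩

lemma actL_quat (a : A) (h : ℍ[ℝ]) :
    objInv d a ◁ quatHom d h ≫ (isoActL d a).hom = (isoActL d a).hom ≫ quatHom d h :=
  Twisted.hom_ext (by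
    change tensHom (𝟙 _) (dblHom d (qmat h)) ≫ vertAM d a one₂ = vertAM d a one₂ ≫ dblHom d (qmat h)
    rw [dblHom_vertAM, vertAM_dblHom, mul₂_one, one_mul₂])

lemma actR_quat (a : A) (h : ℍ[ℝ]) :
    quatHom d h ▷ objInv d a ≫ (isoActR d a).hom = (isoActR d a).hom ≫ quatHom d h :=
  Twisted.hom_ext (by
    change tensHom (dblHom d (qmat h)) (𝟙 _) ≫ vertMA d a one₂ = vertMA d a one₂ ≫ dblHom d (qmat h)
    rw [dblHom_vertMA, vertMA_dblHom, mul₂_one, one_mul₂])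

lemma dblHom_one₂ : dblHom d one₂ = 𝟙 _ := dblHom_one

lemma proj_quat (a : A) (h : ℍ[ℝ]) :
    objM d ◁ quatHom d h ≫ homProj d a = quatHom d (star h) ▷ objM d ≫ homProj d a :=
  Twisted.hom_ext (by
    change tensHom (𝟙 (dbl d)) (dblHom d (qmat h)) ≫ vertMM d a symp =
      tensHom (dblHom d (qmat (star h))) (𝟙 (dbl d)) ≫ vertMM d a symp
    rw [← dblHom_one₂, dblHom_vertMM, dblHom_vertMM, symp_qmat_transpose])

lemma homProj_ne_zero (a : A) : homProj d a ≠ 0 := fun h => by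
  have h1 : vertMM d a symp = 0 := congrArg Subtype.val h
  have h2 := congrArg (fun f => actHom f (fun _ => 1) (tidx (co.symm 0) (co.symm 1) (inv a))) h1
  simp only [vertMM] at h2
  rw [act_vert dbl_isPure dbl_isPure (point_isPure _) (occurs_MM a)] at h2
  have h3 : actHom (0 : tens (dbl d) (dbl d) ⟶ point d (inv a)) (fun _ => 1)
      (tidx (co.symm 0) (co.symm 1) (inv a)) = 0 :=
    Finset.sum_eq_zero fun _ _ => zero_mul _
  rw [h3] at h2
  simp [symp] at h2

lemma one_mul_eq (a : A) : (𝟙 (objInv d 1)) ▷ objInv d a ≫ (isoMul d 1 a).hom ≫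
    eqToHom (congrArg (objInv d) (one_mul a)) = (λ_ (objInv d a)).hom := by
  rw [id_whiskerRight, Category.id_comp]
  exact Twisted.hom_ext ((isoMul_eqToHom (one_mul a)).trans (lunit_eq_vertPt a).symm)

lemma mul_one_eq (a : A) : objInv d a ◁ (𝟙 (objInv d 1)) ≫ (isoMul d a 1).hom ≫
    eqToHom (congrArg (objInv d) (mul_one a)) = (ρ_ (objInv d a)).hom := by
  rw [whiskerLeft_id, Category.id_comp]
  exact Twisted.hom_ext ((isoMul_eqToHom (mul_one a)).trans (runit_eq_vertPt a).symm)

lemma one_actL : (𝟙 (objInv d 1)) ▷ objM d ≫ (isoActL d 1).hom = (λ_ (objM d)).hom := by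
  rw [id_whiskerRight, Category.id_comp]
  exact Twisted.hom_ext lunit_eq_vertAM.symm

lemma actR_one : objM d ◁ (𝟙 (objInv d 1)) ≫ (isoActR d 1).hom = (ρ_ (objM d)).hom := by
  rw [whiskerLeft_id, Category.id_comp]
  exact Twisted.hom_ext runit_eq_vertMA.symm

lemma assoc_a_b_c (a b c : A) :
    (α_ (objInv d a) (objInv d b) (objInv d c)).hom ≫ objInv d a ◁ (isoMul d b c).hom ≫
      (isoMul d a (b * c)).hom =
    (isoMul d a b).hom ▷ objInv d c ≫ (isoMul d (a * b) c).hom ≫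
      eqToHom (congrArg (objInv d) (mul_assoc a b c)) :=
  Twisted.hom_ext ((assoc_AAA a b c _ (mul_assoc a b c)).trans
    (congrArg (tensHom (vertPt d a b (a * b)) (𝟙 _) ≫ ·) (isoMul_eqToHom (mul_assoc a b c)).symm))

lemma assoc_a_b_m (a b : A) :
    (α_ (objInv d a) (objInv d b) (objM d)).hom ≫ objInv d a ◁ (isoActL d b).hom ≫
      (isoActL d a).hom = (isoMul d a b).hom ▷ objM d ≫ (isoActL d (a * b)).hom :=
  Twisted.hom_ext (assoc_AAM a b)

lemma assoc_a_m_b (a b : A) :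
    (α_ (objInv d a) (objM d) (objInv d b)).hom ≫ objInv d a ◁ (isoActR d b).hom ≫
      (isoActL d a).hom =
    (d.χ a b : ℝ) • ((isoActL d a).hom ▷ objInv d b ≫ (isoActR d b).hom) :=
  Twisted.hom_ext ((assoc_AMA a b).trans (Complex.coe_smul _ _))

lemma assoc_m_a_b (a b : A) :
    (α_ (objM d) (objInv d a) (objInv d b)).hom ≫ objM d ◁ (isoMul d a b).hom ≫
      (isoActR d (a * b)).hom = (isoActR d a).hom ▷ objInv d b ≫ (isoActR d b).hom :=
  Twisted.hom_ext (assoc_MAA a b)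

lemma assoc_a_m_m (a b : A) :
    (α_ (objInv d a) (objM d) (objM d)).hom ≫ objInv d a ◁ homProj d b ≫ (isoMul d a b).hom =
      (isoActL d a).hom ▷ objM d ≫ homProj d (a * b) :=
  Twisted.hom_ext (assoc_AMM a b)

lemma assoc_m_a_m (a b : A) :
    (α_ (objM d) (objInv d a) (objM d)).hom ≫ objM d ◁ (isoActL d a).hom ≫ homProj d b =
      (d.χ a b : ℝ) • ((isoActR d a).hom ▷ objM d ≫ homProj d b) :=
  Twisted.hom_ext ((assoc_MAM a b).trans (Complex.coe_smul _ _))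

lemma assoc_m_m_a (a b : A) :
    (α_ (objM d) (objM d) (objInv d a)).hom ≫ objM d ◁ (isoActR d a).hom ≫ homProj d (b * a) =
      homProj d b ▷ objInv d a ≫ (isoMul d b a).hom :=
  Twisted.hom_ext (assoc_MMA a b)

/-- Interchange separates the quaternion on the second factor, absorbed by the pairing, from the one
on the third, absorbed by the action. -/
lemma quat_quat_proj_act (h : ℍ[ℝ]) (b : A) :
    (tensHom (tensHom (𝟙 (dbl d)) (dblHom d (qmat h))) (dblHom d (qmat h)) ≫
      tensHom (vertMM d b symp) (𝟙 (dbl d)) ≫ vertAM d b one₂) =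
    tensHom (vertMM d b (mul₂ symp fun p q => qmat h q p)) (𝟙 _) ≫ vertAM d b (qmat h) := by
  have h1 : vertMM d b (mul₂ symp fun p q => qmat h q p) =
      tensHom (𝟙 (dbl d)) (dblHom d (qmat h)) ≫ vertMM d b symp := by
    rw [← dblHom_one₂, dblHom_vertMM, one_mul₂]
  have h2 : vertAM d b (qmat h) = tensHom (𝟙 _) (dblHom d (qmat h)) ≫ vertAM d b one₂ := by
    rw [dblHom_vertAM, mul₂_one]
  rw [h1, h2]
  have h3 := tensorHom_comp_tensorHom_assoc (C := TYModel d)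
    (tensHom (𝟙 (dbl d)) (dblHom d (qmat h)) : tens (dbl d) (dbl d) ⟶ tens (dbl d) (dbl d))
    (dblHom d (qmat h)) (vertMM d b symp) (𝟙 (dbl d)) (vertAM d b one₂)
  have h4 := tensorHom_comp_tensorHom_assoc (C := TYModel d)
    (tensHom (𝟙 (dbl d)) (dblHom d (qmat h)) ≫ vertMM d b symp) (𝟙 (dbl d))
    (𝟙 _) (dblHom d (qmat h)) (vertAM d b one₂)
  refine h3.trans (Eq.trans ?_ h4.symm)
  rw [Category.comp_id, Category.comp_id, Category.id_comp]

lemma assoc_m_m_m (a : A) :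
    (α_ (objM d) (objM d) (objM d)).hom ≫ objM d ◁ homProj d a ≫ (isoActR d a).hom =
      ∑ b : A, (d.τ * (d.χ a b : ℝ)⁻¹) • ∑ i : Fin 4,
        ((𝟙 (objM d) ⊗ₘ quatHom d (quaternionUnits i)) ⊗ₘ quatHom d (quaternionUnits i)) ≫
          homProj d b ▷ objM d ≫ (isoActL d b).hom :=
  Twisted.hom_ext (by
    refine (assoc_MMM a).trans ?_
    rw [Fintype.sum_prod_type, Twisted.sum_val]
    refine Finset.sum_congr rfl fun b _ => ?_
    rw [Twisted.smul_val, Twisted.sum_val, ← Complex.coe_smul, Finset.smul_sum]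
    refine Finset.sum_congr rfl fun s _ => ?_
    rw [← quat_quat_proj_act]
    rfl)

/-- If the object were invertible, its square would be simple and hence isomorphic to the unit
through the nonzero pairing. Whiskering would then embed `ℍ` into the real endomorphisms of the
unit, contradicting the existence of `i`. -/
lemma exists_smul_of_invertible_objM (hm : IsInvertibleObj (objM d)) (f : objM d ⟶ objM d) :
    ∃ r : ℝ, f = r • 𝟙 _ := by
  have hs : Simple (objM d ⊗ objM d) :=
    IsInvertibleObj.simple (C := fusionCat d) (IsInvertibleObj.tensor (C := fusionCat d) hm hm)
  have := simple_objInv (d := d) 1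
  have := isIso_of_hom_simple (homProj_ne_zero (d := d) 1)
  have e : objM d ⊗ objM d ≅ objInv d 1 := asIso (homProj d 1)
  obtain ⟨r, hr⟩ := exists_smul_of_objInv (e.inv ≫ f ▷ objM d ≫ e.hom)
  refine ⟨r, hm.whiskerRight_injective ?_⟩
  have h1 : f ▷ objM d = e.hom ≫ (r • 𝟙 _) ≫ e.inv := by rw [← hr]; simp
  refine h1.trans ?_
  simp

lemma objM_not_invertible : ¬ IsInvertibleObj (objM d) := fun hm => by
  obtain ⟨r, hr⟩ := exists_smul_of_invertible_objM hm (quatHom d ⟨0, 1, 0, 0⟩)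
  have h : quatHom d ⟨0, 1, 0, 0⟩ = quatHom d (r : ℍ[ℝ]) := by
    rw [hr]
    have : (r : ℍ[ℝ]) = r • 1 := by rw [← Quaternion.coe_mul_eq_smul, mul_one]
    rw [this]
    exact (((quatLin d).map_smul r 1).trans (congrArg (r • ·) (map_one (quatEquiv d)))).symm
  have h2 := congrArg QuaternionAlgebra.imI ((quatEquiv d).injective h)
  simp at h2

lemma isTambaraYamagami : IsTambaraYamagami (fusionCat d) (objM d) where
  simple := simple_objM
  not_invertible := objM_not_invertible
  invertible_or_iso X hX := by
    rcases @iso_of_simple _ _ _ d X hX with ⟨a, ⟨h⟩⟩ | h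
    · exact Or.inl ((objInv_invertible a).of_iso h.symm)
    · exact Or.inr h
  multiplicity_zero := hom_mm_m_eq_zero

/-- The presentation of the real Tambara--Yamagami category of a datum. -/
noncomputable def presentation (d : TYDatum A) : CHPresentation (fusionCat d) d where
  m := objM d
  isTY := isTambaraYamagami
  quat := quatEquiv d
  obj := objInv d
  simple_obj := simple_objInv
  obj_invertible := objInv_invertible
  obj_surjective X hX hI := by
    rcases @iso_of_simple _ _ _ d X hX with h | ⟨⟨h⟩⟩
    · exact h
    · exact absurd (hI.of_iso h) objM_not_invertible
  obj_injective a b h := objInv_injective h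
  unitIso := Iso.refl (objInv d 1)
  mul := isoMul d
  actL := isoActL d
  actR := isoActR d
  proj := homProj d
  proj_ne_zero := homProj_ne_zero
  actL_quat := actL_quat
  actR_quat := actR_quat
  proj_quat := proj_quat
  one_mul_eq := one_mul_eq
  mul_one_eq := mul_one_eq
  one_actL := one_actL
  actR_one := actR_one
  assoc_a_b_c := assoc_a_b_c
  assoc_a_b_m := assoc_a_b_m
  assoc_a_m_b := assoc_a_m_b
  assoc_m_a_b := assoc_m_a_b
  assoc_a_m_m := assoc_a_m_m
  assoc_m_a_m := assoc_m_a_m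
  assoc_m_m_a := assoc_m_m_a
  assoc_m_m_m := assoc_m_m_m

lemma isRealQuaternionicTY (d : TYDatum A) : IsRealQuaternionicTY (fusionCat d) := by
  refine ⟨objM d, isTambaraYamagami, ?_, ⟨(quatEquiv d).symm⟩⟩
  refine ⟨(AlgEquiv.ofBijective (Algebra.ofId ℝ (End (objInv d 1))) ⟨?_, fun f => ?_⟩).symm⟩
  · have : Nontrivial (End (objInv d 1)) := ⟨1, 0, objInv_id_ne_zero 1⟩
    exact (algebraMap ℝ (End (objInv d 1))).injective
  · obtain ⟨r, hr⟩ := exists_smul_of_objInv (d := d) f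
    exact ⟨r, (Algebra.algebraMap_eq_smul_one r).trans hr.symm⟩

end TYModel

end Model

/-- Every datum is realized by a real-quaternionic Tambara--Yamagami category. -/
theorem TYDatum.exists_isCH {A : Type w} [Group A] [Fintype A] (d : TYDatum A) :
    ∃ C : FusionCat.{0, 0, 0} ℝ, IsRealQuaternionicTY C ∧ IsCH C d := by
  classical
  -- The model is built for groups in the lowest universe, so it is applied to a small copy of `A`
  -- and the presentation is then reindexed.
  let A₀ := Shrink.{0} A
  let e : A ≃* A₀ := (Shrink.mulEquiv : Shrink.{0} A ≃* A).symm
  have : Fintype A₀ := Fintype.ofEquiv A e.toEquiv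
  let d₀ : TYDatum A₀ := d.comap e.symm
  refine ⟨TYModel.fusionCat d₀, TYModel.isRealQuaternionicTY d₀, ⟨?_⟩⟩
  have h : d₀.comap e = d := TYDatum.ext (by
    funext a b
    change d.χ (e.symm (e a)) (e.symm (e b)) = _
    simp) rfl
  exact h ▸ (TYModel.presentation d₀).reindex e

/-! ### The pentagon equation in terms of vertices -/

section Pentagon

variable {C : Type u} [Category.{v} C] [MonoidalCategory C] {X Y Z W U V S P T R : C}

/-- Two ways of rebracketing a right comb of vertices. -/
lemma rebracket_right_comb (z₁ : Z ⊗ W ⟶ U) (z₂ : Y ⊗ U ⟶ V) (z₃ : X ⊗ V ⟶ S) :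
    (α_ X Y Z).hom ▷ W ≫ (α_ X (Y ⊗ Z) W).hom ≫ X ◁ ((α_ Y Z W).hom ≫ Y ◁ z₁ ≫ z₂) ≫ z₃ =
      (α_ (X ⊗ Y) Z W).hom ≫ (X ⊗ Y) ◁ z₁ ≫ (α_ X Y U).hom ≫ X ◁ z₂ ≫ z₃ := by
  simp [pentagon_assoc]

lemma rebracket_inner (p : Y ⊗ Z ⟶ P) (r : P ⊗ W ⟶ V) (z : X ⊗ V ⟶ S) :
    (α_ X Y Z).hom ▷ W ≫ (α_ X (Y ⊗ Z) W).hom ≫ X ◁ (p ▷ W ≫ r) ≫ z =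
      ((α_ X Y Z).hom ≫ X ◁ p) ▷ W ≫ (α_ X P W).hom ≫ X ◁ r ≫ z := by
  simp

lemma rebracket_outer (z : Z ⊗ W ⟶ U) (y : X ⊗ Y ⟶ T) (t : T ⊗ U ⟶ S) :
    (α_ (X ⊗ Y) Z W).hom ≫ (X ⊗ Y) ◁ z ≫ y ▷ U ≫ t =
      y ▷ Z ▷ W ≫ (α_ T Z W).hom ≫ T ◁ z ≫ t := by
  rw [whisker_exchange_assoc, associator_naturality_left_assoc]

/-- The pentagon equation for vertices related by scalars. -/
lemma pentagon_smul {𝕜 : Type w} [Field 𝕜] [Preadditive C] [Linear 𝕜 C] [MonoidalPreadditive C]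
    [MonoidalLinear 𝕜 C] {κ₁ κ₂ κ₃ κ₄ κ₅ : 𝕜}
    {z₁ : Z ⊗ W ⟶ U} {z₂ : Y ⊗ U ⟶ V} {z₃ : X ⊗ V ⟶ S} {p : Y ⊗ Z ⟶ P} {r : P ⊗ W ⟶ V}
    {x₁ : X ⊗ P ⟶ R} {x₂ : R ⊗ W ⟶ S} {y₁ : X ⊗ Y ⟶ T} {y₂ : T ⊗ Z ⟶ R} {t : T ⊗ U ⟶ S}
    (h₁ : (α_ Y Z W).hom ≫ Y ◁ z₁ ≫ z₂ = κ₁ • (p ▷ W ≫ r))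
    (h₂ : (α_ X P W).hom ≫ X ◁ r ≫ z₃ = κ₂ • (x₁ ▷ W ≫ x₂))
    (h₃ : (α_ X Y Z).hom ≫ X ◁ p ≫ x₁ = κ₃ • (y₁ ▷ Z ≫ y₂))
    (h₄ : (α_ X Y U).hom ≫ X ◁ z₂ ≫ z₃ = κ₄ • (y₁ ▷ U ≫ t))
    (h₅ : (α_ T Z W).hom ≫ T ◁ z₁ ≫ t = κ₅ • (y₂ ▷ W ≫ x₂)) :
    (κ₁ * κ₂ * κ₃) • (y₁ ▷ Z ▷ W ≫ y₂ ▷ W ≫ x₂) = (κ₄ * κ₅) • (y₁ ▷ Z ▷ W ≫ y₂ ▷ W ≫ x₂) := by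
  have e := rebracket_right_comb z₁ z₂ z₃
  rw [h₁, h₄] at e
  simp only [MonoidalLinear.whiskerLeft_smul, Linear.smul_comp, Linear.comp_smul] at e
  rw [rebracket_inner, rebracket_outer, h₅, h₂] at e
  have h₃' : ((α_ X Y Z).hom ≫ X ◁ p) ▷ W ≫ x₁ ▷ W ≫ x₂ =
      κ₃ • (y₁ ▷ Z ▷ W ≫ y₂ ▷ W ≫ x₂) := by
    rw [← comp_whiskerRight_assoc, Category.assoc, h₃, MonoidalLinear.smul_whiskerRight,
      Linear.smul_comp, comp_whiskerRight, Category.assoc]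
  rwa [Linear.comp_smul, h₃', Linear.comp_smul, smul_smul, smul_smul, smul_smul] at e

end Pentagon

/-! ### Quaternion-linear normalisation of actions and pairings -/

section Gauge

variable {C : FusionCat.{v, u, 0} ℝ} {m : C} (q : ℍ[ℝ] ≃ₐ[ℝ] End m)

/-- An action of the quaternions on an object isomorphic to `m` can be made standard. -/
lemma exists_intertwining_iso {X : C} (e : X ≅ m) (x : ℍ[ℝ] →ₗ[ℝ] (X ⟶ X)) (h1 : x 1 = 𝟙 X)
    (hmul : ∀ g h, x (g * h) = x h ≫ x g) :
    ∃ e' : X ≅ m, ∀ h, x h ≫ e'.hom = e'.hom ≫ qhom q h := by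
  let σ' : ℍ[ℝ] →ₗ[ℝ] ℍ[ℝ] :=
    { toFun := fun h => q.symm (e.inv ≫ x h ≫ e.hom)
      map_add' := fun g h => by
        rw [map_add, Preadditive.add_comp, Preadditive.comp_add]
        exact map_add q.symm (_ : End m) _
      map_smul' := fun r h => by
        rw [map_smul, Linear.smul_comp, Linear.comp_smul]
        exact map_smul q.symm r (_ : End m) }
  have hσ (h : ℍ[ℝ]) : qhom q (σ' h) = e.inv ≫ x h ≫ e.hom := q.apply_symm_apply _
  let σ : ℍ[ℝ] →ₐ[ℝ] ℍ[ℝ] := AlgHom.ofLinearMap σ'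
    (qhom_injective q (by rw [hσ, h1, qhom_one]; simp))
    (fun g h => qhom_injective q (by rw [qhom_mul, hσ, hσ, hσ, hmul]; simp))
  obtain ⟨w, hw, hc⟩ := Quaternion.exists_conj σ
  have hw' := qhom_isIso q (inv_ne_zero hw)
  refine ⟨e ≪≫ asIso (qhom q w⁻¹), fun h => ?_⟩
  have h2 : x h ≫ e.hom = e.hom ≫ qhom q (σ h) := by
    change _ = _ ≫ qhom q (σ' h)
    rw [hσ]; simp
  rw [Iso.trans_hom, asIso_hom, reassoc_of% h2, Category.assoc, ← qhom_mul, ← qhom_mul]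
  congr 2
  rw [inv_mul_eq_iff_eq_mul₀ hw, ← mul_assoc, ← hc, mul_assoc, mul_inv_cancel₀ hw, mul_one]

variable (hm : IsTambaraYamagami C m)
include hm

/-- Some isomorphism `X ⊗ m ≅ m` exists; Skolem–Noether corrects it by a quaternion so that the
action through `m` becomes the standard one. -/
lemma IsTambaraYamagami.exists_actL {X : C} (hX : IsInvertibleObj X) :
    ∃ e : X ⊗ m ≅ m, ∀ h, X ◁ qhom q h ≫ e.hom = e.hom ≫ qhom q h := by
  obtain ⟨e⟩ := hm.nonempty_tensor_iso hX
  exact exists_intertwining_iso q e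
    { toFun := fun h => X ◁ qhom q h
      map_add' := fun g h => by rw [qhom_add, MonoidalPreadditive.whiskerLeft_add]
      map_smul' := fun r h => by rw [qhom_smul, MonoidalLinear.whiskerLeft_smul]; rfl }
    (by simp [qhom_one]) (by simp [qhom_mul])

lemma IsTambaraYamagami.exists_actR {X : C} (hX : IsInvertibleObj X) :
    ∃ e : m ⊗ X ≅ m, ∀ h, qhom q h ▷ X ≫ e.hom = e.hom ≫ qhom q h := by
  obtain ⟨e⟩ := hm.nonempty_iso_tensor hX
  exact exists_intertwining_iso q e
    { toFun := fun h => qhom q h ▷ X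
      map_add' := fun g h => by rw [qhom_add, MonoidalPreadditive.add_whiskerRight]
      map_smul' := fun r h => by rw [qhom_smul, MonoidalLinear.smul_whiskerRight]; rfl }
    (by simp [qhom_one]) (by simp [qhom_mul])

/-- Moving `star h` from the first factor of a nonzero pairing to the second defines an algebra
endomorphism of `ℍ`, since conjugation undoes the reversal of order. Skolem–Noether then gives a
twist of the pairing for which it is the identity. -/
lemma IsTambaraYamagami.exists_balanced {X : C} (hX : IsInvertibleObj X) :
    ∃ e : m ⊗ m ⟶ X, e ≠ 0 ∧ ∀ h, m ◁ qhom q h ≫ e = qhom q (star h) ▷ m ≫ e := by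
  obtain ⟨e, he⟩ := hm.exists_proj hX
  have hex (h : ℍ[ℝ]) : ∃ g, qhom q (star h) ▷ m ≫ e = m ◁ qhom q g ≫ e := by
    obtain ⟨g, hg⟩ := hm.proj_torsor hX e he (qhom q (star h) ▷ m ≫ e)
    obtain ⟨g, rfl⟩ := qhom_surjective q g
    exact ⟨g, hg⟩
  choose σ' hσ using hex
  have inj {g h : ℍ[ℝ]} (e' : m ◁ qhom q g ≫ e = m ◁ qhom q h ≫ e) : g = h :=
    qhom_injective q (qhom_proj_injective q he e')
  let σ : ℍ[ℝ] →ₐ[ℝ] ℍ[ℝ] := AlgHom.ofLinearMap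
    { toFun := σ'
      map_add' := fun g h => inj (by
        rw [← hσ, star_add, qhom_add, MonoidalPreadditive.add_whiskerRight, Preadditive.add_comp,
          hσ, hσ, qhom_add, MonoidalPreadditive.whiskerLeft_add, Preadditive.add_comp])
      map_smul' := fun r h => inj (by
        rw [← hσ, Quaternion.star_smul, qhom_smul, MonoidalLinear.smul_whiskerRight,
          Linear.smul_comp, hσ, qhom_smul, MonoidalLinear.whiskerLeft_smul, Linear.smul_comp]
        rfl) }
    (inj (by
      change m ◁ qhom q (σ' 1) ≫ e = _
      rw [← hσ, star_one, qhom_one]; simp))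
    (fun g h => inj (by
      change m ◁ qhom q (σ' (g * h)) ≫ e = m ◁ qhom q (σ' g * σ' h) ≫ e
      rw [← hσ, star_mul, qhom_mul, comp_whiskerRight, Category.assoc, hσ, ← whisker_exchange_assoc,
        hσ, qhom_mul, whiskerLeft_comp, Category.assoc]))
  obtain ⟨w, hw, hc⟩ := Quaternion.exists_conj σ
  have hw' := qhom_isIso q hw
  refine ⟨m ◁ qhom q w ≫ e, fun h => he ?_, fun h => ?_⟩
  · rwa [← Limits.comp_zero (f := m ◁ qhom q w), cancel_epi] at h
  · rw [← whisker_exchange_assoc, hσ, ← whiskerLeft_comp_assoc, ← whiskerLeft_comp_assoc, ← qhom_mul,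
      ← qhom_mul]
    congr 3
    exact (hc h).symm

include q in
/-- A balanced map `m ⊗ m ⟶ X` is unique up to a scalar. -/
lemma IsTambaraYamagami.exists_smul_of_balanced {X : C} (hX : IsInvertibleObj X) {e f : m ⊗ m ⟶ X}
    (he : e ≠ 0) (hbe : ∀ h, m ◁ qhom q h ≫ e = qhom q (star h) ▷ m ≫ e)
    (hbf : ∀ h, m ◁ qhom q h ≫ f = qhom q (star h) ▷ m ≫ f) : ∃ r : ℝ, f = r • e := by
  obtain ⟨g, rfl⟩ := hm.proj_torsor hX e he f
  obtain ⟨r, rfl⟩ := eq_smul_of_qhom_commute q g fun h => by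
    apply qhom_proj_injective q he
    have := hbf h
    rw [← whisker_exchange_assoc, ← hbe] at this
    simpa using this.symm
  exact ⟨r, by simp⟩

lemma IsTambaraYamagami.whiskerRight_eq_zero {X Y : C} (hX : IsInvertibleObj X)
    (hY : IsInvertibleObj Y) {f : X ⟶ Y} (h : f ▷ m = 0) : f = 0 := by
  by_contra hf
  have := hX.simple
  have := hY.simple
  have := isIso_of_hom_simple hf
  have := hm.simple
  have := hX.simple_tensor (Z := m)
  apply id_nonzero (X ⊗ m)
  rw [← id_whiskerRight, ← IsIso.hom_inv_id f, comp_whiskerRight, h, Limits.zero_comp]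

lemma IsTambaraYamagami.whiskerRight_injective {X Y : C} (hX : IsInvertibleObj X)
    (hY : IsInvertibleObj Y) {f g : X ⟶ Y} (h : f ▷ m = g ▷ m) : f = g :=
  sub_eq_zero.mp (hm.whiskerRight_eq_zero hX hY (by rw [sub_whiskerRight, h, sub_self]))

end Gauge

/-! ### Normalised vertices and the trivial associators -/

/-- A choice of simple objects and vertices of a real-quaternionic Tambara--Yamagami category. -/
structure TYGauge (C : FusionCat.{v, u, 0} ℝ) (A : Type w) [Group A] where
  m : C
  isTY : IsTambaraYamagami C m
  quat : ℍ[ℝ] ≃ₐ[ℝ] End m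
  obj : A → C
  invertible : ∀ a, IsInvertibleObj (obj a)
  obj_surjective : ∀ X : C, Simple X → IsInvertibleObj X → ∃ a, Nonempty (X ≅ obj a)
  obj_injective : ∀ a b, Nonempty (obj a ≅ obj b) → a = b
  unitIso : 𝟙_ C ≅ obj 1
  mul : ∀ a b : A, obj a ⊗ obj b ≅ obj (a * b)
  actL : ∀ a : A, obj a ⊗ m ≅ m
  actL_quat : ∀ (a : A) (h : ℍ[ℝ]),
    obj a ◁ qhom quat h ≫ (actL a).hom = (actL a).hom ≫ qhom quat h
  one_actL : unitIso.hom ▷ m ≫ (actL 1).hom = (λ_ m).hom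
  assoc_a_b_m : ∀ a b : A,
    (α_ (obj a) (obj b) m).hom ≫ obj a ◁ (actL b).hom ≫ (actL a).hom =
      (mul a b).hom ▷ m ≫ (actL (a * b)).hom
  /-- The pairing of `m` with itself. -/
  base : m ⊗ m ⟶ obj 1
  base_ne_zero : base ≠ 0
  base_quat : ∀ h : ℍ[ℝ], m ◁ qhom quat h ≫ base = qhom quat (star h) ▷ m ≫ base

lemma iso_hom_ne_zero {C : Type u} [Category.{v} C] [Limits.HasZeroMorphisms C]
    {X Y : C} [Simple Y] (e : X ≅ Y) : e.hom ≠ 0 := fun h =>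
  id_nonzero Y (by rw [← e.inv_hom_id, h, Limits.comp_zero])

namespace TYGauge

/-- With quaternion-linear actions chosen, the left unit constraint of `m` and the associator of `a,
b, m` involve only nonzero real scalars; rescaling the unit isomorphism and the multiplications
absorbs them. -/
theorem exists_of_obj {C : FusionCat.{v, u, 0} ℝ} {A : Type w} [Group A] {m : C}
    (hm : IsTambaraYamagami C m) (q : ℍ[ℝ] ≃ₐ[ℝ] End m) (obj : A → C)
    (inv : ∀ a, IsInvertibleObj (obj a))
    (surj : ∀ X : C, Simple X → IsInvertibleObj X → ∃ a, Nonempty (X ≅ obj a))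
    (inj : ∀ a b, Nonempty (obj a ≅ obj b) → a = b) (hone : Nonempty (𝟙_ C ≅ obj 1))
    (hmul : ∀ a b, Nonempty (obj a ⊗ obj b ≅ obj (a * b))) : Nonempty (TYGauge C A) := by
  have := hm.simple
  choose actL hactL using fun a => hm.exists_actL q (inv a)
  obtain ⟨base, h0, hb⟩ := hm.exists_balanced q (inv 1)
  obtain ⟨i⟩ := hone
  have hr1 : ∃ r : ℝ, r ≠ 0 ∧ r • (i.hom ▷ m ≫ (actL 1).hom) = (λ_ m).hom := by
    obtain ⟨r, hr⟩ := exists_smul_of_intertwine q (i.hom ▷ m ≫ (actL 1).hom) (λ_ m).hom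
      (fun h => 𝟙_ C ◁ qhom q h)
      (fun h => by rw [← Category.assoc, whisker_exchange, Category.assoc, hactL, Category.assoc])
      (fun h => by simp)
    refine ⟨r, fun h => ?_, hr.symm⟩
    rw [h, zero_smul] at hr
    exact iso_hom_ne_zero (λ_ m) hr
  obtain ⟨r, hr, hr1⟩ := hr1
  have hμ (a b) : ∃ μ : obj a ⊗ obj b ≅ obj (a * b),
      (α_ (obj a) (obj b) m).hom ≫ obj a ◁ (actL b).hom ≫ (actL a).hom =
        μ.hom ▷ m ≫ (actL (a * b)).hom := by
    obtain ⟨μ⟩ := hmul a b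
    obtain ⟨s, hs⟩ := exists_smul_of_intertwine q (μ.hom ▷ m ≫ (actL (a * b)).hom)
      ((α_ (obj a) (obj b) m).hom ≫ obj a ◁ (actL b).hom ≫ (actL a).hom)
      (fun h => (obj a ⊗ obj b) ◁ qhom q h)
      (fun h => by rw [← Category.assoc, whisker_exchange, Category.assoc, hactL, Category.assoc])
      (fun h => by
        rw [associator_naturality_right_assoc, ← whiskerLeft_comp_assoc, hactL b,
          whiskerLeft_comp_assoc, hactL a]
        simp only [Category.assoc])
    have hs0 : s ≠ 0 := fun h => by
      rw [h, zero_smul] at hs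
      exact iso_hom_ne_zero (α_ (obj a) (obj b) m ≪≫ whiskerLeftIso (obj a) (actL b) ≪≫ actL a) hs
    refine ⟨⟨s • μ.hom, s⁻¹ • μ.inv, by simp [smul_smul, hs0], by simp [smul_smul, hs0]⟩, ?_⟩
    rw [hs]
    simp
  choose μ hμ using hμ
  exact ⟨⟨m, hm, q, obj, inv, surj, inj,
    ⟨r • i.hom, r⁻¹ • i.inv, by simp [smul_smul, hr], by simp [smul_smul, hr]⟩, μ, actL, hactL,
    by rw [← hr1]; simp, hμ, base, h0, hb⟩⟩

variable {C : FusionCat.{v, u, 0} ℝ} {A : Type w} [Group A] (G : TYGauge C A)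

instance : Simple G.m := G.isTY.simple
instance (a : A) : Simple (G.obj a) := (G.invertible a).simple

/-- The multiplication with a prescribed target. -/
def mulTo {a b c : A} (h : a * b = c) : G.obj a ⊗ G.obj b ≅ G.obj c :=
  G.mul a b ≪≫ eqToIso (congrArg G.obj h)

lemma mulTo_hom {a b c : A} (h : a * b = c) :
    (G.mulTo h).hom = (G.mul a b).hom ≫ eqToHom (congrArg G.obj h) := rfl

lemma mulTo_rfl (a b : A) : G.mulTo (rfl : a * b = a * b) = G.mul a b := by
  ext; simp [mulTo]

lemma assoc_mulTo {a b c : A} (h : a * b = c) :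
    (α_ (G.obj a) (G.obj b) G.m).hom ≫ G.obj a ◁ (G.actL b).hom ≫ (G.actL a).hom =
      (G.mulTo h).hom ▷ G.m ≫ (G.actL c).hom := by
  subst h
  rw [G.mulTo_rfl, G.assoc_a_b_m]

/-- The pentagon after two of its five associators have been evaluated without scalars. -/
lemma rebracket_of_eq {X Y Z W U V S P T : C} {z₁ : Z ⊗ W ⟶ U} {z₂ : Y ⊗ U ⟶ V} {z₃ : X ⊗ V ⟶ S}
    {p : Y ⊗ Z ⟶ P} {r : P ⊗ W ⟶ V} {y₁ : X ⊗ Y ⟶ T} {t : T ⊗ U ⟶ S}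
    (h₁ : (α_ Y Z W).hom ≫ Y ◁ z₁ ≫ z₂ = p ▷ W ≫ r)
    (h₄ : (α_ X Y U).hom ≫ X ◁ z₂ ≫ z₃ = y₁ ▷ U ≫ t) :
    ((α_ X Y Z).hom ≫ X ◁ p) ▷ W ≫ (α_ X P W).hom ≫ X ◁ r ≫ z₃ =
      y₁ ▷ Z ▷ W ≫ (α_ T Z W).hom ≫ T ◁ z₁ ≫ t := by
  have e := rebracket_right_comb z₁ z₂ z₃
  rwa [h₁, h₄, rebracket_inner, rebracket_outer] at e

/-- The multiplication is associative. -/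
lemma assoc_mul {a b c ab bc abc : A} (h₁ : a * b = ab) (h₂ : b * c = bc) (h₃ : ab * c = abc)
    (h₄ : a * bc = abc) :
    (α_ (G.obj a) (G.obj b) (G.obj c)).hom ≫ G.obj a ◁ (G.mulTo h₂).hom ≫ (G.mulTo h₄).hom =
      (G.mulTo h₁).hom ▷ G.obj c ≫ (G.mulTo h₃).hom := by
  refine G.isTY.whiskerRight_injective (((G.invertible a).tensor (G.invertible b)).tensor
    (G.invertible c)) (G.invertible abc) ?_
  -- The pentagon of `a, b, c, m`, in which every other associator is trivial by normalisation;
  -- tensoring with `m` loses nothing between invertible objects.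
  have e := rebracket_of_eq (G.assoc_mulTo h₂) (G.assoc_mulTo h₁)
  rw [G.assoc_mulTo h₄, G.assoc_mulTo h₃] at e
  rw [← cancel_mono (G.actL abc).hom]
  simpa using e

/-- The pairings of `m` with itself. -/
noncomputable def proj (a : A) : G.m ⊗ G.m ⟶ G.obj a :=
  (G.actL a).inv ▷ G.m ≫ (α_ _ _ _).hom ≫ G.obj a ◁ G.base ≫ (G.mulTo (mul_one a)).hom

lemma assoc_base (a : A) : (α_ (G.obj a) G.m G.m).hom ≫ G.obj a ◁ G.base ≫
    (G.mulTo (mul_one a)).hom = (G.actL a).hom ▷ G.m ≫ G.proj a := by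
  simp [proj]

lemma proj_quat (a : A) (h : ℍ[ℝ]) :
    G.m ◁ qhom G.quat h ≫ G.proj a = qhom G.quat (star h) ▷ G.m ≫ G.proj a := by
  rw [← cancel_epi ((G.actL a).hom ▷ G.m), ← whisker_exchange_assoc, ← comp_whiskerRight_assoc,
    ← G.actL_quat, comp_whiskerRight_assoc, ← assoc_base]
  simp only [associator_naturality_right_assoc, associator_naturality_middle_assoc,
    ← whiskerLeft_comp_assoc, G.base_quat]

lemma proj_ne_zero (a : A) : G.proj a ≠ 0 := fun h => by
  have e := G.assoc_base a
  rw [h, Limits.comp_zero] at e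
  have e' : G.obj a ◁ G.base = 0 := by
    rw [← cancel_epi (α_ (G.obj a) G.m G.m).hom, ← cancel_mono (G.mulTo (mul_one a)).hom]
    simpa using e
  exact G.base_ne_zero ((G.invertible a).whiskerLeft_injective (by simpa using e'))

/-- The pentagon of `a, b, m, m` extends the normalisation from the pairing into `1`, where it
defines `proj`, to all labels. -/
lemma assoc_proj {a b c : A} (h : a * b = c) :
    (α_ (G.obj a) G.m G.m).hom ≫ G.obj a ◁ G.proj b ≫ (G.mulTo h).hom =
      (G.actL a).hom ▷ G.m ≫ G.proj c := by
  have e := rebracket_of_eq (G.assoc_base b) (G.assoc_mul h (mul_one b) (mul_one c) h)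
  rw [G.assoc_base c] at e
  rw [← cancel_epi (((α_ (G.obj a) (G.obj b) G.m).hom ≫ G.obj a ◁ (G.actL b).hom) ▷ G.m), e,
    ← comp_whiskerRight_assoc, ← comp_whiskerRight_assoc, Category.assoc, G.assoc_mulTo h]

/-- For any quaternion-linear `e`, the pairing into `a` obtained by rebracketing `base` is balanced,
hence a real multiple of `proj a`. This scalar is absorbed into `e`. -/
lemma exists_actR (a : A) : ∃ e : G.m ⊗ G.obj a ≅ G.m,
    (∀ h, qhom G.quat h ▷ G.obj a ≫ e.hom = e.hom ≫ qhom G.quat h) ∧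
    (α_ _ _ _).hom ≫ G.m ◁ e.hom ≫ G.proj a =
      G.base ▷ G.obj a ≫ (G.mulTo (one_mul a)).hom := by
  obtain ⟨e, he⟩ := G.isTY.exists_actR G.quat (G.invertible a)
  have he' (h) : qhom G.quat h ≫ e.inv = e.inv ≫ qhom G.quat h ▷ G.obj a := by
    rw [← cancel_epi e.hom, ← cancel_mono e.hom]; simp [← he]
  let f := G.m ◁ e.inv ≫ (α_ _ _ _).inv ≫ G.base ▷ G.obj a ≫ (G.mulTo (one_mul a)).hom
  have hf (h : ℍ[ℝ]) : G.m ◁ qhom G.quat h ≫ f = qhom G.quat (star h) ▷ G.m ≫ f := by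
    have hb := congrArg (· ▷ G.obj a) (G.base_quat h)
    simp only [comp_whiskerRight] at hb
    simp only [f]
    rw [← whiskerLeft_comp_assoc, he', whiskerLeft_comp_assoc, associator_inv_naturality_middle_assoc,
      reassoc_of% hb, ← whisker_exchange_assoc, associator_inv_naturality_left_assoc]
  obtain ⟨r, hr⟩ := G.isTY.exists_smul_of_balanced G.quat (G.invertible a) (G.proj_ne_zero a)
    (G.proj_quat a) hf
  have hr' : (α_ _ _ _).hom ≫ G.m ◁ (r • e.hom) ≫ G.proj a =
      G.base ▷ G.obj a ≫ (G.mulTo (one_mul a)).hom := by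
    rw [MonoidalLinear.whiskerLeft_smul, Linear.smul_comp, ← Linear.comp_smul, ← hr]
    simp [f]
  have hr0 : r ≠ 0 := fun h => by
    rw [h] at hr'
    have e' : G.base ▷ G.obj a = 0 := by
      rw [← cancel_mono (G.mulTo (one_mul a)).hom, ← hr']
      simp
    exact G.base_ne_zero ((G.invertible a).whiskerRight_injective (by simpa using e'))
  exact ⟨⟨r • e.hom, r⁻¹ • e.inv, by simp [smul_smul, hr0], by simp [smul_smul, hr0]⟩,
    fun h => by simp [he], hr'⟩

/-- The isomorphism `m ⊗ a ≅ m`. -/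
noncomputable def actR (a : A) : G.m ⊗ G.obj a ≅ G.m := (G.exists_actR a).choose

lemma actR_quat (a : A) (h : ℍ[ℝ]) :
    qhom G.quat h ▷ G.obj a ≫ (G.actR a).hom = (G.actR a).hom ≫ qhom G.quat h :=
  (G.exists_actR a).choose_spec.1 h

lemma assoc_base_actR (a : A) : (α_ _ _ _).hom ≫ G.m ◁ (G.actR a).hom ≫ G.proj a =
    G.base ▷ G.obj a ≫ (G.mulTo (one_mul a)).hom := (G.exists_actR a).choose_spec.2

/-- The pentagon of `b, m, m, a`. -/
lemma assoc_proj_actR {a b c : A} (h : b * a = c) :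
    (α_ _ _ _).hom ≫ G.m ◁ (G.actR a).hom ≫ G.proj c = G.proj b ▷ G.obj a ≫ (G.mulTo h).hom := by
  have e := rebracket_of_eq (G.assoc_base_actR a) (G.assoc_proj h)
  rw [G.assoc_mul (mul_one b) (one_mul a) h h, ← comp_whiskerRight_assoc, Category.assoc,
    G.assoc_base b, comp_whiskerRight_assoc, cancel_epi] at e
  exact e.symm

/-- The pentagon of `m, m, a, b` gives the identity after pairing with a further `m`, and a nonzero
pairing is injective on the second factor. -/
lemma assoc_mul_actR {a b c : A} (h : a * b = c) :
    (α_ _ _ _).hom ≫ G.m ◁ (G.mulTo h).hom ≫ (G.actR c).hom =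
      (G.actR a).hom ▷ G.obj b ≫ (G.actR b).hom := by
  have e := rebracket_right_comb (G.mulTo h).hom (G.actR c).hom (G.proj c)
  rw [G.assoc_base_actR c, rebracket_outer, G.assoc_mul (one_mul a) h h (one_mul c)] at e
  have e' := rebracket_inner (G.actR a).hom (G.actR b).hom (G.proj c)
  rw [G.assoc_proj_actR h, ← comp_whiskerRight_assoc, Category.assoc, G.assoc_base_actR a,
    comp_whiskerRight_assoc] at e'
  rw [← e', cancel_epi, cancel_epi] at e
  let i := whiskerRightIso (G.actR a) (G.obj b) ≪≫ G.actR b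
  rw [← cancel_epi i.inv]
  refine qhom_proj_injective G.quat (G.proj_ne_zero c) ?_
  rw [whiskerLeft_comp_assoc, e, ← whiskerLeft_comp_assoc]

lemma one_mul_eq (a : A) : G.unitIso.hom ▷ G.obj a ≫ (G.mulTo (one_mul a)).hom =
    (λ_ (G.obj a)).hom := by
  refine G.isTY.whiskerRight_injective (IsInvertibleObj.unit.tensor (G.invertible a))
    (G.invertible a) ?_
  rw [← cancel_mono (G.actL a).hom, comp_whiskerRight_assoc, ← G.assoc_mulTo (one_mul a),
    associator_naturality_left_assoc, ← whisker_exchange_assoc, G.one_actL,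
    id_whiskerLeft]
  simp

lemma mul_one_eq (a : A) : G.obj a ◁ G.unitIso.hom ≫ (G.mulTo (mul_one a)).hom =
    (ρ_ (G.obj a)).hom := by
  refine G.isTY.whiskerRight_injective ((G.invertible a).tensor IsInvertibleObj.unit)
    (G.invertible a) ?_
  rw [← cancel_mono (G.actL a).hom, comp_whiskerRight_assoc, ← G.assoc_mulTo (mul_one a),
    associator_naturality_middle_assoc, ← whiskerLeft_comp_assoc, G.one_actL, triangle_assoc]

lemma proj_one : G.proj 1 = G.base := by
  rw [← cancel_epi ((λ_ G.m).hom ▷ G.m), ← G.one_actL, comp_whiskerRight_assoc,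
    ← G.assoc_base 1, associator_naturality_left_assoc, ← whisker_exchange_assoc, G.one_mul_eq,
    G.one_actL]
  simp

/-- The right unit constraint of `m` is not imposed in the gauge. It follows by pairing with another
`m`, from the normalisation of `actR` on `base`. -/
lemma actR_one : G.m ◁ G.unitIso.hom ≫ (G.actR 1).hom = (ρ_ G.m).hom := by
  rw [← cancel_epi (ρ_ G.m).inv]
  refine qhom_proj_injective G.quat (G.proj_ne_zero 1) ?_
  have e := congrArg (fun f => (G.m ⊗ G.m) ◁ G.unitIso.hom ≫ f) (G.assoc_base_actR 1)
  simp only [associator_naturality_right_assoc, whisker_exchange_assoc] at e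
  rw [G.mul_one_eq 1, ← whiskerLeft_comp_assoc, rightUnitor_naturality] at e
  rw [← cancel_epi (ρ_ (G.m ⊗ G.m)).hom, Iso.inv_hom_id, whiskerLeft_id, Category.id_comp,
    G.proj_one, ← e, G.proj_one, whiskerLeft_comp_assoc]
  simp

end TYGauge

/-! ### The remaining associators: scalars and Casimir sums -/

lemma re_star_quaternionUnits_mul (s t : Fin 4) :
    (star (quaternionUnits t) * quaternionUnits s).re = if s = t then 1 else 0 := by
  simp only [Quaternion.re_mul, Quaternion.re_star, Quaternion.imI_star, Quaternion.imJ_star,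
    Quaternion.imK_star]
  fin_cases s <;> fin_cases t <;> simp [quaternionUnits]

lemma re_quaternionUnits_mul_star (s t : Fin 4) :
    (quaternionUnits s * star (quaternionUnits t)).re = if s = t then 1 else 0 := by
  simp only [Quaternion.re_mul, Quaternion.re_star, Quaternion.imI_star, Quaternion.imJ_star,
    Quaternion.imK_star]
  fin_cases s <;> fin_cases t <;> simp [quaternionUnits]

namespace TYGauge

variable {C : FusionCat.{v, u, 0} ℝ} {A : Type w} [Group A] (G : TYGauge C A)

/-- Both bracketings intertwine the quaternion action on the middle factor, so they differ by a
central scalar. -/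
lemma exists_chi (a b : A) : ∃ r : ℝˣ,
    (α_ (G.obj a) G.m (G.obj b)).hom ≫ G.obj a ◁ (G.actR b).hom ≫ (G.actL a).hom =
      (r : ℝ) • ((G.actL a).hom ▷ G.obj b ≫ (G.actR b).hom) := by
  obtain ⟨r, hr⟩ := exists_smul_of_intertwine G.quat ((G.actL a).hom ▷ G.obj b ≫ (G.actR b).hom)
    ((α_ (G.obj a) G.m (G.obj b)).hom ≫ G.obj a ◁ (G.actR b).hom ≫ (G.actL a).hom)
    (fun h => (G.obj a ◁ qhom G.quat h) ▷ G.obj b)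
    (fun h => by
      rw [← comp_whiskerRight_assoc, G.actL_quat, comp_whiskerRight_assoc, G.actR_quat,
        Category.assoc])
    (fun h => by
      rw [associator_naturality_middle_assoc, ← whiskerLeft_comp_assoc, G.actR_quat,
        whiskerLeft_comp_assoc, G.actL_quat]
      simp only [Category.assoc])
  have hr0 : r ≠ 0 := fun h => by
    rw [h, zero_smul] at hr
    exact iso_hom_ne_zero (α_ (G.obj a) G.m (G.obj b) ≪≫ whiskerLeftIso (G.obj a) (G.actR b) ≪≫
      G.actL a) hr
  exact ⟨Units.mk0 r hr0, hr⟩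

/-- The scalar relating the two ways of multiplying `a ⊗ m ⊗ b`. -/
noncomputable def chi (a b : A) : ℝˣ := (G.exists_chi a b).choose

lemma assoc_chi (a b : A) :
    (α_ (G.obj a) G.m (G.obj b)).hom ≫ G.obj a ◁ (G.actR b).hom ≫ (G.actL a).hom =
      (G.chi a b : ℝ) • ((G.actL a).hom ▷ G.obj b ≫ (G.actR b).hom) :=
  (G.exists_chi a b).choose_spec

/-- The pentagon of `a, b, m, c`; that of `a, m, b, c` gives the other variable. -/
lemma chi_mul_left (a b c : A) : G.chi (a * b) c = G.chi a c * G.chi b c := by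
  have e := pentagon_smul (𝕜 := ℝ) (G.assoc_chi b c) (G.assoc_chi a c)
    ((G.assoc_mulTo rfl).trans (one_smul ℝ _).symm) ((G.assoc_mulTo rfl).trans (one_smul ℝ _).symm)
    (G.assoc_chi (a * b) c)
  have h := smul_left_injective ℝ (iso_hom_ne_zero (whiskerRightIso (whiskerRightIso
    (G.mulTo (rfl : a * b = a * b)) G.m) (G.obj c) ≪≫ whiskerRightIso (G.actL (a * b)) (G.obj c) ≪≫
    G.actR c)) e
  ext
  push_cast
  linarith

lemma chi_mul_right (a b c : A) : G.chi a (b * c) = G.chi a b * G.chi a c := by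
  have e := pentagon_smul (𝕜 := ℝ) ((G.assoc_mul_actR (rfl : b * c = b * c)).trans
    (one_smul ℝ _).symm) (G.assoc_chi a c) (G.assoc_chi a b) (G.assoc_chi a (b * c))
    ((G.assoc_mul_actR (rfl : b * c = b * c)).trans (one_smul ℝ _).symm)
  have h := smul_left_injective ℝ (iso_hom_ne_zero (whiskerRightIso (whiskerRightIso
    (G.actL a) (G.obj b)) (G.obj c) ≪≫ whiskerRightIso (G.actR b) (G.obj c) ≪≫ G.actR c)) e
  ext
  push_cast
  linarith

lemma chi_one_right (a : A) : G.chi a 1 = 1 := by simpa using G.chi_mul_right a 1 1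

/-- After composing with the inverse of `[m,a]`, both sides are balanced pairings into `b`. -/
lemma exists_psi (a b : A) : ∃ r : ℝ,
    (α_ G.m (G.obj a) G.m).hom ≫ G.m ◁ (G.actL a).hom ≫ G.proj b =
      r • ((G.actR a).hom ▷ G.m ≫ G.proj b) := by
  have hR (h) : qhom G.quat h ≫ (G.actR a).inv = (G.actR a).inv ≫ qhom G.quat h ▷ G.obj a := by
    rw [← cancel_epi (G.actR a).hom, ← cancel_mono (G.actR a).hom]; simp [← G.actR_quat]
  obtain ⟨r, hr⟩ := G.isTY.exists_smul_of_balanced G.quat (G.invertible b) (G.proj_ne_zero b)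
    (G.proj_quat b) (f := (G.actR a).inv ▷ G.m ≫ (α_ G.m (G.obj a) G.m).hom ≫
      G.m ◁ (G.actL a).hom ≫ G.proj b) (fun h => by
        rw [whisker_exchange_assoc, associator_naturality_right_assoc, ← whiskerLeft_comp_assoc,
          G.actL_quat, whiskerLeft_comp_assoc, G.proj_quat, ← comp_whiskerRight_assoc, hR,
          comp_whiskerRight_assoc, associator_naturality_left_assoc, whisker_exchange_assoc])
  refine ⟨r, ?_⟩
  rw [← cancel_epi ((G.actR a).inv ▷ G.m), hr]
  simp

/-- The scalar relating the two ways of multiplying `m ⊗ a ⊗ m` into `b`. -/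
noncomputable def psi (a b : A) : ℝ := (G.exists_psi a b).choose

lemma assoc_psi (a b : A) :
    (α_ G.m (G.obj a) G.m).hom ≫ G.m ◁ (G.actL a).hom ≫ G.proj b =
      G.psi a b • ((G.actR a).hom ▷ G.m ≫ G.proj b) :=
  (G.exists_psi a b).choose_spec

section Casimir

/-- The pairing into `b` twisted by a quaternion. -/
noncomputable abbrev twist (b : A) (g : ℍ[ℝ]) : G.m ⊗ G.m ⟶ G.obj b :=
  G.m ◁ qhom G.quat g ≫ G.proj b

lemma quat_twist (b : A) (g h : ℍ[ℝ]) :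
    qhom G.quat h ▷ G.m ≫ G.twist b g = G.twist b (star h * g) := by
  have := G.proj_quat b (star h)
  rw [star_star] at this
  rw [twist, ← whisker_exchange_assoc, ← this, ← whiskerLeft_comp_assoc, ← qhom_mul]

lemma quat_twist' (b : A) (g h : ℍ[ℝ]) :
    G.m ◁ qhom G.quat h ≫ G.twist b g = G.twist b (g * h) := by
  rw [twist, ← whiskerLeft_comp_assoc, ← qhom_mul]

lemma quat_assoc_left (a : A) (h : ℍ[ℝ]) :
    qhom G.quat h ▷ G.m ▷ G.m ≫ (α_ _ _ _).hom ≫ G.m ◁ G.proj a ≫ (G.actR a).hom =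
      ((α_ _ _ _).hom ≫ G.m ◁ G.proj a ≫ (G.actR a).hom) ≫ qhom G.quat h := by
  rw [associator_naturality_left_assoc, ← whisker_exchange_assoc, G.actR_quat]
  simp only [Category.assoc]

lemma quat_assoc_middle (a : A) (h : ℍ[ℝ]) :
    (G.m ◁ qhom G.quat h) ▷ G.m ≫ (α_ _ _ _).hom ≫ G.m ◁ G.proj a ≫ (G.actR a).hom =
      (G.m ⊗ G.m) ◁ qhom G.quat (star h) ≫ (α_ _ _ _).hom ≫ G.m ◁ G.proj a ≫ (G.actR a).hom := by
  rw [associator_naturality_middle_assoc, associator_naturality_right_assoc,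
    ← whiskerLeft_comp_assoc, ← whiskerLeft_comp_assoc, G.proj_quat, star_star]

variable [Fintype A]

/-- These are the dual inclusions belonging to the unit quaternion; against a twist by `g` they
extract the real part. -/
lemma exists_dual_twist : ∃ j : ∀ b, G.obj b ⟶ G.m ⊗ G.m,
    (∀ b g, j b ≫ G.twist b g = g.re • 𝟙 _) ∧ ∀ b l, l ≠ b → ∀ g, j b ≫ G.twist l g = 0 := by
  obtain ⟨j, h1, h2, -⟩ := G.isTY.exists_dual G.quat G.invertible G.obj_surjective G.obj_injective
    G.proj G.proj_ne_zero
  refine ⟨fun b => j (b, 0), fun b g => ?_, fun b l hl g => ?_⟩ <;>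
    obtain ⟨r, hr⟩ := exists_sum_quaternionUnits g <;>
    rw [hr, twist, ← sum_smul_twistedProj, Preadditive.comp_sum]
  · rw [Finset.sum_eq_single 0 (fun s _ hs => by
      rw [Linear.comp_smul]
      exact (congrArg (r s • ·) (h2 (b, 0) (b, s) (by simpa using hs.symm))).trans (smul_zero _))
      (by simp), Linear.comp_smul]
    refine (congrArg (r 0 • ·) (h1 (b, 0))).trans ?_
    simp only [Fin.sum_univ_four, Quaternion.re_add, Quaternion.re_smul]
    simp [quaternionUnits]
  · refine Finset.sum_eq_zero fun s _ => ?_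
    rw [Linear.comp_smul]
    exact (congrArg (r s • ·) (h2 (b, 0) (l, s) (by simp [hl.symm]))).trans (smul_zero _)

/-- The projection dual to the pairing into `b`. -/
noncomputable def coproj (b : A) : G.obj b ⟶ G.m ⊗ G.m := G.exists_dual_twist.choose b

lemma coproj_twist (b : A) (g : ℍ[ℝ]) : G.coproj b ≫ G.twist b g = g.re • 𝟙 _ :=
  G.exists_dual_twist.choose_spec.1 b g

lemma coproj_twist_of_ne {b l : A} (h : l ≠ b) (g : ℍ[ℝ]) : G.coproj b ≫ G.twist l g = 0 :=
  G.exists_dual_twist.choose_spec.2 b l h g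

lemma coproj_proj (b : A) : G.coproj b ≫ G.proj b = 𝟙 _ := by
  simpa [twist, qhom_one] using G.coproj_twist b 1

lemma coproj_proj_of_ne {b l : A} (h : l ≠ b) : G.coproj b ≫ G.proj l = 0 := by
  simpa [twist, qhom_one] using G.coproj_twist_of_ne h 1

lemma coproj_whisker {K : Type*} [Fintype K] {W Z : C} (b : A) (g : A → K → ℍ[ℝ])
    (f : ∀ l, K → (G.obj l ⊗ W ⟶ Z)) :
    G.coproj b ▷ W ≫ ∑ l, ∑ s, G.twist l (g l s) ▷ W ≫ f l s = ∑ s, (g b s).re • f b s := by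
  rw [Preadditive.comp_sum, Finset.sum_eq_single b (fun l _ hl => ?_) (by simp),
    Preadditive.comp_sum]
  · refine Finset.sum_congr rfl fun s _ => ?_
    rw [← comp_whiskerRight_assoc, G.coproj_twist]
    simp
  · rw [Preadditive.comp_sum]
    refine Finset.sum_eq_zero fun s _ => ?_
    rw [← comp_whiskerRight_assoc, G.coproj_twist_of_ne hl]
    simp

lemma exists_eq_sum_twist {W Z : C} (f : (G.m ⊗ G.m) ⊗ W ⟶ Z) :
    ∃ x : ∀ b, Fin 4 → (G.obj b ⊗ W ⟶ Z),
      f = ∑ b, ∑ s, G.twist b (quaternionUnits s) ▷ W ≫ x b s := by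
  obtain ⟨j, -, -, h3⟩ := G.isTY.exists_dual G.quat G.invertible G.obj_surjective G.obj_injective
    G.proj G.proj_ne_zero
  refine ⟨fun b s => j (b, s) ▷ W ≫ f, ?_⟩
  have e : f = (𝟙 (G.m ⊗ G.m)) ▷ W ≫ f := by simp
  rw [← h3] at e
  refine e.trans ?_
  rw [sum_whiskerRight, Preadditive.sum_comp, Fintype.sum_prod_type]
  simp only [comp_whiskerRight, Category.assoc]

/-- The Casimir vertex `(m ⊗ m) ⊗ m ⟶ m` through `b`. -/
noncomputable def casimir (b : A) : (G.m ⊗ G.m) ⊗ G.m ⟶ G.m :=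
  ∑ s, G.twist b (quaternionUnits s) ▷ G.m ≫ (G.actL b).hom ≫ qhom G.quat (quaternionUnits s)

/-- Expand in twisted pairings with quaternion coefficients `x b s`. Equivariance in the first
factor gives `x b t = t * x b 0`, and exchanging quaternions between the middle and last factors
gives `x b t = x b 0 * t`. So `x b 0` is central, and the sum is a real multiple of the Casimir
vertex. -/
lemma exists_casimir (a : A) : ∃ T : A → ℝ,
    (α_ G.m G.m G.m).hom ≫ G.m ◁ G.proj a ≫ (G.actR a).hom = ∑ b, T b • G.casimir b := by
  set f := (α_ G.m G.m G.m).hom ≫ G.m ◁ G.proj a ≫ (G.actR a).hom with hf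
  obtain ⟨y, hy⟩ := G.exists_eq_sum_twist f
  have hx (b s) : ∃ x, y b s = (G.actL b).hom ≫ qhom G.quat x := by
    obtain ⟨x, hx⟩ := qhom_surjective G.quat ((G.actL b).inv ≫ y b s)
    exact ⟨x, by rw [hx]; simp⟩
  choose x hx using hx
  simp only [hx] at hy
  have base (b) : G.coproj b ▷ G.m ≫ f = (G.actL b).hom ≫ qhom G.quat (x b 0) := by
    rw [hy, G.coproj_whisker b (fun _ s => quaternionUnits s), Fin.sum_univ_four]
    simp [quaternionUnits]
  have left (b t) : x b t = quaternionUnits t * x b 0 := by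
    have e := congrArg (G.coproj b ▷ G.m ≫ ·) (G.quat_assoc_left a (quaternionUnits t))
    simp only [← hf] at e
    rw [reassoc_of% (base b), hy] at e
    simp only [Preadditive.comp_sum, ← comp_whiskerRight_assoc, G.quat_twist] at e
    have e' := G.coproj_whisker b (fun _ s => star (quaternionUnits t) * quaternionUnits s)
      (fun l s => (G.actL l).hom ≫ qhom G.quat (x l s))
    simp only [Preadditive.comp_sum, ← comp_whiskerRight_assoc] at e'
    rw [e'] at e
    simp only [re_star_quaternionUnits_mul, ite_smul, one_smul, zero_smul, Finset.sum_ite_eq',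
      Finset.mem_univ, if_true, ← qhom_mul, cancel_epi] at e
    exact qhom_injective G.quat e
  have right (b t) : x b t = x b 0 * quaternionUnits t := by
    have e := congrArg (G.coproj b ▷ G.m ≫ ·) (G.quat_assoc_middle a (star (quaternionUnits t)))
    simp only [← hf] at e
    rw [← whisker_exchange_assoc, base b, reassoc_of% G.actL_quat, hy, star_star] at e
    simp only [Preadditive.comp_sum, ← comp_whiskerRight_assoc, G.quat_twist'] at e
    have e' := G.coproj_whisker b (fun _ s => quaternionUnits s * star (quaternionUnits t))
      (fun l s => (G.actL l).hom ≫ qhom G.quat (x l s))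
    simp only [Preadditive.comp_sum, ← comp_whiskerRight_assoc] at e'
    rw [e'] at e
    simp only [re_quaternionUnits_mul_star, ite_smul, one_smul, zero_smul, Finset.sum_ite_eq',
      Finset.mem_univ, if_true, ← qhom_mul, cancel_epi] at e
    exact qhom_injective G.quat e
  refine ⟨fun b => (x b 0).re, hy.trans (Finset.sum_congr rfl fun b _ => ?_)⟩
  -- The indices `1` and `2` are the units `i` and `j`, and commuting with these two is enough.
  have hreal := Quaternion.eq_coe_of_commute (x b 0) ((right b 1).symm.trans (left b 1))
    ((right b 2).symm.trans (left b 2))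
  rw [casimir, Finset.smul_sum]
  refine Finset.sum_congr rfl fun s _ => ?_
  rw [left b s, qhom_mul, hreal, qhom_algebraMap]
  simp

/-- The coefficients of the associator of `m`, `m`, `m`. -/
noncomputable def coeff (a b : A) : ℝ := (G.exists_casimir a).choose b

lemma assoc_coeff (a : A) : (α_ G.m G.m G.m).hom ≫ G.m ◁ G.proj a ≫ (G.actR a).hom =
    ∑ b, G.coeff a b • G.casimir b := (G.exists_casimir a).choose_spec

end Casimir

end TYGauge

/-! ### Solving the pentagon equations for the remaining coefficients -/

lemma sum_star_quaternionUnits_mul (t : ℍ[ℝ]) :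
    ∑ s, star (quaternionUnits s) * t * quaternionUnits s = algebraMap ℝ ℍ[ℝ] (4 * t.re) := by
  rw [Fin.sum_univ_four]
  apply Quaternion.ext_components <;>
    simp only [Quaternion.re_add, Quaternion.imI_add, Quaternion.imJ_add, Quaternion.imK_add,
      Quaternion.re_mul, Quaternion.imI_mul, Quaternion.imJ_mul, Quaternion.imK_mul,
      Quaternion.re_star, Quaternion.imI_star, Quaternion.imJ_star, Quaternion.imK_star,
      Quaternion.algebraMap_def, Quaternion.re_coe, Quaternion.imI_coe, Quaternion.imJ_coe,
      Quaternion.imK_coe] <;>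
    simp [quaternionUnits] <;> ring

lemma re_quaternionUnits (s : Fin 4) : (quaternionUnits s).re = if s = 0 then 1 else 0 := by
  fin_cases s <;> rfl

namespace TYGauge

variable {C : FusionCat.{v, u, 0} ℝ} {A : Type w} [Group A] (G : TYGauge C A)

lemma assoc_twist {a b c : A} (h : a * b = c) (g : ℍ[ℝ]) :
    (α_ (G.obj a) G.m G.m).hom ≫ G.obj a ◁ G.twist b g ≫ (G.mulTo h).hom =
      (G.actL a).hom ▷ G.m ≫ G.twist c g := by
  rw [twist, whiskerLeft_comp_assoc, ← associator_naturality_right_assoc, G.assoc_proj h,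
    whisker_exchange_assoc]

lemma assoc_mulTo_quat {a b c : A} (h : a * b = c) (g : ℍ[ℝ]) :
    (α_ (G.obj a) (G.obj b) G.m).hom ≫ G.obj a ◁ ((G.actL b).hom ≫ qhom G.quat g) ≫
      (G.actL a).hom = (G.mulTo h).hom ▷ G.m ≫ (G.actL c).hom ≫ qhom G.quat g := by
  rw [whiskerLeft_comp_assoc, G.actL_quat, reassoc_of% (G.assoc_mulTo h)]

lemma assoc_twist_actR {a b c : A} (h : b * a = c) (g : ℍ[ℝ]) :
    (α_ _ _ _).hom ≫ G.m ◁ (G.actR a).hom ≫ G.twist c g =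
      G.twist b g ▷ G.obj a ≫ (G.mulTo h).hom := by
  have e : G.m ◁ (G.actR a).hom ≫ G.m ◁ qhom G.quat g =
      G.m ◁ (qhom G.quat g ▷ G.obj a) ≫ G.m ◁ (G.actR a).hom := by
    rw [← whiskerLeft_comp, ← whiskerLeft_comp, G.actR_quat]
  rw [twist, reassoc_of% e, ← associator_naturality_middle_assoc, G.assoc_proj_actR h,
    comp_whiskerRight_assoc]

lemma assoc_psi_twist (a x : A) (g : ℍ[ℝ]) :
    (α_ G.m (G.obj a) G.m).hom ≫ G.m ◁ (G.actL a).hom ≫ G.twist x g =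
      G.psi a x • ((G.actR a).hom ▷ G.m ≫ G.twist x g) := by
  rw [twist, ← whiskerLeft_comp_assoc, ← G.actL_quat, whiskerLeft_comp_assoc,
    ← associator_naturality_right_assoc, G.assoc_psi, Linear.comp_smul, whisker_exchange_assoc]

lemma assoc_psi_quat (b c : A) (g : ℍ[ℝ]) :
    (α_ G.m (G.obj b) G.m).hom ≫ G.m ◁ ((G.actL b).hom ≫ qhom G.quat g) ≫ G.proj c =
      G.psi b c • (((G.actR b).hom ≫ qhom G.quat (star g)) ▷ G.m ≫ G.proj c) := by
  rw [whiskerLeft_comp_assoc, G.proj_quat, whisker_exchange_assoc,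
    ← associator_naturality_left_assoc, G.assoc_psi, Linear.comp_smul, comp_whiskerRight_assoc,
    ← comp_whiskerRight_assoc, G.actR_quat, comp_whiskerRight_assoc]

lemma assoc_casimir_left (a b : A) :
    (α_ (G.obj a) G.m G.m).hom ▷ G.m ≫ (α_ _ _ _).hom ≫ G.obj a ◁ G.casimir b ≫ (G.actL a).hom =
      (G.actL a).hom ▷ G.m ▷ G.m ≫ G.casimir (a * b) := by
  simp only [casimir, whiskerLeft_sum, Preadditive.sum_comp, Preadditive.comp_sum]
  refine Finset.sum_congr rfl fun s _ => ?_
  rw [rebracket_inner, G.assoc_mulTo_quat rfl, ← comp_whiskerRight_assoc, Category.assoc,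
    G.assoc_twist rfl, comp_whiskerRight_assoc]

lemma assoc_casimir_right (a b : A) :
    (α_ (G.m ⊗ G.m) (G.obj a) G.m).hom ≫ (G.m ⊗ G.m) ◁ (G.actL a).hom ≫ G.casimir b =
      ((α_ G.m G.m (G.obj a)).hom ≫ G.m ◁ (G.actR a).hom) ▷ G.m ≫ G.casimir (b * a) := by
  simp only [casimir, Preadditive.comp_sum]
  refine Finset.sum_congr rfl fun s _ => ?_
  rw [rebracket_outer, reassoc_of% (G.assoc_mulTo (rfl : b * a = b * a)), ← comp_whiskerRight_assoc,
    ← comp_whiskerRight_assoc, Category.assoc, G.assoc_twist_actR rfl]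

lemma assoc_casimir_middle (a x : A) :
    ((α_ G.m (G.obj a) G.m).hom ≫ G.m ◁ (G.actL a).hom) ▷ G.m ≫ G.casimir x =
      G.psi a x • ((G.actR a).hom ▷ G.m ▷ G.m ≫ G.casimir x) := by
  simp only [casimir, Preadditive.comp_sum, Finset.smul_sum]
  refine Finset.sum_congr rfl fun s _ => ?_
  rw [← comp_whiskerRight_assoc, ← comp_whiskerRight_assoc, Category.assoc, G.assoc_psi_twist,
    MonoidalLinear.smul_whiskerRight, Linear.smul_comp]

/-- Averaging `star s * t * s` over the units leaves four times the real part of `t`, so only the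
term `t = 1` of the Casimir sum survives. This is the origin of the `4` in `4τ²|A| = 1`. -/
lemma sum_quat_casimir (x : A) :
    ∑ s, (G.m ⊗ G.m) ◁ qhom G.quat (quaternionUnits s) ≫ G.casimir x ≫
      qhom G.quat (star (quaternionUnits s)) = (4 : ℝ) • (G.proj x ▷ G.m ≫ (G.actL x).hom) := by
  have h (s t : Fin 4) : (G.m ⊗ G.m) ◁ qhom G.quat (quaternionUnits s) ≫
      (G.twist x (quaternionUnits t) ▷ G.m ≫ (G.actL x).hom ≫ qhom G.quat (quaternionUnits t)) ≫
        qhom G.quat (star (quaternionUnits s)) =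
      G.twist x (quaternionUnits t) ▷ G.m ≫ (G.actL x).hom ≫
        qhom G.quat (star (quaternionUnits s) * quaternionUnits t * quaternionUnits s) := by
    simp only [Category.assoc]
    rw [whisker_exchange_assoc, reassoc_of% (G.actL_quat), qhom_mul, qhom_mul]
  simp only [casimir, Preadditive.comp_sum, Preadditive.sum_comp, h]
  rw [Finset.sum_comm]
  simp only [← Preadditive.comp_sum, ← qhom_sum, sum_star_quaternionUnits_mul, qhom_algebraMap]
  rw [Finset.sum_eq_single 0 (fun t _ ht => by simp [re_quaternionUnits, ht]) (by simp)]
  simp [twist, qhom_one]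

variable [Fintype A]

/-- Restricting along `coproj b` kills the other labels and leaves the coefficient times the
isomorphism `[b,m]`. -/
lemma casimir_injective {r s : A → ℝ} (h : ∑ b, r b • G.casimir b = ∑ b, s b • G.casimir b) :
    r = s := by
  have key (r : A → ℝ) (b) : G.coproj b ▷ G.m ≫ ∑ l, r l • G.casimir l = r b • (G.actL b).hom := by
    have e := G.coproj_whisker (W := G.m) b (fun _ => quaternionUnits)
      (fun l s => r l • ((G.actL l).hom ≫ qhom G.quat (quaternionUnits s)))
    simp only [Linear.comp_smul] at e
    simp only [casimir, Finset.smul_sum]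
    rw [e, Finset.sum_eq_single 0 (fun t _ ht => by simp [re_quaternionUnits, ht]) (by simp)]
    simp [qhom_one]
  funext b
  have e := congrArg (G.coproj b ▷ G.m ≫ ·) h
  simp only [key] at e
  exact smul_left_injective ℝ (iso_hom_ne_zero (G.actL b)) e

/-- Reindexing an expansion into Casimir vertices. -/
lemma eq_of_sum_casimir {r s : A → ℝ} (f : A ≃ A)
    (h : ∑ b, r b • G.casimir (f b) = ∑ b, s b • G.casimir b) (b : A) : r b = s (f b) := by
  rw [← Equiv.sum_comp f fun b => s b • G.casimir b] at h
  have h' : ∑ b, (r ∘ f.symm) (f b) • G.casimir (f b) = ∑ b, s (f b) • G.casimir (f b) := by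
    simpa using h
  rw [Equiv.sum_comp f fun b => (r ∘ f.symm) b • G.casimir b,
    Equiv.sum_comp f fun b => s b • G.casimir b] at h'
  simpa using congrFun (G.casimir_injective h') (f b)

/-- The pentagon of `a, m, m, m`, with Casimir vertices compared coefficientwise. -/
lemma coeff_chi (a b c : A) : G.coeff c b = G.chi a c * G.coeff c (a * b) := by
  have e := rebracket_right_comb (X := G.obj a) (G.proj c) (G.actR c).hom (G.actL a).hom
  rw [G.assoc_coeff, G.assoc_chi, Linear.comp_smul, Linear.comp_smul, rebracket_outer,
    G.assoc_coeff] at e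
  simp only [whiskerLeft_sum, Preadditive.sum_comp, Preadditive.comp_sum, Linear.comp_smul,
    Linear.smul_comp, MonoidalLinear.whiskerLeft_smul, G.assoc_casimir_left, Finset.smul_sum,
    smul_smul] at e
  simp only [← Linear.comp_smul, ← Preadditive.comp_sum, cancel_epi] at e
  exact G.eq_of_sum_casimir (s := fun b => G.chi a c * G.coeff c b) (Equiv.mulLeft a) e b

/-- The pentagon of `m, m, a, m`. -/
lemma coeff_psi (a b c : A) : G.coeff c b = G.psi a c * G.coeff c (b * a) := by
  have e := rebracket_right_comb (X := G.m) (Y := G.m) (G.actL a).hom (G.proj c) (G.actR c).hom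
  rw [G.assoc_coeff, G.assoc_psi, MonoidalLinear.whiskerLeft_smul, Linear.smul_comp,
    Linear.comp_smul, Linear.comp_smul, rebracket_inner, G.assoc_coeff] at e
  simp only [Preadditive.comp_sum, Linear.comp_smul, G.assoc_casimir_right, Finset.smul_sum,
    smul_smul] at e
  simp only [← Linear.comp_smul, ← Preadditive.comp_sum, cancel_epi] at e
  exact G.eq_of_sum_casimir (s := fun b => G.psi a c * G.coeff c b) (Equiv.mulRight a) e.symm b

/-- The pentagon of `m, a, m, m`. -/
lemma coeff_mul (a b x : A) : G.coeff (a * b) x * G.psi a x = G.coeff b x := by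
  have e := rebracket_right_comb (X := G.m) (G.proj b) (G.mulTo (rfl : a * b = a * b)).hom
    (G.actR (a * b)).hom
  rw [G.assoc_proj, rebracket_inner, G.assoc_coeff, G.assoc_mul_actR, rebracket_outer,
    G.assoc_coeff] at e
  simp only [Preadditive.comp_sum, Linear.comp_smul, G.assoc_casimir_middle, smul_smul] at e
  simp only [← Linear.comp_smul, ← Preadditive.comp_sum, cancel_epi] at e
  exact congrFun (G.casimir_injective e) x

/-- By `coeff_chi` one zero spreads over all intermediate labels, and then `m ◁ proj a` would
vanish, although `proj a` has a section. -/
lemma coeff_ne_zero (a b : A) : G.coeff a b ≠ 0 := fun h => by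
  have h0 (c) : G.coeff a c = 0 := by
    have e := G.coeff_chi (c * b⁻¹) b a
    rw [h] at e
    simpa using e.symm
  have e := G.assoc_coeff a
  simp only [h0, zero_smul, Finset.sum_const_zero] at e
  have e' : G.m ◁ G.proj a = 0 := by
    rw [← cancel_epi (α_ G.m G.m G.m).hom, ← cancel_mono (G.actR a).hom]
    simpa using e
  apply iso_hom_ne_zero (G.actR a)
  rw [← Category.id_comp (G.actR a).hom, ← whiskerLeft_id, ← G.coproj_proj, whiskerLeft_comp, e',
    Limits.comp_zero, Limits.zero_comp]

/-- The two recursions for the coefficients agree at the neutral element, where left and right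
multiplication by `a` coincide, and the coefficients are nonzero. -/
lemma psi_eq_chi (a b : A) : G.psi a b = G.chi a b := by
  have h1 := G.coeff_psi a 1 b
  have h2 := G.coeff_chi a 1 b
  rw [one_mul] at h1
  rw [mul_one] at h2
  exact mul_right_cancel₀ (G.coeff_ne_zero b a) (h1.symm.trans h2)

lemma coeff_eq (a b : A) : G.coeff a b = G.coeff 1 1 * (G.chi a b : ℝ)⁻¹ := by
  have h1 := G.coeff_mul a 1 b
  have h2 := G.coeff_chi b 1 1
  rw [G.psi_eq_chi, mul_one] at h1
  rw [G.chi_one_right, mul_one, Units.val_one, one_mul] at h2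
  rw [h2, ← h1, mul_assoc, mul_inv_cancel₀ (G.chi a b).ne_zero, mul_one]

/-- The coefficient at `(a, b)` is computed both from `coeff_eq` and from `coeff_chi`; the former
yields `chi a b`, the latter `chi b a`. -/
lemma chi_symm (a b : A) : G.chi a b = G.chi b a := by
  have h1 := G.coeff_chi b 1 a
  have h2 := G.coeff_eq a 1
  rw [mul_one, G.coeff_eq a b, h2, G.chi_one_right] at h1
  have h3 := G.coeff_ne_zero 1 1
  have h4 : (G.chi a b : ℝ) ≠ 0 := (G.chi a b).ne_zero
  ext
  field_simp at h1
  simpa using h1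

/-- In the pentagon of four copies of `m`, balancing the outer pairing places the Casimir units
around a second associator, and `sum_quat_casimir` collapses their sum. -/
lemma assoc_casimir_proj (b c : A) :
    (α_ G.m G.m G.m).hom ▷ G.m ≫ (α_ _ _ _).hom ≫ G.m ◁ G.casimir b ≫ G.proj c =
      ∑ x, (4 * G.psi b c * G.coeff b x) •
        (G.proj x ▷ G.m ≫ (G.actL x).hom) ▷ G.m ≫ G.proj c := by
  have h (s : Fin 4) : (α_ G.m G.m G.m).hom ▷ G.m ≫ (α_ _ _ _).hom ≫
      G.m ◁ (G.twist b (quaternionUnits s) ▷ G.m ≫ (G.actL b).hom ≫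
        qhom G.quat (quaternionUnits s)) ≫ G.proj c =
      ∑ x, (G.psi b c * G.coeff b x) • ((G.m ⊗ G.m) ◁ qhom G.quat (quaternionUnits s) ≫
        G.casimir x ≫ qhom G.quat (star (quaternionUnits s))) ▷ G.m ≫ G.proj c := by
    rw [rebracket_inner, G.assoc_psi_quat, Linear.comp_smul, ← comp_whiskerRight_assoc,
      Category.assoc, twist, whiskerLeft_comp_assoc, ← associator_naturality_right_assoc,
      reassoc_of% (G.assoc_coeff b)]
    simp only [Preadditive.sum_comp, Preadditive.comp_sum, sum_whiskerRight, Finset.smul_sum,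
      Linear.smul_comp, Linear.comp_smul, MonoidalLinear.smul_whiskerRight, smul_smul]
  have e : G.casimir b = ∑ s, G.twist b (quaternionUnits s) ▷ G.m ≫ (G.actL b).hom ≫
        qhom G.quat (quaternionUnits s) := rfl
  rw [e]
  simp only [whiskerLeft_sum, Preadditive.sum_comp, Preadditive.comp_sum, h]
  rw [Finset.sum_comm]
  refine Finset.sum_congr rfl fun x _ => ?_
  rw [← Finset.smul_sum, ← Preadditive.sum_comp, ← sum_whiskerRight, G.sum_quat_casimir,
    MonoidalLinear.smul_whiskerRight, Linear.smul_comp, smul_smul]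
  congr 1
  ring

/-- The pentagon of `m, m, m, m` into `c`, restricted along the component `x` of the first pair.
Once the coefficients are known it reads `4τ² ∑ χ(b,c) χ(b,x)⁻¹ = δ`. -/
lemma sum_coeff (c x : A) [DecidableEq A] :
    ∑ b, G.coeff 1 b * (4 * G.psi b c * G.coeff b x) = if x = c then 1 else 0 := by
  have e := rebracket_right_comb (X := G.m) (G.proj 1) (G.actR 1).hom (G.proj c)
  rw [G.assoc_coeff, G.assoc_proj_actR (mul_one c), rebracket_outer, G.assoc_proj] at e
  simp only [whiskerLeft_sum, Preadditive.sum_comp, Preadditive.comp_sum, Linear.comp_smul,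
    Linear.smul_comp, MonoidalLinear.whiskerLeft_smul, G.assoc_casimir_proj] at e
  have key (l) : G.coproj x ▷ G.m ▷ G.m ≫ (G.proj l ▷ G.m ≫ (G.actL l).hom) ▷ G.m ≫ G.proj c =
      if x = l then (G.actL x).hom ▷ G.m ≫ G.proj c else 0 := by
    split_ifs with hl
    · subst hl
      rw [← comp_whiskerRight_assoc, ← comp_whiskerRight_assoc, G.coproj_proj]
      simp
    · rw [← comp_whiskerRight_assoc, ← comp_whiskerRight_assoc, G.coproj_proj_of_ne (Ne.symm hl)]
      simp
  have e' := congrArg (G.coproj x ▷ G.m ▷ G.m ≫ ·) e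
  rw [← comp_whiskerRight_assoc (G.proj c ▷ G.m)] at e'
  simp only [Preadditive.comp_sum, Linear.comp_smul, key, Finset.smul_sum, smul_smul, smul_ite,
    smul_zero, Finset.sum_ite_eq, Finset.mem_univ, if_true] at e'
  rw [← Finset.sum_smul] at e'
  have hne : (G.actL x).hom ▷ G.m ≫ G.proj c ≠ 0 := fun h => G.proj_ne_zero c (by
    rw [← cancel_epi ((G.actL x).hom ▷ G.m), h, Limits.comp_zero])
  refine smul_left_injective ℝ hne ?_
  refine e'.trans ?_
  split_ifs <;> simp

lemma tau_sq : 4 * G.coeff 1 1 ^ 2 * Fintype.card A = 1 := by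
  classical
  have e := G.sum_coeff 1 1
  rw [if_pos rfl] at e
  rw [← e, ← nsmul_eq_mul', ← Finset.card_univ, ← Finset.sum_const]
  refine Finset.sum_congr rfl fun b _ => ?_
  rw [G.coeff_eq 1 b, G.coeff_eq b 1, G.psi_eq_chi, G.chi_symm 1 b, G.chi_one_right]
  simp
  ring

/-- If `a ≠ 1` were in the radical, the orthogonality sum for the distinct labels `a` and `1` would
equal `4τ²|A| = 1` instead of `0`. -/
lemma chi_nondegenerate (a : A) (h : ∀ b, G.chi a b = 1) : a = 1 := by
  classical
  by_contra ha
  have e := G.sum_coeff a 1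
  rw [if_neg (Ne.symm ha)] at e
  have e' : ∑ b, G.coeff 1 b * (4 * G.psi b a * G.coeff b 1) =
      4 * G.coeff 1 1 ^ 2 * Fintype.card A := by
    rw [← nsmul_eq_mul', ← Finset.card_univ, ← Finset.sum_const]
    refine Finset.sum_congr rfl fun b _ => ?_
    rw [G.coeff_eq 1 b, G.coeff_eq b 1, G.psi_eq_chi, G.chi_symm b a, h, G.chi_symm 1 b,
      G.chi_one_right]
    simp
    ring
  rw [e', G.tau_sq] at e
  exact one_ne_zero e

/-- The datum of a gauge. -/
noncomputable def datum : TYDatum A where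
  χ := G.chi
  τ := G.coeff 1 1
  mul_left := G.chi_mul_left
  mul_right := G.chi_mul_right
  symm := G.chi_symm
  nondegenerate := G.chi_nondegenerate
  tau_eq := by
    have hc : (0 : ℝ) < 4 * Fintype.card A := by
      have := Fintype.card_pos (α := A)
      positivity
    rw [← sq_eq_sq_iff_eq_or_eq_neg, div_pow, Real.sq_sqrt hc.le, one_pow, eq_div_iff hc.ne',
      ← G.tau_sq]
    ring

/-- The presentation given by a gauge. -/
noncomputable def presentation : CHPresentation C G.datum where
  m := G.m
  isTY := G.isTY
  quat := G.quat
  obj := G.obj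
  simple_obj _ := inferInstance
  obj_invertible := G.invertible
  obj_surjective := G.obj_surjective
  obj_injective := G.obj_injective
  unitIso := G.unitIso
  mul := G.mul
  actL := G.actL
  actR := G.actR
  proj := G.proj
  proj_ne_zero := G.proj_ne_zero
  actL_quat := G.actL_quat
  actR_quat := G.actR_quat
  proj_quat := G.proj_quat
  one_mul_eq := G.one_mul_eq
  mul_one_eq := G.mul_one_eq
  one_actL := G.one_actL
  actR_one := G.actR_one
  assoc_a_b_c a b c := by
    have := G.assoc_mul rfl rfl (mul_assoc a b c) rfl
    rwa [G.mulTo_rfl, G.mulTo_rfl, G.mulTo_rfl, G.mulTo_hom] at this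
  assoc_a_b_m := G.assoc_a_b_m
  assoc_a_m_b := G.assoc_chi
  assoc_m_a_b a b := by
    have := G.assoc_mul_actR (rfl : a * b = a * b)
    rwa [G.mulTo_rfl] at this
  assoc_a_m_m a b := by
    have := G.assoc_proj (rfl : a * b = a * b)
    rwa [G.mulTo_rfl] at this
  assoc_m_a_m a b := by
    rw [G.assoc_psi, G.psi_eq_chi]
    rfl
  assoc_m_m_a a b := by
    have := G.assoc_proj_actR (rfl : b * a = b * a)
    rwa [G.mulTo_rfl] at this
  assoc_m_m_m a := by
    rw [G.assoc_coeff]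
    refine Finset.sum_congr rfl fun b _ => ?_
    rw [G.coeff_eq a b, casimir]
    refine congrArg _ (Finset.sum_congr rfl fun s _ => ?_)
    rw [← G.actL_quat, ← whisker_exchange_assoc]
    simp only [MonoidalCategory.tensorHom_def', twist, comp_whiskerRight, Category.assoc,
      id_whiskerRight, Category.id_comp]

end TYGauge

/-! ### The group of isomorphism classes of invertible objects -/

section Picard

variable {C : Type u} [Category.{v} C] [MonoidalCategory C]

/-- A representative of an invertible isomorphism class. -/
noncomputable def unitObj (x : (Skeleton C)ˣ) : C := Quotient.out (x : Skeleton C)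

lemma toSkeleton_unitObj (x : (Skeleton C)ˣ) : toSkeleton (unitObj x) = x :=
  Quotient.out_eq (x : Skeleton C)

lemma nonempty_unitObj_mul (x y : (Skeleton C)ˣ) :
    Nonempty (unitObj x ⊗ unitObj y ≅ unitObj (x * y)) := by
  rw [← toSkeleton_eq_toSkeleton_iff, toSkeleton_unitObj, Skeleton.toSkeleton_tensorObj,
    toSkeleton_unitObj, toSkeleton_unitObj, Units.val_mul]

lemma nonempty_unit_unitObj : Nonempty (𝟙_ C ≅ unitObj (1 : (Skeleton C)ˣ)) := by
  rw [← toSkeleton_eq_toSkeleton_iff, toSkeleton_unitObj]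
  rfl

lemma isInvertibleObj_unitObj (x : (Skeleton C)ˣ) : IsInvertibleObj (unitObj x) := by
  obtain ⟨e⟩ := nonempty_unit_unitObj (C := C)
  obtain ⟨f⟩ := nonempty_unitObj_mul x x⁻¹
  obtain ⟨g⟩ := nonempty_unitObj_mul x⁻¹ x
  rw [mul_inv_cancel] at f
  rw [inv_mul_cancel] at g
  exact ⟨unitObj x⁻¹, ⟨f ≪≫ e.symm⟩, ⟨g ≪≫ e.symm⟩⟩

lemma IsInvertibleObj.exists_unitObj {X : C} (hX : IsInvertibleObj X) :
    ∃ x, Nonempty (X ≅ unitObj x) := by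
  obtain ⟨Y, ⟨f⟩, ⟨g⟩⟩ := hX
  refine ⟨⟨toSkeleton X, toSkeleton Y, ?_, ?_⟩, ?_⟩
  · rw [← Skeleton.toSkeleton_tensorObj]
    exact congr_toSkeleton_of_iso f
  · rw [← Skeleton.toSkeleton_tensorObj]
    exact congr_toSkeleton_of_iso g
  · rw [← toSkeleton_eq_toSkeleton_iff, toSkeleton_unitObj]

lemma unitObj_injective {x y : (Skeleton C)ˣ} (h : Nonempty (unitObj x ≅ unitObj y)) : x = y := by
  rw [← toSkeleton_eq_toSkeleton_iff, toSkeleton_unitObj, toSkeleton_unitObj] at h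
  exact Units.ext h

end Picard

/-- Invertible objects are simple, and there are finitely many simple isomorphism classes. -/
lemma FusionCat.finite_units {𝕜 : Type w} [Field 𝕜] (C : FusionCat.{v, u, w} 𝕜) :
    Finite (Skeleton C)ˣ := by
  obtain ⟨n, S, hS⟩ := C.finite_simples
  choose f hf using fun x : (Skeleton C)ˣ => hS (unitObj x) (isInvertibleObj_unitObj x).simple
  refine Finite.of_injective f fun x y h => unitObj_injective ?_
  obtain ⟨e⟩ := hf x
  obtain ⟨e'⟩ := hf y
  exact ⟨e ≪≫ eqToIso (congrArg S h) ≪≫ e'.symm⟩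

/-- Every real-quaternionic Tambara--Yamagami category has a presentation. -/
theorem IsRealQuaternionicTY.exists_isCH {D : FusionCat.{v, u, 0} ℝ} (hD : IsRealQuaternionicTY D) :
    ∃ (A : Type) (_ : Group A) (_ : Fintype A) (d : TYDatum A), IsCH D d := by
  obtain ⟨m, hm, -, ⟨q⟩⟩ := hD
  have := D.finite_units
  -- Finiteness of this group is what allows it to be moved to the lowest universe.
  let e : Shrink.{0} (Skeleton D)ˣ ≃* (Skeleton D)ˣ := Shrink.mulEquiv
  obtain ⟨G⟩ := TYGauge.exists_of_obj hm q.symm (fun a => unitObj (e a))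
    (fun a => isInvertibleObj_unitObj _)
    (fun X _ hX => by
      obtain ⟨x, hx⟩ := hX.exists_unitObj
      exact ⟨e.symm x, by simpa using hx⟩)
    (fun a b h => e.injective (unitObj_injective h))
    (by rw [map_one]; exact nonempty_unit_unitObj)
    (fun a b => by rw [map_mul]; exact nonempty_unitObj_mul _ _)
  have : Finite (Shrink.{0} (Skeleton D)ˣ) := Finite.of_equiv _ e.symm.toEquiv
  have := Fintype.ofFinite (Shrink.{0} (Skeleton D)ˣ)
  exact ⟨_, _, _, G.datum, ⟨G.presentation⟩⟩

theorem theorem5p4 :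
    -- each triple gives rise to such a category
    (∀ (A : Type w) [Group A] [Fintype A] (d : TYDatum A),
      ∃ C : FusionCat.{0, 0, 0} ℝ, IsRealQuaternionicTY C ∧ IsCH C d) ∧
    -- every such category arises in this way, up to monoidal equivalence
    (∀ D : FusionCat.{v, u, 0} ℝ, IsRealQuaternionicTY D →
      ∃ (A : Type) (_ : Group A) (_ : Fintype A) (d : TYDatum A) (C : FusionCat.{0, 0, 0} ℝ),
        IsCH C d ∧ MonoidallyEquivalent D C) ∧
    -- classification up to monoidal equivalence
    (∀ (A : Type w) [Group A] [Fintype A] (A' : Type w') [Group A'] [Fintype A']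
      (d : TYDatum A) (d' : TYDatum A')
      (C : FusionCat.{v, u, 0} ℝ) (C' : FusionCat.{v', u', 0} ℝ),
      IsCH C d → IsCH C' d' →
        (MonoidallyEquivalent C C' ↔
          d.τ = d'.τ ∧ ∃ f : A ≃* A', ∀ a b : A, d'.χ (f a) (f b) = d.χ a b)) := by
  refine ⟨fun A _ _ d => d.exists_isCH, fun D hD => ?_, fun A _ _ A' _ _ d d' C C' ⟨P⟩ ⟨P'⟩ => ?_⟩
  · obtain ⟨A, _, _, d, ⟨P⟩⟩ := hD.exists_isCH
    obtain ⟨C, -, ⟨P'⟩⟩ := d.exists_isCH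
    exact ⟨A, _, _, d, C, ⟨P'⟩, P.monoidallyEquivalent P'⟩
  · constructor
    · rintro ⟨F, _, _, _, ⟨_⟩⟩
      -- The transported presentation and `P'` live on the same category, so their data agree up to
      -- a group isomorphism.
      exact (P.map F).exists_mulEquiv P'
    · rintro ⟨hτ, f, hf⟩
      have h : d'.comap f = d := TYDatum.ext (by funext a b; exact hf a b) hτ.symm
      exact P.monoidallyEquivalent (h ▸ P'.reindex f)
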